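/- **Setting.** Let $\alpha>0$, and let $X$ be a random variable with values in $\{1,2,\dots\}$ and $\mathbb P(X>x)=c_X x^{-\alpha}(1+o(1))$ as $x\to\infty$, for some $c_X>0$. Let $\mathcal T$ be a branching-process tree with root $\varnothing$, in which the numbers of children are i.i.d. copies of $X$, and whose edges carry i.i.d. uniform$[0,1]$ weights, independent of the tree. Invasion percolation starts from $\{\varnothing\}$ and at each step adds the edge of smallest weight among the edges that join the current cluster to its complement, with its new endpoint; the invasion percolation cluster $T$ is the increasing limit. Almost surely $T$ has a unique infinite path $\varnothing=v_0,v_1,v_2,\dots$ from the root (the backbone). Let $\beta_i$ be the weight of $\{v_{i-1},v_i\}$ and $W_k=\max_{i>k}\beta_i$. The $k$-cut cluster $\mathcal M_k$ is the component of $\varnothing$ in $T$ after the edge $\{v_k,v_{k+1}\}$ is removed; $M_k$ is its number of vertices and $C_k$ the sum of the weights of its edges. Let $p_c=1/\mathbb E[X]$, with $p_c=0$ if $\mathbb E[X]=\infty$. Below, convergence of processes indexed by $t>0$ means convergence in distribution in the Skorokhod $J_1$ topology on $D[\varepsilon,\infty)$ for every $\varepsilon>0$, where a step path $t\mapsto a_{\lceil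 kt\rceil}$ is identified with its right-continuous version. All limits are as $k\to\infty$. **Theorem (Weight scaling of the IPC).** (i) Let $\alpha>2$ or $\alpha\in(1,2)$. Suppose that $\gamma\ge 2$ and that $(Z_\alpha(t))_{t>0}$ is an a.s. finite random process whose paths are a.s. integrable on $(0,t]$ for every $t>0$, such that $(k^{-\gamma}M_{\lceil kt\rceil})_{t>0}\to\big(\int_0^t Z_\alpha(u)\,\mathrm du\big)_{t>0}$. Then $(k^{-\gamma}C_{\lceil kt\rceil})_{t>0}\to\big(\tfrac{p_c}{2}\int_0^t Z_\alpha(u)\,\mathrm du\big)_{t>0}$. (ii) Let $\alpha\in(1/2,1)$. Suppose that $Z_\alpha$ is an a.s. finite random variable such that $W_k^{\alpha/(1-\alpha)}(M_k-M_{k-1})\to Z_\alpha$ in distribution. Let $(P_i)_{i\ge1}$ and $(Z_\alpha(j))_{j\ge1}$ be independent i.i.d. sequences, where $Z_\alpha(j)$ has the law of $Z_\alpha$, and $P_i$ equals $1$ with probability $\alpha$ and has the law of $V^{(1-\alpha)/\alpha}$, $V$ uniform on $[0,1]$, with probability $1-\alpha$. Then the series $$\tilde Z_\alpha(\ell)=\frac12\sum_{j=\ell}^{\infty}\Big(\prod_{u=1}^{j}P_u\Big)^{\frac{2\alpha-1}{1-\alpha}}Z_\alpha(j),\qquad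 \ell\ge1,$$ converge a.s., and for every $m\ge1$, $$\big(W_k^{\alpha/(1-\alpha)-1}C_{k-\ell}\big)_{\ell=1}^m\to\big(\tilde Z_\alpha(\ell)\big)_{\ell=1}^m\quad\text{in distribution.}$$ (iii) Let $\alpha\in(0,1/2)$. Then there is an a.s. finite random variable $\tilde Z_\alpha$ such that $C_k\to\tilde Z_\alpha$ in distribution, and also almost surely. -/

import Mathlib

open MeasureTheory ProbabilityTheory Filter
open scoped Topology

namespace IPC

noncomputable section

/-! ### Càdlàg paths and the Skorokhod J₁ topology -/

/-- A real function on `[ε, ∞)` is càdlàg: right-continuous with left limits. -/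
def IsCadlag {ε : ℝ} (f : Set.Ici ε → ℝ) : Prop :=
  ∀ t, ContinuousWithinAt f (Set.Ici t) t ∧ ∃ l, Tendsto f (𝓝[<] t) (𝓝 l)

/-- The space `D[ε, ∞)` of real càdlàg paths. -/
structure D (ε : ℝ) : Type where
  /-- The path as a function. -/
  path : Set.Ici ε → ℝ
  isCadlag : IsCadlag path

lemma isCadlag_zero {ε : ℝ} : IsCadlag (fun _ : Set.Ici ε => (0 : ℝ)) :=
  fun _ => ⟨continuousWithinAt_const, 0, tendsto_const_nhds⟩

/-- Two paths are `n`-close if some time change `φ` (an increasing bijection of `[ε, ∞)`) moves all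
times by less than `1 / (n + 1)`, and the first path is, at all times up to `n`, within
`1 / (n + 1)` of the second path run along `φ`. -/
def close (ε : ℝ) (n : ℕ) : Set (D ε × D ε) :=
  {p | ∃ φ : Set.Ici ε ≃o Set.Ici ε,
    (∀ t, |(φ t : ℝ) - t| < 1 / ((n : ℝ) + 1)) ∧
    ∀ t : Set.Ici ε, (t : ℝ) ≤ n → |p.2.path (φ t) - p.1.path t| < 1 / ((n : ℝ) + 1)}

lemma close_mono (ε : ℝ) {m n : ℕ} (h : m ≤ n) : close ε n ⊆ close ε m := by
  rintro p ⟨φ, h1, h2⟩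
  have hmn : (m : ℝ) ≤ n := by exact_mod_cast h
  have hle : 1 / ((n : ℝ) + 1) ≤ 1 / ((m : ℝ) + 1) := by gcongr
  exact ⟨φ, fun t => (h1 t).trans_le hle, fun t ht => (h2 t (ht.trans hmn)).trans_le hle⟩

lemma close_refl (ε : ℝ) (n : ℕ) (x : D ε) : (x, x) ∈ close ε n :=
  ⟨OrderIso.refl _, fun t => by simp; positivity, fun t _ => by simp; positivity⟩

lemma close_symm (ε : ℝ) (n : ℕ) : close ε (n + 1) ⊆ Prod.swap ⁻¹' close ε n := by
  rintro ⟨x, y⟩ ⟨φ, h1, h2⟩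
  have hle : 1 / (((n + 1 : ℕ) : ℝ) + 1) ≤ 1 / ((n : ℝ) + 1) := by gcongr; simp
  have hone : 1 / (((n + 1 : ℕ) : ℝ) + 1) ≤ 1 := by
    rw [div_le_one (by positivity)]; push_cast; linarith [n.cast_nonneg (α := ℝ)]
  refine ⟨φ.symm, fun s => ?_, fun s hs => ?_⟩
  · have := (h1 (φ.symm s)).trans_le hle
    rw [φ.apply_symm_apply, abs_sub_comm] at this
    exact this
  · have h3 := h1 (φ.symm s)
    rw [φ.apply_symm_apply] at h3
    have h4 := h2 (φ.symm s) (by push_cast; linarith [(abs_lt.1 h3).1])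
    rw [φ.apply_symm_apply, abs_sub_comm] at h4
    exact h4.trans_le hle

lemma close_comp (ε : ℝ) (n : ℕ) {x y z : D ε} (hxy : (x, y) ∈ close ε (2 * n + 1))
    (hyz : (y, z) ∈ close ε (2 * n + 1)) : (x, z) ∈ close ε n := by
  obtain ⟨φ, h1, h2⟩ := hxy
  obtain ⟨ψ, h3, h4⟩ := hyz
  have hn := n.cast_nonneg (α := ℝ)
  have hsum : 1 / (((2 * n + 1 : ℕ) : ℝ) + 1) + 1 / (((2 * n + 1 : ℕ) : ℝ) + 1)
      = 1 / ((n : ℝ) + 1) := by push_cast; field_simp; ring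
  have hone : 1 / (((2 * n + 1 : ℕ) : ℝ) + 1) ≤ 1 := by
    rw [div_le_one (by positivity)]; push_cast; linarith
  refine ⟨φ.trans ψ, fun t => ?_, fun t ht => ?_⟩
  · have a := abs_lt.1 (h1 t)
    have b := abs_lt.1 (h3 (φ t))
    rw [OrderIso.trans_apply, ← hsum, abs_lt]
    constructor <;> linarith
  · have a := abs_lt.1 (h2 t (by push_cast; linarith))
    have b := abs_lt.1 (h4 (φ t) (by push_cast; linarith [(abs_lt.1 (h1 t)).2]))
    rw [OrderIso.trans_apply, ← hsum, abs_lt]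
    constructor <;> linarith

/-- The uniform structure whose topology is the J₁ topology: `x k → x` iff there are time changes
`φ k` with `φ k t - t → 0` uniformly in `t` and `x k (φ k t) - x t → 0` uniformly for `t` in
bounded sets. -/
instance (ε : ℝ) : UniformSpace (D ε) :=
  UniformSpace.ofCore <| UniformSpace.Core.mkOfBasis
    { sets := Set.range (close ε)
      nonempty := Set.range_nonempty _
      inter_sets := by
        rintro _ _ ⟨m, rfl⟩ ⟨n, rfl⟩
        exact ⟨_, ⟨max m n, rfl⟩,
          Set.subset_inter (close_mono ε (le_max_left _ _)) (close_mono ε (le_max_right _ _))⟩ }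
    (by rintro _ ⟨n, rfl⟩ x; exact close_refl ε n x)
    (by rintro _ ⟨n, rfl⟩; exact ⟨_, ⟨n + 1, rfl⟩, close_symm ε n⟩)
    (by
      rintro _ ⟨n, rfl⟩
      refine ⟨_, ⟨2 * n + 1, rfl⟩, ?_⟩
      rintro ⟨x, z⟩ ⟨y, hxy, hyz⟩
      exact close_comp ε n hxy hyz)

instance (ε : ℝ) : MeasurableSpace (D ε) := borel (D ε)

instance (ε : ℝ) : BorelSpace (D ε) := ⟨rfl⟩

open Classical in
/-- The element of `D[ε, ∞)` given by the path `f`: its right-continuous version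
`t ↦ lim_{s ↓ t} f s`, which is `f` itself where `f` is right-continuous. (The value for an `f`
whose right-continuous version is not càdlàg is irrelevant.) -/
def toD (ε : ℝ) (f : ℝ → ℝ) : D ε :=
  if h : IsCadlag (fun t : Set.Ici ε => Function.rightLim f t) then ⟨_, h⟩
  else ⟨_, isCadlag_zero⟩

/-- `toD` yields the right-continuous version of every path that has one-sided limits. -/
lemma toD_apply (ε : ℝ) (f : ℝ → ℝ) (hr : ∀ t, ε ≤ t → ∃ y, Tendsto f (𝓝[>] t) (𝓝 y))
    (hl : ∀ t, ε < t → ∃ y, Tendsto f (𝓝[<] t) (𝓝 y)) (t : Set.Ici ε) :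
    (toD ε f).path t = Function.rightLim f t := by
  have key : IsCadlag (fun t : Set.Ici ε => Function.rightLim f t) := by
    intro t
    constructor
    · have h := continuousWithinAt_rightLim_Ici
        (tendsto_rightLim_of_tendsto (hr t t.2))
      exact h.comp continuous_subtype_val.continuousWithinAt fun s hs => hs
    · rcases eq_or_lt_of_le (show ε ≤ (t : ℝ) from t.2) with h | h
      · refine ⟨0, ?_⟩
        have : Set.Iio t = ∅ := by
          ext s
          simp only [Set.mem_Iio, Set.mem_empty_iff_false, iff_false, not_lt]
          exact Subtype.coe_le_coe.1 (h ▸ s.2)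
        simp [this]
      · obtain ⟨y, hy⟩ := hl t h
        refine ⟨y, ?_⟩
        have hmap : Tendsto (Subtype.val : Set.Ici ε → ℝ) (𝓝[<] t) (𝓝[<] (t : ℝ)) :=
          tendsto_nhdsWithin_of_tendsto_nhds_of_eventually_within _
            (continuous_subtype_val.tendsto t |>.mono_left nhdsWithin_le_nhds)
            (eventually_nhdsWithin_of_forall fun s hs => hs)
        suffices main : Tendsto (fun s => Function.rightLim f s) (𝓝[<] (t : ℝ)) (𝓝 y) from
          main.comp hmap
        rw [(closed_nhds_basis y).tendsto_right_iff]
        intro s hs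
        have ev : ∀ᶠ u in 𝓝[<] (t : ℝ), f u ∈ s := hy hs.1
        obtain ⟨a, ha, hsub⟩ := (mem_nhdsLT_iff_exists_Ioo_subset' h).1 ev
        filter_upwards [Ioo_mem_nhdsLT (max_lt ha h)] with u hu
        have hu' := max_lt_iff.1 hu.1
        refine hs.2.mem_of_tendsto (tendsto_rightLim_of_tendsto (hr u hu'.2.le)) ?_
        filter_upwards [Ioo_mem_nhdsGT hu.2] with v hv
        exact hsub ⟨hu'.1.trans hv.1, hv.2⟩
  rw [toD, dif_pos key]

/-- Convergence in distribution in the J₁ topology on `D[ε, ∞)`, for every `ε > 0`, of the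
processes `(X k t)_{t > 0}` to the process `(Y t)_{t > 0}`, as `k → ∞`. -/
def TendstoJ1 {Ω Ω' : Type*} [MeasurableSpace Ω] [MeasurableSpace Ω']
    (X : ℕ → ℝ → Ω → ℝ) (Y : ℝ → Ω' → ℝ) (μ : Measure Ω) [IsProbabilityMeasure μ]
    (μ' : Measure Ω') [IsProbabilityMeasure μ'] : Prop :=
  ∀ ε : ℝ, 0 < ε →
    TendstoInDistribution (fun (k : ℕ) ω => toD ε fun t => X k t ω) atTop
      (fun ω => toD ε fun t => Y t ω) (fun _ => μ) μ'

/-! ### The weighted branching-process tree -/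

/-- Ulam–Harris labels: `[]` is the root and `i :: v` is the `i`-th child of `v` (from `i = 0`). So
`u` is a descendant of `v`, or equal to it, iff `v <:+ u`. -/
abbrev Vertex : Type := List ℕ

/-- The number of children of the vertices (`X v` for the vertex `v`) are i.i.d. with law `ν`, the
edge weights (`U v` for the edge from `v` to its parent) are i.i.d. uniform on `[0, 1]`, and the
two families are independent. -/
structure IsWeightedBPTree {Ω : Type*} [MeasurableSpace Ω] (ν : Measure ℕ)
    (X : Vertex → Ω → ℕ) (U : Vertex → Ω → ℝ) (μ : Measure Ω) : Prop where
  offspring_law : ∀ v, HasLaw (X v) ν μ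
  weight_law : ∀ v, HasLaw (U v) (volume.restrict (Set.Icc (0 : ℝ) 1)) μ
  offspring_indep : iIndepFun X μ
  weight_indep : iIndepFun U μ
  indep : IndepFun (fun ω v => X v ω) (fun ω v => U v ω) μ

/-! ### Invasion percolation on a realisation

Here `x v` is the number of children of `v`, and `w v` the weight of the edge from `v` to its
parent. -/

/-- The vertices of the tree outside `S` that have their parent in `S`. -/
def boundary (x : Vertex → ℕ) (S : Finset Vertex) : Finset Vertex :=
  S.biUnion (fun v => (Finset.range (x v)).image fun i => i :: v) \ S

open Classical in
/-- One step of invasion percolation: add the boundary vertex whose edge has the least weight.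
(If there are several, all are added; almost surely there are no ties.) -/
def invasionStep (x : Vertex → ℕ) (w : Vertex → ℝ) (S : Finset Vertex) : Finset Vertex :=
  S ∪ (boundary x S).filter fun v => ∀ u ∈ boundary x S, w v ≤ w u

/-- The cluster after `n` steps of invasion percolation from the root. -/
def invasion (x : Vertex → ℕ) (w : Vertex → ℝ) : ℕ → Finset Vertex
  | 0 => {[]}
  | n + 1 => invasionStep x w (invasion x w n)

/-- The invasion percolation cluster. -/
def cluster (x : Vertex → ℕ) (w : Vertex → ℝ) : Set Vertex :=
  ⋃ n, (invasion x w n : Set Vertex)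

/-- `b` is a path from the root to infinity in the invasion percolation cluster. -/
def IsRay (x : Vertex → ℕ) (w : Vertex → ℝ) (b : ℕ → Vertex) : Prop :=
  b 0 = [] ∧ ∀ i, b i ∈ cluster x w ∧ ∃ j, b (i + 1) = j :: b i

open Classical in
/-- The backbone: the path to infinity in the cluster (almost surely there is exactly one). -/
def backbone (x : Vertex → ℕ) (w : Vertex → ℝ) : ℕ → Vertex :=
  if h : ∃ b, IsRay x w b then h.choose else fun _ => []

/-- The vertices of the `k`-cut cluster: the component of the root after the edge between the
backbone vertices `k` and `k + 1` is cut. -/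
def cutCluster (x : Vertex → ℕ) (w : Vertex → ℝ) (k : ℕ) : Set Vertex :=
  {u | u ∈ cluster x w ∧ ¬ backbone x w (k + 1) <:+ u}

/-- `M_k`, the number of vertices of the `k`-cut cluster. -/
def cutSize (x : Vertex → ℕ) (w : Vertex → ℝ) (k : ℕ) : ℕ := (cutCluster x w k).ncard

/-- `C_k`, the sum of all edge weights of the `k`-cut cluster; its edges are those from its
vertices other than the root to their parents. -/
def cutWeight (x : Vertex → ℕ) (w : Vertex → ℝ) (k : ℕ) : ℝ :=
  ∑ᶠ u ∈ cutCluster x w k \ {[]}, w u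

/-- `W_k`, the future maximum weight: the largest weight of a backbone edge after the `k`-th
backbone vertex. -/
def futureMax (x : Vertex → ℕ) (w : Vertex → ℝ) (k : ℕ) : ℝ :=
  ⨆ i : ℕ, w (backbone x w (k + 1 + i))

/-! ### The constants and limits -/

/-- The critical probability `p_c = 1 / E[X]` of the offspring law `ν`
(`0` if the expectation is infinite). -/
def criticalProb (ν : Measure ℕ) : ℝ := (∫ n : ℕ, (n : ℝ) ∂ν)⁻¹

/-- The law of a variable that is `1` with probability `α`, and `V ^ ((1 - α) / α)` with `V` uniform
on `[0, 1]` with probability `1 - α`. -/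
def ratioLaw (α : ℝ) : Measure ℝ :=
  ENNReal.ofReal α • Measure.dirac 1 +
    ENNReal.ofReal (1 - α) •
      (volume.restrict (Set.Icc (0 : ℝ) 1)).map fun u => u ^ ((1 - α) / α)

/-- The `j`-th term `(P_1 ⋯ P_j) ^ (α / (1 - α) - 1) * Z_j` of the limiting random series. -/
def seriesTerm (α : ℝ) (P Z : ℕ → ℝ) (j : ℕ) : ℝ :=
  (∏ u ∈ Finset.Icc 1 j, P u) ^ (α / (1 - α) - 1) * Z j

/-- The limiting random series `(1 / 2) * ∑_{j ≥ ℓ} (P_1 ⋯ P_j) ^ (α / (1 - α) - 1) * Z_j`. -/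
def limitSeries (α : ℝ) (P Z : ℕ → ℝ) (ℓ : ℕ) : ℝ :=
  (1 / 2) * ∑' i : ℕ, seriesTerm α P Z (ℓ + i)

end

end IPC

/-! For a configuration of degrees and weights, let `R` be the least level at which the root lies in
an infinite open cluster, and let `next` pass to the subtree below the child through which this
happens. If there are no ties, invasion can enter infinitely many vertices only along this path, so
the path is the backbone. The future maximum weight `W_k` is then the threshold `R_k` at the `k`-th
backbone vertex, and what hangs off the backbone at this vertex is exactly the finite cluster (the
bush) reachable at level `R_k`. Hence `M_k` and `C_k` are sums of bush sizes and bush weights along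
the backbone, up to the backbone itself, and `R_k` is nonincreasing.

The exact tool is `lintegral_step`. For a product over the bush edges of a function `q` of level and
weight, the mean of `Ψ(R) * bushProd * H(next)` equals the mean of `Ψ(S) * H * G'(f(S))`. Here `S`
is the maximum of `R` and the weight above the root, `G` is the offspring generating function, and
`f(s)` is the mean contribution of a branch at level `s`. With `q = 1` it shows that the
configuration below the `n`-th backbone vertex has a density with respect to the original law that
depends on thresholds only (`lintegral_dens`). A general `q` merely changes the rate `G'(f(s))`.
With `θ(s) = P(R ≤ s)`, which solves `θ = phi(sθ)` for `phi(x) = 1 - G(1 - x)`, this yields absence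
of atoms, genericity, and `R_k → p_c`.

For (i): if `∫_0^s q ≤ s` for all `s`, the rate for `q` is at most the rate for `1`, so products of
bush functionals along the backbone have mean at most `1`. For `q = exp(l(u - s/2) - l²)`, a
Chernoff bound and Borel-Cantelli show that the total bush weight is the sum of `R_j/2` times the
bush sizes, up to a small multiple of total size (`ae_eventually_abs_excess_le`). Since `R_j → p_c`
and the backbone contributes only `O(k)`, which `k^(-γ)` kills, the two rescaled step paths are
uniformly close on bounded time intervals.

For (ii): regular variation gives `phi(x) ~ c₁ x^α`, hence `θ(s) ~ const * s^a` with `a = α/(1-α)`.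
At a small level the threshold stays put with probability near `α` and otherwise shrinks by a factor
distributed like `V^(1/a)`. The change of rate caused by `q` has a limit that depends only on the
limit `l` of `(s - Q(s))/s^(1+a)`, where `Q(s) = ∫_0^s q` (`Regular.exists_rate_limit`). Charging
each edge `exp(-l s^a)` gives `l`; charging its weight `exp(-l s^(a-1) u)` gives `l/2`, since the
mean weight is half the level. So the hypothesis on sizes fixes the Laplace transform of the
rescaled weights, with the factor `1/2`. `Regular.asymp_step` turns the exact formula into
factorizing limits of mixed moments, which gives joint convergence of finite windows. The bushes
before the window are negligible by the geometric bound `Regular.exists_lintegral_min_le`.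

For (iii): when `α < 1/2`, the mean of `1 - exp(-weight)` of a bush at threshold `r` is at most a
constant times `r^(1-a)`, with a positive exponent. Since moments of the thresholds decay
geometrically, the bush weights and the backbone weights are almost surely summable. -/

namespace IPC

noncomputable section

open scoped ENNReal
open ENNReal (ofReal ofReal_mul ofReal_le_ofReal ofReal_add ofReal_le_one ofReal_ne_top
  ofReal_toReal)
open Real (exp exp_pos rpow_pos_of_pos rpow_nonneg measurable_exp exp_le_one_iff norm_of_nonneg
  zero_rpow div_rpow rpow_le_one)
open Set (Icc Ioi Iic Ici Ioo Ioc)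
open Finset (range Ico mem_range prod_congr sum_congr sum_nonneg)
open Function (uncurry rightLim iterate_succ_apply')

set_option linter.unusedSectionVars false

section

/-! ### Configurations and their branches -/

/-- A configuration: `(false, v)` carries the number of children of the vertex `v` and `(true, v)`
the weight of the edge from `v` to its parent. -/
abbrev Config : Type := Bool × Vertex → ℝ

/-- The number of children of `v`, forced to be positive. -/
def deg (η : Config) (v : Vertex) : ℕ := max 1 ⌊η (false, v)⌋₊

/-- The weight of the edge above `v`, forced to be in `[0, 1]`. -/
def wt (η : Config) (v : Vertex) : ℝ := max 0 (min 1 (η (true, v)))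

/-- The configuration on the subtree below `u`. -/
def shv (u : Vertex) (η : Config) : Config := fun p => η (p.1, p.2 ++ u)

lemma deg_pos (η : Config) (v : Vertex) : 0 < deg η v := by simp [deg]

lemma wt_nonneg (η : Config) (v : Vertex) : 0 ≤ wt η v := le_max_left _ _

lemma wt_le_one (η : Config) (v : Vertex) : wt η v ≤ 1 := by simp [wt]

lemma range_deg_nonempty (η : Config) (v : Vertex) : (range (deg η v)).Nonempty :=
  ⟨0, mem_range.2 (deg_pos η v)⟩

lemma wt_shv (u v : Vertex) (η : Config) : wt (shv u η) v = wt η (v ++ u) := rfl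

lemma deg_shv (u v : Vertex) (η : Config) : deg (shv u η) v = deg η (v ++ u) := rfl

lemma shv_nil (η : Config) : shv [] η = η := by ext p; simp [shv]

lemma shv_shv (u v : Vertex) (η : Config) : shv u (shv v η) = shv (u ++ v) η := by
  ext p; simp [shv]

lemma measurable_deg (v : Vertex) : Measurable fun η : Config => deg η v :=
  measurable_const.max (Nat.measurable_floor.comp (measurable_pi_apply _))

lemma measurable_wt (v : Vertex) : Measurable fun η : Config => wt η v :=
  measurable_const.max (measurable_const.min (measurable_pi_apply _))

lemma measurable_shv (u : Vertex) : Measurable (shv u) :=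
  measurable_pi_lambda _ fun _ => measurable_pi_apply _

/-! ### The percolation threshold of a configuration -/

/-- The least `p` such that some path from the root to generation `n` has all weights at most `p`. -/
def Rn : ℕ → Config → ℝ
  | 0, _ => 0
  | n + 1, η => (range (deg η [])).inf' (range_deg_nonempty η [])
      fun i => max (wt η [i]) (Rn n (shv [i] η))

/-- The least `p` such that the root lies in an infinite component of the edges of weight at most
`p`. -/
def R (η : Config) : ℝ := ⨆ n, Rn n η

/-- The least `p` such that the root is reached from above and lies in an infinite component of the
edges of weight at most `p`. -/
def S (η : Config) : ℝ := max (wt η []) (R η)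

lemma Rn_nonneg (n : ℕ) (η : Config) : 0 ≤ Rn n η := by
  induction n generalizing η with
  | zero => simp [Rn]
  | succ n ih => exact (Finset.le_inf'_iff _ _).2 fun i _ => le_max_of_le_left (wt_nonneg _ _)

lemma Rn_le_one (n : ℕ) (η : Config) : Rn n η ≤ 1 := by
  induction n generalizing η with
  | zero => simp [Rn]
  | succ n ih =>
    exact (Finset.inf'_le _ (mem_range.2 (deg_pos η []))).trans
      (max_le (wt_le_one _ _) (ih _))

lemma Rn_le_succ (n : ℕ) (η : Config) : Rn n η ≤ Rn (n + 1) η := by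
  induction n generalizing η with
  | zero => exact Rn_nonneg _ _
  | succ n ih =>
    refine (Finset.le_inf'_iff _ _).2 fun i hi => (Finset.inf'_le _ hi).trans ?_
    exact max_le_max le_rfl (ih _)

lemma Rn_mono (η : Config) : Monotone fun n => Rn n η := monotone_nat_of_le_succ fun n => Rn_le_succ n η

lemma bddAbove_Rn (η : Config) : BddAbove (Set.range fun n => Rn n η) :=
  ⟨1, by rintro _ ⟨n, rfl⟩; exact Rn_le_one n η⟩

lemma Rn_le_R (n : ℕ) (η : Config) : Rn n η ≤ R η := le_ciSup (bddAbove_Rn η) n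

lemma R_le_iff {η : Config} {s : ℝ} : R η ≤ s ↔ ∀ n, Rn n η ≤ s := ciSup_le_iff (bddAbove_Rn η)

lemma lt_R_iff {η : Config} {s : ℝ} : s < R η ↔ ∃ n, s < Rn n η := by
  rw [← not_le, R_le_iff]; push Not; rfl

lemma R_nonneg (η : Config) : 0 ≤ R η := (Rn_nonneg 0 η).trans (Rn_le_R 0 η)

lemma R_le_one (η : Config) : R η ≤ 1 := R_le_iff.2 fun n => Rn_le_one n η

lemma S_nonneg (η : Config) : 0 ≤ S η := le_max_of_le_left (wt_nonneg _ _)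

lemma S_le_one (η : Config) : S η ≤ 1 := max_le (wt_le_one _ _) (R_le_one _)

lemma R_le_S (η : Config) : R η ≤ S η := le_max_right _ _

lemma Rn_succ_le_iff {n : ℕ} {η : Config} {s : ℝ} :
    Rn (n + 1) η ≤ s ↔ ∃ i < deg η [], wt η [i] ≤ s ∧ Rn n (shv [i] η) ≤ s := by
  simp only [Rn, Finset.inf'_le_iff, mem_range, max_le_iff]

lemma lt_Rn_succ_iff {n : ℕ} {η : Config} {s : ℝ} :
    s < Rn (n + 1) η ↔ ∀ i < deg η [], s < wt η [i] ∨ s < Rn n (shv [i] η) := by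
  simp only [Rn, Finset.lt_inf'_iff, mem_range, lt_max_iff]

/-- A compactness argument: there are finitely many children, so if each of them failed at some
depth, all would fail at the largest of these depths. -/
lemma R_le_iff_child {η : Config} {s : ℝ} : R η ≤ s ↔ ∃ i < deg η [], S (shv [i] η) ≤ s := by
  constructor
  · intro h
    have h' : ∀ n, ∃ i < deg η [], wt η [i] ≤ s ∧ Rn n (shv [i] η) ≤ s := fun n =>
      Rn_succ_le_iff.1 (R_le_iff.1 h (n + 1))
    by_contra! hc
    have : ∀ i < deg η [], ∃ n, s < wt η [i] ∨ s < Rn n (shv [i] η) := by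
      intro i hi
      rcases lt_max_iff.1 (hc i hi) with h1 | h1
      · exact ⟨0, Or.inl h1⟩
      · obtain ⟨n, hn⟩ := lt_R_iff.1 h1
        exact ⟨n, Or.inr hn⟩
    choose! N hN using this
    obtain ⟨i, hi, h1, h2⟩ := h' ((range (deg η [])).sup N)
    rcases hN i hi with h3 | h3
    · exact absurd h1 (not_le.2 h3)
    · exact absurd (h2.trans_lt h3)
        (not_lt.2 (Rn_mono _ (Finset.le_sup (f := N) (mem_range.2 hi))))
  · rintro ⟨i, hi, h⟩
    refine R_le_iff.2 fun n => (Rn_le_succ n η).trans (Rn_succ_le_iff.2 ⟨i, hi, ?_, ?_⟩)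
    · exact (le_max_left _ _).trans h
    · exact (Rn_le_R n _).trans ((le_max_right _ _).trans h)

lemma lt_R_iff_child {η : Config} {s : ℝ} : s < R η ↔ ∀ i < deg η [], s < S (shv [i] η) := by
  rw [← not_le, R_le_iff_child]; push Not; rfl

lemma R_le_S_child {η : Config} {i : ℕ} (hi : i < deg η []) : R η ≤ S (shv [i] η) :=
  R_le_iff_child.2 ⟨i, hi, le_rfl⟩

lemma exists_argmin (η : Config) : ∃ i, i < deg η [] ∧ S (shv [i] η) ≤ R η := by
  simpa using R_le_iff_child.1 (le_refl (R η))

open Classical in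
/-- The child of the root through which the root percolates first. -/
def argmin (η : Config) : ℕ := Nat.find (exists_argmin η)

lemma argmin_lt (η : Config) : argmin η < deg η [] := by
  classical exact (Nat.find_spec (exists_argmin η)).1

lemma S_argmin (η : Config) : S (shv [argmin η] η) = R η := by
  classical
  exact le_antisymm (Nat.find_spec (exists_argmin η)).2 (R_le_S_child (argmin_lt η))

/-- The configuration below the child through which the root percolates first. -/
def next (η : Config) : Config := shv [argmin η] η

/-- The identity behind the Markov structure: the threshold is the larger of the next backbone
weight and the next threshold. -/
lemma S_next (η : Config) : S (next η) = R η := S_argmin η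

lemma R_next_le (η : Config) : R (next η) ≤ R η := (R_le_S _).trans (S_next η).le

lemma measurable_Rn (n : ℕ) : Measurable (Rn n) := by
  induction n with
  | zero => exact measurable_const
  | succ n ih =>
    refine measurable_of_Iic fun s => ?_
    have : Rn (n + 1) ⁻¹' Iic s =
        ⋃ i : ℕ, {η | i < deg η []} ∩ ({η | wt η [i] ≤ s} ∩ {η | Rn n (shv [i] η) ≤ s}) := by
      ext η; simp [Rn_succ_le_iff]
    rw [this]
    refine .iUnion fun i => ((measurableSet_lt measurable_const (measurable_deg _)).inter
      ((measurableSet_le (measurable_wt _) measurable_const).inter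
        (measurableSet_le (ih.comp (measurable_shv _)) measurable_const)))

lemma measurable_R : Measurable R := Measurable.iSup fun n => measurable_Rn n

lemma measurable_S : Measurable S := (measurable_wt _).max measurable_R

lemma measurable_argmin : Measurable argmin := by
  classical
  refine measurable_find _ fun i => ?_
  exact (measurableSet_lt measurable_const (measurable_deg _)).inter
    (measurableSet_le (measurable_S.comp (measurable_shv _)) measurable_R)

/-- Used for products and shifts whose index (`deg`, `argmin`) is itself random: measurability is
checked for each value of the index. -/
lemma measurable_nat_apply {β : Type*} [MeasurableSpace β] {d : Config → ℕ} (hd : Measurable d)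
    {F : ℕ → Config → β} (hF : ∀ n, Measurable (F n)) : Measurable fun η => F (d η) η :=
  (measurable_from_prod_countable_right (f := fun p : ℕ × Config => F p.1 p.2) hF).comp
    (hd.prodMk measurable_id)

lemma measurable_next : Measurable next :=
  measurable_nat_apply (F := fun i η => shv [i] η) measurable_argmin fun i => measurable_shv [i]

/-! ### Open paths from the root -/

/-- The path from the root to a vertex of the tree has all weights at most `p`. -/
def Reach (p : ℝ) (η : Config) : Vertex → Prop
  | [] => True
  | i :: u => Reach p η u ∧ i < deg η u ∧ wt η (i :: u) ≤ p

lemma reach_append {p : ℝ} {η : Config} {u v : Vertex} :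
    Reach p η (u ++ v) ↔ Reach p η v ∧ Reach p (shv v η) u := by
  induction u with
  | nil => simp [Reach]
  | cons i u ih => simp [Reach, ih, deg_shv, wt_shv, and_assoc]

lemma reach_concat {p : ℝ} {η : Config} {u : Vertex} {i : ℕ} :
    Reach p η (u ++ [i]) ↔ (i < deg η [] ∧ wt η [i] ≤ p) ∧ Reach p (shv [i] η) u := by
  simp [reach_append, Reach]

lemma Reach.mono {p q : ℝ} {η : Config} {u : Vertex} (h : Reach p η u) (hpq : p ≤ q) :
    Reach q η u := by
  induction u with
  | nil => trivial
  | cons i u ih => exact ⟨ih h.1, h.2.1, h.2.2.trans hpq⟩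

lemma exists_reach_of_Rn_le {n : ℕ} {p : ℝ} {η : Config} (h : Rn n η ≤ p) :
    ∃ u, u.length = n ∧ Reach p η u := by
  induction n generalizing η with
  | zero => exact ⟨[], rfl, trivial⟩
  | succ n ih =>
    obtain ⟨i, hi, h1, h2⟩ := Rn_succ_le_iff.1 h
    obtain ⟨u, hu, hr⟩ := ih h2
    exact ⟨u ++ [i], by simp [hu], reach_concat.2 ⟨⟨hi, h1⟩, hr⟩⟩

lemma eq_nil_or_concat_of_reach {p : ℝ} {η : Config} {u : Vertex} (h : Reach p η u) :
    u = [] ∨ ∃ i v, u = v ++ [i] ∧ i < deg η [] ∧ wt η [i] ≤ p ∧ Reach p (shv [i] η) v := by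
  rcases List.eq_nil_or_concat' u with rfl | ⟨v, i, rfl⟩
  · exact Or.inl rfl
  · obtain ⟨⟨h1, h2⟩, h3⟩ := reach_concat.1 h
    exact Or.inr ⟨i, v, rfl, h1, h2, h3⟩

lemma length_lt_of_lt_Rn {n : ℕ} {p : ℝ} {η : Config} (hp : 0 ≤ p) (h : p < Rn n η) {u : Vertex}
    (hu : Reach p η u) : u.length < n := by
  induction n generalizing η u with
  | zero => exact absurd (h.trans_le le_rfl) (not_lt.2 hp)
  | succ n ih =>
    rcases eq_nil_or_concat_of_reach hu with rfl | ⟨i, v, rfl, h1, h2, h3⟩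
    · simp
    · have := (lt_Rn_succ_iff.1 h i h1).resolve_left (not_lt.2 h2)
      simpa using ih this h3

lemma finite_reach_length (p : ℝ) (η : Config) (n : ℕ) :
    {u | Reach p η u ∧ u.length < n}.Finite := by
  induction n with
  | zero => simp
  | succ n ih =>
    refine (((ih.biUnion fun u _ => (range (deg η u)).finite_toSet.image
      fun i => i :: u)).union (Set.finite_singleton [])).subset ?_
    rintro (_ | ⟨i, u⟩) ⟨h1, h2⟩
    · simp
    · left
      simp only [Set.mem_iUnion]
      refine ⟨u, ⟨h1.1, by simpa using h2⟩, i, by simpa using h1.2.1, rfl⟩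

/-- The vertices reached from the root along edges of weight at most `p`. -/
def reachSet (p : ℝ) (η : Config) : Set Vertex := {u | Reach p η u}

lemma finite_reachSet {p : ℝ} {η : Config} (hp : 0 ≤ p) (h : p < R η) : (reachSet p η).Finite := by
  obtain ⟨n, hn⟩ := lt_R_iff.1 h
  exact (finite_reach_length p η n).subset fun u hu => ⟨hu, length_lt_of_lt_Rn hp hn hu⟩

lemma infinite_reachSet {p : ℝ} {η : Config} (h : R η ≤ p) : (reachSet p η).Infinite := by
  intro hf
  obtain ⟨N, hN⟩ := (hf.image List.length).bddAbove
  obtain ⟨u, hu, hr⟩ := exists_reach_of_Rn_le ((Rn_le_R (N + 1) η).trans h)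
  have := hN ⟨u, hr, rfl⟩
  omega

/-- With `infinite_reachSet` this identifies `R`, defined by a recursion over generations, with the
threshold for an infinite open cluster. -/
lemma R_le_of_infinite {p : ℝ} {η : Config} (hp : 0 ≤ p) (h : (reachSet p η).Infinite) :
    R η ≤ p := by
  by_contra! hc
  exact h (finite_reachSet hp hc)

/-! ### Multiplicative functionals of finite clusters -/

/-- The product of `q s` over the weights of the edges in the open cluster of the root at level `s`
if this cluster does not reach generation `n`, and `0` otherwise. -/
def gn (q : ℝ → ℝ → ℝ≥0∞) (s : ℝ) : ℕ → Config → ℝ≥0∞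
  | 0, _ => 0
  | n + 1, η => ∏ i ∈ range (deg η []),
      if wt η [i] ≤ s then q s (wt η [i]) * gn q s n (shv [i] η) else 1

/-- The product of `q s` over the weights of the edges in the open cluster of the root at level `s`
if this cluster is finite, and `0` otherwise. -/
def clusterProd (q : ℝ → ℝ → ℝ≥0∞) (s : ℝ) (η : Config) : ℝ≥0∞ := ⨆ n, gn q s n η

/-- The contribution of a branch to the functional `clusterProd` of its parent. -/
def fac (q : ℝ → ℝ → ℝ≥0∞) (s : ℝ) (η : Config) : ℝ≥0∞ :=
  if wt η [] ≤ s then q s (wt η []) * clusterProd q s η else 1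

variable {q : ℝ → ℝ → ℝ≥0∞} {s : ℝ} {η : Config}

lemma gn_eq_zero {n : ℕ} (h : Rn n η ≤ s) : gn q s n η = 0 := by
  induction n generalizing η with
  | zero => rfl
  | succ n ih =>
    obtain ⟨i, hi, h1, h2⟩ := Rn_succ_le_iff.1 h
    exact Finset.prod_eq_zero (mem_range.2 hi) (by rw [if_pos h1, ih h2, mul_zero])

/-- Once the open cluster stays below generation `n`, the truncation at `n` is inactive. So the
supremum in `clusterProd` is attained, although `q` may exceed `1`. -/
lemma gn_eq_of_lt {n m : ℕ} (hs : 0 ≤ s) (h : s < Rn n η) (hnm : n ≤ m) :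
    gn q s m η = gn q s n η := by
  induction n generalizing η m with
  | zero => exact absurd h (not_lt.2 hs)
  | succ n ih =>
    obtain ⟨m, rfl⟩ := Nat.exists_eq_add_of_lt hnm
    refine prod_congr rfl fun i hi => ?_
    split_ifs with h1
    · rw [ih ((lt_Rn_succ_iff.1 h i (mem_range.1 hi)).resolve_left (not_lt.2 h1)) (by omega)]
    · rfl

lemma gn_mono (hs : 0 ≤ s) : Monotone fun n => gn q s n η := by
  intro m n h
  rcases le_or_gt (Rn m η) s with h1 | h1
  · simp [gn_eq_zero h1]
  · exact (gn_eq_of_lt hs h1 h).ge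

lemma clusterProd_eq_zero (h : R η ≤ s) : clusterProd q s η = 0 := by
  simp [clusterProd, fun n => gn_eq_zero (q := q) (R_le_iff.1 h n)]

lemma clusterProd_eq_gn {n : ℕ} (hs : 0 ≤ s) (h : s < Rn n η) :
    clusterProd q s η = gn q s n η := by
  refine le_antisymm (iSup_le fun m => ?_) (le_iSup (fun n => gn q s n η) n)
  rcases le_total m n with h1 | h1
  · exact gn_mono hs h1
  · exact (gn_eq_of_lt hs h h1).le

lemma fac_eq_zero (h : S η ≤ s) : fac q s η = 0 := by
  rw [fac, if_pos ((le_max_left _ _).trans h), clusterProd_eq_zero ((le_max_right _ _).trans h),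
    mul_zero]

/-- If the root percolates, so does some branch, and both sides vanish. Otherwise the recursion of
`gn` is applied at a depth where it has stabilized. -/
lemma clusterProd_eq_prod (hs : 0 ≤ s) :
    clusterProd q s η = ∏ i ∈ range (deg η []), fac q s (shv [i] η) := by
  rcases le_or_gt (R η) s with h | h
  · obtain ⟨i, hi, h1⟩ := R_le_iff_child.1 h
    rw [clusterProd_eq_zero h,
      Finset.prod_eq_zero (mem_range.2 hi) (fac_eq_zero h1)]
  · obtain ⟨n, hn⟩ := lt_R_iff.1 h
    have hn' := hn.trans_le (Rn_le_succ n η)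
    rw [clusterProd_eq_gn hs hn']
    refine prod_congr rfl fun i hi => ?_
    by_cases h1 : wt η [i] ≤ s
    · rw [fac, wt_shv, List.nil_append, if_pos h1, if_pos h1, clusterProd_eq_gn hs
        ((lt_Rn_succ_iff.1 hn' i (mem_range.1 hi)).resolve_left (not_lt.2 h1))]
    · rw [fac, wt_shv, List.nil_append, if_neg h1, if_neg h1]

lemma clusterProd_one (hs : 0 ≤ s) :
    clusterProd (fun _ _ => 1) s η = if s < R η then 1 else 0 := by
  have key : ∀ n (η : Config), s < Rn n η → gn (fun _ _ => 1) s n η = 1 := by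
    intro n
    induction n with
    | zero => exact fun η h => absurd h (not_lt.2 hs)
    | succ n ih =>
      refine fun η h => Finset.prod_eq_one fun i hi => ?_
      split_ifs with h1
      · rw [one_mul, ih _ ((lt_Rn_succ_iff.1 h i (mem_range.1 hi)).resolve_left (not_lt.2 h1))]
      · rfl
  split_ifs with h
  · obtain ⟨n, hn⟩ := lt_R_iff.1 h
    rw [clusterProd_eq_gn hs hn, key n η hn]
  · exact clusterProd_eq_zero (not_lt.1 h)

lemma measurable_gn (hq : Measurable (uncurry q)) (n : ℕ) :
    Measurable fun p : ℝ × Config => gn q p.1 n p.2 := by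
  induction n with
  | zero => exact measurable_const
  | succ n ih =>
    have h : ∀ m, Measurable fun p : ℝ × Config => ∏ i ∈ range m,
        if wt p.2 [i] ≤ p.1 then q p.1 (wt p.2 [i]) * gn q p.1 n (shv [i] p.2) else 1 := by
      refine fun m => Finset.measurable_prod _ fun i _ => Measurable.ite ?_ ?_ measurable_const
      · exact measurableSet_le ((measurable_wt _).comp measurable_snd) measurable_fst
      · exact (hq.comp (measurable_fst.prodMk ((measurable_wt _).comp measurable_snd))).mul
          (ih.comp (measurable_fst.prodMk ((measurable_shv _).comp measurable_snd)))
    exact (measurable_from_prod_countable_right (f := fun p : ℕ × (ℝ × Config) =>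
      ∏ i ∈ range p.1, if wt p.2.2 [i] ≤ p.2.1 then
        q p.2.1 (wt p.2.2 [i]) * gn q p.2.1 n (shv [i] p.2.2) else 1) h).comp
      (((measurable_deg []).comp measurable_snd).prodMk measurable_id)

lemma measurable_clusterProd (hq : Measurable (uncurry q)) :
    Measurable fun p : ℝ × Config => clusterProd q p.1 p.2 :=
  Measurable.iSup fun n => measurable_gn hq n

lemma measurable_fac (hq : Measurable (uncurry q)) :
    Measurable fun p : ℝ × Config => fac q p.1 p.2 :=
  Measurable.ite (measurableSet_le ((measurable_wt _).comp measurable_snd) measurable_fst)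
    ((hq.comp (measurable_fst.prodMk ((measurable_wt _).comp measurable_snd))).mul
      (measurable_clusterProd hq)) measurable_const

/-- The product of `q` over the weights of the edges that the root carries outside the backbone. -/
def bushProd (q : ℝ → ℝ → ℝ≥0∞) (η : Config) : ℝ≥0∞ :=
  ∏ j ∈ (range (deg η [])).erase (argmin η), fac q (R η) (shv [j] η)

lemma measurable_bushProd (hq : Measurable (uncurry q)) : Measurable (bushProd q) := by
  have h : ∀ m i, Measurable fun η : Config => ∏ j ∈ (range m).erase i,
      fac q (R η) (shv [j] η) := fun m i => Finset.measurable_prod _ fun j _ =>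
    (measurable_fac hq).comp (measurable_R.prodMk (measurable_shv _))
  exact measurable_nat_apply (F := fun m η => ∏ j ∈ (range m).erase (argmin η),
      fac q (R η) (shv [j] η)) (measurable_deg []) fun m =>
    measurable_nat_apply (F := fun i η => ∏ j ∈ (range m).erase i,
      fac q (R η) (shv [j] η)) measurable_argmin fun i => h m i

/-- The decomposition over the child through which the root percolates: the terms of the other
children vanish. -/
lemma bushProd_eq_sum (Ψ : ℝ → ℝ≥0∞) (H : Config → ℝ≥0∞) :
    Ψ (R η) * bushProd q η * H (next η) =
      ∑ i ∈ range (deg η []), Ψ (S (shv [i] η)) * H (shv [i] η) *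
        ∏ j ∈ (range (deg η [])).erase i, fac q (S (shv [i] η)) (shv [j] η) := by
  rw [Finset.sum_eq_single (argmin η)]
  · rw [S_argmin, bushProd, next]; ring
  · intro i hi hne
    rw [Finset.prod_eq_zero (i := argmin η), mul_zero]
    · exact Finset.mem_erase.2 ⟨hne.symm, mem_range.2 (argmin_lt η)⟩
    · exact fac_eq_zero ((S_argmin η).trans_le (R_le_S_child (mem_range.1 hi)))
  · exact fun h => absurd (mem_range.2 (argmin_lt η)) h

/-- Distinct branches merge at distinct levels. -/
def NoTie (η : Config) : Prop := ∀ j < deg η [], j ≠ argmin η → R η < S (shv [j] η)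

/-- The vertices reached from the root at level `R η` outside the branch that percolates. -/
def bush (η : Config) : Set Vertex := {u | Reach (R η) η u ∧ ¬ [argmin η] <:+ u}

lemma finprod_branches {J : Finset ℕ} (f : Vertex → ℝ≥0∞)
    (hfin : ∀ i ∈ J, (reachSet s (shv [i] η)).Finite) :
    ∏ᶠ u ∈ ⋃ i ∈ J, (fun u => u ++ [i]) '' reachSet s (shv [i] η), f u =
      ∏ i ∈ J, f [i] * ∏ᶠ u ∈ reachSet s (shv [i] η) \ {[]}, f (u ++ [i]) := by
  change ∏ᶠ u ∈ ⋃ i ∈ (J : Set ℕ), (fun u : Vertex => u ++ [i]) '' reachSet s (shv [i] η), f u = _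
  rw [finprod_mem_biUnion, finprod_mem_coe_finset]
  · refine prod_congr rfl fun i hi => ?_
    rw [finprod_mem_image fun a _ b _ h => by simpa using h]
    have : reachSet s (shv [i] η) = insert [] (reachSet s (shv [i] η) \ {[]}) := by
      rw [Set.insert_sdiff_singleton, Set.insert_eq_of_mem]; exact trivial
    conv_lhs => rw [this]
    rw [finprod_mem_insert _ (by simp) ((hfin i hi).subset Set.sdiff_subset)]
    simp
  · intro i _ j _ hij
    rw [Function.onFun, Set.disjoint_left]
    rintro _ ⟨u, _, rfl⟩ ⟨v, _, h⟩
    simp only [] at h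
    have := (List.append_inj' h (by simp)).2
    simp only [List.cons.injEq, and_true] at this
    exact hij this.symm
  · exact J.finite_toSet
  · exact fun i hi => (hfin i hi).image _

lemma clusterProd_eq_finprod (hs : 0 ≤ s) (h : s < R η) :
    clusterProd q s η = ∏ᶠ u ∈ reachSet s η \ {[]}, q s (wt η u) := by
  obtain ⟨n, hn⟩ := lt_R_iff.1 h
  clear h
  induction n generalizing η with
  | zero => exact absurd hn (not_lt.2 hs)
  | succ n ih =>
    have hc : ∀ i < deg η [], wt η [i] ≤ s → s < Rn n (shv [i] η) := fun i hi h1 =>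
      (lt_Rn_succ_iff.1 hn i hi).resolve_left (not_lt.2 h1)
    have hset : reachSet s η \ {[]} = ⋃ i ∈ (range (deg η [])).filter (fun i => wt η [i] ≤ s),
        (fun u => u ++ [i]) '' reachSet s (shv [i] η) := by
      ext u
      simp only [reachSet, Set.mem_sdiff, Set.mem_ofPred_eq, Set.mem_singleton_iff,
        Set.mem_iUnion, Set.mem_image, Finset.mem_filter, mem_range]
      constructor
      · rintro ⟨h1, h2⟩
        obtain ⟨i, v, rfl, h3, h4, h5⟩ := (eq_nil_or_concat_of_reach h1).resolve_left h2
        exact ⟨i, ⟨h3, h4⟩, v, h5, rfl⟩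
      · rintro ⟨i, ⟨h3, h4⟩, v, h5, rfl⟩
        exact ⟨reach_concat.2 ⟨⟨h3, h4⟩, h5⟩, by simp⟩
    rw [hset, finprod_branches, clusterProd_eq_prod hs, Finset.prod_filter]
    · refine prod_congr rfl fun i hi => ?_
      rw [fac, wt_shv, List.nil_append]
      split_ifs with h1
      · rw [ih (hc i (mem_range.1 hi) h1)]; rfl
      · rfl
    · intro i hi
      simp only [Finset.mem_filter, mem_range] at hi
      exact finite_reachSet hs (lt_R_iff.2 ⟨n, hc i hi.1 hi.2⟩)

lemma bush_eq : bush η \ {[]} =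
    ⋃ i ∈ ((range (deg η [])).erase (argmin η)).filter (fun i => wt η [i] ≤ R η),
      (fun u => u ++ [i]) '' reachSet (R η) (shv [i] η) := by
  ext u
  simp only [reachSet, bush, Set.mem_sdiff, Set.mem_ofPred_eq, Set.mem_singleton_iff,
    Set.mem_iUnion, Set.mem_image, Finset.mem_filter, mem_range, Finset.mem_erase]
  constructor
  · rintro ⟨⟨h1, h6⟩, h2⟩
    obtain ⟨i, v, rfl, h3, h4, h5⟩ := (eq_nil_or_concat_of_reach h1).resolve_left h2
    refine ⟨i, ⟨⟨?_, h3⟩, h4⟩, v, h5, rfl⟩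
    rintro rfl
    exact h6 (List.suffix_append _ _)
  · rintro ⟨i, ⟨⟨h6, h3⟩, h4⟩, v, h5, rfl⟩
    refine ⟨⟨reach_concat.2 ⟨⟨h3, h4⟩, h5⟩, fun h => h6 ?_⟩, by simp⟩
    obtain ⟨t, ht⟩ := h
    have := (List.append_inj' ht (by simp)).2
    simpa using this.symm

lemma finite_branch (h : NoTie η) {i : ℕ}
    (hi : i ∈ ((range (deg η [])).erase (argmin η)).filter (fun i => wt η [i] ≤ R η)) :
    R η < R (shv [i] η) := by
  simp only [Finset.mem_filter, mem_range, Finset.mem_erase] at hi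
  exact (lt_max_iff.1 (h i hi.1.2 hi.1.1)).resolve_left (not_lt.2 hi.2)

lemma finite_bush (h : NoTie η) : (bush η).Finite := by
  have : (bush η \ {[]}).Finite := by
    rw [bush_eq]
    refine Set.Finite.biUnion (Finset.finite_toSet _) fun i hi => Set.Finite.image _ ?_
    exact finite_reachSet (R_nonneg η) (finite_branch h hi)
  exact (this.insert []).subset (by simp)

/-- Without ties each open branch other than the percolating one is finite, so each factor is an
honest product over its edges. -/
lemma bushProd_eq_finprod (h : NoTie η) :
    bushProd q η = ∏ᶠ u ∈ bush η \ {[]}, q (R η) (wt η u) := by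
  rw [bush_eq, finprod_branches, bushProd, Finset.prod_filter]
  · refine prod_congr rfl fun i hi => ?_
    rw [fac, wt_shv, List.nil_append]
    split_ifs with h1
    · rw [clusterProd_eq_finprod (R_nonneg η) (finite_branch h (Finset.mem_filter.2 ⟨hi, h1⟩))]; rfl
    · rfl
  · exact fun i hi => finite_reachSet (R_nonneg η) (finite_branch h hi)

end

section

/-! ### The invasion percolation cluster of a configuration -/

lemma mem_boundary {x : Vertex → ℕ} {A : Finset Vertex} {b : Vertex} :
    b ∈ boundary x A ↔ (∃ v ∈ A, ∃ i < x v, i :: v = b) ∧ b ∉ A := by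
  simp [boundary]

variable {η : Config}

lemma invasion_mono : Monotone fun n => invasion (deg η) (wt η) n :=
  monotone_nat_of_le_succ fun _ => Finset.subset_union_left

lemma mem_invasion_succ {n : ℕ} {u : Vertex} (h : u ∈ invasion (deg η) (wt η) (n + 1))
    (h' : u ∉ invasion (deg η) (wt η) n) :
    u ∈ boundary (deg η) (invasion (deg η) (wt η) n) ∧
      ∀ b ∈ boundary (deg η) (invasion (deg η) (wt η) n), wt η u ≤ wt η b := by
  rw [invasion, invasionStep, Finset.mem_union] at h
  simpa using h.resolve_left h'

/-- The time at which a vertex other than the root is invaded. -/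
lemma exists_invasion_time {i : ℕ} {u : Vertex} (h : i :: u ∈ cluster (deg η) (wt η)) :
    i < deg η u ∧ ∃ n, i :: u ∉ invasion (deg η) (wt η) n ∧ u ∈ invasion (deg η) (wt η) n ∧
      ∀ b ∈ boundary (deg η) (invasion (deg η) (wt η) n), wt η (i :: u) ≤ wt η b := by
  classical
  have hex : ∃ n, i :: u ∈ invasion (deg η) (wt η) n := by simpa [cluster] using h
  obtain ⟨n, hn⟩ : ∃ n, Nat.find hex = n + 1 := by
    refine Nat.exists_eq_succ_of_ne_zero fun h0 => ?_
    have := Nat.find_spec hex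
    rw [h0] at this
    simp [invasion] at this
  have h1 : i :: u ∈ invasion (deg η) (wt η) (n + 1) := hn ▸ Nat.find_spec hex
  have h2 : i :: u ∉ invasion (deg η) (wt η) n := Nat.find_min hex (by omega)
  obtain ⟨h3, h4⟩ := mem_invasion_succ h1 h2
  obtain ⟨⟨v, hv, j, hj, he⟩, -⟩ := mem_boundary.1 h3
  obtain ⟨rfl, rfl⟩ := List.cons.inj he
  exact ⟨hj, n, h2, hv, h4⟩

lemma mem_invasion_of_cons {n i : ℕ} {u : Vertex} (h : i :: u ∈ invasion (deg η) (wt η) n) :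
    u ∈ invasion (deg η) (wt η) n := by
  induction n with
  | zero => simp [invasion] at h
  | succ n ih =>
    by_cases h' : i :: u ∈ invasion (deg η) (wt η) n
    · exact invasion_mono (Nat.le_succ n) (ih h')
    · obtain ⟨⟨v, hv, j, hj, he⟩, -⟩ := mem_boundary.1 (mem_invasion_succ h h').1
      obtain ⟨rfl, rfl⟩ := List.cons.inj he
      exact invasion_mono (Nat.le_succ n) hv

lemma mem_invasion_of_append {n : ℕ} {u v : Vertex} (h : u ++ v ∈ invasion (deg η) (wt η) n) :
    v ∈ invasion (deg η) (wt η) n := by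
  induction u with
  | nil => exact h
  | cons i u ih => exact ih (mem_invasion_of_cons h)

lemma mem_cluster_iff {u : Vertex} :
    u ∈ cluster (deg η) (wt η) ↔ ∃ n, u ∈ invasion (deg η) (wt η) n := by simp [cluster]

lemma mem_cluster_of_append {u v : Vertex} (h : u ++ v ∈ cluster (deg η) (wt η)) :
    v ∈ cluster (deg η) (wt η) := by
  obtain ⟨n, hn⟩ := mem_cluster_iff.1 h
  exact mem_cluster_iff.2 ⟨n, mem_invasion_of_append hn⟩

lemma exists_boundary_le {A : Finset Vertex} {p : ℝ} {v z : Vertex} (h : Reach p (shv v η) z)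
    (hv : v ∈ A) (hz : z ++ v ∉ A) : ∃ b ∈ boundary (deg η) A, wt η b ≤ p := by
  induction z with
  | nil => exact absurd hv hz
  | cons i z ih =>
    by_cases hzA : z ++ v ∈ A
    · exact ⟨i :: (z ++ v), mem_boundary.2 ⟨⟨_, hzA, i, h.2.1, rfl⟩, hz⟩, h.2.2⟩
    · exact ih h.1 hzA

/-- The infinite cluster below `v` at level `R (shv v η)` must leave the finite set `A`, and the
edge through which it leaves lies on the boundary. Invasion therefore always has such an edge on
offer. -/
lemma exists_boundary_le_R {v : Vertex} (A : Finset Vertex) (hv : v ∈ A) :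
    ∃ b ∈ boundary (deg η) A, wt η b ≤ R (shv v η) := by
  have hinf := (infinite_reachSet (le_refl (R (shv v η)))).image
    (f := fun z : Vertex => z ++ v) fun a _ b _ h => by simpa using h
  obtain ⟨_, ⟨z, hz, rfl⟩, hzA⟩ := hinf.exists_notMem_finset A
  exact exists_boundary_le hz hv hzA

lemma root_mem_invasion (n : ℕ) : [] ∈ invasion (deg η) (wt η) n :=
  invasion_mono (Nat.zero_le n) (by simp [invasion])

lemma lt_card_invasion (n : ℕ) : n < (invasion (deg η) (wt η) n).card := by
  induction n with
  | zero => simp [invasion]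
  | succ n ih =>
    refine (Nat.lt_of_le_of_lt (Nat.succ_le_of_lt ih) (Finset.card_lt_card ?_))
    obtain ⟨b, hb, -⟩ := exists_boundary_le_R (η := η) _ (root_mem_invasion (η := η) n)
    obtain ⟨c, hc, hmin⟩ := Finset.exists_min_image _ (wt η) ⟨b, hb⟩
    refine (Finset.ssubset_iff_of_subset (invasion_mono (Nat.le_succ n))).2
      ⟨c, ?_, (mem_boundary.1 hc).2⟩
    change c ∈ invasionStep _ _ _
    rw [invasionStep, Finset.mem_union]
    exact Or.inr (by simpa using ⟨hc, hmin⟩)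

lemma infinite_cluster : (cluster (deg η) (wt η)).Infinite := by
  intro hf
  have : (invasion (deg η) (wt η) hf.toFinset.card).card ≤ hf.toFinset.card :=
    Finset.card_le_card fun u hu => by simpa using mem_cluster_iff.2 ⟨_, hu⟩
  exact absurd (lt_card_invasion (η := η) hf.toFinset.card) (not_lt.2 this)

/-- In the cluster, all edges below a vertex `v` have weight at most `R (shv v η)`. -/
lemma reach_of_mem_cluster {v z : Vertex} (h : z ++ v ∈ cluster (deg η) (wt η)) :
    Reach (R (shv v η)) (shv v η) z := by
  induction z with
  | nil => trivial
  | cons i z ih =>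
    obtain ⟨hi, n, h1, h2, h3⟩ := exists_invasion_time h
    refine ⟨ih (mem_cluster_iff.2 ⟨n, h2⟩), hi, ?_⟩
    obtain ⟨b, hb, hle⟩ := exists_boundary_le_R (η := η) _ (mem_invasion_of_append h2)
    exact (h3 b hb).trans hle

/-- All cluster edges below `v` have weight at most `R (shv v η)`. Infinitely many invaded vertices
through the child `i` thus make this child percolate at that level, and only one child can. -/
lemma eq_argmin_of_infinite {v : Vertex} {i : ℕ} (hno : NoTie (shv v η))
    (h : {u | u ∈ cluster (deg η) (wt η) ∧ i :: v <:+ u}.Infinite) : i = argmin (shv v η) := by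
  have hr : ∀ z : Vertex, z ++ i :: v ∈ cluster (deg η) (wt η) →
      (i < deg (shv v η) [] ∧ wt (shv v η) [i] ≤ R (shv v η)) ∧
        Reach (R (shv v η)) (shv [i] (shv v η)) z := fun z hz =>
    reach_concat.1 (reach_of_mem_cluster (v := v) (z := z ++ [i]) (by simpa using hz))
  have hinf : (reachSet (R (shv v η)) (shv [i] (shv v η))).Infinite := by
    intro hf
    refine h ((hf.image fun z => z ++ i :: v).subset ?_)
    rintro _ ⟨hu, z, rfl⟩
    exact ⟨z, (hr z hu).2, rfl⟩
  obtain ⟨_, hu, z, rfl⟩ := h.nonempty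
  have hS : S (shv [i] (shv v η)) ≤ R (shv v η) :=
    max_le (hr z hu).1.2 (R_le_of_infinite (R_nonneg _) hinf)
  by_contra hne
  exact absurd hS (not_le.2 (hno i (hr z hu).1.1 hne))

/-- The path along which each vertex percolates first. -/
def spine (η : Config) : ℕ → Vertex
  | 0 => []
  | j + 1 => argmin (shv (spine η j) η) :: spine η j

lemma shv_spine (η : Config) (j : ℕ) : shv (spine η j) η = next^[j] η := by
  induction j with
  | zero => exact shv_nil η
  | succ j ih =>
    rw [iterate_succ_apply', ← ih, next, shv_shv]
    rfl

lemma wt_spine (η : Config) (j : ℕ) : wt η (spine η j) = wt (next^[j] η) [] := by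
  rw [← shv_spine, wt_shv, List.nil_append]

/-- There are no ties below any vertex. -/
def HNoTie (η : Config) : Prop := ∀ v, NoTie (shv v η)

/-- Pigeonhole over the finitely many children: some child carries infinitely many invaded vertices,
and it must be `argmin`. -/
lemma infinite_spine (hno : HNoTie η) (j : ℕ) :
    {u | u ∈ cluster (deg η) (wt η) ∧ spine η j <:+ u}.Infinite := by
  induction j with
  | zero => simpa [spine] using infinite_cluster
  | succ j ih =>
    have hsub : {u | u ∈ cluster (deg η) (wt η) ∧ spine η j <:+ u} ⊆ {spine η j} ∪
        ⋃ i ∈ range (deg η (spine η j)),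
          {u | u ∈ cluster (deg η) (wt η) ∧ i :: spine η j <:+ u} := by
      rintro _ ⟨hu, z, rfl⟩
      rcases List.eq_nil_or_concat' z with rfl | ⟨z, i, rfl⟩
      · simp
      · right
        simp only [Set.mem_iUnion]
        rw [List.append_assoc, List.singleton_append] at hu ⊢
        exact ⟨i, mem_range.2 (exists_invasion_time (mem_cluster_of_append hu)).1, hu,
          List.suffix_append _ _⟩
    obtain ⟨i, hi⟩ : ∃ i, {u | u ∈ cluster (deg η) (wt η) ∧ i :: spine η j <:+ u}.Infinite := by
      by_contra! hc
      exact ih (((Set.finite_singleton _).union (Set.Finite.biUnion (Finset.finite_toSet _)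
        fun i _ => hc i)).subset hsub)
    rwa [eq_argmin_of_infinite (hno _) hi] at hi

lemma spine_mem_cluster (hno : HNoTie η) (j : ℕ) : spine η j ∈ cluster (deg η) (wt η) := by
  obtain ⟨_, hu, z, rfl⟩ := (infinite_spine hno j).nonempty
  exact mem_cluster_of_append hu

lemma isRay_spine (hno : HNoTie η) : IsRay (deg η) (wt η) (spine η) :=
  ⟨rfl, fun j => ⟨spine_mem_cluster hno j, _, rfl⟩⟩

/-- The tail of any ray supplies infinitely many invaded vertices below each of its vertices, so
every step of the ray is forced. -/
lemma isRay_unique (hno : HNoTie η) {b : ℕ → Vertex} (hb : IsRay (deg η) (wt η) b) :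
    b = spine η := by
  have hsuf : ∀ j m, b j <:+ b (j + m) := by
    intro j m
    induction m with
    | zero => exact List.suffix_rfl
    | succ m ih =>
      obtain ⟨i, hi⟩ := (hb.2 (j + m)).2
      rw [← add_assoc, hi]
      exact ih.trans (List.suffix_cons _ _)
  have hlen : ∀ j, (b j).length = j := by
    intro j
    induction j with
    | zero => simp [hb.1]
    | succ j ih =>
      obtain ⟨i, hi⟩ := (hb.2 j).2
      simp [hi, ih]
  funext j
  induction j with
  | zero => exact hb.1
  | succ j ih =>
    obtain ⟨i, hi⟩ := (hb.2 j).2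
    have hinf : {u | u ∈ cluster (deg η) (wt η) ∧ i :: spine η j <:+ u}.Infinite := by
      rw [← ih, ← hi]
      refine Set.infinite_of_injective_forall_mem (f := fun m => b (j + 1 + m)) ?_
        fun m => ⟨(hb.2 _).1, hsuf _ _⟩
      intro m m' h
      have := congrArg List.length h
      simp only [hlen] at this
      omega
    rw [hi, ih, eq_argmin_of_infinite (hno _) hinf]
    rfl

lemma backbone_eq (hno : HNoTie η) : backbone (deg η) (wt η) = spine η := by
  have h : ∃ b, IsRay (deg η) (wt η) b := ⟨_, isRay_spine hno⟩
  rw [backbone, dif_pos h]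
  exact isRay_unique hno h.choose_spec

lemma R_iterate_antitone (η : Config) : Antitone fun j => R (next^[j] η) :=
  antitone_nat_of_succ_le fun j => by
    rw [iterate_succ_apply']; exact R_next_le _

lemma wt_iterate_succ_le (η : Config) (j : ℕ) : wt (next^[j + 1] η) [] ≤ R (next^[j] η) := by
  rw [iterate_succ_apply', ← S_next]
  exact le_max_left _ _

lemma bddAbove_wt (f : ℕ → Vertex) : BddAbove (Set.range fun i => wt η (f i)) :=
  ⟨1, by rintro _ ⟨i, rfl⟩; exact wt_le_one _ _⟩

/-- One inequality is monotonicity of the thresholds. For the other, the spine is itself an infinite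
path with weights at most the supremum, so the threshold is no larger. -/
lemma iSup_wt_spine (η : Config) (k : ℕ) :
    ⨆ i : ℕ, wt η (spine η (k + 1 + i)) = R (next^[k] η) := by
  apply le_antisymm
  · refine ciSup_le fun i => ?_
    rw [wt_spine, add_right_comm]
    exact (wt_iterate_succ_le η _).trans (R_iterate_antitone η (Nat.le_add_right k i))
  · set p := ⨆ i : ℕ, wt η (spine η (k + 1 + i))
    have hp : ∀ i, wt η (spine η (k + 1 + i)) ≤ p := fun i =>
      le_ciSup (bddAbove_wt fun i => spine η (k + 1 + i)) i
    have key : ∀ i, ∃ z : Vertex, z.length = i ∧ spine η (k + i) = z ++ spine η k ∧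
        Reach p (shv (spine η k) η) z := by
      intro i
      induction i with
      | zero => exact ⟨[], rfl, rfl, trivial⟩
      | succ i ih =>
        obtain ⟨z, h1, h2, h3⟩ := ih
        have h4 : spine η (k + 1 + i) = argmin (shv (spine η (k + i)) η) :: (z ++ spine η k) := by
          rw [← h2, add_right_comm]; rfl
        refine ⟨argmin (shv (spine η (k + i)) η) :: z, by simp [h1], ?_, h3, ?_, ?_⟩
        · rw [← add_assoc, add_right_comm, h4]; rfl
        · have := argmin_lt (shv (spine η (k + i)) η)
          rw [deg_shv, List.nil_append] at this
          rwa [deg_shv, ← h2]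
        · have := hp i
          rwa [h4] at this
    have hinf : (reachSet p (shv (spine η k) η)).Infinite := by
      intro hf
      obtain ⟨N, hN⟩ := (hf.image List.length).bddAbove
      obtain ⟨z, h1, -, h3⟩ := key (N + 1)
      have := hN ⟨z, h3, rfl⟩
      omega
    rw [← shv_spine]
    exact R_le_of_infinite ((wt_nonneg _ _).trans (hp 0)) hinf

lemma futureMax_eq (hno : HNoTie η) (k : ℕ) :
    futureMax (deg η) (wt η) k = R (next^[k] η) := by
  rw [futureMax, backbone_eq hno, iSup_wt_spine]

/-- No edge outside the backbone has the weight at which the root percolates. -/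
def Clean (η : Config) : Prop := ∀ u ∈ bush η, u ≠ [] → wt η u ≠ R η

/-- A path has finitely many edges, and none has weight exactly `R η`, so there is room below the
threshold. -/
lemma exists_reach_lt (hc : Clean η) {z : Vertex} (hz : z ∈ bush η) :
    ∃ p < R η, Reach p η z := by
  induction z with
  | nil => exact ⟨R η - 1, by linarith, trivial⟩
  | cons i z ih =>
    obtain ⟨p, hp, hr⟩ := ih ⟨hz.1.1, fun h => hz.2 (h.trans (List.suffix_cons _ _))⟩
    refine ⟨max p (wt η (i :: z)), max_lt hp (lt_of_le_of_ne hz.1.2.2 (hc _ hz (by simp))), ?_⟩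
    exact ⟨hr.mono (le_max_left _ _), hz.1.2.1, le_max_right _ _⟩

lemma suffix_append_right_cancel {a b v : Vertex} : a ++ v <:+ b ++ v ↔ a <:+ b := by
  constructor
  · rintro ⟨t, ht⟩
    rw [← List.append_assoc] at ht
    exact ⟨t, List.append_cancel_right ht⟩
  · rintro ⟨t, rfl⟩
    exact ⟨t, by simp⟩

/-- There are no ties, and the levels are not taken by edges outside the backbone. -/
def Generic (η : Config) : Prop := ∀ v, NoTie (shv v η) ∧ Clean (shv v η)

lemma Generic.hNoTie (h : Generic η) : HNoTie η := fun v => (h v).1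

lemma Generic.noTie_iterate (h : Generic η) (j : ℕ) : NoTie (next^[j] η) := by
  rw [← shv_spine]; exact (h _).1

lemma Generic.clean_iterate (h : Generic η) (j : ℕ) : Clean (next^[j] η) := by
  rw [← shv_spine]; exact (h _).2

/-- A bush vertex is reachable at some level `p < R`, and a later backbone edge has weight above
`p`. When that edge is invaded, no cheaper boundary edge is left, so the bush vertex is already in
the cluster. -/
lemma bush_subset_cluster (h : Generic η) {j : ℕ} {z : Vertex} (hz : z ∈ bush (next^[j] η)) :
    z ++ spine η j ∈ cluster (deg η) (wt η) := by
  obtain ⟨p, hp, hr⟩ := exists_reach_lt (h.clean_iterate j) hz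
  rw [← iSup_wt_spine] at hp
  obtain ⟨i, hi⟩ := exists_lt_of_lt_ciSup hp
  have hmem := spine_mem_cluster h.hNoTie (j + i + 1)
  obtain ⟨-, n, -, h2, h3⟩ := exists_invasion_time hmem
  have hsuf : ∀ m, spine η j <:+ spine η (j + m) := by
    intro m
    induction m with
    | zero => exact List.suffix_rfl
    | succ m ih => exact ih.trans (List.suffix_cons _ _)
  obtain ⟨t, ht⟩ := hsuf i
  rw [← ht] at h2
  by_contra hcon
  obtain ⟨b, hb, hle⟩ := exists_boundary_le (η := η) (v := spine η j) (z := z) (p := p)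
    (by rwa [shv_spine]) (mem_invasion_of_append h2)
    (fun hh => hcon (mem_cluster_iff.2 ⟨n, hh⟩))
  have h4 : wt η (spine η (j + i + 1)) ≤ wt η b := h3 b hb
  rw [add_right_comm] at h4
  linarith

lemma mem_image_bush_iff (h : Generic η) {j : ℕ} {u : Vertex} :
    u ∈ (fun z => z ++ spine η j) '' bush (next^[j] η) ↔
      u ∈ cluster (deg η) (wt η) ∧ spine η j <:+ u ∧ ¬ spine η (j + 1) <:+ u := by
  have hs : spine η (j + 1) = [argmin (next^[j] η)] ++ spine η j := by
    rw [spine, shv_spine]; rfl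
  constructor
  · rintro ⟨z, hz, rfl⟩
    refine ⟨bush_subset_cluster h hz, List.suffix_append _ _, ?_⟩
    rw [hs, suffix_append_right_cancel]
    exact hz.2
  · rintro ⟨h1, ⟨z, rfl⟩, h3⟩
    refine ⟨z, ⟨?_, ?_⟩, rfl⟩
    · rw [← shv_spine]; exact reach_of_mem_cluster h1
    · rwa [hs, suffix_append_right_cancel] at h3

lemma cutCluster_zero (h : Generic η) : cutCluster (deg η) (wt η) 0 = bush η := by
  ext u
  have := mem_image_bush_iff h (j := 0) (u := u)
  simp only [spine, List.append_nil, Function.iterate_zero, id_eq, Set.image_id',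
    List.nil_suffix, true_and] at this
  rw [this, cutCluster, backbone_eq h.hNoTie]
  rfl

lemma cutCluster_succ (h : Generic η) (k : ℕ) :
    cutCluster (deg η) (wt η) (k + 1) = cutCluster (deg η) (wt η) k ∪
      (fun z => z ++ spine η (k + 1)) '' bush (next^[k + 1] η) := by
  ext u
  rw [Set.mem_union, mem_image_bush_iff h]
  simp only [cutCluster, backbone_eq h.hNoTie, Set.mem_ofPred_eq]
  have : spine η (k + 1 + 1) <:+ u → spine η (k + 1) <:+ u :=
    fun h => (List.suffix_cons _ _).trans h
  tauto

lemma disjoint_cutCluster (h : Generic η) (k : ℕ) :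
    Disjoint (cutCluster (deg η) (wt η) k)
      ((fun z => z ++ spine η (k + 1)) '' bush (next^[k + 1] η)) := by
  rw [Set.disjoint_left]
  intro u hu hu'
  rw [cutCluster, backbone_eq h.hNoTie] at hu
  exact hu.2 ((mem_image_bush_iff h).1 hu').2.1

lemma finite_cutCluster (h : Generic η) (k : ℕ) : (cutCluster (deg η) (wt η) k).Finite := by
  induction k with
  | zero => rw [cutCluster_zero h]; exact finite_bush (h.noTie_iterate 0)
  | succ k ih =>
    rw [cutCluster_succ h]
    exact ih.union ((finite_bush (h.noTie_iterate _)).image _)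

/-- The total weight of the edges that the root carries outside the backbone. -/
def bushWeight (η : Config) : ℝ := ∑ᶠ u ∈ bush η \ {[]}, wt η u

/-- The number of the edges that the root carries outside the backbone. -/
def bushSize (η : Config) : ℕ := (bush η \ {[]}).ncard

lemma nil_mem_bush (η : Config) : [] ∈ bush η := ⟨trivial, by simp⟩

lemma ncard_bush (h : NoTie η) : (bush η).ncard = bushSize η + 1 :=
  (Set.ncard_sdiff_singleton_add_one (nil_mem_bush η) (finite_bush h)).symm

lemma append_right_injective (v : Vertex) : Function.Injective fun z : Vertex => z ++ v :=
  fun a b h => by simpa using h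

lemma cutSize_eq (h : Generic η) (k : ℕ) :
    cutSize (deg η) (wt η) k = ∑ j ∈ range (k + 1), (bushSize (next^[j] η) + 1) := by
  induction k with
  | zero =>
    simpa [cutSize, cutCluster_zero h] using ncard_bush (h.noTie_iterate 0)
  | succ k ih =>
    rw [Finset.sum_range_succ, ← ih, cutSize, cutCluster_succ h,
      Set.ncard_union_eq (disjoint_cutCluster h k) (finite_cutCluster h k)
        ((finite_bush (h.noTie_iterate _)).image _),
      Set.ncard_image_of_injective _ (append_right_injective _),
      ncard_bush (h.noTie_iterate _)]
    rfl

lemma cutWeight_eq (h : Generic η) (k : ℕ) :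
    cutWeight (deg η) (wt η) k = ∑ j ∈ range (k + 1), bushWeight (next^[j] η) +
      ∑ j ∈ range k, wt (next^[j + 1] η) [] := by
  induction k with
  | zero => simp [cutWeight, cutCluster_zero h, bushWeight]
  | succ k ih =>
    have hb := finite_bush (h.noTie_iterate (k + 1))
    have hset : cutCluster (deg η) (wt η) (k + 1) \ {[]} =
        (cutCluster (deg η) (wt η) k \ {[]}) ∪
          (fun z => z ++ spine η (k + 1)) '' bush (next^[k + 1] η) := by
      rw [cutCluster_succ h, Set.union_sdiff_distrib, Set.sdiff_singleton_eq_self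
        (s := (fun z => z ++ spine η (k + 1)) '' bush (next^[k + 1] η))]
      rintro ⟨z, -, hz⟩
      simp [spine] at hz
    have hsum : ∑ᶠ u ∈ (fun z => z ++ spine η (k + 1)) '' bush (next^[k + 1] η), wt η u =
        wt (next^[k + 1] η) [] + bushWeight (next^[k + 1] η) := by
      rw [finsum_mem_image (append_right_injective _).injOn]
      have : bush (next^[k + 1] η) = insert [] (bush (next^[k + 1] η) \ {[]}) := by
        rw [Set.insert_sdiff_singleton, Set.insert_eq_of_mem (nil_mem_bush _)]
      -- The vertex `[]` of the bush stands for the backbone vertex itself; it contributes the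
      -- backbone edge above it, which `bushWeight` omits.
      conv_lhs => rw [this]
      rw [finsum_mem_insert _ (by simp) (hb.subset Set.sdiff_subset), bushWeight]
      simp only [← wt_shv, shv_spine]
    rw [cutWeight, hset, finsum_mem_union
      ((disjoint_cutCluster h k).mono_left Set.sdiff_subset)
      ((finite_cutCluster h k).subset Set.sdiff_subset) (hb.image _), hsum,
      Finset.sum_range_succ (fun j => bushWeight (next^[j] η)) (k + 1),
      Finset.sum_range_succ (fun j => wt (next^[j + 1] η) []) k, ← cutWeight, ih]
    ring

end

section

/-! ### The law of a random configuration -/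

/-- The uniform law on `[0, 1]`. -/
def unif : Measure ℝ := volume.restrict (Icc (0 : ℝ) 1)

instance : IsProbabilityMeasure unif := ⟨by simp [unif]⟩

/-- The laws of the entries of a configuration. -/
def entryLaw (ν : Measure ℕ) (b : Bool) : Measure ℝ :=
  match b with
  | true => unif
  | false => ν.map fun n : ℕ => (n : ℝ)

variable {ν : Measure ℕ} [IsProbabilityMeasure ν]

instance (b : Bool) : IsProbabilityMeasure (entryLaw ν b) := by
  cases b
  · exact Measure.isProbabilityMeasure_map (measurable_of_countable _).aemeasurable
  · exact inferInstanceAs (IsProbabilityMeasure unif)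

/-- The law of a configuration with independent entries. -/
def law (ν : Measure ℕ) : Measure Config := Measure.infinitePi fun p => entryLaw ν p.1

instance : IsProbabilityMeasure (law ν) :=
  inferInstanceAs (IsProbabilityMeasure (Measure.infinitePi fun p : Bool × Vertex => entryLaw ν p.1))

/-- Disjoint blocks of coordinates of a product measure are independent; injectivity of `f` on the
sigma type expresses disjointness. -/
lemma iIndepFun_group {ι : Type} {κ : ι → Type} (f : (Σ i, κ i) → Bool × Vertex)
    (hf : Function.Injective f) :
    iIndepFun (fun i (η : Config) (j : κ i) => η (f ⟨i, j⟩)) (law ν) := by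
  rw [iIndepFun_iff_map_fun_eq_infinitePi_map (by fun_prop)]
  have h1 : (law ν).map (fun η (p : Σ i, κ i) => η (f p)) =
      Measure.infinitePi fun p => entryLaw ν (f p).1 :=
    Measure.map_infinitePi_infinitePi_of_inj hf
  have h2 : ∀ i, (law ν).map (fun η (j : κ i) => η (f ⟨i, j⟩)) =
      Measure.infinitePi fun j => entryLaw ν (f ⟨i, j⟩).1 := fun i =>
    Measure.map_infinitePi_infinitePi_of_inj (f := fun j => f ⟨i, j⟩)
      fun a b h => by simpa using hf h
  have h3 := Measure.infinitePi_map_piCurry (X := fun (i : ι) (_ : κ i) => ℝ)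
    fun i j => entryLaw ν (f ⟨i, j⟩).1
  simp_rw [h2]
  rw [← h3]
  change _ = Measure.map _ (Measure.infinitePi fun p => entryLaw ν (f p).1)
  rw [← h1, Measure.map_map (by fun_prop) (by fun_prop)]
  rfl

open Classical in
/-- The configuration with the entries outside `A` removed. -/
def keep (A : Set (Bool × Vertex)) (η : Config) : Config := fun p => if p ∈ A then η p else 0

lemma measurable_keep (A : Set (Bool × Vertex)) : Measurable (keep A) := by
  refine measurable_pi_lambda _ fun p => ?_
  by_cases h : p ∈ A
  · simpa [keep, h] using measurable_pi_apply p
  · simp [keep, h]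

lemma indepFun_keep (A : Set (Bool × Vertex)) : IndepFun (keep A) (keep Aᶜ) (law ν) := by
  classical
  have h := iIndepFun_group (ν := ν) (ι := Bool) (κ := fun b => {p // decide (p ∈ A) = b})
    (fun p => p.2.1) (by
      rintro ⟨b, p, hp⟩ ⟨b', p', hp'⟩ h
      obtain rfl : p = p' := h
      subst hp; subst hp'; rfl)
  have h' := h.indepFun (i := true) (j := false) (by simp)
  have hm : ∀ b, Measurable fun (ξ : {p // decide (p ∈ A) = b} → ℝ) (p : Bool × Vertex) =>
      if hp : decide (p ∈ A) = b then ξ ⟨p, hp⟩ else 0 := by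
    refine fun b => measurable_pi_lambda _ fun p => ?_
    by_cases hp : decide (p ∈ A) = b
    · simpa [hp] using measurable_pi_apply (⟨p, hp⟩ : {p // decide (p ∈ A) = b})
    · simp [hp]
  convert h'.comp (hm true) (hm false) using 1
  · ext η p; simp [keep]
  · ext η p; simp [keep]

lemma lintegral_of_indepFun {Ω β γ : Type*} [MeasurableSpace Ω] [MeasurableSpace β]
    [MeasurableSpace γ] {μ : Measure Ω} [IsProbabilityMeasure μ] {X : Ω → β} {Y : Ω → γ}
    (h : IndepFun X Y μ) (hX : Measurable X) (hY : Measurable Y) {F : β × γ → ℝ≥0∞}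
    (hF : Measurable F) : ∫⁻ ω, F (X ω, Y ω) ∂μ = ∫⁻ ω, ∫⁻ ω', F (X ω, Y ω') ∂μ ∂μ := by
  have := Measure.isProbabilityMeasure_map (μ := μ) hY.aemeasurable
  rw [← lintegral_map hF (hX.prodMk hY), (indepFun_iff_map_prod_eq_prod_map_map hX.aemeasurable
    hY.aemeasurable).1 h, lintegral_prod _ hF.aemeasurable,
    lintegral_map hF.lintegral_prod_right' hX]
  exact lintegral_congr fun ω => lintegral_map (hF.comp measurable_prodMk_left) hY

lemma map_shv (u : Vertex) : (law ν).map (shv u) = law ν :=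
  Measure.map_infinitePi_infinitePi_of_inj (f := fun p : Bool × Vertex => (p.1, p.2 ++ u))
    fun a b h => by simpa [Prod.ext_iff] using h

lemma measurePreserving_shv (u : Vertex) : MeasurePreserving (shv u) (law ν) (law ν) :=
  ⟨measurable_shv u, map_shv u⟩

/-- The clipping in `deg` is invisible to the law, because `ν` charges neither zero nor
non-integers. -/
lemma map_deg (hν : ν {0} = 0) (v : Vertex) : (law ν).map (fun η => deg η v) = ν := by
  have h1 : (law ν).map (fun η => η (false, v)) = ν.map fun n : ℕ => (n : ℝ) :=
    Measure.infinitePi_map_eval _ (false, v)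
  have h2 : (fun η : Config => deg η v) = (fun x : ℝ => max 1 ⌊x⌋₊) ∘ fun η => η (false, v) := rfl
  have hm : Measurable fun x : ℝ => max 1 ⌊x⌋₊ := measurable_const.max Nat.measurable_floor
  rw [h2, ← Measure.map_map hm (measurable_pi_apply _), h1, Measure.map_map hm
    (measurable_of_countable _)]
  conv_rhs => rw [← Measure.map_id (μ := ν)]
  refine Measure.map_congr ?_
  have : ∀ᵐ n ∂ν, n ≠ 0 := measure_eq_zero_iff_ae_notMem.1 hν
  filter_upwards [this] with n hn
  simpa using Nat.one_le_iff_ne_zero.2 hn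

lemma map_wt (v : Vertex) : (law ν).map (fun η => wt η v) = unif := by
  have h1 : (law ν).map (fun η => η (true, v)) = unif := Measure.infinitePi_map_eval _ (true, v)
  have h2 : (fun η : Config => wt η v) = (fun x : ℝ => max 0 (min 1 x)) ∘ fun η => η (true, v) :=
    rfl
  have hm : Measurable fun x : ℝ => max 0 (min 1 x) :=
    measurable_const.max (measurable_const.min measurable_id)
  rw [h2, ← Measure.map_map hm (measurable_pi_apply _), h1]
  conv_rhs => rw [← Measure.map_id (μ := unif)]
  refine Measure.map_congr ?_
  filter_upwards [ae_restrict_mem measurableSet_Icc] with x hx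
  simp [hx.1, hx.2]

/-! ### Functionals that do not depend on the weight above the root -/

/-- The functional does not depend on the weight above the root. -/
def RootFree {β : Type*} (H : Config → β) : Prop := ∀ η, H (keep {(true, [])}ᶜ η) = H η

lemma deg_keep_root (η : Config) (v : Vertex) : deg (keep {(true, [])}ᶜ η) v = deg η v := by
  simp [deg, keep]

lemma wt_keep_root (η : Config) (v : Vertex) (i : ℕ) :
    wt (keep {(true, [])}ᶜ η) (v ++ [i]) = wt η (v ++ [i]) := by
  simp [wt, keep]

lemma shv_keep_root (η : Config) (i : ℕ) : shv [i] (keep {(true, [])}ᶜ η) = shv [i] η := by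
  ext p; simp [shv, keep]

lemma rootFree_Rn (n : ℕ) : RootFree (Rn n) := by
  intro η
  cases n with
  | zero => rfl
  | succ n =>
    have hw : ∀ i, wt (keep {(true, [])}ᶜ η) [i] = wt η [i] := fun i => wt_keep_root η [] i
    refine eq_of_forall_ge_iff fun s => ?_
    simp only [Rn_succ_le_iff, deg_keep_root, shv_keep_root, hw]

lemma rootFree_R : RootFree R := fun η => by simp only [R, rootFree_Rn _ η]

lemma argmin_keep_root (η : Config) : argmin (keep {(true, [])}ᶜ η) = argmin η := by
  simp only [argmin, deg_keep_root, shv_keep_root, rootFree_R η]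

lemma rootFree_next : RootFree next := fun η => by
  rw [next, argmin_keep_root, shv_keep_root, next]

lemma rootFree_next_iterate (n : ℕ) : RootFree (next^[n + 1]) := fun η => by
  rw [Function.iterate_succ_apply, rootFree_next, Function.iterate_succ_apply]

lemma RootFree.comp_left {β γ : Type*} {H : Config → β} (h : RootFree H) (f : β → γ) :
    RootFree fun η => f (H η) := fun η => congrArg f (h η)

lemma rootFree_clusterProd {q : ℝ → ℝ → ℝ≥0∞} {s : ℝ} (hs : 0 ≤ s) :
    RootFree (clusterProd q s) := fun η => by
  simp only [clusterProd_eq_prod hs, deg_keep_root, shv_keep_root]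

lemma rootFree_bushProd {q : ℝ → ℝ → ℝ≥0∞} : RootFree (bushProd q) := fun η => by
  simp only [bushProd, deg_keep_root, shv_keep_root, argmin_keep_root, rootFree_R η]

/-- The weight above the root is independent of what lies below. -/
lemma lintegral_root {F : ℝ → Config → ℝ≥0∞} (hF : Measurable (uncurry F))
    (hfree : ∀ u, RootFree (F u)) :
    ∫⁻ η, F (wt η []) η ∂law ν = ∫⁻ η, ∫⁻ u, F u η ∂unif ∂law ν := by
  have h1 : ∀ η, F (wt η []) η =
      F (wt (keep {(true, [])} η) []) (keep {(true, [])}ᶜ η) := fun η => by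
    rw [hfree]; simp [wt, keep]
  have h := lintegral_of_indepFun (indepFun_keep (ν := ν) {(true, [])}) (measurable_keep _)
    (measurable_keep _) (F := fun p => F (wt p.1 []) p.2)
    (hF.comp (((measurable_wt _).comp measurable_fst).prodMk measurable_snd))
  calc _ = _ := lintegral_congr h1
    _ = _ := h
    _ = ∫⁻ η, ∫⁻ η', F (wt η []) η' ∂law ν ∂law ν := by
      refine lintegral_congr fun η => lintegral_congr fun η' => ?_
      rw [hfree]; simp [wt, keep]
    _ = ∫⁻ η', ∫⁻ η, F (wt η []) η' ∂law ν ∂law ν := by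
      refine lintegral_lintegral_swap (Measurable.aemeasurable ?_)
      exact hF.comp (((measurable_wt _).comp measurable_fst).prodMk measurable_snd)
    _ = _ := by
      refine lintegral_congr fun η' => ?_
      have := lintegral_map (μ := law ν) (f := fun u => F u η') (hF.comp measurable_prodMk_right)
        (measurable_wt [])
      rw [map_wt] at this
      exact this.symm

/-! ### Independence of the branches -/

/-- The entries of the root and of its branches. -/
def branchIndex : (Σ o : Bool ⊕ ℕ, Sum.elim (fun _ => Unit) (fun _ => Bool × Vertex) o) →
    Bool × Vertex
  | ⟨Sum.inl b, _⟩ => (b, [])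
  | ⟨Sum.inr i, p⟩ => (p.1, p.2 ++ [i])

lemma branchIndex_injective : Function.Injective branchIndex := by
  rintro ⟨_ | i, p⟩ ⟨_ | j, p'⟩ h
  · simp only [branchIndex, Prod.mk.injEq] at h
    obtain ⟨rfl, -⟩ := h; rfl
  · simp [branchIndex] at h
  · simp [branchIndex] at h
  · simp only [branchIndex, Prod.mk.injEq] at h
    have h2 := List.append_inj' h.2 (by simp)
    simp only [List.cons.injEq, and_true] at h2
    obtain ⟨b, v⟩ := p
    obtain ⟨b', v'⟩ := p'
    obtain ⟨h1, h3, rfl⟩ : b = b' ∧ v = v' ∧ i = j := ⟨h.1, h2.1, h2.2⟩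
    subst h1; subst h3; rfl

lemma measurable_indicator_deg (n : ℕ) :
    Measurable ({η : Config | deg η [] = n}.indicator (1 : Config → ℝ≥0∞)) :=
  measurable_one.indicator (measurable_deg [] (measurableSet_singleton n))

/-- The degree of the root and the branches are disjoint blocks of coordinates, and every branch has
the law of the whole configuration. -/
lemma lintegral_prod_branches_deg (hν : ν {0} = 0) (n : ℕ) (J : Finset ℕ)
    {φ : ℕ → Config → ℝ≥0∞} (hφ : ∀ j, Measurable (φ j)) :
    ∫⁻ η, {η | deg η [] = n}.indicator 1 η * ∏ j ∈ J, φ j (shv [j] η) ∂law ν =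
      ν {n} * ∏ j ∈ J, ∫⁻ τ, φ j τ ∂law ν := by
  have h := iIndepFun_group (ν := ν) branchIndex branchIndex_injective
  have hset : MeasurableSet {η : Config | deg η [] = n} :=
    measurable_deg [] (measurableSet_singleton n)
  -- The block of the root weight gets the constant function `1`, since it is not involved.
  have h2 := h.comp (γ := fun _ => ℝ≥0∞) (g := fun o => match o with
    | Sum.inl true => fun _ => 1
    | Sum.inl false => fun ξ => {x : ℝ | max 1 ⌊x⌋₊ = n}.indicator 1 (ξ ())
    | Sum.inr i => φ i) (by
      rintro ((_ | _) | i)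
      · change Measurable fun ξ : Unit → ℝ =>
          {x : ℝ | max 1 ⌊x⌋₊ = n}.indicator (1 : ℝ → ℝ≥0∞) (ξ ())
        refine (measurable_one.indicator ?_).comp (measurable_pi_apply ())
        exact (measurable_const.max Nat.measurable_floor) (measurableSet_singleton n)
      · exact measurable_const
      · exact hφ i)
  have h3 := lintegral_prod_eq_prod_lintegral_of_indepFun
    (insert (Sum.inl false) (J.map ⟨Sum.inr, Sum.inr_injective⟩)) _ h2 (by
      rintro ((_ | _) | i)
      · exact measurable_indicator_deg n
      · exact measurable_const
      · exact (hφ i).comp (measurable_shv [i]))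
  simp only [Finset.prod_insert (show Sum.inl false ∉ J.map ⟨Sum.inr, Sum.inr_injective⟩ by simp),
    Finset.prod_map] at h3
  have h4 : ν {n} = ∫⁻ η, {η | deg η [] = n}.indicator 1 η ∂law ν := by
    have h5 : ν {n} = (law ν).map (fun η => deg η []) {n} := by rw [map_deg hν]
    rw [lintegral_indicator_one hset, h5,
      Measure.map_apply (measurable_deg _) (measurableSet_singleton n)]
    rfl
  have h5 : ∀ j, ∫⁻ τ, φ j τ ∂law ν = ∫⁻ η, φ j (shv [j] η) ∂law ν := fun j =>
    ((measurePreserving_shv [j]).lintegral_comp (hφ j)).symm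
  simp_rw [h4, h5]
  exact h3

lemma lintegral_eq_tsum_deg (f : Config → ℝ≥0∞) (hf : ∀ n, Measurable fun η =>
      {η | deg η [] = n}.indicator 1 η * f η) :
    ∫⁻ η, f η ∂law ν = ∑' n, ∫⁻ η, {η | deg η [] = n}.indicator 1 η * f η ∂law ν := by
  rw [← lintegral_tsum fun n => (hf n).aemeasurable]
  refine lintegral_congr fun η => ?_
  rw [tsum_eq_single (deg η [])]
  · simp
  · intro n hn
    simp [hn.symm]

lemma indicator_deg_mul (n : ℕ) (f : ℕ → Config → ℝ≥0∞) (η : Config) :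
    {η | deg η [] = n}.indicator 1 η * f (deg η []) η =
      {η | deg η [] = n}.indicator 1 η * f n η := by
  by_cases h : deg η [] = n
  · rw [h]
  · simp [h]

/-- The generating function of `ν`. -/
def pgf (ν : Measure ℕ) (t : ℝ≥0∞) : ℝ≥0∞ := ∫⁻ n, t ^ n ∂ν

/-- The derivative of the generating function of `ν`. -/
def pgfDeriv (ν : Measure ℕ) (t : ℝ≥0∞) : ℝ≥0∞ := ∫⁻ n, n * t ^ (n - 1) ∂ν

lemma lintegral_prod_branches (hν : ν {0} = 0) {φ : Config → ℝ≥0∞} (hφ : Measurable φ) :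
    ∫⁻ η, ∏ i ∈ range (deg η []), φ (shv [i] η) ∂law ν = pgf ν (∫⁻ τ, φ τ ∂law ν) := by
  have hm : ∀ n, Measurable fun η : Config => ∏ i ∈ range n, φ (shv [i] η) := fun n =>
    Finset.measurable_prod _ fun i _ => hφ.comp (measurable_shv [i])
  have h1 : ∀ n (η : Config), _ := fun n η => indicator_deg_mul n
    (fun m η => ∏ i ∈ range m, φ (shv [i] η)) η
  rw [lintegral_eq_tsum_deg]
  · simp_rw [h1, lintegral_prod_branches_deg hν _ _ (fun _ => hφ)]
    simp_rw [pgf, lintegral_countable' (μ := ν), Finset.prod_const, Finset.card_range, mul_comm]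
  · intro n
    simp_rw [h1]
    exact (measurable_indicator_deg n).mul (hm n)

lemma keep_branch (i : ℕ) (η : Config) :
    shv [i] (keep {p | [i] <:+ p.2} η) = shv [i] η := by
  ext p; simp [shv, keep]

lemma keep_branch_compl {i j : ℕ} (h : j ≠ i) (η : Config) :
    shv [j] (keep {p | [i] <:+ p.2}ᶜ η) = shv [j] η := by
  ext p
  have : ¬ [i] <:+ p.2 ++ [j] := by
    rintro ⟨t, ht⟩
    have := (List.append_inj' ht (by simp)).2
    simp only [List.cons.injEq, and_true] at this
    exact h this.symm
  simp [shv, keep, this]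

lemma deg_keep_branch_compl (i : ℕ) (η : Config) :
    deg (keep {p | [i] <:+ p.2}ᶜ η) [] = deg η [] := by
  simp [deg, keep]

/-- The branch `i` is frozen first and the rest integrated by Fubini, which is what allows the
factors of the other branches to depend on the branch `i`. -/
lemma lintegral_branch_deg (hν : ν {0} = 0) (n i : ℕ) {G : Config → ℝ≥0∞} (hG : Measurable G)
    {φ : Config → Config → ℝ≥0∞} (hφ : Measurable (uncurry φ)) (J : Finset ℕ)
    (hJ : i ∉ J) :
    ∫⁻ η, {η | deg η [] = n}.indicator 1 η * (G (shv [i] η) *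
        ∏ j ∈ J, φ (shv [i] η) (shv [j] η)) ∂law ν =
      ν {n} * ∫⁻ τ, G τ * (∫⁻ τ', φ τ τ' ∂law ν) ^ J.card ∂law ν := by
  have hφ1 : ∀ a, Measurable (φ a) := fun a => hφ.comp measurable_prodMk_left
  have hne : ∀ j ∈ J, j ≠ i := fun j hj h => hJ (h ▸ hj)
  set F : Config × Config → ℝ≥0∞ := fun p => {η | deg η [] = n}.indicator 1 p.2 *
    (G (shv [i] p.1) * ∏ j ∈ J, φ (shv [i] p.1) (shv [j] p.2)) with hF
  have hFm : Measurable F := by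
    refine ((measurable_indicator_deg n).comp measurable_snd).mul
      ((hG.comp ((measurable_shv [i]).comp measurable_fst)).mul
        (Finset.measurable_prod _ fun j _ => ?_))
    exact hφ.comp (((measurable_shv [i]).comp measurable_fst).prodMk
      ((measurable_shv [j]).comp measurable_snd))
  have hind : ∀ η : Config, {η : Config | deg η [] = n}.indicator (1 : Config → ℝ≥0∞)
      (keep {p | [i] <:+ p.2}ᶜ η) = {η : Config | deg η [] = n}.indicator 1 η := fun η => by
    simp only [Set.indicator, Set.mem_ofPred_eq, deg_keep_branch_compl]
    split_ifs <;> rfl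
  have hrew : ∀ η η' : Config, F (keep {p | [i] <:+ p.2} η, keep {p | [i] <:+ p.2}ᶜ η') =
      F (η, η') := fun η η' => by
    simp only [hF, hind, keep_branch]
    rw [prod_congr rfl fun j hj => by rw [keep_branch_compl (hne j hj)]]
  have h := lintegral_of_indepFun (indepFun_keep (ν := ν) {p | [i] <:+ p.2}) (measurable_keep _)
    (measurable_keep _) hFm
  simp only [hrew] at h
  refine h.trans ?_
  have h2 : ∀ η, ∫⁻ η', F (η, η') ∂law ν =
      ν {n} * (G (shv [i] η) * (∫⁻ τ', φ (shv [i] η) τ' ∂law ν) ^ J.card) := fun η => by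
    have h3 : ∀ η', F (η, η') = G (shv [i] η) * ({η | deg η [] = n}.indicator 1 η' *
        ∏ j ∈ J, φ (shv [i] η) (shv [j] η')) := fun η' => by simp only [hF]; ring
    simp_rw [h3]
    rw [lintegral_const_mul, lintegral_prod_branches_deg hν n J fun _ => hφ1 _]
    · simp only [Finset.prod_const]; ring
    · exact (measurable_indicator_deg n).mul (Finset.measurable_prod _ fun j _ =>
        (hφ1 _).comp (measurable_shv [j]))
  have hm : Measurable fun τ => G τ * (∫⁻ τ', φ τ τ' ∂law ν) ^ J.card :=
    hG.mul (hφ.lintegral_prod_right'.pow_const _)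
  simp_rw [h2]
  refine (lintegral_const_mul _ (hm.comp (measurable_shv [i]))).trans ?_
  rw [← (measurePreserving_shv [i]).lintegral_comp hm]
  rfl

/-! ### The recursion along the backbone -/

variable {q : ℝ → ℝ → ℝ≥0∞}

/-- The expected contribution of a branch at level `s`. -/
def facMean (ν : Measure ℕ) (q : ℝ → ℝ → ℝ≥0∞) (s : ℝ) : ℝ≥0∞ := ∫⁻ τ, fac q s τ ∂law ν

lemma measurable_facMean (hq : Measurable (uncurry q)) : Measurable (facMean ν q) :=
  (measurable_fac hq).lintegral_prod_right'

lemma measurable_pgfDeriv : Measurable (pgfDeriv ν) := by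
  have : Measurable fun p : ℝ≥0∞ × ℕ => (p.2 : ℝ≥0∞) * p.1 ^ (p.2 - 1) :=
    measurable_from_prod_countable_left fun n => by
      dsimp only
      exact (measurable_id.pow_const _).const_mul _
  exact this.lintegral_prod_right'

/-- Each of the `n` children may be the percolating one, and the factors of the others force this
choice because they vanish otherwise. By symmetry this gives `n` equal terms with `n - 1`
independent factors each; summing over `n` produces the derivative of the generating function. -/
lemma lintegral_step (hν : ν {0} = 0) (hq : Measurable (uncurry q)) {Ψ : ℝ → ℝ≥0∞}
    (hΨ : Measurable Ψ) {H : Config → ℝ≥0∞} (hH : Measurable H) :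
    ∫⁻ η, Ψ (R η) * bushProd q η * H (next η) ∂law ν =
      ∫⁻ τ, Ψ (S τ) * H τ * pgfDeriv ν (facMean ν q (S τ)) ∂law ν := by
  have hG : Measurable fun τ => Ψ (S τ) * H τ := (hΨ.comp measurable_S).mul hH
  have hφ : Measurable (uncurry fun τ τ' : Config => fac q (S τ) τ') :=
    (measurable_fac hq).comp ((measurable_S.comp measurable_fst).prodMk measurable_snd)
  have hterm : ∀ (J : Finset ℕ) i, Measurable fun η : Config => Ψ (S (shv [i] η)) *
      H (shv [i] η) * ∏ j ∈ J, fac q (S (shv [i] η)) (shv [j] η) := fun J i =>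
    (hG.comp (measurable_shv [i])).mul (Finset.measurable_prod _ fun j _ =>
      hφ.comp ((measurable_shv [i]).prodMk (measurable_shv [j])))
  have h1 : ∀ n (η : Config), _ := fun n η => indicator_deg_mul n (fun m η =>
    ∑ i ∈ range m, Ψ (S (shv [i] η)) * H (shv [i] η) *
        ∏ j ∈ (range m).erase i, fac q (S (shv [i] η)) (shv [j] η)) η
  simp_rw [bushProd_eq_sum]
  rw [lintegral_eq_tsum_deg]
  · simp_rw [h1]
    have h2 : ∀ n, ∫⁻ η, {η | deg η [] = n}.indicator 1 η * ∑ i ∈ range n,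
        Ψ (S (shv [i] η)) * H (shv [i] η) *
          ∏ j ∈ (range n).erase i, fac q (S (shv [i] η)) (shv [j] η) ∂law ν =
        ∫⁻ τ, Ψ (S τ) * H τ * (n * facMean ν q (S τ) ^ (n - 1) * ν {n}) ∂law ν := by
      intro n
      simp_rw [Finset.mul_sum]
      rw [lintegral_finsetSum]
      swap
      · exact fun i _ => (measurable_indicator_deg n).mul (hterm _ i)
      have h3 : ∀ i ∈ range n, ∫⁻ η, {η | deg η [] = n}.indicator 1 η *
          (Ψ (S (shv [i] η)) * H (shv [i] η) *
          ∏ j ∈ (range n).erase i, fac q (S (shv [i] η)) (shv [j] η)) ∂law ν =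
          ν {n} * ∫⁻ τ, Ψ (S τ) * H τ * facMean ν q (S τ) ^ (n - 1) ∂law ν := by
        intro i hi
        have := lintegral_branch_deg hν n i hG hφ ((range n).erase i) (by simp)
        rw [Finset.card_erase_of_mem hi, Finset.card_range] at this
        exact this
      rw [sum_congr rfl h3, Finset.sum_const, Finset.card_range, nsmul_eq_mul, ← mul_assoc,
        ← lintegral_const_mul]
      · refine lintegral_congr fun τ => ?_
        ring
      · exact hG.mul (((measurable_facMean hq).comp measurable_S).pow_const _)
    simp_rw [h2]
    rw [← lintegral_tsum]
    · refine lintegral_congr fun τ => ?_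
      rw [ENNReal.tsum_mul_left, pgfDeriv, lintegral_countable']
    · intro n
      exact (hG.mul (((((measurable_facMean hq).comp measurable_S).pow_const _).const_mul _).mul_const
        _)).aemeasurable
  · intro n
    simp_rw [h1]
    exact (measurable_indicator_deg n).mul (Finset.measurable_fun_sum _ fun i _ => hterm _ i)

lemma lintegral_clusterProd (hν : ν {0} = 0) (hq : Measurable (uncurry q)) {s : ℝ}
    (hs : 0 ≤ s) : ∫⁻ η, clusterProd q s η ∂law ν = pgf ν (facMean ν q s) := by
  simp_rw [clusterProd_eq_prod hs]
  exact lintegral_prod_branches hν ((measurable_fac hq).comp measurable_prodMk_left)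

end

section

variable {ν : Measure ℕ} [IsProbabilityMeasure ν]

/-! ### Generating functions -/

/-- The probability that a variable of law `ν` has a marked unit, if the units are marked
independently with probability `x`. -/
def phi (ν : Measure ℕ) (x : ℝ) : ℝ := ∫ n, (1 - (1 - x) ^ n) ∂ν

/-- The derivative of `phi`. -/
def dphi (ν : Measure ℕ) (x : ℝ) : ℝ := ∫ n, n * (1 - x) ^ (n - 1) ∂ν

lemma one_sub_pow_mem {x : ℝ} (hx : x ∈ Icc (0 : ℝ) 1) (n : ℕ) :
    (1 - x) ^ n ∈ Icc (0 : ℝ) 1 :=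
  ⟨pow_nonneg (by linarith [hx.2]) n, pow_le_one₀ (by linarith [hx.2]) (by linarith [hx.1])⟩

lemma integrable_pow {x : ℝ} (hx : x ∈ Icc (0 : ℝ) 1) :
    Integrable (fun n : ℕ => (1 - x) ^ n) ν := by
  refine Integrable.of_bound (measurable_of_countable _).aestronglyMeasurable 1
    (Eventually.of_forall fun n => ?_)
  rw [Real.norm_eq_abs, abs_of_nonneg (one_sub_pow_mem hx n).1]
  exact (one_sub_pow_mem hx n).2

lemma integrable_one_sub_pow {x : ℝ} (hx : x ∈ Icc (0 : ℝ) 1) :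
    Integrable (fun n : ℕ => 1 - (1 - x) ^ n) ν := (integrable_const 1).sub (integrable_pow hx)

/-- In terms of `n` independent marks of probability `x`: exactly one mark is less likely than at
least one. -/
lemma mul_mul_pow_le {x : ℝ} (hx : x ∈ Icc (0 : ℝ) 1) (n : ℕ) :
    n * x * (1 - x) ^ (n - 1) ≤ 1 - (1 - x) ^ n := by
  induction n with
  | zero => simp
  | succ n ih =>
    rcases Nat.eq_zero_or_pos n with rfl | hn
    · simp
    · obtain ⟨m, rfl⟩ := Nat.exists_eq_add_of_lt hn
      have h1 := (one_sub_pow_mem hx m).1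
      have h2 := hx.1
      have h3 : (1 - x) ^ (m + 1) = (1 - x) ^ m * (1 - x) := pow_succ _ _
      have h4 : (1 - x) ^ (m + 2) = (1 - x) ^ m * (1 - x) * (1 - x) := by ring
      simp only [zero_add, Nat.add_sub_cancel] at ih ⊢
      push_cast at ih ⊢
      rw [h3] at ih ⊢
      rw [h4]
      have : 0 ≤ (m + 1) * x * x * (1 - x) ^ m := by positivity
      nlinarith

/-- The right-hand side is the probability of at least two marks among `n`, which is at least that
for the first two. It quantifies strict concavity of `phi`. -/
lemma sq_le_sub {x : ℝ} (hx : x ∈ Icc (0 : ℝ) 1) {n : ℕ} (hn : 2 ≤ n) :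
    x ^ 2 ≤ 1 - (1 - x) ^ n - n * x * (1 - x) ^ (n - 1) := by
  induction n, hn using Nat.le_induction with
  | base => simp; nlinarith
  | succ n hn ih =>
    obtain ⟨m, rfl⟩ : ∃ m, n = m + 1 := ⟨n - 1, by omega⟩
    have h1 := (one_sub_pow_mem hx m).1
    have h2 := hx.1
    have h3 : (1 - x) ^ (m + 1) = (1 - x) ^ m * (1 - x) := pow_succ _ _
    have h4 : (1 - x) ^ (m + 2) = (1 - x) ^ m * (1 - x) * (1 - x) := by ring
    simp only [Nat.add_sub_cancel] at ih ⊢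
    push_cast at ih ⊢
    rw [h3] at ih ⊢
    rw [h4]
    have : 0 ≤ (m + 1) * x * x * (1 - x) ^ m := by positivity
    nlinarith

/-- No moment of `ν` is assumed: away from `x = 0` the integrand is bounded by `1 / x`. -/
lemma integrable_dpow {x : ℝ} (hx0 : 0 < x) (hx1 : x ≤ 1) :
    Integrable (fun n : ℕ => (n : ℝ) * (1 - x) ^ (n - 1)) ν := by
  have hx : x ∈ Icc (0 : ℝ) 1 := ⟨hx0.le, hx1⟩
  refine Integrable.of_bound (measurable_of_countable _).aestronglyMeasurable (1 / x)
    (Eventually.of_forall fun n => ?_)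
  have h1 := (one_sub_pow_mem hx (n - 1)).1
  rw [Real.norm_eq_abs, abs_of_nonneg (by positivity), le_div_iff₀ hx0]
  have := mul_mul_pow_le hx n
  have := (one_sub_pow_mem hx n).1
  linarith

lemma phi_nonneg {x : ℝ} (hx : x ∈ Icc (0 : ℝ) 1) : 0 ≤ phi ν x :=
  integral_nonneg fun n => sub_nonneg.2 (one_sub_pow_mem hx n).2

lemma phi_le_one {x : ℝ} (hx : x ∈ Icc (0 : ℝ) 1) : phi ν x ≤ 1 := by
  calc phi ν x ≤ ∫ _, 1 ∂ν := integral_mono (integrable_one_sub_pow hx) (integrable_const 1)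
        fun n => by have := (one_sub_pow_mem hx n).1; simp only; linarith
    _ = 1 := by simp

lemma phi_zero : phi ν 0 = 0 := by simp [phi]

lemma dphi_nonneg {x : ℝ} (hx : x ∈ Icc (0 : ℝ) 1) : 0 ≤ dphi ν x :=
  integral_nonneg fun n => mul_nonneg n.cast_nonneg (one_sub_pow_mem hx _).1

lemma phi_mono {x y : ℝ} (hx : x ∈ Icc (0 : ℝ) 1) (hy : y ∈ Icc (0 : ℝ) 1) (h : x ≤ y) :
    phi ν x ≤ phi ν y :=
  integral_mono (integrable_one_sub_pow hx) (integrable_one_sub_pow hy) fun n =>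
    sub_le_sub_left (pow_le_pow_left₀ (by linarith [hy.2]) (by linarith) n) 1

lemma pow_sub_pow_le_mul {a b : ℝ} (hb : 0 ≤ b) (hab : b ≤ a) (n : ℕ) :
    a ^ n - b ^ n ≤ (a - b) * (n * a ^ (n - 1)) ∧ (a - b) * (n * b ^ (n - 1)) ≤ a ^ n - b ^ n := by
  induction n with
  | zero => simp
  | succ n ih =>
    rcases Nat.eq_zero_or_pos n with rfl | hn
    · simp
    · obtain ⟨m, rfl⟩ : ∃ m, n = m + 1 := ⟨n - 1, by omega⟩
      simp only [Nat.add_sub_cancel] at ih ⊢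
      push_cast at ih ⊢
      have ha : 0 ≤ a := hb.trans hab
      have hp : b ^ (m + 1) ≤ a ^ (m + 1) := pow_le_pow_left₀ hb hab _
      have e1 : a ^ (m + 1 + 1) = a ^ (m + 1) * a := pow_succ _ _
      have e2 : b ^ (m + 1 + 1) = b ^ (m + 1) * b := pow_succ _ _
      have e3 : a ^ (m + 1) = a ^ m * a := pow_succ _ _
      have e4 : b ^ (m + 1) = b ^ m * b := pow_succ _ _
      have h1 := mul_le_mul_of_nonneg_right ih.1 ha
      have h2 := mul_le_mul_of_nonneg_right ih.2 hb
      have h3 := mul_le_mul_of_nonneg_right hp (sub_nonneg.2 hab)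
      constructor
      · calc a ^ (m + 1 + 1) - b ^ (m + 1 + 1) =
            (a ^ (m + 1) - b ^ (m + 1)) * a + b ^ (m + 1) * (a - b) := by rw [e1, e2]; ring
          _ ≤ (a - b) * ((m + 1) * a ^ m) * a + a ^ (m + 1) * (a - b) := add_le_add h1 h3
          _ = _ := by rw [e3]; ring
      · calc (a - b) * ((m + 1 + 1) * b ^ (m + 1)) =
            (a - b) * ((m + 1) * b ^ m) * b + b ^ (m + 1) * (a - b) := by rw [e4]; ring
          _ ≤ (a ^ (m + 1) - b ^ (m + 1)) * b + a ^ (m + 1) * (a - b) := add_le_add h2 h3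
          _ = _ := by rw [e1, e2]; ring

/-- Concavity of `phi`, integrated from the tangent bounds for powers; `le_phi_sub` is the opposite
tangent bound. -/
lemma phi_sub_le {x y : ℝ} (hx : 0 < x) (hxy : x ≤ y) (hy : y ≤ 1) :
    phi ν y - phi ν x ≤ (y - x) * dphi ν x := by
  rw [phi, phi, ← integral_sub (integrable_one_sub_pow ⟨by linarith, hy⟩)
    (integrable_one_sub_pow ⟨hx.le, by linarith⟩), dphi, ← integral_const_mul]
  refine integral_mono ((integrable_one_sub_pow ⟨by linarith, hy⟩).sub
    (integrable_one_sub_pow ⟨hx.le, by linarith⟩))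
    ((integrable_dpow hx (hxy.trans hy)).const_mul _) fun n => ?_
  have := (pow_sub_pow_le_mul (a := 1 - x) (b := 1 - y) (by linarith) (by linarith) n).1
  simp only
  linarith

lemma le_phi_sub {x y : ℝ} (hx : 0 ≤ x) (hxy : x ≤ y) (hy : y ≤ 1) (hy0 : 0 < y) :
    (y - x) * dphi ν y ≤ phi ν y - phi ν x := by
  rw [phi, phi, ← integral_sub (integrable_one_sub_pow ⟨by linarith, hy⟩)
    (integrable_one_sub_pow ⟨hx, by linarith⟩), dphi, ← integral_const_mul]
  refine integral_mono ((integrable_dpow hy0 hy).const_mul _)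
    ((integrable_one_sub_pow ⟨by linarith, hy⟩).sub (integrable_one_sub_pow ⟨hx, by linarith⟩))
    fun n => ?_
  have := (pow_sub_pow_le_mul (a := 1 - x) (b := 1 - y) (by linarith) (by linarith) n).2
  simp only
  linarith

lemma mul_dphi_le {x : ℝ} (hx0 : 0 < x) (hx1 : x ≤ 1) :
    x * dphi ν x ≤ phi ν x - ν.real {n | 2 ≤ n} * x ^ 2 := by
  have hx : x ∈ Icc (0 : ℝ) 1 := ⟨hx0.le, hx1⟩
  have hset : MeasurableSet {n : ℕ | 2 ≤ n} := .of_discrete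
  have h1 : ν.real {n | 2 ≤ n} * x ^ 2 = ∫ n, {n : ℕ | 2 ≤ n}.indicator (fun _ => x ^ 2) n ∂ν := by
    rw [integral_indicator_const _ hset, smul_eq_mul]
  rw [h1, phi, dphi, ← integral_const_mul, ← integral_sub (integrable_one_sub_pow hx)
    ((integrable_const _).indicator hset)]
  refine integral_mono ((integrable_dpow hx0 hx1).const_mul _)
    ((integrable_one_sub_pow hx).sub ((integrable_const _).indicator hset)) fun n => ?_
  by_cases hn : 2 ≤ n
  · have := sq_le_sub hx hn
    simp only [Set.indicator, Set.mem_ofPred_eq, hn, if_true]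
    nlinarith
  · have := mul_mul_pow_le hx n
    simp only [Set.indicator, Set.mem_ofPred_eq, hn, if_false]
    nlinarith

/-- Strict decrease of `phi(x)/x`: the tangent at `x` lies above `phi`, and its intercept at `0` is
at least `ν{n ≥ 2} x²`. It gives uniqueness of positive solutions of `t = phi(s t)`. -/
lemma mul_phi_lt {x y : ℝ} (h2 : 0 < ν.real {n | 2 ≤ n}) (hx : 0 < x) (hxy : x < y) (hy : y ≤ 1) :
    x * phi ν y < y * phi ν x := by
  have h3 := phi_sub_le (ν := ν) hx hxy.le hy
  have h4 := mul_dphi_le (ν := ν) hx (hxy.le.trans hy)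
  have h5 : 0 < ν.real {n | 2 ≤ n} * x ^ 2 := by positivity
  have h6 := mul_le_mul_of_nonneg_left h3 hx.le
  have h7 := mul_le_mul_of_nonneg_left h4 (sub_nonneg.2 hxy.le)
  have h8 := mul_pos (sub_pos.2 hxy) h5
  nlinarith

/-- Convexity of `dphi`: its decrease on `[x, y]` is compared with the slope of the chord over
`[x/2, x]`, which avoids a second derivative. -/
lemma dphi_sub_le {x y : ℝ} (hx : 0 < x) (hxy : x ≤ y) (hy : y ≤ 1) :
    dphi ν x - dphi ν y ≤ (y - x) / (x / 2) * (dphi ν (x / 2) - dphi ν x) := by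
  have h1 := integrable_dpow (ν := ν) hx (hxy.trans hy)
  have h2 := integrable_dpow (ν := ν) (hx.trans_le hxy) hy
  have h3 := integrable_dpow (ν := ν) (x := x / 2) (by linarith) (by linarith)
  rw [dphi, dphi, dphi, ← integral_sub h1 h2, ← integral_sub h3 h1, ← integral_const_mul]
  refine integral_mono (h1.sub h2) ((h3.sub h1).const_mul _) fun n => ?_
  simp only
  set m := n - 1
  have hA := (pow_sub_pow_le_mul (a := 1 - x) (b := 1 - y) (by linarith) (by linarith) m).1
  have hB := (pow_sub_pow_le_mul (a := 1 - x / 2) (b := 1 - x) (by linarith) (by linarith) m).2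
  have hC : (1 - x) ^ m - (1 - y) ^ m ≤ (y - x) / (x / 2) * ((1 - x / 2) ^ m - (1 - x) ^ m) := by
    have e : (y - x) * (m * (1 - x) ^ (m - 1)) =
        (y - x) / (x / 2) * ((x / 2) * (m * (1 - x) ^ (m - 1))) := by field_simp
    have e1 : (1 - x - (1 - y)) = y - x := by ring
    have e2 : (1 - x / 2 - (1 - x)) = x / 2 := by ring
    rw [e1, e] at hA
    rw [e2] at hB
    exact hA.trans (mul_le_mul_of_nonneg_left hB (div_nonneg (by linarith) (by linarith)))
  calc (n : ℝ) * (1 - x) ^ m - n * (1 - y) ^ m = n * ((1 - x) ^ m - (1 - y) ^ m) := by ring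
    _ ≤ n * ((y - x) / (x / 2) * ((1 - x / 2) ^ m - (1 - x) ^ m)) := by gcongr
    _ = _ := by ring

lemma dphi_anti {x y : ℝ} (hx : 0 < x) (hxy : x ≤ y) (hy : y ≤ 1) : dphi ν y ≤ dphi ν x :=
  integral_mono (integrable_dpow (hx.trans_le hxy) hy) (integrable_dpow hx (hxy.trans hy))
    fun n => mul_le_mul_of_nonneg_left (pow_le_pow_left₀ (by linarith) (by linarith) _)
      n.cast_nonneg

lemma pgf_ofReal {x : ℝ} (hx : x ∈ Icc (0 : ℝ) 1) :
    pgf ν (ofReal (1 - x)) = ofReal (1 - phi ν x) := by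
  have h1 : 1 - phi ν x = ∫ n, (1 - x) ^ n ∂ν := by
    rw [phi, integral_sub (integrable_const 1) (integrable_pow hx)]; simp
  rw [h1, ofReal_integral_eq_lintegral_ofReal (integrable_pow hx)
    (Eventually.of_forall fun n => (one_sub_pow_mem hx n).1), pgf]
  exact lintegral_congr fun n => (ENNReal.ofReal_pow (by linarith [hx.2]) n).symm

lemma pgfDeriv_ofReal {x : ℝ} (hx0 : 0 < x) (hx1 : x ≤ 1) :
    pgfDeriv ν (ofReal (1 - x)) = ofReal (dphi ν x) := by
  rw [dphi, ofReal_integral_eq_lintegral_ofReal (integrable_dpow hx0 hx1)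
    (Eventually.of_forall fun n => mul_nonneg n.cast_nonneg
      (one_sub_pow_mem ⟨hx0.le, hx1⟩ _).1), pgfDeriv]
  refine lintegral_congr fun n => ?_
  rw [ofReal_mul n.cast_nonneg, ENNReal.ofReal_pow (by linarith), ENNReal.ofReal_natCast]

lemma pgf_mono {s t : ℝ≥0∞} (h : s ≤ t) : pgf ν s ≤ pgf ν t :=
  lintegral_mono fun n => pow_le_pow_left' h n

lemma pgfDeriv_mono {s t : ℝ≥0∞} (h : s ≤ t) : pgfDeriv ν s ≤ pgfDeriv ν t :=
  lintegral_mono fun _ => mul_le_mul_right (pow_le_pow_left' h _) _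

end

section

variable {ν : Measure ℕ} [IsProbabilityMeasure ν] {q : ℝ → ℝ → ℝ≥0∞} {s : ℝ}

/-! ### The distribution of the percolation threshold -/

lemma lintegral_unif_ite (hs : s ∈ Icc (0 : ℝ) 1) (f : ℝ → ℝ≥0∞) :
    ∫⁻ u, (if u ≤ s then f u else 1) ∂unif =
      (∫⁻ u in Icc 0 s, f u) + ofReal (1 - s) := by
  have h1 : ∀ u, (if u ≤ s then f u else 1) = (Iic s).piecewise f 1 u := fun u => by
    simp [Set.piecewise]
  simp_rw [h1]
  rw [lintegral_piecewise measurableSet_Iic]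
  congr 1
  · rw [unif, Measure.restrict_restrict measurableSet_Iic]
    congr 2
    ext u
    simp only [Set.mem_inter_iff, Set.mem_Iic, Set.mem_Icc]
    constructor
    · rintro ⟨h, h0, -⟩; exact ⟨h0, h⟩
    · rintro ⟨h0, h⟩; exact ⟨h, h0, h.trans hs.2⟩
  · simp only [Pi.one_apply, lintegral_const, one_mul, Measure.restrict_apply_univ]
    rw [unif, Measure.restrict_apply measurableSet_Iic.compl]
    have : (Iic s)ᶜ ∩ Icc 0 1 = Ioc s 1 := by
      ext u
      simp only [Set.mem_inter_iff, Set.mem_compl_iff, Set.mem_Iic, Set.mem_Icc, not_le,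
        Set.mem_Ioc]
      constructor
      · rintro ⟨h, -, h1⟩; exact ⟨h, h1⟩
      · rintro ⟨h, h1⟩; exact ⟨h, hs.1.trans h.le, h1⟩
    rw [this, Real.volume_Ioc]

lemma lintegral_ite_wt (hs : s ∈ Icc (0 : ℝ) 1) {c : ℝ → ℝ≥0∞} (hc : Measurable c)
    {f : Config → ℝ≥0∞} (hf : Measurable f) (hfree : RootFree f) :
    ∫⁻ η, (if wt η [] ≤ s then c (wt η []) * f η else 1) ∂law ν =
      (∫⁻ u in Icc 0 s, c u) * (∫⁻ η, f η ∂law ν) + ofReal (1 - s) := by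
  rw [lintegral_root (F := fun u η => if u ≤ s then c u * f η else 1)]
  · simp_rw [lintegral_unif_ite hs]
    rw [lintegral_add_right _ measurable_const]
    simp_rw [lintegral_mul_const _ hc]
    rw [lintegral_const_mul _ hf]
    simp
  · exact Measurable.ite (measurableSet_le measurable_fst measurable_const)
      ((hc.comp measurable_fst).mul (hf.comp measurable_snd)) measurable_const
  · intro u η
    simp only [hfree η]

/-- A branch contributes `1` if its edge is closed (weight above `s`); otherwise the weight and the
cluster below it are independent, so only the integral of `q s` enters. -/
lemma facMean_eq (hq : Measurable (uncurry q)) (hs : s ∈ Icc (0 : ℝ) 1) :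
    facMean ν q s = (∫⁻ u in Icc 0 s, q s u) * (∫⁻ η, clusterProd q s η ∂law ν) +
      ofReal (1 - s) :=
  lintegral_ite_wt hs (hq.comp measurable_prodMk_left)
    ((measurable_clusterProd hq).comp measurable_prodMk_left) (rootFree_clusterProd hs.1)

lemma lintegral_Icc_one : ∫⁻ _ in Icc 0 s, (1 : ℝ≥0∞) = ofReal s := by simp

lemma lintegral_ite_wt_indicator (hs : s ∈ Icc (0 : ℝ) 1) {A : Set Config}
    (hA : MeasurableSet A) (hfree : RootFree fun η => A.indicator (1 : Config → ℝ≥0∞) η) :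
    ∫⁻ η, (if wt η [] ≤ s then A.indicator 1 η else 1) ∂law ν =
      ofReal (1 - s * (1 - (law ν).real A)) := by
  have h := lintegral_ite_wt (ν := ν) hs (measurable_const (a := (1 : ℝ≥0∞)))
    (measurable_one.indicator hA) hfree
  simp only [one_mul] at h
  rw [h, lintegral_Icc_one, lintegral_indicator_one hA, ← ofReal_measureReal,
    ← ofReal_mul hs.1, ← ofReal_add (mul_nonneg hs.1 measureReal_nonneg)
      (by linarith [hs.2])]
  congr 1; ring

/-- The probability that the root percolates at level `s`. -/
def theta (ν : Measure ℕ) (s : ℝ) : ℝ := (law ν).real {η | R η ≤ s}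

lemma theta_nonneg (s : ℝ) : 0 ≤ theta ν s := measureReal_nonneg

lemma theta_le_one (s : ℝ) : theta ν s ≤ 1 := measureReal_le_one

lemma theta_mono : Monotone (theta ν) := fun _ _ h =>
  measureReal_mono fun _ h' => le_trans (α := ℝ) h' h

lemma measurable_theta : Measurable (theta ν) := theta_mono.measurable

lemma measurableSet_R_le (s : ℝ) : MeasurableSet {η | R η ≤ s} :=
  measurableSet_le measurable_R measurable_const

lemma mul_mem_Icc {x y : ℝ} (hx : x ∈ Icc (0 : ℝ) 1) (hy : y ∈ Icc (0 : ℝ) 1) :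
    x * y ∈ Icc (0 : ℝ) 1 := ⟨mul_nonneg hx.1 hy.1, mul_le_one₀ hx.2 hy.1 hy.2⟩

lemma theta_mem (s : ℝ) : theta ν s ∈ Icc (0 : ℝ) 1 := ⟨theta_nonneg s, theta_le_one s⟩

lemma prod_indicator (A : Set Config) (hA : MeasurableSet A) (hν : ν {0} = 0)
    (B : Set Config) (hB : MeasurableSet B)
    (h : ∀ η, η ∈ B ↔ ∀ i < deg η [], shv [i] η ∈ A) :
    (law ν) B = pgf ν ((law ν) A) := by
  rw [← lintegral_indicator_one hA, ← lintegral_prod_branches hν (measurable_one.indicator hA),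
    ← lintegral_indicator_one hB]
  refine lintegral_congr fun η => ?_
  by_cases hη : η ∈ B
  · rw [Set.indicator_of_mem hη, Finset.prod_eq_one]; · rfl
    intro i hi
    rw [Set.indicator_of_mem ((h η).1 hη i (mem_range.1 hi))]; rfl
  · rw [Set.indicator_of_notMem hη]
    have := mt (h η).2 hη
    push Not at this
    obtain ⟨i, hi, hi'⟩ := this
    rw [Finset.prod_eq_zero (mem_range.2 hi) (Set.indicator_of_notMem hi' _)]

/-- The recursion for the probability that the root is not cut off at level `s`. -/
lemma one_sub_real_eq_phi (hν : ν {0} = 0) (hs : s ∈ Icc (0 : ℝ) 1) {A B B' : Set Config}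
    (hA : MeasurableSet A) (hB : MeasurableSet B) (hB' : MeasurableSet B')
    (hfree : RootFree fun η => A.indicator (1 : Config → ℝ≥0∞) η)
    (hBA : ∀ᵐ η ∂law ν, η ∈ B' ↔ (wt η [] ≤ s → η ∈ A))
    (h : ∀ η, η ∈ B ↔ ∀ i < deg η [], shv [i] η ∈ B') :
    1 - (law ν).real B = phi ν (s * (1 - (law ν).real A)) := by
  have hmem : s * (1 - (law ν).real A) ∈ Icc (0 : ℝ) 1 :=
    mul_mem_Icc hs ⟨sub_nonneg.2 measureReal_le_one, by linarith [measureReal_nonneg (μ := law ν) (s := A)]⟩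
  have h1 : (law ν) B' = ofReal (1 - s * (1 - (law ν).real A)) := by
    rw [← lintegral_ite_wt_indicator hs hA hfree, ← lintegral_indicator_one hB']
    refine lintegral_congr_ae ?_
    filter_upwards [hBA] with η hη
    by_cases h1 : wt η [] ≤ s <;> by_cases h2 : η ∈ A <;> simp [Set.indicator, hη, h1, h2]
  have h2 := prod_indicator B' hB' hν B hB h
  rw [h1, pgf_ofReal hmem] at h2
  rw [measureReal_def, h2, ENNReal.toReal_ofReal (sub_nonneg.2 (phi_le_one hmem))]
  ring

lemma one_sub_real_lt_R (s : ℝ) : 1 - (law ν).real {η | s < R η} = theta ν s := by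
  have : {η | s < R η} = {η | R η ≤ s}ᶜ := by ext; simp
  rw [this, probReal_compl_eq_one_sub (measurableSet_R_le s), theta]; ring

lemma rootFree_indicator {β : Type*} {f : Config → β} (hf : RootFree f) (C : Set β) :
    RootFree fun η => {η | f η ∈ C}.indicator (1 : Config → ℝ≥0∞) η := fun η => by
  by_cases h : f η ∈ C <;> simp [Set.indicator, hf η, h]

/-- The root percolates exactly if some child is joined to it by an open edge and percolates;
children are marked in this way with probability `s * theta ν s`. -/
lemma theta_eq (hν : ν {0} = 0) (hs : s ∈ Icc (0 : ℝ) 1) :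
    theta ν s = phi ν (s * theta ν s) := by
  have := one_sub_real_eq_phi (ν := ν) hν hs (A := {η | s < R η}) (B := {η | s < R η})
    (B' := {η | s < S η}) (measurableSet_lt measurable_const measurable_R)
    (measurableSet_lt measurable_const measurable_R)
    (measurableSet_lt measurable_const measurable_S) (rootFree_indicator rootFree_R (Ioi s))
    (Eventually.of_forall fun η => by simp [S, imp_iff_not_or])
    (fun η => lt_R_iff_child)
  rwa [one_sub_real_lt_R] at this

lemma unif_singleton (s : ℝ) : unif {s} = 0 := by
  refine le_antisymm ((Measure.restrict_apply_le _ _).trans ?_) zero_le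
  simp

lemma law_wt_eq (v : Vertex) (s : ℝ) : (law ν) {η | wt η v = s} = 0 := by
  have := Measure.map_apply (μ := law ν) (measurable_wt v) (measurableSet_singleton s)
  rw [map_wt, unif_singleton] at this
  exact this.symm

/-- The strict event satisfies the same fixed-point equation, since a weight equals `s` with
probability zero. Comparing both solutions excludes atoms. -/
lemma real_R_lt_eq (hν : ν {0} = 0) (hs : s ∈ Icc (0 : ℝ) 1) :
    (law ν).real {η | R η < s} = phi ν (s * (law ν).real {η | R η < s}) := by
  have h1 : ∀ η, s ≤ R η ↔ ∀ i < deg η [], s ≤ S (shv [i] η) := fun η => by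
    rw [← not_lt, ← not_iff_not]
    push Not
    constructor
    · intro h
      exact ⟨argmin η, argmin_lt η, (S_argmin η).trans_lt h⟩
    · rintro ⟨i, hi, h⟩
      exact (R_le_S_child hi).trans_lt h
  have h2 : ∀ᵐ η ∂law ν, wt η [] ≠ s := measure_eq_zero_iff_ae_notMem.1 (law_wt_eq [] s)
  have := one_sub_real_eq_phi (ν := ν) hν hs (A := {η | s ≤ R η}) (B := {η | s ≤ R η})
    (B' := {η | s ≤ S η}) (measurableSet_le measurable_const measurable_R)
    (measurableSet_le measurable_const measurable_R)
    (measurableSet_le measurable_const measurable_S) (rootFree_indicator rootFree_R (Ici s))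
    (by
      filter_upwards [h2] with η hη
      simp only [S, le_max_iff, imp_iff_not_or, not_le]
      rw [(Ne.symm hη).le_iff_lt]) h1
  have h3 : {η | s ≤ R η} = {η | R η < s}ᶜ := by ext; simp
  rw [h3, probReal_compl_eq_one_sub (measurableSet_lt measurable_R measurable_const)] at this
  simpa using this

/-- The probabilities of reaching generation `n` start at `1` and iterate the increasing map `t ↦
phi(s t)`, so they never fall below a subsolution; their limit is `theta`. -/
lemma le_theta (hν : ν {0} = 0) (hs : s ∈ Icc (0 : ℝ) 1) {x : ℝ} (hx : x ∈ Icc (0 : ℝ) 1)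
    (h : x ≤ phi ν (s * x)) : x ≤ theta ν s := by
  have hn : ∀ n, x ≤ (law ν).real {η | Rn n η ≤ s} := by
    intro n
    induction n with
    | zero =>
      have : {η | Rn 0 η ≤ s} = Set.univ := Set.eq_univ_of_forall fun η => hs.1
      simpa [this] using hx.2
    | succ n ih =>
      have hc : ∀ m, {η | s < Rn m η} = {η | Rn m η ≤ s}ᶜ := fun m => by ext; simp
      have hm : ∀ m, MeasurableSet {η | Rn m η ≤ s} := fun m =>
        measurableSet_le (measurable_Rn m) measurable_const
      have := one_sub_real_eq_phi (ν := ν) hν hs (A := {η | s < Rn n η})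
        (B := {η | s < Rn (n + 1) η}) (B' := {η | s < wt η [] ∨ s < Rn n η})
        (measurableSet_lt measurable_const (measurable_Rn _))
        (measurableSet_lt measurable_const (measurable_Rn _))
        ((measurableSet_lt measurable_const (measurable_wt _)).union
          (measurableSet_lt measurable_const (measurable_Rn _)))
        (rootFree_indicator (rootFree_Rn n) (Ioi s))
        (Eventually.of_forall fun η => by simp [imp_iff_not_or])
        (fun η => by simpa [wt_shv] using lt_Rn_succ_iff)
      rw [hc, hc, probReal_compl_eq_one_sub (hm _), probReal_compl_eq_one_sub (hm _)] at this
      simp only [sub_sub_cancel] at this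
      rw [this]
      refine h.trans (phi_mono (mul_mem_Icc hs hx)
        (mul_mem_Icc hs ⟨measureReal_nonneg, measureReal_le_one⟩) ?_)
      exact mul_le_mul_of_nonneg_left ih hs.1
  have hset : {η | R η ≤ s} = ⋂ n, {η | Rn n η ≤ s} := by
    ext η; simp [R_le_iff]
  have hlim : Tendsto (fun n => (law ν) {η | Rn n η ≤ s}) atTop (𝓝 ((law ν) {η | R η ≤ s})) := by
    rw [hset]
    refine tendsto_measure_iInter_atTop (fun n => (measurableSet_le (measurable_Rn n)
      measurable_const).nullMeasurableSet) ?_ ⟨0, measure_ne_top _ _⟩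
    exact fun m n hmn η h => le_trans (Rn_mono η hmn) h
  exact ge_of_tendsto' ((ENNReal.tendsto_toReal (measure_ne_top _ _)).comp hlim) hn

/-- The threshold has no atoms. -/
lemma law_R_eq (hν : ν {0} = 0) (h2 : 0 < ν.real {n | 2 ≤ n}) (s : ℝ) :
    (law ν) {η | R η = s} = 0 := by
  rcases lt_or_ge s 0 with h0 | h0
  · have : {η | R η = s} = ∅ := by
      ext η
      simp only [Set.mem_ofPred_eq, Set.mem_empty_iff_false, iff_false]
      exact (h0.trans_le (R_nonneg η)).ne'
    simp [this]
  rcases lt_or_ge 1 s with h1 | h1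
  · have : {η | R η = s} = ∅ := by
      ext η
      simp only [Set.mem_ofPred_eq, Set.mem_empty_iff_false, iff_false]
      exact ((R_le_one η).trans_lt h1).ne
    simp [this]
  have hs : s ∈ Icc (0 : ℝ) 1 := ⟨h0, h1⟩
  set A := (law ν).real {η | R η < s} with hA
  have hA1 : A = phi ν (s * A) := real_R_lt_eq hν hs
  have hB1 := theta_eq (ν := ν) hν hs
  set B := theta ν s with hB
  have hAm : A ∈ Icc (0 : ℝ) 1 := ⟨measureReal_nonneg, measureReal_le_one⟩
  have hBm : B ∈ Icc (0 : ℝ) 1 := theta_mem s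
  have hAB : A ≤ B := measureReal_mono fun η h => le_of_lt (α := ℝ) h
  suffices hle : B ≤ A by
    have hdiff : {η | R η = s} = {η | R η ≤ s} \ {η | R η < s} := by
      ext η; simp [le_antisymm_iff]
    have : (law ν).real {η | R η = s} = 0 := by
      have hsub : {η | R η < s} ⊆ {η | R η ≤ s} := fun η h => le_of_lt (α := ℝ) h
      rw [hdiff, measureReal_sdiff hsub (measurableSet_lt measurable_R measurable_const)]
      exact sub_eq_zero.2 (le_antisymm hle hAB)
    exact (measureReal_eq_zero_iff (measure_ne_top _ _)).1 this
  by_contra! hlt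
  have hBpos : 0 < B := hAm.1.trans_lt hlt
  have hspos : 0 < s := by
    rcases h0.lt_or_eq with h | h
    · exact h
    · rw [← h, zero_mul, phi_zero] at hB1
      exact absurd hB1 hBpos.ne'
  have hsB : s * B ≤ 1 := (mul_mem_Icc hs hBm).2
  -- `A` and `B` both solve `t = phi(s t)`; two different positive solutions contradict the strict
  -- decrease of `phi(y)/y`.
  rcases hAm.1.lt_or_eq with hApos | hA0
  · have := mul_phi_lt (ν := ν) h2 (mul_pos hspos hApos) (mul_lt_mul_of_pos_left hlt hspos) hsB
    rw [← hA1, ← hB1] at this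
    nlinarith
  -- If `A = 0 < B`, then `x = phi(sB/2)` exceeds `B/2`, so `x` is a fixed point at the level
  -- `sB/(2x) < s`. Percolation there would already have positive probability, contradicting `A =
  -- 0`.
  · have hyp : 0 < s * B / 2 := by positivity
    have h3 := mul_phi_lt (ν := ν) h2 hyp (show s * B / 2 < s * B by linarith) hsB
    rw [← hB1] at h3
    have hym : s * B / 2 ∈ Icc (0 : ℝ) 1 := ⟨hyp.le, by linarith⟩
    set x := phi ν (s * B / 2) with hx
    have hx1 : B / 2 < x := by
      have : s * B * (B / 2) < s * B * x := by nlinarith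
      exact lt_of_mul_lt_mul_left this (by positivity)
    have hxpos : 0 < x := by linarith
    have hlt' : s * B / 2 / x < s := by
      rw [div_lt_iff₀ hxpos]; nlinarith
    have h4 : x ≤ theta ν (s * B / 2 / x) := by
      refine le_theta hν ⟨by positivity, by linarith⟩ ⟨hxpos.le, phi_le_one hym⟩ ?_
      rw [div_mul_cancel₀ _ hxpos.ne']
    have h5 : theta ν (s * B / 2 / x) ≤ A :=
      measureReal_mono fun η h => lt_of_le_of_lt (α := ℝ) h hlt'
    linarith

lemma law_S_eq (hν : ν {0} = 0) (h2 : 0 < ν.real {n | 2 ≤ n}) (s : ℝ) :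
    (law ν) {η | S η = s} = 0 := by
  refine measure_mono_null (t := {η | wt η [] = s} ∪ {η | R η = s}) ?_
    (measure_union_null (law_wt_eq [] s) (law_R_eq hν h2 s))
  intro η h
  rcases max_choice (wt η []) (R η) with h' | h'
  · exact Or.inl (h'.symm.trans h)
  · exact Or.inr (h'.symm.trans h)

lemma real_R_lt (hν : ν {0} = 0) (h2 : 0 < ν.real {n | 2 ≤ n}) (s : ℝ) :
    (law ν) {η | R η < s} = ofReal (theta ν s) := by
  rw [theta, ofReal_measureReal]
  refine measure_congr ?_
  have : ∀ᵐ η ∂law ν, R η ≠ s := measure_eq_zero_iff_ae_notMem.1 (law_R_eq hν h2 s)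
  filter_upwards [this] with η hη
  exact propext ⟨fun h => le_of_lt h, fun h => lt_of_le_of_ne h hη⟩

/-! ### Almost all configurations are generic -/

/-- The two branches are independent, and conditionally on one of them the other functional has no
atom. -/
lemma ae_ne_branches {f g : Config → ℝ} (hf : Measurable f) (hg : Measurable g)
    (hat : ∀ s, (law ν) {η | f η = s} = 0) {i j : ℕ} (hij : i ≠ j) :
    ∀ᵐ η ∂law ν, f (shv [i] η) ≠ g (shv [j] η) := by
  have h := lintegral_of_indepFun (indepFun_keep (ν := ν) {p | [j] <:+ p.2}) (measurable_keep _)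
    (measurable_keep _) (F := fun p => {p : Config × Config |
      f (shv [i] p.2) = g (shv [j] p.1)}.indicator 1 p) (by
      refine measurable_one.indicator (measurableSet_eq_fun ?_ ?_)
      · exact hf.comp ((measurable_shv _).comp measurable_snd)
      · exact hg.comp ((measurable_shv _).comp measurable_fst))
  have h1 : ∀ η η' : Config, {p : Config × Config | f (shv [i] p.2) = g (shv [j] p.1)}.indicator
      (1 : Config × Config → ℝ≥0∞) (keep {p | [j] <:+ p.2} η, keep {p | [j] <:+ p.2}ᶜ η') =
      {η' | f (shv [i] η') = g (shv [j] η)}.indicator 1 η' := fun η η' => by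
    simp only [Set.indicator, Set.mem_ofPred_eq, keep_branch, keep_branch_compl hij]
    rfl
  simp only [h1] at h
  have hm : ∀ s, MeasurableSet {η' : Config | f (shv [i] η') = s} := fun s =>
    (hf.comp (measurable_shv [i])) (measurableSet_singleton s)
  have h0 : ∀ s, (law ν) {η' | f (shv [i] η') = s} = 0 := fun s =>
    ((measurePreserving_shv [i]).measure_preimage
      (hf (measurableSet_singleton s)).nullMeasurableSet).trans (hat s)
  have h2 : ∫⁻ η, {η' | f (shv [i] η') = g (shv [j] η')}.indicator 1 η ∂law ν = 0 := by
    refine Eq.trans ?_ (h.trans ?_)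
    · exact lintegral_congr fun η => by simp [Set.indicator]
    · simp_rw [lintegral_indicator_one (hm _), h0]; simp
  have hms : MeasurableSet {η' : Config | f (shv [i] η') = g (shv [j] η')} :=
    measurableSet_eq_fun (hf.comp (measurable_shv _)) (hg.comp (measurable_shv _))
  rw [lintegral_indicator_one hms] at h2
  exact measure_eq_zero_iff_ae_notMem.1 h2

lemma ae_generic (hν : ν {0} = 0) (h2 : 0 < ν.real {n | 2 ≤ n}) :
    ∀ᵐ η ∂law ν, Generic η := by
  rw [show Generic = fun η => ∀ v, NoTie (shv v η) ∧ Clean (shv v η) from rfl, ae_all_iff]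
  intro v
  have h1 : ∀ᵐ η ∂law ν, ∀ i j, i ≠ j → S (shv [i] η) ≠ S (shv [j] η) := by
    rw [ae_all_iff]; intro i; rw [ae_all_iff]; intro j
    by_cases hij : i = j
    · simp [hij]
    · filter_upwards [ae_ne_branches (ν := ν) measurable_S measurable_S (law_S_eq hν h2) hij]
        with η h _ using h
  have h3 : ∀ᵐ η ∂law ν, ∀ i j u, i ≠ j → wt (shv [i] η) u ≠ S (shv [j] η) := by
    rw [ae_all_iff]; intro i; rw [ae_all_iff]; intro j; rw [ae_all_iff]; intro u
    by_cases hij : i = j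
    · simp [hij]
    · filter_upwards [ae_ne_branches (ν := ν) (measurable_wt u) measurable_S (law_wt_eq u) hij]
        with η h _ using h
  have h4 : ∀ᵐ η ∂law ν, NoTie η ∧ Clean η := by
    filter_upwards [h1, h3] with η h1 h3
    constructor
    · intro j hj hne
      refine lt_of_le_of_ne (R_le_S_child hj) ?_
      rw [← S_argmin]
      exact h1 _ _ hne.symm
    -- The threshold is a function of the branch `argmin`, while the edge lies in another branch;
    -- independence separates the two values.
    · intro u hu hne
      obtain ⟨i, z, rfl, -, -, -⟩ := (eq_nil_or_concat_of_reach hu.1).resolve_left hne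
      have hi : i ≠ argmin η := by
        rintro rfl
        exact hu.2 (List.suffix_append _ _)
      rw [← S_argmin]
      exact h3 i _ z hi
  have := (measurePreserving_shv (ν := ν) v).quasiMeasurePreserving.ae h4
  exact this

/-! ### The weight and the size of the bush -/

/-- The multiplicative functional of an exponential encodes the additive ones. It also shows why
`bw` and `bs`, as logarithms, are measurable versions of the bush weight and size. -/
lemma bushProd_exp {η : Config} (h : NoTie η) (a b : ℝ → ℝ) :
    bushProd (fun s u => ofReal (exp (a s * u + b s))) η =
      ofReal (exp (a (R η) * bushWeight η + b (R η) * bushSize η)) := by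
  have hf : (bush η \ {[]}).Finite := (finite_bush h).subset Set.sdiff_subset
  rw [bushProd_eq_finprod h, finprod_mem_eq_finite_toFinset_prod _ hf, bushWeight,
    finsum_mem_eq_finite_toFinset_sum _ hf, bushSize, Set.ncard_eq_toFinset_card _ hf,
    ← ENNReal.ofReal_prod_of_nonneg fun _ _ => (exp_pos _).le, ← Real.exp_sum,
    Finset.sum_add_distrib, ← Finset.mul_sum, Finset.sum_const, nsmul_eq_mul]
  ring_nf

/-- A measurable version of `bushWeight`. -/
def bw (η : Config) : ℝ :=
  -Real.log (bushProd (fun _ u => ofReal (exp (-u))) η).toReal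

/-- A measurable version of `bushSize`. -/
def bs (η : Config) : ℝ :=
  -Real.log (bushProd (fun _ _ => ofReal (exp (-1))) η).toReal

lemma bw_eq {η : Config} (h : NoTie η) : bw η = bushWeight η := by
  have := bushProd_exp h (fun _ => -1) (fun _ => 0)
  simp only [neg_mul, one_mul, add_zero, zero_mul] at this
  rw [bw, this, ENNReal.toReal_ofReal (exp_pos _).le, Real.log_exp, neg_neg]

lemma bs_eq {η : Config} (h : NoTie η) : bs η = bushSize η := by
  have := bushProd_exp h (fun _ => 0) (fun _ => -1)
  simp only [neg_mul, one_mul, zero_mul, zero_add] at this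
  rw [bs, this, ENNReal.toReal_ofReal (exp_pos _).le, Real.log_exp, neg_neg]

lemma measurable_bw : Measurable bw := by
  refine (Real.measurable_log.comp (measurable_bushProd ?_).ennreal_toReal).neg
  exact (measurable_exp.comp measurable_snd.neg).ennreal_ofReal

lemma measurable_bs : Measurable bs :=
  (Real.measurable_log.comp (measurable_bushProd measurable_const).ennreal_toReal).neg

lemma rootFree_bw : RootFree bw := rootFree_bushProd.comp_left fun x => -Real.log x.toReal

lemma bw_nonneg {η : Config} (h : NoTie η) : 0 ≤ bw η := by
  rw [bw_eq h]
  exact finsum_nonneg fun u => finsum_nonneg fun _ => wt_nonneg η u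

lemma bs_nonneg {η : Config} (h : NoTie η) : 0 ≤ bs η := by
  rw [bs_eq h]; positivity

lemma bushProd_exp' {η : Config} (h : NoTie η) (a b : ℝ → ℝ) :
    bushProd (fun s u => ofReal (exp (a s * u + b s))) η =
      ofReal (exp (a (R η) * bw η + b (R η) * bs η)) := by
  rw [bushProd_exp h, bw_eq h, bs_eq h]

lemma bushProd_one {η : Config} (h : NoTie η) : bushProd (fun _ _ => 1) η = 1 := by
  have := bushProd_exp h (fun _ => 0) (fun _ => 0)
  simpa using this

end

section

variable {ν : Measure ℕ} [IsProbabilityMeasure ν] {q : ℝ → ℝ → ℝ≥0∞} {s : ℝ}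

/-! ### Evolution along the backbone -/

lemma rootFree_gn (n : ℕ) : RootFree (gn q s n) := fun η => by
  cases n with
  | zero => rfl
  | succ n =>
    simp only [gn, deg_keep_root, shv_keep_root]
    exact prod_congr rfl fun i _ => by
      rw [show wt (keep {(true, [])}ᶜ η) [i] = wt η [i] from wt_keep_root η [] i]

lemma gn_succ_eq (n : ℕ) (η : Config) : gn q s (n + 1) η = ∏ i ∈ range (deg η []),
    (fun τ => if wt τ [] ≤ s then q s (wt τ []) * gn q s n τ else 1) (shv [i] η) := by
  simp only [wt_shv, List.nil_append]; rfl

/-- Both sides obey the same increasing recursion through `pgf`; only the integral of `q s` enters,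
and it is at most that of `1`. -/
lemma lintegral_gn_le (hν : ν {0} = 0) (hq : Measurable (uncurry q))
    (hs : s ∈ Icc (0 : ℝ) 1) (h : ∫⁻ u in Icc 0 s, q s u ≤ ofReal s) (n : ℕ) :
    ∫⁻ η, gn q s n η ∂law ν ≤ ∫⁻ η, gn (fun _ _ => 1) s n η ∂law ν := by
  have hm : ∀ {q : ℝ → ℝ → ℝ≥0∞} (n), Measurable (uncurry q) →
      Measurable (gn q s n) := fun n hq => (measurable_gn hq n).comp measurable_prodMk_left
  have key : ∀ {q : ℝ → ℝ → ℝ≥0∞} (n), Measurable (uncurry q) →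
      ∫⁻ η, gn q s (n + 1) η ∂law ν = pgf ν ((∫⁻ u in Icc 0 s, q s u) *
        (∫⁻ η, gn q s n η ∂law ν) + ofReal (1 - s)) := by
    intro q n hq
    rw [lintegral_congr (gn_succ_eq n)]
    have hqs : Measurable (q s) := hq.comp measurable_prodMk_left
    rw [lintegral_prod_branches hν (φ := fun τ => if wt τ [] ≤ s then q s (wt τ []) * gn q s n τ else 1),
      lintegral_ite_wt hs hqs (hm n hq) (rootFree_gn n)]
    exact Measurable.ite (measurableSet_le (measurable_wt _) measurable_const)
      ((hqs.comp (measurable_wt _)).mul (hm n hq)) measurable_const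
  induction n with
  | zero => exact le_rfl
  | succ n ih =>
    rw [key n hq, key n measurable_const, lintegral_Icc_one]
    exact pgf_mono (by gcongr)

lemma lintegral_clusterProd_le (hν : ν {0} = 0) (hq : Measurable (uncurry q))
    (hs : s ∈ Icc (0 : ℝ) 1) (h : ∫⁻ u in Icc 0 s, q s u ≤ ofReal s) :
    ∫⁻ η, clusterProd q s η ∂law ν ≤ ∫⁻ η, clusterProd (fun _ _ => 1) s η ∂law ν := by
  simp_rw [clusterProd]
  rw [lintegral_iSup (f := fun n η => gn q s n η)
    (fun n => (measurable_gn hq n).comp measurable_prodMk_left) fun m n hmn η => gn_mono hs.1 hmn]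
  refine iSup_le fun n => (lintegral_gn_le hν hq hs h n).trans (lintegral_mono fun η => ?_)
  exact le_iSup (fun n => gn (fun _ _ => 1) s n η) n

lemma lintegral_clusterProd_one (hs : 0 ≤ s) :
    ∫⁻ η, clusterProd (fun _ _ => 1) s η ∂law ν = ofReal (1 - theta ν s) := by
  have : ∀ η, clusterProd (fun _ _ => 1) s η =
      ({η | R η ≤ s}ᶜ : Set Config).indicator 1 η := fun η => by
    rw [clusterProd_one hs]; simp [Set.indicator]
  simp_rw [this]
  rw [lintegral_indicator_one (measurableSet_R_le s).compl, theta,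
    ← probReal_compl_eq_one_sub (measurableSet_R_le s), ofReal_measureReal]

lemma facMean_le (hν : ν {0} = 0) (hq : Measurable (uncurry q))
    (hs : s ∈ Icc (0 : ℝ) 1) (h : ∫⁻ u in Icc 0 s, q s u ≤ ofReal s) :
    facMean ν q s ≤ facMean ν (fun _ _ => 1) s := by
  rw [facMean_eq hq hs, facMean_eq measurable_const hs, lintegral_Icc_one]
  gcongr ?_ * ?_ + _
  exact lintegral_clusterProd_le hν hq hs h

lemma facMean_one (hs : s ∈ Icc (0 : ℝ) 1) :
    facMean ν (fun _ _ => 1) s = ofReal (1 - s * theta ν s) := by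
  rw [facMean_eq measurable_const hs, lintegral_Icc_one, lintegral_clusterProd_one hs.1,
    ← ofReal_mul hs.1, ← ofReal_add
      (mul_nonneg hs.1 (sub_nonneg.2 (theta_le_one s))) (by linarith [hs.2])]
  congr 1; ring

/-- The factor `pgfDeriv ν (facMean ν q s)` of the one-step formula `lintegral_step`. -/
def rate (ν : Measure ℕ) (q : ℝ → ℝ → ℝ≥0∞) (s : ℝ) : ℝ≥0∞ := pgfDeriv ν (facMean ν q s)

/-- The trivial edge functional. -/
abbrev unitq : ℝ → ℝ → ℝ≥0∞ := fun _ _ => 1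

lemma measurable_unitq : Measurable (uncurry unitq) := measurable_const

lemma measurable_rate (hq : Measurable (uncurry q)) : Measurable (rate ν q) :=
  measurable_pgfDeriv.comp (measurable_facMean hq)

lemma rate_le (hν : ν {0} = 0) (hq : Measurable (uncurry q))
    (hs : s ∈ Icc (0 : ℝ) 1) (h : ∫⁻ u in Icc 0 s, q s u ≤ ofReal s) :
    rate ν q s ≤ rate ν unitq s := pgfDeriv_mono (facMean_le hν hq hs h)

lemma rate_unitq (hs : s ∈ Icc (0 : ℝ) 1) (hpos : 0 < s * theta ν s) :
    rate ν unitq s = ofReal (dphi ν (s * theta ν s)) := by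
  rw [rate, facMean_one hs, pgfDeriv_ofReal hpos (mul_mem_Icc hs (theta_mem s)).2]

lemma S_mem (η : Config) : S η ∈ Icc (0 : ℝ) 1 := ⟨S_nonneg η, S_le_one η⟩

lemma R_mem (η : Config) : R η ∈ Icc (0 : ℝ) 1 := ⟨R_nonneg η, R_le_one η⟩

/-- The transfer operator of the evolution along the backbone. -/
def evol (ν : Measure ℕ) (q : ℝ → ℝ → ℝ≥0∞) (g : ℝ → ℝ≥0∞) (r : ℝ) : ℝ≥0∞ :=
  ∫⁻ u, g (max u r) * rate ν q (max u r) ∂unif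

lemma measurable_evol (hq : Measurable (uncurry q)) {g : ℝ → ℝ≥0∞} (hg : Measurable g) :
    Measurable (evol ν q g) := by
  have : Measurable fun p : ℝ × ℝ => g (max p.2 p.1) * rate ν q (max p.2 p.1) :=
    (hg.mul (measurable_rate hq)).comp (measurable_snd.max measurable_fst)
  exact this.lintegral_prod_right'

lemma evol_eq_zero {g : ℝ → ℝ≥0∞} (h : ∀ r, s < r → g r = 0) {r : ℝ} (hr : s < r) :
    evol ν q g r = 0 := by
  simp [evol, fun u => h (max u r) (lt_max_of_lt_right hr)]

/-- The weight above the root is uniform and independent of all that lies below, so `S` is the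
maximum of `R` and an independent uniform variable. -/
lemma lintegral_S {F : ℝ → ℝ≥0∞} (hF : Measurable F) {K : Config → ℝ≥0∞} (hK : Measurable K)
    (hfree : RootFree K) : ∫⁻ η, F (S η) * K η ∂law ν =
      ∫⁻ η, (∫⁻ u, F (max u (R η)) ∂unif) * K η ∂law ν := by
  have hm : Measurable fun p : ℝ × Config => F (max p.1 (R p.2)) :=
    hF.comp (measurable_fst.max (measurable_R.comp measurable_snd))
  rw [show (fun η => F (S η) * K η) = fun η =>
    (fun u η => F (max u (R η)) * K η) (wt η []) η from rfl,
    lintegral_root (F := fun u η => F (max u (R η)) * K η)]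
  · refine lintegral_congr fun η => ?_
    have : Measurable fun u => F (max u (R η)) := hm.comp measurable_prodMk_right
    rw [lintegral_mul_const _ this]
  · exact hm.mul (hK.comp measurable_snd)
  · intro u η
    simp only [hfree η, rootFree_R η]

lemma lintegral_step' (hν : ν {0} = 0) (hq : Measurable (uncurry q)) {g : ℝ → ℝ≥0∞}
    (hg : Measurable g) {K : Config → ℝ≥0∞} (hK : Measurable K) (hfree : RootFree K) :
    ∫⁻ η, g (R η) * bushProd q η * K (next η) ∂law ν =
      ∫⁻ η, evol ν q g (R η) * K η ∂law ν := by
  rw [lintegral_step hν hq hg hK]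
  have := lintegral_S (ν := ν) (F := fun s => g s * rate ν q s) (hg.mul (measurable_rate hq)) hK
    hfree
  rw [show (∫⁻ η, evol ν q g (R η) * K η ∂law ν) = _ from this.symm]
  refine lintegral_congr fun η => ?_
  rw [rate]; ring

lemma ae_noTie (hν : ν {0} = 0) (h2 : 0 < ν.real {n | 2 ≤ n}) : ∀ᵐ η ∂law ν, NoTie η := by
  filter_upwards [ae_generic hν h2] with η h using h.noTie_iterate 0

/-- The case `q = 1`, where the bush product is almost surely `1`: it gives the law of the
configuration one step down the backbone. -/
lemma lintegral_next (hν : ν {0} = 0) (h2 : 0 < ν.real {n | 2 ≤ n}) {g : ℝ → ℝ≥0∞}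
    (hg : Measurable g) {K : Config → ℝ≥0∞} (hK : Measurable K) :
    ∫⁻ η, g (R η) * K (next η) ∂law ν =
      ∫⁻ η, g (S η) * rate ν unitq (S η) * K η ∂law ν := by
  have := lintegral_step hν measurable_unitq hg hK
  calc _ = _ := lintegral_congr_ae (by
        filter_upwards [ae_noTie hν h2] with η h; rw [bushProd_one h, mul_one])
    _ = _ := this
    _ = _ := lintegral_congr fun η => by rw [rate]; ring

lemma lintegral_evol (hν : ν {0} = 0) (h2 : 0 < ν.real {n | 2 ≤ n}) {g : ℝ → ℝ≥0∞}
    (hg : Measurable g) {K : Config → ℝ≥0∞} (hK : Measurable K) (hfree : RootFree K) :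
    ∫⁻ η, g (R η) * K (next η) ∂law ν = ∫⁻ η, evol ν unitq g (R η) * K η ∂law ν := by
  rw [← lintegral_step' hν measurable_unitq hg hK hfree]
  refine lintegral_congr_ae ?_
  filter_upwards [ae_noTie hν h2] with η h
  rw [bushProd_one h, mul_one]

/-- The density of the state of the `n`-th backbone vertex, if the root has the density `g`. -/
def dens (ν : Measure ℕ) (n : ℕ) (g : ℝ → ℝ≥0∞) : ℝ → ℝ≥0∞ := (evol ν unitq)^[n] g

lemma dens_succ (n : ℕ) (g : ℝ → ℝ≥0∞) : dens ν (n + 1) g = dens ν n (evol ν unitq g) := rfl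

lemma measurable_dens (n : ℕ) {g : ℝ → ℝ≥0∞} (hg : Measurable g) : Measurable (dens ν n g) := by
  induction n generalizing g with
  | zero => exact hg
  | succ n ih => exact ih (measurable_evol measurable_unitq hg)

lemma dens_eq_zero (n : ℕ) {g : ℝ → ℝ≥0∞} (h : ∀ r, s < r → g r = 0) :
    ∀ r, s < r → dens ν n g r = 0 := by
  induction n generalizing g with
  | zero => exact h
  | succ n ih => exact ih fun r hr => evol_eq_zero h hr

lemma RootFree.comp_next {β : Type*} (K : Config → β) : RootFree fun η => K (next η) :=
  rootFree_next.comp_left K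

lemma RootFree.iterate {β : Type*} {K : Config → β} (h : RootFree K) (n : ℕ) :
    RootFree fun η => K (next^[n] η) := by
  cases n with
  | zero => exact h
  | succ n => exact (rootFree_next_iterate n).comp_left K

lemma measurable_iterate_next (n : ℕ) : Measurable next^[n] := measurable_next.iterate n

/-- Iterating the one-step formula, the history of the backbone survives only as a function of the
current threshold. `RootFree` is needed since the weight above the current vertex has been
integrated out. -/
lemma lintegral_dens (hν : ν {0} = 0) (h2 : 0 < ν.real {n | 2 ≤ n}) (n : ℕ) {g : ℝ → ℝ≥0∞}
    (hg : Measurable g) {K : Config → ℝ≥0∞} (hK : Measurable K) (hfree : RootFree K) :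
    ∫⁻ η, g (R η) * K (next^[n] η) ∂law ν = ∫⁻ η, dens ν n g (R η) * K η ∂law ν := by
  induction n generalizing g with
  | zero => rfl
  | succ n ih =>
    rw [dens_succ, ← ih (measurable_evol measurable_unitq hg)]
    exact lintegral_evol hν h2 hg (hK.comp (measurable_iterate_next n)) (hfree.iterate n)

/-- The law one step down has a density with respect to `law ν`, so almost sure properties pass to
all backbone vertices. -/
lemma quasiMeasurePreserving_next (hν : ν {0} = 0) (h2 : 0 < ν.real {n | 2 ≤ n}) :
    Measure.QuasiMeasurePreserving next (law ν) (law ν) := by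
  refine ⟨measurable_next, Measure.AbsolutelyContinuous.mk fun A hA h0 => ?_⟩
  rw [Measure.map_apply measurable_next hA]
  have h := lintegral_next hν h2 (measurable_const (a := (1 : ℝ≥0∞)))
    (measurable_one.indicator hA)
  have h1 : ∫⁻ η, (1 : ℝ≥0∞) * A.indicator 1 (next η) ∂law ν = (law ν) (next ⁻¹' A) := by
    simp_rw [one_mul]
    exact lintegral_indicator_one (measurable_next hA)
  rw [← h1, h]
  refine (lintegral_congr_ae ?_).trans lintegral_zero
  filter_upwards [measure_eq_zero_iff_ae_notMem.1 h0] with η hη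
  simp [hη]

lemma ae_iterate (hν : ν {0} = 0) (h2 : 0 < ν.real {n | 2 ≤ n}) {p : Config → Prop}
    (h : ∀ᵐ η ∂law ν, p η) (n : ℕ) : ∀ᵐ η ∂law ν, p (next^[n] η) :=
  ((quasiMeasurePreserving_next hν h2).iterate n).ae h

/-! ### The threshold falls to the critical value -/

lemma lintegral_unif_max {r : ℝ} (hr : r ∈ Icc (0 : ℝ) 1) (F : ℝ → ℝ≥0∞) :
    ∫⁻ u, F (max u r) ∂unif =
      ofReal r * F r + ∫⁻ u, (Ioi r).indicator F u ∂unif := by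
  have h1 : ∀ u, F (max u r) = (Iic r).piecewise (fun _ => F r) F u := fun u => by
    simp only [Set.piecewise, Set.mem_Iic]
    split_ifs with h
    · rw [max_eq_right h]
    · rw [max_eq_left (not_le.1 h).le]
  simp_rw [h1]
  rw [lintegral_piecewise measurableSet_Iic, setLIntegral_const, mul_comm, Set.compl_Iic,
    lintegral_indicator measurableSet_Ioi, unif, Measure.restrict_apply measurableSet_Iic]
  have : Iic r ∩ Icc 0 1 = Icc 0 r := by
    ext u
    simp only [Set.mem_inter_iff, Set.mem_Iic, Set.mem_Icc]
    exact ⟨fun h => ⟨h.2.1, h.1⟩, fun h => ⟨h.2, h.1, h.2.trans hr.2⟩⟩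
  rw [this, Real.volume_Icc, sub_zero]

/-- The first term is the case in which the weight above the root is at most `R`, of conditional
probability `R`; in the second the weight is the maximum. -/
lemma lintegral_S_split {F k : ℝ → ℝ≥0∞} (hF : Measurable F) (hk : Measurable k) :
    ∫⁻ η, F (S η) * k (R η) ∂law ν = ∫⁻ η, ofReal (R η) * F (R η) * k (R η) ∂law ν +
      ∫⁻ u, F u * ∫⁻ η in {η | R η < u}, k (R η) ∂law ν ∂unif := by
  rw [lintegral_S (K := fun η => k (R η)) hF (hk.comp measurable_R) (rootFree_R.comp_left k)]
  simp_rw [lintegral_unif_max (R_mem _), add_mul]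
  rw [lintegral_add_left]
  swap
  · exact (measurable_R.ennreal_ofReal.mul (hF.comp measurable_R)).mul (hk.comp measurable_R)
  congr 1
  have hm : Measurable fun p : ℝ × Config => (Ioi (R p.2)).indicator F p.1 * k (R p.2) := by
    have : (fun p : ℝ × Config => (Ioi (R p.2)).indicator F p.1) =
        {p : ℝ × Config | R p.2 < p.1}.indicator fun p => F p.1 := by
      ext p; simp [Set.indicator]
    refine Measurable.mul ?_ (hk.comp (measurable_R.comp measurable_snd))
    rw [this]
    exact (hF.comp measurable_fst).indicator
      (measurableSet_lt (measurable_R.comp measurable_snd) measurable_fst)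
  have hind : ∀ r, Measurable ((Ioi r).indicator F) := fun r => hF.indicator measurableSet_Ioi
  calc _ = ∫⁻ η, ∫⁻ u, (Ioi (R η)).indicator F u * k (R η) ∂unif ∂law ν :=
        lintegral_congr fun η => (lintegral_mul_const _ (hind _)).symm
    _ = ∫⁻ u, ∫⁻ η, (Ioi (R η)).indicator F u * k (R η) ∂law ν ∂unif :=
        lintegral_lintegral_swap (hm.comp measurable_swap).aemeasurable
    _ = _ := by
      refine lintegral_congr fun u => ?_
      rw [← lintegral_indicator (measurableSet_lt measurable_R measurable_const),
        ← lintegral_const_mul]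
      · refine lintegral_congr fun η => ?_
        simp only [Set.indicator, Set.mem_Ioi, Set.mem_ofPred_eq]
        split_ifs <;> simp
      · exact (hk.comp measurable_R).indicator (measurableSet_lt measurable_R measurable_const)

/-- The left-hand side is the conditional probability that the threshold stays at `s` in one step.
Strict concavity at `s * theta ν s`, divided by `theta ν s`, keeps it away from `1`. -/
lemma mul_rate_le (hν : ν {0} = 0) {p : ℝ} (hp : 0 < p) (hθ : 0 < theta ν p) (hps : p ≤ s)
    (hs : s ≤ 1) : ofReal s * rate ν unitq s ≤
      ofReal (1 - ν.real {n | 2 ≤ n} * p ^ 2 * theta ν p) := by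
  have hsm : s ∈ Icc (0 : ℝ) 1 := ⟨by linarith, hs⟩
  have hθs := hθ.trans_le (theta_mono hps)
  have hs0 : 0 < s := hp.trans_le hps
  rw [rate_unitq hsm (by positivity), ← ofReal_mul hsm.1]
  refine ofReal_le_ofReal ?_
  have h1 := mul_dphi_le (ν := ν) (mul_pos hs0 hθs) (mul_mem_Icc hsm (theta_mem s)).2
  rw [← theta_eq hν hsm] at h1
  have h3 : s * dphi ν (s * theta ν s) ≤ 1 - ν.real {n | 2 ≤ n} * (s ^ 2 * theta ν s) := by
    refine le_of_mul_le_mul_left ?_ hθs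
    linarith
  have h4 : p ^ 2 * theta ν p ≤ s ^ 2 * theta ν s := by
    have := theta_mono (ν := ν) hps
    gcongr
  have h5 : ν.real {n | 2 ≤ n} * (p ^ 2 * theta ν p) ≤ ν.real {n | 2 ≤ n} * (s ^ 2 * theta ν s) :=
    mul_le_mul_of_nonneg_left h4 measureReal_nonneg
  linarith

/-- Each backbone step brings the threshold below `p` with a probability bounded from below. -/
lemma lintegral_stay_le (hν : ν {0} = 0) (h2 : 0 < ν.real {n | 2 ≤ n}) {p : ℝ} (hp : 0 < p)
    (hp1 : p ≤ 1) (hθ : 0 < theta ν p) {g : ℝ → ℝ≥0∞} (hg : Measurable g) (hsupp : ∀ r ≤ p, g r = 0)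
    (hfin : ∫⁻ η, g (R η) ∂law ν ≠ ∞) :
    ∫⁻ η, g (R η) * (Ioi p).indicator 1 (R (next η)) ∂law ν ≤
      ofReal (1 - theta ν p * (ν.real {n | 2 ≤ n} * p ^ 2 * theta ν p)) *
        ∫⁻ η, g (R η) ∂law ν := by
  set δ := ν.real {n | 2 ≤ n} * p ^ 2 * theta ν p with hδ
  have hF : Measurable fun s => g s * rate ν unitq s := hg.mul (measurable_rate measurable_unitq)
  have hI : Measurable ((Ioi p).indicator (1 : ℝ → ℝ≥0∞)) :=
    measurable_one.indicator measurableSet_Ioi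
  have hb := lintegral_next hν h2 hg (measurable_const (a := (1 : ℝ≥0∞)))
  rw [lintegral_S_split hF measurable_const] at hb
  rw [lintegral_next (K := fun η => (Ioi p).indicator 1 (R η)) hν h2 hg
    (hI.comp measurable_R), lintegral_S_split hF hI]
  simp only [mul_one] at hb
  set b := ∫⁻ η, g (R η) ∂law ν with hbdef
  -- The mass of `g` is `x + y`: `x` belongs to steps that keep the threshold, `y` to steps in which
  -- the backbone edge is larger than the new threshold, which is then distributed as `R` given `R <
  -- u`.
  set x := ∫⁻ η, ofReal (R η) * (g (R η) * rate ν unitq (R η)) ∂law ν with hx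
  have hy : ∀ u, ∫⁻ η in {η | R η < u}, (1 : ℝ≥0∞) ∂law ν = ofReal (theta ν u) := by
    intro u
    rw [setLIntegral_one, real_R_lt hν h2]
  simp_rw [hy] at hb
  set y := ∫⁻ u, g u * rate ν unitq u * ofReal (theta ν u) ∂unif with hydef
  have hx1 : x ≤ ofReal (1 - δ) * b := by
    have : Measurable fun η => g (R η) := hg.comp measurable_R
    rw [hx, hbdef, ← lintegral_const_mul _ this]
    refine lintegral_mono fun η => ?_
    rcases le_or_gt (R η) p with h | h
    · simp [hsupp _ h]
    · calc _ = ofReal (R η) * rate ν unitq (R η) * g (R η) := by ring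
        _ ≤ _ := by gcongr; exact mul_rate_le hν hp hθ h.le (R_le_one η)
  have hxl : ∫⁻ η, ofReal (R η) * (g (R η) * rate ν unitq (R η)) *
      (Ioi p).indicator 1 (R η) ∂law ν ≤ x := lintegral_mono fun η => by
    refine mul_le_of_le_one_right (zero_le) ?_
    simp only [Set.indicator]; split_ifs <;> simp
  have hyl : ∫⁻ u, g u * rate ν unitq u * ∫⁻ η in {η | R η < u},
      (Ioi p).indicator 1 (R η) ∂law ν ∂unif ≤ ofReal (1 - theta ν p) * y := by
    have hθm : Measurable fun u => ofReal (theta ν u) := measurable_theta.ennreal_ofReal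
    have : Measurable fun u => g u * rate ν unitq u * ofReal (theta ν u) := hF.mul hθm
    rw [hydef, ← lintegral_const_mul _ this]
    refine lintegral_mono fun u => ?_
    rcases le_or_gt u p with h | h
    · simp [hsupp _ h]
    -- The left-hand side is `θ(u) - θ(p)`, and `θ(p) ≥ θ(p) θ(u)`: a fresh threshold is below `p`
    -- with conditional probability at least `θ(p)`.
    have : ∫⁻ η in {η | R η < u}, (Ioi p).indicator 1 (R η) ∂law ν ≤
        ofReal (1 - theta ν p) * ofReal (theta ν u) := by
      have hmp : MeasurableSet {η | p < R η} := measurableSet_lt measurable_const measurable_R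
      have h1 : ∫⁻ η in {η | R η < u}, (Ioi p).indicator 1 (R η) ∂law ν =
          (law ν) ({η | R η < u} \ {η | R η ≤ p}) := by
        have : ∀ η, (Ioi p).indicator (1 : ℝ → ℝ≥0∞) (R η) = {η | p < R η}.indicator 1 η :=
          fun η => by simp [Set.indicator]
        simp_rw [this]
        rw [lintegral_indicator_one hmp, Measure.restrict_apply hmp]
        congr 1; ext η; simp [and_comm]
      have hsub : {η | R η ≤ p} ⊆ {η | R η < u} := fun η h' => lt_of_le_of_lt (α := ℝ) h' h
      rw [h1, measure_sdiff hsub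
        (measurableSet_R_le p).nullMeasurableSet (measure_ne_top _ _), real_R_lt hν h2,
        ← ofReal_measureReal, ← ENNReal.ofReal_sub _ measureReal_nonneg,
        ← ofReal_mul (sub_nonneg.2 (theta_le_one p))]
      refine ofReal_le_ofReal ?_
      change theta ν u - theta ν p ≤ _
      nlinarith [theta_le_one (ν := ν) u, theta_nonneg (ν := ν) p]
    calc _ ≤ g u * rate ν unitq u * (ofReal (1 - theta ν p) * ofReal (theta ν u)) := by
          gcongr
      _ = _ := by ring
  refine (add_le_add hxl hyl).trans ?_
  have hxf : x ≠ ∞ := fun h => hfin (by rw [hb, h, top_add])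
  have hyf : y ≠ ∞ := fun h => hfin (by rw [hb, h, add_top])
  have hδ0 : 0 ≤ δ := by positivity
  have hδ1 : δ ≤ 1 := by
    have : ν.real {n | 2 ≤ n} ≤ 1 := measureReal_le_one
    have : p ^ 2 ≤ 1 := pow_le_one₀ hp.le hp1
    have := theta_le_one (ν := ν) p
    exact mul_le_one₀ (mul_le_one₀ ‹_› (by positivity) ‹_›) hθ.le ‹_›
  have hθ1 := theta_le_one (ν := ν) p
  rw [hb, ← ofReal_toReal hxf, ← ofReal_toReal hyf] at hx1 ⊢
  have hX := ENNReal.toReal_nonneg (a := x)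
  have hY := ENNReal.toReal_nonneg (a := y)
  rw [← ofReal_add hX hY, ← ofReal_mul (sub_nonneg.2 hδ1),
    ENNReal.ofReal_le_ofReal_iff (mul_nonneg (sub_nonneg.2 hδ1) (by positivity))] at hx1
  rw [← ofReal_add hX hY, ← ofReal_mul (sub_nonneg.2 hθ1),
    ← ofReal_add hX (mul_nonneg (sub_nonneg.2 hθ1) hY),
    ← ofReal_mul (sub_nonneg.2 (mul_le_one₀ hθ1 hδ0 hδ1))]
  refine ofReal_le_ofReal ?_
  nlinarith

/-- If the root percolates at level `p` with positive probability, then so does, eventually, the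
`n`-th backbone vertex. -/
lemma ae_exists_R_le (hν : ν {0} = 0) (h2 : 0 < ν.real {n | 2 ≤ n}) {p : ℝ} (hp : 0 < p)
    (hp1 : p ≤ 1) (hθ : 0 < theta ν p) : ∀ᵐ η ∂law ν, ∃ n, R (next^[n] η) ≤ p := by
  set ρ := ofReal (1 - theta ν p * (ν.real {n | 2 ≤ n} * p ^ 2 * theta ν p)) with hρ
  have hρ1 : ρ < 1 := by
    rw [hρ, ENNReal.ofReal_lt_one]
    have : 0 < theta ν p * (ν.real {n | 2 ≤ n} * p ^ 2 * theta ν p) := by positivity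
    linarith
  have hI : Measurable ((Ioi p).indicator (1 : ℝ → ℝ≥0∞)) :=
    measurable_one.indicator measurableSet_Ioi
  have hR : ∀ n, Measurable fun η => (Ioi p).indicator (1 : ℝ → ℝ≥0∞) (R (next^[n] η)) :=
    fun n => hI.comp (measurable_R.comp (measurable_iterate_next n))
  set a : ℕ → ℝ≥0∞ := fun n => ∫⁻ η, (Ioi p).indicator 1 (R (next^[n] η)) ∂law ν with ha
  have ha1 : ∀ n, a n ≤ 1 := fun n => by
    have : a n ≤ ∫⁻ _, 1 ∂law ν := lintegral_mono fun η => by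
      simp only [Set.indicator]; split_ifs <;> simp
    simpa using this
  have hstep : ∀ n, a (n + 1) ≤ ρ * a n := by
    intro n
    have hd := measurable_dens (ν := ν) n (measurable_const (a := (1 : ℝ≥0∞)))
    have key : ∀ {K : Config → ℝ≥0∞}, Measurable K → RootFree K →
        ∫⁻ η, K (next^[n] η) ∂law ν = ∫⁻ η, dens ν n (fun _ => 1) (R η) * K η ∂law ν :=
      fun hK hf => by
        rw [← lintegral_dens hν h2 n measurable_const hK hf]; simp only [one_mul]
    have h1 : ∫⁻ η, (dens ν n (fun _ => 1) (R η) * (Ioi p).indicator 1 (R η)) ∂law ν = a n :=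
      (key (K := fun η => (Ioi p).indicator 1 (R η)) (hR 0) (rootFree_R.comp_left _)).symm
    -- The density is restricted to thresholds above `p`. Nothing is lost, because thresholds do not
    -- increase: being above `p` at time `n + 1` implies it at time `n`.
    have h3 := lintegral_stay_le (ν := ν) hν h2 hp hp1 hθ
      (g := fun r => dens ν n (fun _ => 1) r * (Ioi p).indicator 1 r) (hd.mul hI)
      (fun r hr => by simp [Set.indicator, not_lt.2 hr])
      (by rw [h1]; exact ((ha1 n).trans_lt ENNReal.one_lt_top).ne)
    rw [h1] at h3
    refine le_trans (le_of_eq ?_) h3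
    have h4 := key (K := fun η => (Ioi p).indicator 1 (R η) *
      (Ioi p).indicator 1 (R (next η))) ((hR 0).mul (hR 1))
      (fun η => by simp only [rootFree_R η, rootFree_next η])
    simp_rw [← mul_assoc] at h4
    rw [← h4]
    refine lintegral_congr fun η => ?_
    rw [iterate_succ_apply']
    simp only [Set.indicator, Set.mem_Ioi]
    have := R_next_le (next^[n] η)
    split_ifs <;> first | (exfalso; linarith) | simp
  have hpow : ∀ n, a n ≤ ρ ^ n := by
    intro n
    induction n with
    | zero => simpa using ha1 0
    | succ n ih => rw [pow_succ']; exact (hstep n).trans (by gcongr)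
  have hnull : (law ν) {η | ∀ n, p < R (next^[n] η)} = 0 := by
    refine le_antisymm (ge_of_tendsto' (ENNReal.tendsto_pow_atTop_nhds_zero_of_lt_one hρ1)
      fun n => le_trans ?_ (hpow n)) (zero_le)
    have hms : MeasurableSet {η | p < R (next^[n] η)} :=
      measurableSet_lt measurable_const (measurable_R.comp (measurable_iterate_next n))
    have : a n = (law ν) {η | p < R (next^[n] η)} := by
      rw [← lintegral_indicator_one hms]
      exact lintegral_congr fun η => by simp [Set.indicator]
    rw [this]
    exact measure_mono fun η h => h n
  filter_upwards [measure_eq_zero_iff_ae_notMem.1 hnull] with η hη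
  simpa using hη

lemma theta_eq_zero_of (hν : ν {0} = 0) (hs : s ∈ Icc (0 : ℝ) 1)
    (h : ∀ y, 0 < y → y ≤ 1 → phi ν y * s < y) : theta ν s = 0 := by
  by_contra hne
  have hpos : 0 < theta ν s := lt_of_le_of_ne (theta_nonneg s) (Ne.symm hne)
  have h1 := theta_eq hν hs
  rcases hs.1.eq_or_lt with h0 | h0
  · rw [← h0, zero_mul, phi_zero] at h1
    rw [← h0] at hne
    exact hne h1
  · have := h (s * theta ν s) (by positivity) (mul_mem_Icc hs (theta_mem s)).2
    rw [← h1] at this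
    linarith

end

section

variable {ν : Measure ℕ} [IsProbabilityMeasure ν] {s : ℝ}

/-! ### The critical value -/

lemma phi_le_mul_mean {y : ℝ} (hy : y ∈ Icc (0 : ℝ) 1) (hint : Integrable (fun n : ℕ => (n : ℝ)) ν) :
    phi ν y ≤ y * ∫ n, (n : ℝ) ∂ν := by
  rw [phi, ← integral_const_mul]
  refine integral_mono (integrable_one_sub_pow hy) (hint.const_mul y) fun n => ?_
  have := one_add_mul_le_pow (show (-2 : ℝ) ≤ -y by linarith [hy.2]) n
  rw [← sub_eq_add_neg] at this
  dsimp only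
  linarith

/-- At `p_c = 1/m` a positive fixed point would need `phi(y) = y m`, but `phi(y)/y < phi(y/2)/(y/2)
≤ m`. For infinite mean the integral defaults to zero, so `p_c = 0`, as it should be. -/
lemma theta_criticalProb (hν : ν {0} = 0) (h2 : 0 < ν.real {n | 2 ≤ n})
    (h : criticalProb ν ≤ 1) : theta ν (criticalProb ν) = 0 := by
  have h0 : 0 ≤ criticalProb ν := inv_nonneg.2 (integral_nonneg fun n => n.cast_nonneg)
  refine theta_eq_zero_of hν ⟨h0, h⟩ fun y hy hy1 => ?_
  rcases h0.eq_or_lt with h0 | h0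
  · rwa [← h0, mul_zero]
  · have hm : 0 < ∫ n, (n : ℝ) ∂ν := inv_pos.1 h0
    have hint : Integrable (fun n : ℕ => (n : ℝ)) ν := by
      by_contra hne
      rw [integral_undef hne] at hm
      exact hm.false
    have h3 := mul_phi_lt (ν := ν) h2 (half_pos hy) (half_lt_self hy) hy1
    have h4 := phi_le_mul_mean (ν := ν) (y := y / 2) ⟨by positivity, by linarith⟩ hint
    have h5 : phi ν y < y * ∫ n, (n : ℝ) ∂ν := by nlinarith
    rw [criticalProb, ← div_eq_mul_inv, div_lt_iff₀ hm]
    exact h5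

/-- A truncated mean bounds the slope near zero from below, which covers finite and infinite means
at once. -/
lemma le_dphi {y : ℝ} (hy0 : 0 < y) (hy1 : y ≤ 1) (N : ℕ) :
    ofReal ((1 - y) ^ N) * ∑ n ∈ range N, n * ν {n} ≤ ofReal (dphi ν y) := by
  rw [← pgfDeriv_ofReal hy0 hy1, pgfDeriv, lintegral_countable']
  refine le_trans ?_ (ENNReal.sum_le_tsum (range N))
  rw [Finset.mul_sum]
  refine Finset.sum_le_sum fun n hn => ?_
  rw [← ENNReal.ofReal_pow (by linarith)]
  calc _ = n * ofReal ((1 - y) ^ N) * ν {n} := by ring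
    _ ≤ _ := by
      have hle : (1 - y) ^ N ≤ (1 - y) ^ (n - 1) :=
        pow_le_pow_of_le_one (by linarith) (by linarith) (by
          have := mem_range.1 hn; omega)
      have := ofReal_le_ofReal hle
      gcongr

/-- Above `p_c` the mean exceeds `1/p`, hence so does the slope of `phi` near zero. Then `y/p` is a
positive subsolution for small `y`. -/
lemma theta_pos (hν : ν {0} = 0) {p : ℝ} (hp : criticalProb ν < p) (hp1 : p ≤ 1) :
    0 < theta ν p := by
  have h0 : 0 ≤ criticalProb ν := inv_nonneg.2 (integral_nonneg fun n => n.cast_nonneg)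
  have hp0 : 0 < p := h0.trans_lt hp
  have hE : (ofReal p)⁻¹ < ∫⁻ n, (n : ℝ≥0∞) ∂ν := by
    have h1 : criticalProb ν = (∫⁻ n, (n : ℝ≥0∞) ∂ν).toReal⁻¹ := by
      rw [criticalProb, integral_eq_lintegral_of_nonneg_ae
        (Eventually.of_forall fun n => n.cast_nonneg) (Measurable.of_discrete).aestronglyMeasurable]
      simp
    rw [h1] at hp
    by_cases htop : ∫⁻ n, (n : ℝ≥0∞) ∂ν = ∞
    · rw [htop]; simpa using hp0
    have hpos : 0 < (∫⁻ n, (n : ℝ≥0∞) ∂ν).toReal := by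
      refine ENNReal.toReal_pos (fun h => ?_) htop
      have h3 : ∫⁻ _, (1 : ℝ≥0∞) ∂ν ≤ ∫⁻ n, (n : ℝ≥0∞) ∂ν := by
        refine lintegral_mono_ae ?_
        filter_upwards [measure_eq_zero_iff_ae_notMem.1 hν] with n hn
        have : n ≠ 0 := hn
        exact_mod_cast Nat.one_le_iff_ne_zero.2 this
      rw [h] at h3
      simp at h3
    rw [← ENNReal.ofReal_inv_of_pos hp0, ENNReal.ofReal_lt_iff_lt_toReal (by positivity) htop]
    exact (inv_lt_comm₀ hpos hp0).1 hp
  rw [lintegral_countable', ENNReal.tsum_eq_iSup_nat, lt_iSup_iff] at hE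
  obtain ⟨N, hN⟩ := hE
  set e := ∑ n ∈ range N, (n : ℝ≥0∞) * ν {n} with he
  have hlim : Tendsto (fun y : ℝ => ofReal ((1 - y) ^ N) * e) (𝓝[>] 0) (𝓝 e) := by
    have h1 : Tendsto (fun y : ℝ => ofReal ((1 - y) ^ N)) (𝓝[>] 0) (𝓝 1) := by
      have : Continuous fun y : ℝ => ofReal ((1 - y) ^ N) :=
        ENNReal.continuous_ofReal.comp (by fun_prop)
      simpa using (this.tendsto 0).mono_left nhdsWithin_le_nhds
    have := ENNReal.Tendsto.mul_const (b := e) h1 (Or.inl one_ne_zero)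
    rwa [one_mul] at this
  obtain ⟨y, hy, hy0, hyp⟩ := ((hlim.eventually (lt_mem_nhds hN)).and
    (Ioo_mem_nhdsGT hp0)).exists
  have hy1 : y ≤ 1 := hyp.le.trans hp1
  have h3 := hy.trans_le (le_dphi (ν := ν) hy0 hy1 N)
  rw [← ENNReal.ofReal_inv_of_pos hp0, ENNReal.ofReal_lt_ofReal_iff_of_nonneg (by positivity)] at h3
  have h4 := le_phi_sub (ν := ν) le_rfl hy0.le hy1 hy0
  rw [phi_zero, sub_zero, sub_zero] at h4
  have h5 : y / p ≤ phi ν y := by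
    rw [div_eq_mul_inv]
    exact (mul_le_mul_of_nonneg_left h3.le hy0.le).trans h4
  refine (div_pos hy0 hp0).trans_le (le_theta hν ⟨hp0.le, hp1⟩
    ⟨by positivity, (div_le_one hp0).2 hyp.le⟩ ?_)
  rwa [mul_div_cancel₀ _ hp0.ne']

lemma ae_criticalProb_le (hν : ν {0} = 0) (h2 : 0 < ν.real {n | 2 ≤ n}) (h : criticalProb ν ≤ 1) :
    ∀ᵐ η ∂law ν, criticalProb ν < R η := by
  have h0 := theta_criticalProb hν h2 h
  rw [theta, measureReal_eq_zero_iff] at h0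
  filter_upwards [measure_eq_zero_iff_ae_notMem.1 h0] with η hη
  simpa using hη

lemma criticalProb_le_one (hν : ν {0} = 0) : criticalProb ν ≤ 1 := by
  by_cases hint : Integrable (fun n : ℕ => (n : ℝ)) ν
  · refine inv_le_one_of_one_le₀ ?_
    have : ∫ _, (1 : ℝ) ∂ν ≤ ∫ n, (n : ℝ) ∂ν := by
      refine integral_mono_ae (integrable_const 1) hint ?_
      filter_upwards [measure_eq_zero_iff_ae_notMem.1 hν] with n hn
      have : n ≠ 0 := hn
      exact_mod_cast Nat.one_le_iff_ne_zero.2 this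
    simpa using this
  · rw [criticalProb, integral_undef hint]; simp

/-- The future maximum weight tends to the critical value. -/
lemma tendsto_R_iterate (hν : ν {0} = 0) (h2 : 0 < ν.real {n | 2 ≤ n}) :
    ∀ᵐ η ∂law ν, Tendsto (fun n => R (next^[n] η)) atTop (𝓝 (criticalProb ν)) := by
  have h0 : 0 ≤ criticalProb ν := inv_nonneg.2 (integral_nonneg fun n => n.cast_nonneg)
  have h1 : ∀ᵐ η ∂law ν, ∀ n, criticalProb ν < R (next^[n] η) :=
    ae_all_iff.2 fun n => ae_iterate hν h2 (ae_criticalProb_le hν h2 (criticalProb_le_one hν)) n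
  have h3 : ∀ᵐ η ∂law ν, ∀ m : ℕ, ∃ n, R (next^[n] η) ≤ criticalProb ν + 1 / ((m : ℝ) + 1) := by
    rw [ae_all_iff]
    intro m
    have hm : 0 < 1 / ((m : ℝ) + 1) := by positivity
    rcases le_or_gt (criticalProb ν + 1 / ((m : ℝ) + 1)) 1 with h | h
    · exact ae_exists_R_le hν h2 (by linarith) h (theta_pos hν (by linarith) h)
    · exact Eventually.of_forall fun η => ⟨0, (R_le_one _).trans h.le⟩
  filter_upwards [h1, h3] with η h1 h3
  refine tendsto_order.2 ⟨fun a ha => Eventually.of_forall fun n => ha.trans (h1 n), fun a ha => ?_⟩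
  obtain ⟨m, hm⟩ := exists_nat_one_div_lt (sub_pos.2 ha)
  obtain ⟨n, hn⟩ := h3 m
  -- By monotonicity a single visit below the level `a` suffices.
  filter_upwards [eventually_ge_atTop n] with k hk
  have := R_iterate_antitone η hk
  dsimp only at this
  linarith

end

section

variable {ν : Measure ℕ} [IsProbabilityMeasure ν]

/-! ### From a weighted tree to a configuration -/

section Transfer

variable {Ω : Type*} [MeasurableSpace Ω] {μ : Measure Ω} [IsProbabilityMeasure μ]
  {X : Vertex → Ω → ℕ} {U : Vertex → Ω → ℝ}

/-- The configuration of a weighted tree. -/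
def field (X : Vertex → Ω → ℕ) (U : Vertex → Ω → ℝ) (ω : Ω) : Config :=
  fun p => if p.1 then U p.2 ω else (X p.2 ω : ℝ)

lemma aemeasurable_field (h : IsWeightedBPTree ν X U μ) : AEMeasurable (field X U) μ := by
  refine aemeasurable_pi_lambda _ fun p => ?_
  rcases p with ⟨b, v⟩
  cases b
  · exact (measurable_of_countable (fun n : ℕ => (n : ℝ))).comp_aemeasurable
      (h.offspring_law v).aemeasurable
  · exact (h.weight_law v).aemeasurable

open Classical in
-- Checked on cylinder boxes: the box splits into a condition on degrees and one on weights, which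
-- are independent of each other and each factorize.
lemma map_field (h : IsWeightedBPTree ν X U μ) : μ.map (field X U) = law ν := by
  refine Measure.eq_infinitePi _ fun s t ht => ?_
  rw [Measure.map_apply_of_aemeasurable (aemeasurable_field h)
    (MeasurableSet.pi s.countable_toSet fun p _ => ht p)]
  set s0 : Finset Vertex := (s.filter fun p => p.1 = false).image Prod.snd with hs0
  set s1 : Finset Vertex := (s.filter fun p => p.1 = true).image Prod.snd with hs1
  have hm0 : ∀ v, v ∈ s0 ↔ (false, v) ∈ s := fun v => by simp [hs0]
  have hm1 : ∀ v, v ∈ s1 ↔ (true, v) ∈ s := fun v => by simp [hs1]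
  set t0 : Vertex → Set ℕ := fun v => (fun n : ℕ => (n : ℝ)) ⁻¹' t (false, v) with ht0
  have hpre : field X U ⁻¹' (Set.pi s t) =
      ((fun ω v => X v ω) ⁻¹' Set.pi s0 t0) ∩
        ((fun ω v => U v ω) ⁻¹' Set.pi s1 fun v => t (true, v)) := by
    ext ω
    simp only [Set.mem_preimage, Set.mem_pi, Set.mem_inter_iff, Finset.mem_coe, hm0, hm1,
      Prod.forall, Bool.forall_bool]
    rfl
  have h0 : μ ((fun ω v => X v ω) ⁻¹' Set.pi s0 t0) = ∏ v ∈ s0, entryLaw ν false (t (false, v)) := by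
    have := h.offspring_indep.measure_inter_preimage_eq_mul s0 (sets := t0)
      fun v _ => .of_discrete
    rw [show ((fun ω v => X v ω) ⁻¹' Set.pi s0 t0) = ⋂ i ∈ s0, X i ⁻¹' t0 i by
      ext; simp [Set.mem_pi], this]
    refine prod_congr rfl fun v _ => ?_
    rw [entryLaw, Measure.map_apply (measurable_of_countable _) (ht _),
      ← (h.offspring_law v).map_eq, Measure.map_apply_of_aemeasurable
        (h.offspring_law v).aemeasurable .of_discrete]
  have h1 : μ ((fun ω v => U v ω) ⁻¹' Set.pi s1 fun v => t (true, v)) =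
      ∏ v ∈ s1, entryLaw ν true (t (true, v)) := by
    have := h.weight_indep.measure_inter_preimage_eq_mul s1 (sets := fun v => t (true, v))
      fun v _ => ht _
    rw [show ((fun ω v => U v ω) ⁻¹' Set.pi s1 fun v => t (true, v)) =
      ⋂ i ∈ s1, U i ⁻¹' t (true, i) by ext; simp [Set.mem_pi], this]
    refine prod_congr rfl fun v _ => ?_
    rw [entryLaw, unif, ← (h.weight_law v).map_eq, Measure.map_apply_of_aemeasurable
        (h.weight_law v).aemeasurable (ht _)]
  rw [hpre, h.indep.measure_inter_preimage_eq_mul _ _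
    (MeasurableSet.pi s0.countable_toSet fun _ _ => .of_discrete)
    (MeasurableSet.pi s1.countable_toSet fun _ _ => ht _), h0, h1,
    ← Finset.prod_filter_mul_prod_filter_not s (fun p => p.1 = false)]
  have hinj : ∀ b : Bool, Set.InjOn Prod.snd ((s.filter fun p => p.1 = b : Finset _) :
      Set (Bool × Vertex)) := by
    rintro b ⟨b1, v1⟩ h1 ⟨b2, v2⟩ h2 h12
    simp only [Finset.coe_filter, Set.mem_ofPred_eq] at h1 h2 h12
    rw [h1.2, h2.2, h12]
  congr 1
  · rw [hs0, Finset.prod_image (hinj false)]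
    refine prod_congr rfl fun p hp => ?_
    rw [Finset.mem_filter] at hp
    rw [← hp.2]
  · rw [hs1, Finset.prod_image (hinj true)]
    simp only [Bool.not_eq_false]
    refine prod_congr rfl fun p hp => ?_
    rw [Finset.mem_filter] at hp
    rw [← hp.2]

lemma hasLaw_field (h : IsWeightedBPTree ν X U μ) : HasLaw (field X U) (law ν) μ :=
  ⟨aemeasurable_field h, map_field h⟩

lemma ae_field (h : IsWeightedBPTree ν X U μ) {p : Config → Prop} (hp : ∀ᵐ η ∂law ν, p η) :
    ∀ᵐ ω ∂μ, p (field X U ω) := by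
  rw [← map_field h] at hp
  exact ae_of_ae_map (aemeasurable_field h) hp

lemma ae_deg_field (h : IsWeightedBPTree ν X U μ) (hν : ν {0} = 0) :
    ∀ᵐ ω ∂μ, deg (field X U ω) = fun v => X v ω := by
  have : ∀ᵐ ω ∂μ, ∀ v, X v ω ≠ 0 := by
    rw [ae_all_iff]
    intro v
    have h0 : ∀ᵐ n ∂ν, n ≠ 0 := measure_eq_zero_iff_ae_notMem.1 hν
    rw [← (h.offspring_law v).map_eq] at h0
    exact ae_of_ae_map (h.offspring_law v).aemeasurable h0
  filter_upwards [this] with ω hω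
  ext v
  simpa [deg, field] using Nat.one_le_iff_ne_zero.2 (hω v)

lemma ae_wt_field (h : IsWeightedBPTree ν X U μ) :
    ∀ᵐ ω ∂μ, wt (field X U ω) = fun v => U v ω := by
  have : ∀ᵐ ω ∂μ, ∀ v, U v ω ∈ Icc (0 : ℝ) 1 := by
    rw [ae_all_iff]
    intro v
    have h0 : ∀ᵐ x ∂(volume.restrict (Icc (0 : ℝ) 1)), x ∈ Icc (0 : ℝ) 1 :=
      ae_restrict_mem measurableSet_Icc
    rw [← (h.weight_law v).map_eq] at h0
    exact ae_of_ae_map (h.weight_law v).aemeasurable h0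
  filter_upwards [this] with ω hω
  ext v
  simp [wt, field, (hω v).1, (hω v).2]

end Transfer

/-- A measurable version of the size of the cut cluster. -/
def sizeSum (k : ℕ) (η : Config) : ℝ := ∑ j ∈ range (k + 1), (bs (next^[j] η) + 1)

/-- A measurable version of the weight of the cut cluster. -/
def weightSum (k : ℕ) (η : Config) : ℝ :=
  ∑ j ∈ range (k + 1), bw (next^[j] η) + ∑ j ∈ range k, wt (next^[j + 1] η) []

lemma measurable_sizeSum (k : ℕ) : Measurable (sizeSum k) :=
  Finset.measurable_fun_sum _ fun j _ =>
    (measurable_bs.comp (measurable_iterate_next j)).add_const 1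

lemma measurable_weightSum (k : ℕ) : Measurable (weightSum k) :=
  (Finset.measurable_fun_sum _ fun j _ => measurable_bw.comp (measurable_iterate_next j)).add
    (Finset.measurable_fun_sum _ fun j _ => (measurable_wt []).comp (measurable_iterate_next (j + 1)))

lemma cutSize_eq_sizeSum {η : Config} (h : Generic η) (k : ℕ) :
    (cutSize (deg η) (wt η) k : ℝ) = sizeSum k η := by
  rw [cutSize_eq h, sizeSum]
  push_cast
  exact sum_congr rfl fun j _ => by rw [bs_eq (h.noTie_iterate j)]

lemma cutWeight_eq_weightSum {η : Config} (h : Generic η) (k : ℕ) :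
    cutWeight (deg η) (wt η) k = weightSum k η := by
  rw [cutWeight_eq h, weightSum]
  congr 1
  exact sum_congr rfl fun j _ => by rw [bw_eq (h.noTie_iterate j)]

lemma offspring_zero (hone : ∀ᵐ n ∂ν, 1 ≤ n) : ν {0} = 0 := by
  refine measure_eq_zero_iff_ae_notMem.2 ?_
  filter_upwards [hone] with n hn h
  have : n = 0 := h
  omega

/-- The tail is asymptotic to a positive function, so it is nonzero at some point `y ≥ 1`. -/
lemma offspring_two {α c : ℝ} (hc : 0 < c) (htail : Asymptotics.IsEquivalent atTop
      (fun y : ℝ => ν.real {n : ℕ | y < (n : ℝ)}) (fun y : ℝ => c * y ^ (-α))) :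
    0 < ν.real {n | 2 ≤ n} := by
  have h1 : ∀ᶠ y : ℝ in atTop, c * y ^ (-α) ≠ 0 := by
    filter_upwards [eventually_gt_atTop 0] with y hy
    exact (mul_pos hc (rpow_pos_of_pos hy _)).ne'
  have h2 := (Asymptotics.isEquivalent_iff_tendsto_one h1).1 htail
  obtain ⟨y, hy, hy1⟩ := ((h2.eventually (lt_mem_nhds one_pos)).and (eventually_ge_atTop 1)).exists
  have hne : ν.real {n : ℕ | y < (n : ℝ)} ≠ 0 := fun h => by
    simp [h] at hy
  have : ν.real {n : ℕ | y < (n : ℝ)} ≤ ν.real {n | 2 ≤ n} := measureReal_mono fun n hn => by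
    have hn' : y < (n : ℝ) := hn
    have : (1 : ℝ) < n := by linarith
    exact_mod_cast this
  exact (lt_of_le_of_ne measureReal_nonneg (Ne.symm hne)).trans_le this

lemma tendstoInDistribution_comp_iff {Ω Ω' Ω₁ E : Type*} [MeasurableSpace Ω] [MeasurableSpace Ω']
    [MeasurableSpace Ω₁] [TopologicalSpace E] [MeasurableSpace E] [OpensMeasurableSpace E]
    {μ : Measure Ω} [IsProbabilityMeasure μ] {μ' : Measure Ω'} [IsProbabilityMeasure μ']
    {μ₁ : Measure Ω₁} [IsProbabilityMeasure μ₁] {Ξ : Ω → Ω₁} (hΞ : HasLaw Ξ μ₁ μ)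
    {Y : ℕ → Ω₁ → E} (hY : ∀ n, Measurable (Y n)) {Z : Ω' → E} :
    TendstoInDistribution (fun n ω => Y n (Ξ ω)) atTop Z (fun _ => μ) μ' ↔
      TendstoInDistribution Y atTop Z (fun _ => μ₁) μ' := by
  have hmap : ∀ n, μ.map (fun ω => Y n (Ξ ω)) = μ₁.map (Y n) := fun n => by
    rw [← hΞ.map_eq, AEMeasurable.map_map_of_aemeasurable (hY n).aemeasurable hΞ.aemeasurable]
    rfl
  constructor
  · rintro ⟨h1, h2, h3⟩
    refine ⟨fun n => (hY n).aemeasurable, h2, ?_⟩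
    exact h3.congr fun n => Subtype.ext (hmap n)
  · rintro ⟨h1, h2, h3⟩
    refine ⟨fun n => (hY n).comp_aemeasurable hΞ.aemeasurable, h2, ?_⟩
    exact h3.congr fun n => Subtype.ext (hmap n).symm

end

section

variable {ν : Measure ℕ} [IsProbabilityMeasure ν] {α c : ℝ}

/-! ### Regular variation of the generating function -/

/-- The tail of the offspring law. -/
def tail (ν : Measure ℕ) (y : ℝ) : ℝ := ν.real {n : ℕ | y < (n : ℝ)}

lemma tail_antitone : Antitone (tail ν) := fun _ _ h =>
  measureReal_mono fun _ hn => lt_of_le_of_lt (α := ℝ) h hn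

/-- The layer-cake formula applied to `1 - exp(-y n)`, the integral of `exp(-t)` over `[0, y n]`. -/
lemma phi_eq_integral_tail {y : ℝ} (hy : 0 < y) :
    phi ν (1 - exp (-y)) = ∫ u in Ioi 0, exp (-u) * tail ν (u / y) := by
  have h1 : ∀ n : ℕ, 1 - (1 - (1 - exp (-y))) ^ n = ∫ t in (0 : ℝ)..y * n, exp (-t) := by
    intro n
    rw [sub_sub_cancel, ← Real.exp_nat_mul, intervalIntegral.integral_comp_neg, integral_exp,
      neg_zero, Real.exp_zero]
    ring_nf
  have h0 : ∀ n : ℕ, 0 ≤ ∫ t in (0 : ℝ)..y * n, exp (-t) := fun n =>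
    intervalIntegral.integral_nonneg (by positivity) fun t _ => (exp_pos _).le
  rw [phi, integral_congr_ae (Eventually.of_forall h1), integral_eq_lintegral_of_nonneg_ae
    (Eventually.of_forall h0) (Measurable.of_discrete).aestronglyMeasurable,
    lintegral_comp_eq_lintegral_meas_lt_mul ν (f := fun n : ℕ => y * (n : ℝ))
      (Eventually.of_forall fun n => by positivity) (Measurable.of_discrete).aemeasurable
      (fun t _ => (Continuous.intervalIntegrable (by fun_prop) _ _))
      (Eventually.of_forall fun t => (exp_pos _).le),
    integral_eq_lintegral_of_nonneg_ae]
  · congr 1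
    refine lintegral_congr fun t => ?_
    rw [ofReal_mul (exp_pos _).le, mul_comm, tail, ofReal_measureReal]
    congr 2
    ext n
    simp only [Set.mem_ofPred_eq]
    rw [div_lt_iff₀ hy, mul_comm]
  · exact Eventually.of_forall fun t => mul_nonneg (exp_pos _).le measureReal_nonneg
  · refine Measurable.aestronglyMeasurable ?_
    exact (measurable_exp.comp measurable_neg).mul
      (tail_antitone.measurable.comp (measurable_id.div_const y))

/-- The asymptotics hold only for large `t`; for bounded `t` the trivial bound `1` is absorbed into
the constant. This supplies the dominating function of the Abelian theorem. -/
lemma exists_tail_le (hα : 0 < α) (hc : 0 < c) (htail : Asymptotics.IsEquivalent atTop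
      (fun y : ℝ => ν.real {n : ℕ | y < (n : ℝ)}) (fun y : ℝ => c * y ^ (-α))) :
    ∃ K, 0 ≤ K ∧ ∀ t, 0 < t → tail ν t ≤ K * t ^ (-α) := by
  have h1 : ∀ᶠ y : ℝ in atTop, c * y ^ (-α) ≠ 0 := by
    filter_upwards [eventually_gt_atTop 0] with y hy
    exact (mul_pos hc (rpow_pos_of_pos hy _)).ne'
  have h2 := (Asymptotics.isEquivalent_iff_tendsto_one h1).1 htail
  obtain ⟨t0, ht0⟩ := eventually_atTop.1 (h2.eventually (gt_mem_nhds (one_lt_two)))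
  refine ⟨max (2 * c) ((max t0 1) ^ α), le_max_of_le_left (by positivity), fun t ht => ?_⟩
  have hp := rpow_pos_of_pos ht (-α)
  rcases le_or_gt t (max t0 1) with h | h
  · calc tail ν t ≤ 1 := measureReal_le_one
      _ = t ^ α * t ^ (-α) := by rw [← Real.rpow_add ht]; simp
      _ ≤ _ := by
        gcongr
        exact le_max_of_le_right (Real.rpow_le_rpow ht.le h hα.le)
  · have := ht0 t ((le_max_left _ _).trans h.le)
    simp only [Pi.div_apply] at this
    rw [div_lt_iff₀ (by positivity)] at this
    calc tail ν t ≤ 2 * c * t ^ (-α) := by rw [tail]; linarith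
      _ ≤ _ := by gcongr; exact le_max_left _ _

lemma tendsto_tail_scaled (hc : 0 < c) (htail : Asymptotics.IsEquivalent atTop
      (fun y : ℝ => ν.real {n : ℕ | y < (n : ℝ)}) (fun y : ℝ => c * y ^ (-α))) {u : ℝ} (hu : 0 < u) :
    Tendsto (fun y => y ^ (-α) * tail ν (u / y)) (𝓝[>] 0) (𝓝 (c * u ^ (-α))) := by
  have h1 : ∀ᶠ y : ℝ in atTop, c * y ^ (-α) ≠ 0 := by
    filter_upwards [eventually_gt_atTop 0] with y hy
    exact (mul_pos hc (rpow_pos_of_pos hy _)).ne'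
  have h2 := (Asymptotics.isEquivalent_iff_tendsto_one h1).1 htail
  have h3 : Tendsto (fun y => u / y) (𝓝[>] 0) atTop := by
    simp_rw [div_eq_mul_inv]
    exact tendsto_inv_nhdsGT_zero.const_mul_atTop hu
  have h4 := (h2.comp h3).mul_const (c * u ^ (-α))
  rw [one_mul] at h4
  refine h4.congr' ?_
  filter_upwards [self_mem_nhdsWithin] with y hy
  have hy' : 0 < y := hy
  have e1 : (u / y) ^ (-α) = u ^ (-α) * (y ^ (-α))⁻¹ := by
    rw [div_rpow hu.le hy'.le, div_eq_mul_inv]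
  have p1 := rpow_pos_of_pos hy' (-α)
  have p2 := rpow_pos_of_pos hu (-α)
  simp only [Function.comp, Pi.div_apply, e1, tail]
  field_simp

/-- Dominated convergence with the majorant `K exp(-u) u^(-α)`, integrable because `α < 1`; the
limit integral is `Γ(1 - α)`. -/
lemma tendsto_phi_exp (hα : 0 < α) (hα1 : α < 1) (hc : 0 < c)
    (htail : Asymptotics.IsEquivalent atTop
      (fun y : ℝ => ν.real {n : ℕ | y < (n : ℝ)}) (fun y : ℝ => c * y ^ (-α))) :
    Tendsto (fun y => y ^ (-α) * phi ν (1 - exp (-y))) (𝓝[>] 0)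
      (𝓝 (c * Real.Gamma (1 - α))) := by
  obtain ⟨K, hK0, hK⟩ := exists_tail_le hα hc htail
  have hconv := Real.GammaIntegral_convergent (s := 1 - α) (by linarith)
  simp only [sub_sub_cancel_left] at hconv
  have hlim : ∫ u in Ioi (0 : ℝ), exp (-u) * (c * u ^ (-α)) = c * Real.Gamma (1 - α) := by
    rw [Real.Gamma_eq_integral (by linarith), ← integral_const_mul]
    simp only [sub_sub_cancel_left]
    congr 1; ext u; ring
  rw [← hlim]
  have hF := tendsto_integral_filter_of_dominated_convergence (μ := volume.restrict (Ioi (0:ℝ)))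
    (l := 𝓝[>] (0 : ℝ)) (F := fun y u => exp (-u) * (y ^ (-α) * tail ν (u / y)))
    (f := fun u => exp (-u) * (c * u ^ (-α)))
    (bound := fun u => K * (exp (-u) * u ^ (-α))) ?_ ?_ ?_ ?_
  · refine hF.congr' ?_
    filter_upwards [self_mem_nhdsWithin] with y hy
    rw [phi_eq_integral_tail hy, ← integral_const_mul]
    congr 1; ext u; ring
  · refine Eventually.of_forall fun y => Measurable.aestronglyMeasurable ?_
    exact (measurable_exp.comp measurable_neg).mul
      ((tail_antitone.measurable.comp (measurable_id.div_const y)).const_mul _)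
  · filter_upwards [self_mem_nhdsWithin] with y hy
    have hy' : 0 < y := hy
    filter_upwards [ae_restrict_mem measurableSet_Ioi] with u hu
    have hu' : 0 < u := hu
    have p1 := rpow_pos_of_pos hy' (-α)
    have h0 : 0 ≤ tail ν (u / y) := measureReal_nonneg
    rw [norm_of_nonneg (by positivity)]
    have := hK (u / y) (by positivity)
    rw [div_rpow hu'.le hy'.le] at this
    calc exp (-u) * (y ^ (-α) * tail ν (u / y))
        ≤ exp (-u) * (y ^ (-α) * (K * (u ^ (-α) / y ^ (-α)))) := by gcongr
      _ = _ := by field_simp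
  · exact hconv.const_mul K
  · filter_upwards [ae_restrict_mem measurableSet_Ioi] with u hu
    exact (tendsto_tail_scaled hc htail hu).const_mul _

/-- The Abelian theorem for the generating function. -/
lemma tendsto_phi_div (hα : 0 < α) (hα1 : α < 1) (hc : 0 < c)
    (htail : Asymptotics.IsEquivalent atTop
      (fun y : ℝ => ν.real {n : ℕ | y < (n : ℝ)}) (fun y : ℝ => c * y ^ (-α))) :
    Tendsto (fun x => phi ν x / x ^ α) (𝓝[>] 0) (𝓝 (c * Real.Gamma (1 - α))) := by
  -- The substitution `x = 1 - exp(-y)` with `y ~ x` passes from the Laplace variable to `x`.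
  have hlog : Tendsto (fun x : ℝ => -Real.log (1 - x) / x) (𝓝[>] 0) (𝓝 1) := by
    have h1 : HasDerivAt (fun x : ℝ => -Real.log (1 - x)) 1 0 := by
      have := ((hasDerivAt_id (0 : ℝ)).const_sub 1).log (by simp)
      exact this.neg.congr_deriv (by simp)
    have h2 := h1.tendsto_slope_zero_right
    refine h2.congr fun x => ?_
    simp [div_eq_inv_mul]
  have hy : Tendsto (fun x : ℝ => -Real.log (1 - x)) (𝓝[>] 0) (𝓝[>] 0) := by
    refine tendsto_nhdsWithin_iff.2 ⟨?_, ?_⟩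
    · have : ContinuousAt (fun x : ℝ => -Real.log (1 - x)) 0 :=
        ((continuousAt_const.sub continuousAt_id).log (by simp)).neg
      have h := this.tendsto.mono_left (nhdsWithin_le_nhds (s := Ioi 0))
      simpa using h
    · filter_upwards [Ioo_mem_nhdsGT (one_pos)] with x hx
      have := Real.log_neg (sub_pos.2 hx.2) (by linarith [hx.1])
      simpa using this
  have h1 := ((tendsto_phi_exp hα hα1 hc htail).comp hy).mul
    (hlog.rpow_const (p := α) (Or.inl one_ne_zero))
  rw [Real.one_rpow, mul_one] at h1
  refine h1.congr' ?_
  filter_upwards [Ioo_mem_nhdsGT (one_pos)] with x hx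
  have hl : 0 < -Real.log (1 - x) := by
    have := Real.log_neg (sub_pos.2 hx.2) (by linarith [hx.1])
    linarith
  simp only [Function.comp, neg_neg]
  rw [Real.exp_log (sub_pos.2 hx.2), sub_sub_cancel, div_rpow hl.le hx.1.le,
    Real.rpow_neg hl.le]
  have := rpow_pos_of_pos hl α
  field_simp

variable {c₁ : ℝ}

lemma tendsto_phi_mul_div (hφ : Tendsto (fun x => phi ν x / x ^ α) (𝓝[>] 0) (𝓝 c₁))
    {b : ℝ} (hb : 0 < b) : Tendsto (fun x => phi ν (b * x) / x ^ α) (𝓝[>] 0) (𝓝 (c₁ * b ^ α)) := by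
  have h1 : Tendsto (fun x : ℝ => b * x) (𝓝[>] 0) (𝓝[>] 0) := by
    refine tendsto_nhdsWithin_iff.2 ⟨?_, ?_⟩
    · have : Continuous fun x : ℝ => b * x := by fun_prop
      simpa using (this.tendsto 0).mono_left (nhdsWithin_le_nhds (s := Ioi 0))
    · filter_upwards [self_mem_nhdsWithin] with x hx
      exact mul_pos hb hx
  refine ((hφ.comp h1).mul_const (b ^ α)).congr' ?_
  filter_upwards [self_mem_nhdsWithin] with x hx
  have hx' : (0 : ℝ) < x := hx
  have := rpow_pos_of_pos hb α
  have := rpow_pos_of_pos hx' α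
  simp only [Function.comp]
  rw [Real.mul_rpow hb.le hx'.le]
  field_simp

/-- The monotone density theorem for the derivative of the generating function. -/
lemma tendsto_mul_dphi_div (hφ : Tendsto (fun x => phi ν x / x ^ α) (𝓝[>] 0) (𝓝 c₁)) :
    Tendsto (fun x => x * dphi ν x / x ^ α) (𝓝[>] 0) (𝓝 (c₁ * α)) := by
  have hder : HasDerivAt (fun h : ℝ => c₁ * (1 + h) ^ α) (c₁ * α) 0 := by
    have h1 : HasDerivAt (fun h : ℝ => 1 + h) 1 0 := (hasDerivAt_id (0 : ℝ)).const_add 1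
    have := (h1.rpow_const (p := α) (Or.inl (by simp))).const_mul c₁
    simpa using this
  have hone := tendsto_phi_mul_div hφ one_pos
  have hev : ∀ᶠ x : ℝ in 𝓝[>] 0, x ∈ Ioo (0 : ℝ) (1 / 2) := Ioo_mem_nhdsGT (by norm_num)
  have hkey : ∀ h : ℝ, h ≠ 0 → -1 < h → Tendsto (fun x => h⁻¹ * ((phi ν ((1 + h) * x) -
      phi ν (1 * x)) / x ^ α)) (𝓝[>] 0) (𝓝 (h⁻¹ * (c₁ * (1 + h) ^ α - c₁ * 1 ^ α))) := by
    intro h _ h1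
    simp_rw [sub_div]
    exact ((tendsto_phi_mul_div hφ (by linarith)).sub hone).const_mul _
  refine tendsto_order.2 ⟨fun b hb => ?_, fun b hb => ?_⟩
  -- By concavity `x * dphi x` lies between the difference quotients of `phi` over `[x, (1+h)x]`
  -- with `h > 0` and `[(1+h)x, x]` with `h < 0`. After division by `x^α` these converge for fixed
  -- `h`, and then `h → 0`.
  · have h1 := hder.tendsto_slope_zero_right
    simp only [zero_add, add_zero, smul_eq_mul] at h1
    obtain ⟨h, hh, h0, h11⟩ := ((h1.eventually (lt_mem_nhds hb)).and
      (Ioo_mem_nhdsGT one_pos)).exists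
    filter_upwards [(hkey h h0.ne' (by linarith)).eventually (lt_mem_nhds hh), hev] with x hx hx1
    refine hx.trans_le ?_
    have h3 := phi_sub_le (ν := ν) hx1.1 (show x ≤ (1 + h) * x by nlinarith [hx1.1])
      (by nlinarith [hx1.1, hx1.2])
    have := rpow_pos_of_pos hx1.1 α
    rw [← mul_div_assoc]
    refine div_le_div_of_nonneg_right ?_ this.le
    rw [one_mul, inv_mul_le_iff₀ h0]
    linarith
  · have h1 := hder.tendsto_slope_zero_left
    simp only [zero_add, add_zero, smul_eq_mul] at h1
    obtain ⟨h, hh, h0, h11⟩ := ((h1.eventually (gt_mem_nhds hb)).and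
      (Ioo_mem_nhdsLT (show (-1 : ℝ) < 0 by norm_num))).exists
    filter_upwards [(hkey h h11.ne h0).eventually (gt_mem_nhds hh), hev] with x hx hx1
    refine lt_of_le_of_lt ?_ hx
    have h3 := le_phi_sub (ν := ν) (x := (1 + h) * x) (y := x) (by nlinarith [hx1.1])
      (by nlinarith [hx1.1]) (by linarith [hx1.2]) hx1.1
    have := rpow_pos_of_pos hx1.1 α
    rw [← mul_div_assoc]
    refine div_le_div_of_nonneg_right ?_ this.le
    rw [one_mul, ← neg_sub, ← neg_mul_comm, ← inv_neg, inv_mul_eq_div, le_div_iff₀ (by linarith)]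
    linarith

end

section

variable {ν : Measure ℕ} [IsProbabilityMeasure ν] {α c₁ s : ℝ} {q : ℝ → ℝ → ℝ≥0∞} {Q : ℝ → ℝ}

/-! ### Percolation near level zero for offspring of infinite mean -/

/-- The offspring law has no atom at zero, is not degenerate, and its generating function is
regularly varying with exponent `α < 1`. -/
structure Regular (ν : Measure ℕ) (α c₁ : ℝ) : Prop where
  zero : ν {0} = 0
  two : 0 < ν.real {n | 2 ≤ n}
  pos : 0 < α
  lt_one : α < 1
  const_pos : 0 < c₁
  asymp : Tendsto (fun x => phi ν x / x ^ α) (𝓝[>] 0) (𝓝 c₁)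

/-- Near zero `phi(s x)` is of order `x^α`, far above `x`, so every small `x` is a subsolution:
percolation occurs at every positive level. -/
lemma Regular.theta_pos (h : Regular ν α c₁) (hs0 : 0 < s) (hs1 : s ≤ 1) : 0 < theta ν s := by
  have h1 := tendsto_phi_mul_div h.asymp hs0
  have hpos : 0 < c₁ * s ^ α := mul_pos h.const_pos (rpow_pos_of_pos hs0 _)
  have h2 : Tendsto (fun x : ℝ => x ^ (1 - α)) (𝓝[>] 0) (𝓝 0) := by
    have := (Real.continuousAt_rpow_const 0 (1 - α) (Or.inr (by linarith [h.lt_one]))).tendsto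
    rw [zero_rpow (by linarith [h.lt_one])] at this
    exact this.mono_left nhdsWithin_le_nhds
  obtain ⟨x, ⟨hx1, hx2⟩, hx0, hx3⟩ := ((h1.eventually (lt_mem_nhds (half_lt_self hpos))).and
    (h2.eventually (gt_mem_nhds (half_pos hpos)))).and (Ioo_mem_nhdsGT one_pos) |>.exists
  have hxα := rpow_pos_of_pos hx0 α
  rw [lt_div_iff₀ hxα] at hx1
  have h3 : x ≤ phi ν (s * x) := by
    have : x = x ^ (1 - α) * x ^ α := by rw [← Real.rpow_add hx0]; simp
    have h4 := mul_lt_mul_of_pos_right hx2 hxα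
    linarith
  exact hx0.trans_le (le_theta h.zero ⟨hs0.le, hs1⟩ ⟨hx0.le, hx3.le⟩ h3)

lemma eventually_unit : ∀ᶠ s : ℝ in 𝓝[>] 0, 0 < s ∧ s ≤ 1 := by
  filter_upwards [Ioo_mem_nhdsGT one_pos] with s hs using ⟨hs.1, hs.2.le⟩

lemma Regular.tendsto_phi_zero (h : Regular ν α c₁) : Tendsto (phi ν) (𝓝[>] 0) (𝓝 0) := by
  have h2 : Tendsto (fun x : ℝ => x ^ α) (𝓝[>] 0) (𝓝 0) := by
    have := (Real.continuousAt_rpow_const 0 α (Or.inr h.pos.le)).tendsto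
    rw [zero_rpow h.pos.ne'] at this
    exact this.mono_left nhdsWithin_le_nhds
  have := h.asymp.mul h2
  rw [mul_zero] at this
  refine this.congr' ?_
  filter_upwards [self_mem_nhdsWithin] with x hx
  exact div_mul_cancel₀ _ (rpow_pos_of_pos hx α).ne'

lemma Regular.tendsto_theta_zero (h : Regular ν α c₁) : Tendsto (theta ν) (𝓝[>] 0) (𝓝 0) := by
  refine tendsto_of_tendsto_of_tendsto_of_le_of_le' tendsto_const_nhds h.tendsto_phi_zero
    (Eventually.of_forall theta_nonneg) ?_
  filter_upwards [eventually_unit] with s hs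
  have hm : s ∈ Icc (0 : ℝ) 1 := ⟨hs.1.le, hs.2⟩
  calc theta ν s = phi ν (s * theta ν s) := theta_eq h.zero hm
    _ ≤ phi ν s := phi_mono (mul_mem_Icc hm (theta_mem s)) hm
      (mul_le_of_le_one_right hm.1 (theta_le_one s))

lemma Regular.tendsto_mul_theta (h : Regular ν α c₁) :
    Tendsto (fun s => s * theta ν s) (𝓝[>] 0) (𝓝[>] 0) := by
  refine tendsto_nhdsWithin_iff.2 ⟨?_, ?_⟩
  · have : Tendsto (fun s : ℝ => s) (𝓝[>] 0) (𝓝 0) := nhdsWithin_le_nhds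
    simpa using this.mul h.tendsto_theta_zero
  · filter_upwards [eventually_unit] with s hs
    exact mul_pos hs.1 (h.theta_pos hs.1 hs.2)

lemma Regular.tendsto_theta_div_mul (h : Regular ν α c₁) :
    Tendsto (fun s => theta ν s / (s * theta ν s) ^ α) (𝓝[>] 0) (𝓝 c₁) := by
  refine (h.asymp.comp h.tendsto_mul_theta).congr' ?_
  filter_upwards [eventually_unit] with s hs
  simp only [Function.comp]
  rw [← theta_eq h.zero ⟨hs.1.le, hs.2⟩]

/-- Solving `θ ~ c₁ (sθ)^α` for `θ`, by taking the power `1/(1-α)`. -/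
lemma Regular.tendsto_theta_div (h : Regular ν α c₁) :
    Tendsto (fun s => theta ν s / s ^ (α / (1 - α))) (𝓝[>] 0) (𝓝 (c₁ ^ (1 / (1 - α)))) := by
  have h1 : 0 < 1 - α := by linarith [h.lt_one]
  refine (h.tendsto_theta_div_mul.rpow_const (p := 1 / (1 - α)) (Or.inl h.const_pos.ne')).congr' ?_
  filter_upwards [eventually_unit] with s hs
  have hθ := h.theta_pos hs.1 hs.2
  rw [div_rpow hθ.le (rpow_nonneg (mul_pos hs.1 hθ).le _), ← Real.rpow_mul (mul_pos hs.1 hθ).le,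
    Real.mul_rpow hs.1.le hθ.le, mul_one_div, ← div_div, div_right_comm, ← Real.rpow_sub hθ,
    ← sub_div, div_self h1.ne', Real.rpow_one]

/-- The quotient of `x * dphi x ~ c₁ α x^α` by `phi x ~ c₁ x^α` at `x = sθ`, where `phi x = θ`. The
limit `α` is the probability that the threshold stays put, the atom of the law of `P_i`. -/
lemma Regular.tendsto_mul_dphi (h : Regular ν α c₁) :
    Tendsto (fun s => s * dphi ν (s * theta ν s)) (𝓝[>] 0) (𝓝 α) := by
  have h1 := ((tendsto_mul_dphi_div h.asymp).comp h.tendsto_mul_theta).div h.tendsto_theta_div_mul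
    h.const_pos.ne'
  rw [mul_div_cancel_left₀ _ h.const_pos.ne'] at h1
  refine h1.congr' ?_
  filter_upwards [eventually_unit] with s hs
  have hθ := h.theta_pos hs.1 hs.2
  have := rpow_pos_of_pos (mul_pos hs.1 hθ) α
  simp only [Function.comp, Pi.div_apply]
  field_simp

/-- Halving the argument multiplies `dphi` asymptotically by `2^(1-α)`, which is less than `2`. -/
lemma Regular.eventually_dphi_half (h : Regular ν α c₁) :
    ∀ᶠ x in 𝓝[>] 0, dphi ν (x / 2) ≤ 2 * dphi ν x := by
  have hhalf : Tendsto (fun x : ℝ => x / 2) (𝓝[>] 0) (𝓝[>] 0) := by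
    refine tendsto_nhdsWithin_iff.2 ⟨?_, ?_⟩
    · have : Continuous fun x : ℝ => x / 2 := by fun_prop
      simpa using (this.tendsto 0).mono_left (nhdsWithin_le_nhds (s := Ioi 0))
    · filter_upwards [self_mem_nhdsWithin] with x hx using half_pos (show (0 : ℝ) < x from hx)
  have hL := mul_pos h.const_pos h.pos
  have h1 := tendsto_mul_dphi_div h.asymp
  have h2 := h1.comp hhalf
  have h3 : c₁ * α < c₁ * α * (2 : ℝ) ^ α := by
    have : (1 : ℝ) < 2 ^ α := Real.one_lt_rpow one_lt_two h.pos
    nlinarith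
  have h4 := h2.sub (h1.mul_const ((2 : ℝ) ^ α))
  filter_upwards [h4.eventually (gt_mem_nhds (sub_neg.2 h3)), self_mem_nhdsWithin] with x hx hx0
  have hx0' : (0 : ℝ) < x := hx0
  have p1 := rpow_pos_of_pos hx0' α
  have p2 : (0 : ℝ) < 2 ^ α := rpow_pos_of_pos two_pos α
  simp only [Function.comp] at hx
  rw [div_rpow hx0'.le two_pos.le] at hx
  have h5 : x / 2 * dphi ν (x / 2) / (x ^ α / 2 ^ α) - x * dphi ν x / x ^ α * 2 ^ α =
    x * 2 ^ α / (2 * x ^ α) * (dphi ν (x / 2) - 2 * dphi ν x) := by field_simp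
  rw [h5] at hx
  have h6 : 0 < x * 2 ^ α / (2 * x ^ α) := by positivity
  by_contra! hlt
  nlinarith [mul_pos h6 (sub_pos.2 hlt)]

/-- The deficit of the expected factor of a branch. -/
def deficit (ν : Measure ℕ) (q : ℝ → ℝ → ℝ≥0∞) (s : ℝ) : ℝ := 1 - (facMean ν q s).toReal

/-- `q` is a measurable edge functional whose integral up to level `s` is `Q s ≤ s`. -/
structure EdgeFun (q : ℝ → ℝ → ℝ≥0∞) (Q : ℝ → ℝ) : Prop where
  meas : Measurable (uncurry q)
  eq : ∀ s, 0 < s → s ≤ 1 → ∫⁻ u in Icc 0 s, q s u = ofReal (Q s)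
  nonneg : ∀ s, 0 < s → s ≤ 1 → 0 ≤ Q s
  le : ∀ s, 0 < s → s ≤ 1 → Q s ≤ s

lemma EdgeFun.facMean_le (h : Regular ν α c₁) (hq : EdgeFun q Q) (hs0 : 0 < s) (hs1 : s ≤ 1) :
    facMean ν q s ≤ ofReal (1 - s * theta ν s) := by
  rw [← facMean_one ⟨hs0.le, hs1⟩]
  refine IPC.facMean_le h.zero hq.meas ⟨hs0.le, hs1⟩ ?_
  rw [hq.eq s hs0 hs1]
  exact ofReal_le_ofReal (hq.le s hs0 hs1)

lemma EdgeFun.facMean_eq (h : Regular ν α c₁) (hq : EdgeFun q Q) (hs0 : 0 < s) (hs1 : s ≤ 1) :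
    facMean ν q s = ofReal (1 - deficit ν q s) := by
  rw [deficit, sub_sub_cancel, ofReal_toReal]
  exact ((hq.facMean_le h hs0 hs1).trans_lt ENNReal.ofReal_lt_top).ne

lemma EdgeFun.le_deficit (h : Regular ν α c₁) (hq : EdgeFun q Q) (hs0 : 0 < s) (hs1 : s ≤ 1) :
    s * theta ν s ≤ deficit ν q s := by
  have h1 := ENNReal.toReal_mono ofReal_ne_top (hq.facMean_le h hs0 hs1)
  rw [ENNReal.toReal_ofReal (sub_nonneg.2 (mul_mem_Icc ⟨hs0.le, hs1⟩ (theta_mem s)).2)] at h1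
  rw [deficit]
  linarith

lemma EdgeFun.deficit_le (h : Regular ν α c₁) (hq : EdgeFun q Q) (hs0 : 0 < s) (hs1 : s ≤ 1) :
    deficit ν q s ≤ s := by
  have h1 : ofReal (1 - s) ≤ facMean ν q s := by
    rw [IPC.facMean_eq hq.meas ⟨hs0.le, hs1⟩]; exact le_add_self
  have h2 := ENNReal.toReal_mono ((hq.facMean_le h hs0 hs1).trans_lt ENNReal.ofReal_lt_top).ne h1
  rw [ENNReal.toReal_ofReal (by linarith)] at h2
  rw [deficit]
  linarith

/-- The perturbed fixed-point equation: for `Q s = s` it becomes `ξ = s * phi(ξ)`, solved by `ξ = s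
* theta ν s`. -/
lemma EdgeFun.deficit_eq (h : Regular ν α c₁) (hq : EdgeFun q Q) (hs0 : 0 < s) (hs1 : s ≤ 1) :
    deficit ν q s = s - Q s * (1 - phi ν (deficit ν q s)) := by
  have hd0 := hq.le_deficit h hs0 hs1
  have hd1 := hq.deficit_le h hs0 hs1
  have hmem : deficit ν q s ∈ Icc (0 : ℝ) 1 :=
    ⟨(mul_nonneg hs0.le (theta_nonneg s)).trans hd0, hd1.trans hs1⟩
  have h1 := IPC.facMean_eq (ν := ν) hq.meas ⟨hs0.le, hs1⟩
  rw [lintegral_clusterProd h.zero hq.meas hs0.le, hq.facMean_eq h hs0 hs1, hq.eq s hs0 hs1,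
    pgf_ofReal hmem, ← ofReal_mul (hq.nonneg s hs0 hs1), ← ofReal_add
      (mul_nonneg (hq.nonneg s hs0 hs1) (sub_nonneg.2 (phi_le_one hmem))) (by linarith),
    ENNReal.ofReal_eq_ofReal_iff (by linarith [hmem.2]) (add_nonneg (mul_nonneg
      (hq.nonneg s hs0 hs1) (sub_nonneg.2 (phi_le_one hmem))) (by linarith))] at h1
  linarith

lemma EdgeFun.rate_eq (h : Regular ν α c₁) (hq : EdgeFun q Q) (hs0 : 0 < s) (hs1 : s ≤ 1) :
    rate ν q s = ofReal (dphi ν (deficit ν q s)) := by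
  rw [rate, hq.facMean_eq h hs0 hs1, pgfDeriv_ofReal
    ((mul_pos hs0 (h.theta_pos hs0 hs1)).trans_le (hq.le_deficit h hs0 hs1))
    ((hq.deficit_le h hs0 hs1).trans hs1)]

lemma Regular.rate_unitq (h : Regular ν α c₁) (hs0 : 0 < s) (hs1 : s ≤ 1) :
    rate ν unitq s = ofReal (dphi ν (s * theta ν s)) :=
  IPC.rate_unitq ⟨hs0.le, hs1⟩ (mul_pos hs0 (h.theta_pos hs0 hs1))

lemma Regular.exists_deficit_sub_le (h : Regular ν α c₁) : ∃ K, 0 < K ∧ ∀ᶠ s in 𝓝[>] 0,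
    ∀ q Q, EdgeFun q Q → deficit ν q s - s * theta ν s ≤ K * (s - Q s) := by
  have h1 : 0 < 1 - α := by linarith [h.lt_one]
  -- The map `ξ ↦ s * phi(ξ)` has slope at most `s * dphi(sθ)` above the fixed point. This tends to
  -- `α`, so it is eventually below `(1+α)/2`, and `1 - (1+α)/2 = (1-α)/2`.
  refine ⟨2 / (1 - α), by positivity, ?_⟩
  filter_upwards [eventually_unit, h.tendsto_mul_dphi.eventually
    (gt_mem_nhds (show α < (1 + α) / 2 by linarith [h.lt_one]))] with s hs hs2 q Q hq
  have hle := hq.le_deficit h hs.1 hs.2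
  have hle1 := hq.deficit_le h hs.1 hs.2
  have heq := hq.deficit_eq h hs.1 hs.2
  have hpos := mul_pos hs.1 (h.theta_pos hs.1 hs.2)
  have h3 := phi_sub_le (ν := ν) hpos hle (hle1.trans hs.2)
  rw [← theta_eq h.zero ⟨hs.1.le, hs.2⟩] at h3
  have hQ0 := hq.nonneg s hs.1 hs.2
  have hQ := hq.le s hs.1 hs.2
  set ξ := deficit ν q s
  have hξ := phi_nonneg (ν := ν) (x := ξ) ⟨hpos.le.trans hle, hle1.trans hs.2⟩
  have h4 : ξ - s * theta ν s ≤ (s - Q s) + s * (phi ν ξ - theta ν s) := by nlinarith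
  have h5 : s * (phi ν ξ - theta ν s) ≤
      (ξ - s * theta ν s) * (s * dphi ν (s * theta ν s)) := by
    calc _ ≤ s * ((ξ - s * theta ν s) * dphi ν (s * theta ν s)) := by gcongr; exact hs.1.le
      _ = _ := by ring
  have h6 : (ξ - s * theta ν s) * (s * dphi ν (s * theta ν s)) ≤
      (ξ - s * theta ν s) * ((1 + α) / 2) :=
    mul_le_mul_of_nonneg_left hs2.le (sub_nonneg.2 hle)
  rw [div_mul_eq_mul_div, le_div_iff₀ h1]
  linarith

/-- The effect of an edge functional on the rate is controlled by its first moment. -/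
lemma Regular.exists_rate_le (h : Regular ν α c₁) : ∃ K, 0 < K ∧ ∀ᶠ s in 𝓝[>] 0,
    ∀ q Q, EdgeFun q Q → rate ν unitq s ≤ rate ν q s +
      ofReal (K * ((s - Q s) / s ^ (1 / (1 - α)))) * rate ν unitq s := by
  obtain ⟨K, hK, hev⟩ := h.exists_deficit_sub_le
  have h1 : 0 < 1 - α := by linarith [h.lt_one]
  have hy0 : 0 < c₁ ^ (1 / (1 - α)) := rpow_pos_of_pos h.const_pos _
  set y₀ := c₁ ^ (1 / (1 - α)) with hy0def
  refine ⟨8 * K / y₀, by positivity, ?_⟩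
  filter_upwards [eventually_unit, hev, h.tendsto_mul_theta.eventually h.eventually_dphi_half,
    h.tendsto_theta_div.eventually (lt_mem_nhds (half_lt_self hy0))] with s hs hs1 hs2 hs3 q Q hq
  have hle := hq.le_deficit h hs.1 hs.2
  have hle1 := hq.deficit_le h hs.1 hs.2
  have hθ := h.theta_pos hs.1 hs.2
  have hpos := mul_pos hs.1 hθ
  have hsQ := sub_nonneg.2 (hq.le s hs.1 hs.2)
  have hsp := rpow_pos_of_pos hs.1 (1 / (1 - α))
  rw [h.rate_unitq hs.1 hs.2, hq.rate_eq h hs.1 hs.2]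
  have hm : s * theta ν s ≤ 1 := hle.trans (hle1.trans hs.2)
  have hd0 := dphi_nonneg (ν := ν) (x := s * theta ν s) ⟨hpos.le, hm⟩
  rw [← ofReal_mul (by positivity), ← ofReal_add
    (dphi_nonneg ⟨hpos.le.trans hle, hle1.trans hs.2⟩) (by positivity)]
  refine ofReal_le_ofReal ?_
  have h3 := dphi_sub_le (ν := ν) hpos hle (hle1.trans hs.2)
  have h4 := hs1 q Q hq
  have h5 : s ^ (1 / (1 - α)) = s * s ^ (α / (1 - α)) := by
    rw [← Real.rpow_one_add' hs.1.le (by have := h.pos; positivity)]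
    congr 1; field_simp; ring
  rw [lt_div_iff₀ (rpow_pos_of_pos hs.1 _)] at hs3
  have h6 : y₀ / 2 * s ^ (1 / (1 - α)) ≤ s * theta ν s := by
    rw [h5]; nlinarith [hs.1]
  -- The shift of the argument of `dphi`, relative to `sθ/2`, is bounded using `sθ ≥ (y₀/2)
  -- s^(1/(1-α))`. The chord bound then controls `dphi`, and doubling bounds the chord by `2 *
  -- dphi`.
  have h7 : (deficit ν q s - s * theta ν s) / (s * theta ν s / 2) ≤
      4 * K / y₀ * ((s - Q s) / s ^ (1 / (1 - α))) := by
    calc _ ≤ K * (s - Q s) / (y₀ / 2 * s ^ (1 / (1 - α)) / 2) := by gcongr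
      _ = _ := by field_simp; ring
  calc dphi ν (s * theta ν s) ≤ dphi ν (deficit ν q s) +
        (deficit ν q s - s * theta ν s) / (s * theta ν s / 2) *
        (dphi ν (s * theta ν s / 2) - dphi ν (s * theta ν s)) := by linarith
    _ ≤ dphi ν (deficit ν q s) + 4 * K / y₀ * ((s - Q s) / s ^ (1 / (1 - α))) *
        (2 * dphi ν (s * theta ν s)) := by
      have h8 : 0 ≤ dphi ν (s * theta ν s / 2) - dphi ν (s * theta ν s) :=
        sub_nonneg.2 (dphi_anti (half_pos hpos) (by linarith) hm)
      have h9 : dphi ν (s * theta ν s / 2) - dphi ν (s * theta ν s) ≤ 2 * dphi ν (s * theta ν s) := by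
        linarith
      gcongr
    _ = _ := by ring

end

/-! ### Scaling limits of the deficit and of the rate at small levels -/

section

variable {ν : Measure ℕ} [IsProbabilityMeasure ν] {α c₁ s : ℝ} {q : ℝ → ℝ → ℝ≥0∞} {Q : ℝ → ℝ}

/-- The left endpoint is the positive zero of `w - c₁ w^α`; beyond it both factors of `w (1 - c₁
w^(α-1))` increase. This makes the scaled fixed-point equation uniquely solvable on the relevant
branch. -/
lemma strictMonoOn_sub_rpow (hα1 : α < 1) (hc : 0 < c₁) :
    StrictMonoOn (fun w : ℝ => w - c₁ * w ^ α) (Ici (c₁ ^ (1 / (1 - α)))) := by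
  have h1 : 0 < 1 - α := by linarith
  have hy0 : 0 < c₁ ^ (1 / (1 - α)) := rpow_pos_of_pos hc _
  have hkey : c₁ * (c₁ ^ (1 / (1 - α))) ^ (α - 1) = 1 := by
    rw [← Real.rpow_mul hc.le, show 1 / (1 - α) * (α - 1) = -1 by field_simp; ring,
      Real.rpow_neg_one, mul_inv_cancel₀ hc.ne']
  have hf : ∀ w : ℝ, 0 < w → w - c₁ * w ^ α = w * (1 - c₁ * w ^ (α - 1)) := fun w hw => by
    rw [Real.rpow_sub_one hw.ne']; field_simp
  intro w hw w' hw' hlt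
  have hw0 : 0 < w := hy0.trans_le hw
  have hw0' := hw0.trans hlt
  simp only [hf w hw0, hf w' hw0']
  have e1 : c₁ * w ^ (α - 1) ≤ 1 := by
    refine le_of_le_of_eq ?_ hkey
    exact mul_le_mul_of_nonneg_left (Real.rpow_le_rpow_of_nonpos hy0 hw (by linarith)) hc.le
  have e2 : c₁ * w' ^ (α - 1) < c₁ * w ^ (α - 1) :=
    mul_lt_mul_of_pos_left (Real.rpow_lt_rpow_of_neg hw0 hlt (show α - 1 < 0 by linarith)) hc
  nlinarith

lemma exists_sub_rpow_eq (hα : 0 < α) (hα1 : α < 1) (hc : 0 < c₁) {l : ℝ} (hl : 0 ≤ l) :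
    ∃ y, c₁ ^ (1 / (1 - α)) ≤ y ∧ y - c₁ * y ^ α = l := by
  have h1 : 0 < 1 - α := by linarith
  have hy0 : 0 < c₁ ^ (1 / (1 - α)) := rpow_pos_of_pos hc _
  set y₀ := c₁ ^ (1 / (1 - α)) with hy
  have h2c : 0 < (2 * c₁) ^ (1 / (1 - α)) := rpow_pos_of_pos (by positivity) _
  -- Beyond `(2c₁)^(1/(1-α))` the power term is at most half of `w`, so a right endpoint `b ≥ 2l`
  -- has value at least `l`.
  set b := max (max y₀ ((2 * c₁) ^ (1 / (1 - α)))) (2 * l) with hb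
  have hyb : y₀ ≤ b := (le_max_left _ _).trans (le_max_left _ _)
  have hb0 : 0 < b := hy0.trans_le hyb
  have hcont : ContinuousOn (fun w : ℝ => w - c₁ * w ^ α) (Icc y₀ b) :=
    (continuous_id.sub (continuous_const.mul (Real.continuous_rpow_const hα.le))).continuousOn
  have hz : y₀ - c₁ * y₀ ^ α = 0 := by
    have : y₀ = c₁ * y₀ ^ α := by
      rw [hy, ← Real.rpow_mul hc.le, ← Real.rpow_one_add' hc.le
        (by have := mul_pos (one_div_pos.2 h1) hα; positivity)]
      congr 1; field_simp; ring
    linarith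
  have hbl : l ≤ b - c₁ * b ^ α := by
    have e1 : 2 * c₁ * b ^ α ≤ b := by
      have e2 : 2 * c₁ ≤ b ^ (1 - α) := by
        calc 2 * c₁ = ((2 * c₁) ^ (1 / (1 - α))) ^ (1 - α) := by
              rw [← Real.rpow_mul (by positivity), one_div_mul_cancel h1.ne', Real.rpow_one]
          _ ≤ b ^ (1 - α) := Real.rpow_le_rpow h2c.le
            ((le_max_right _ _).trans (le_max_left _ _)) h1.le
      calc 2 * c₁ * b ^ α ≤ b ^ (1 - α) * b ^ α :=
            mul_le_mul_of_nonneg_right e2 (rpow_nonneg hb0.le _)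
        _ = b := by rw [← Real.rpow_add hb0]; simp
    have e3 : 2 * l ≤ b := le_max_right _ _
    linarith
  obtain ⟨y, hy1, hy2⟩ := intermediate_value_Icc hyb hcont
    (show l ∈ Icc (y₀ - c₁ * y₀ ^ α) (b - c₁ * b ^ α) from ⟨by rw [hz]; exact hl, hbl⟩)
  exact ⟨y, hy1.1, hy2⟩

lemma Regular.exponent (h : Regular ν α c₁) (hs : 0 < s) :
    s ^ (1 / (1 - α)) = s * s ^ (α / (1 - α)) := by
  have h1 : 0 < 1 - α := by linarith [h.lt_one]
  rw [← Real.rpow_one_add' hs.le (by have := h.pos; positivity)]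
  congr 1; field_simp; ring

lemma EdgeFun.tendsto_deficit_zero (h : Regular ν α c₁) (hq : EdgeFun q Q) :
    Tendsto (deficit ν q) (𝓝[>] 0) (𝓝[>] 0) := by
  refine tendsto_nhdsWithin_iff.2 ⟨?_, ?_⟩
  · have : Tendsto (fun s : ℝ => s) (𝓝[>] 0) (𝓝 0) := nhdsWithin_le_nhds
    refine tendsto_of_tendsto_of_tendsto_of_le_of_le' (tendsto_const_nhds (x := (0 : ℝ))) this ?_ ?_
    · filter_upwards [eventually_unit] with s hs
      exact (mul_nonneg hs.1.le (theta_nonneg s)).trans (hq.le_deficit h hs.1 hs.2)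
    · filter_upwards [eventually_unit] with s hs
      exact hq.deficit_le h hs.1 hs.2
  · filter_upwards [eventually_unit] with s hs
    exact (mul_pos hs.1 (h.theta_pos hs.1 hs.2)).trans_le (hq.le_deficit h hs.1 hs.2)

/-- The scaled deficit converges if the scaled first moment of the edge functional does. -/
lemma EdgeFun.tendsto_deficit_div (h : Regular ν α c₁) (hq : EdgeFun q Q) {l y : ℝ}
    (hlim : Tendsto (fun s => (s - Q s) / s ^ (1 / (1 - α))) (𝓝[>] 0) (𝓝 l))
    (hy : c₁ ^ (1 / (1 - α)) ≤ y) (hyl : y - c₁ * y ^ α = l) :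
    Tendsto (fun s => deficit ν q s / s ^ (1 / (1 - α))) (𝓝[>] 0) (𝓝 y) := by
  have h1 : 0 < 1 - α := by linarith [h.lt_one]
  set w : ℝ → ℝ := fun s => deficit ν q s / s ^ (1 / (1 - α)) with hw
  set y₀ := c₁ ^ (1 / (1 - α)) with hy₀
  obtain ⟨K, hK, hev⟩ := h.exists_deficit_sub_le
  have hth := h.tendsto_theta_div
  have hlow : ∀ᶠ s in 𝓝[>] 0, theta ν s / s ^ (α / (1 - α)) ≤ w s := by
    filter_upwards [eventually_unit] with s hs
    have hp := rpow_pos_of_pos hs.1 (α / (1 - α))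
    rw [hw]
    dsimp only
    rw [h.exponent hs.1, ← mul_div_mul_left _ _ hs.1.ne']
    have := hq.le_deficit h hs.1 hs.2
    have := mul_pos hs.1 hp
    gcongr
  -- An a priori bound: the scaled deficit exceeds the scaled `sθ` by at most `K` times the scaled
  -- first moment.
  set B := y₀ + 1 + K * (l + 1) with hB
  have hup : ∀ᶠ s in 𝓝[>] 0, w s ≤ B := by
    filter_upwards [eventually_unit, hev, hth.eventually (gt_mem_nhds (lt_add_one y₀)),
      hlim.eventually (gt_mem_nhds (lt_add_one l))] with s hs hs1 hs2 hs3
    have hp := rpow_pos_of_pos hs.1 (1 / (1 - α))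
    have h2 := hs1 q Q hq
    have h3 : w s ≤ theta ν s / s ^ (α / (1 - α)) + K * ((s - Q s) / s ^ (1 / (1 - α))) := by
      rw [← mul_div_mul_left _ _ hs.1.ne', ← h.exponent hs.1, ← mul_div_assoc, ← add_div, hw]
      dsimp only
      gcongr
      linarith
    have h4 := mul_lt_mul_of_pos_left hs3 hK
    linarith
  have hnn : ∀ᶠ s in 𝓝[>] 0, 0 ≤ w s := by
    filter_upwards [eventually_unit, hlow] with s hs hs1
    exact (div_nonneg (theta_nonneg s) (rpow_nonneg hs.1.le _)).trans hs1
  have hg : Tendsto (fun s => Q s / s * (phi ν (deficit ν q s) / deficit ν q s ^ α)) (𝓝[>] 0)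
      (𝓝 c₁) := by
    have h2 : Tendsto (fun s : ℝ => s ^ (α / (1 - α))) (𝓝[>] 0) (𝓝 0) := by
      have hpos : 0 < α / (1 - α) := div_pos h.pos h1
      have := (Real.continuousAt_rpow_const 0 (α / (1 - α)) (Or.inr hpos.le)).tendsto
      rw [zero_rpow hpos.ne'] at this
      exact this.mono_left nhdsWithin_le_nhds
    have h3 : Tendsto (fun s => Q s / s) (𝓝[>] 0) (𝓝 1) := by
      have h4 := (tendsto_const_nhds (x := (1 : ℝ)) (f := 𝓝[>] (0 : ℝ))).sub (hlim.mul h2)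
      rw [mul_zero, sub_zero] at h4
      refine h4.congr' ?_
      filter_upwards [eventually_unit] with s hs
      have hp := rpow_pos_of_pos hs.1 (α / (1 - α))
      have := hs.1.ne'
      rw [h.exponent hs.1]
      field_simp
      ring
    have := h3.mul (h.asymp.comp (hq.tendsto_deficit_zero h))
    rwa [one_mul] at this
  -- Dividing the equation of the deficit by `s^(1/(1-α))` gives `w - (Q/s)(phi(ξ)/ξ^α) w^α =
  -- (s-Q)/s^(1/(1-α))`, whose coefficient tends to `c₁`.
  have hf : Tendsto (fun s => w s - c₁ * w s ^ α) (𝓝[>] 0) (𝓝 l) := by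
    have h2 : Tendsto (fun s => (Q s / s * (phi ν (deficit ν q s) / deficit ν q s ^ α) - c₁) *
        w s ^ α) (𝓝[>] 0) (𝓝 0) := by
      have h3 : Tendsto (fun s => Q s / s * (phi ν (deficit ν q s) / deficit ν q s ^ α) - c₁)
          (𝓝[>] 0) (𝓝 0) := by simpa using hg.sub_const c₁
      refine h3.zero_mul_isBoundedUnder_le ⟨B ^ α, ?_⟩
      rw [eventually_map]
      filter_upwards [hup, hnn] with s hs hs1
      simp only [Function.comp, Real.norm_eq_abs]
      rw [abs_of_nonneg (rpow_nonneg hs1 _)]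
      exact Real.rpow_le_rpow hs1 hs h.pos.le
    have h3 := hlim.add h2
    rw [add_zero] at h3
    refine h3.congr' ?_
    filter_upwards [eventually_unit] with s hs
    have hξ := (mul_pos hs.1 (h.theta_pos hs.1 hs.2)).trans_le (hq.le_deficit h hs.1 hs.2)
    have hp := rpow_pos_of_pos hs.1 (α / (1 - α))
    have hξα := rpow_pos_of_pos hξ α
    have heq := hq.deficit_eq h hs.1 hs.2
    have hwα : w s ^ α = deficit ν q s ^ α / s ^ (α / (1 - α)) := by
      rw [hw]
      dsimp only
      rw [div_rpow hξ.le (rpow_nonneg hs.1.le _), ← Real.rpow_mul hs.1.le]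
      congr 2; ring
    have hs0 := hs.1.ne'
    rw [sub_mul, hwα, hw]
    dsimp only
    rw [h.exponent hs.1]
    field_simp
    linear_combination (-1) * heq
  -- Every cluster point solves the limit equation and is at least `y₀`, thanks to the lower bound
  -- by `theta`; on that branch the solution is unique.
  refine isCompact_Icc.tendsto_nhds_of_unique_mapClusterPt (s := Icc 0 B)
    (by filter_upwards [hnn, hup] with s h1 h2 using ⟨h1, h2⟩) fun y' _ hcl => ?_
  have hy'0 : y₀ ≤ y' := by
    by_contra! hlt
    have h2 : ∀ᶠ s in 𝓝[>] 0, (y' + y₀) / 2 < w s := by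
      filter_upwards [hlow, hth.eventually (lt_mem_nhds (show (y' + y₀) / 2 < y₀ by linarith))]
        with s hs hs1 using hs1.trans_le hs
    have h3 := hcl.frequently (gt_mem_nhds (show y' < (y' + y₀) / 2 by linarith))
    obtain ⟨s, hs, hs1⟩ := (h3.and_eventually h2).exists
    exact lt_asymm hs hs1
  have hcont : Continuous fun w : ℝ => w - c₁ * w ^ α :=
    continuous_id.sub (continuous_const.mul (Real.continuous_rpow_const h.pos.le))
  have h2 : MapClusterPt (y' - c₁ * y' ^ α) (𝓝[>] (0 : ℝ)) fun s => w s - c₁ * w s ^ α :=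
    hcl.continuousAt_comp (f := fun w : ℝ => w - c₁ * w ^ α) hcont.continuousAt
  have h3 : y' - c₁ * y' ^ α = l := by
    have h5 : ClusterPt (y' - c₁ * y' ^ α) (𝓝 l) := ClusterPt.mono h2 hf
    exact eq_of_nhds_neBot h5
  exact (strictMonoOn_sub_rpow h.lt_one h.const_pos).injOn hy'0 hy (h3.trans hyl.symm)

/-- `dphi` is regularly varying of index `α - 1`, so the ratio tends to a power of the ratio of
scaled arguments. The limit depends on `q` through `l` alone, which is what lets edge weights be
compared with edge counts. -/
lemma Regular.exists_rate_limit (h : Regular ν α c₁) {l : ℝ} (hl : 0 ≤ l) :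
    ∃ L, 0 < L ∧ ∀ q Q, EdgeFun q Q →
      Tendsto (fun s => (s - Q s) / s ^ (1 / (1 - α))) (𝓝[>] 0) (𝓝 l) →
      Tendsto (fun s => dphi ν (deficit ν q s) / dphi ν (s * theta ν s)) (𝓝[>] 0) (𝓝 L) := by
  obtain ⟨y, hy, hyl⟩ := exists_sub_rpow_eq h.pos h.lt_one h.const_pos hl
  have hy0 : 0 < c₁ ^ (1 / (1 - α)) := rpow_pos_of_pos h.const_pos _
  have hypos := hy0.trans_le hy
  refine ⟨(y / c₁ ^ (1 / (1 - α))) ^ (α - 1), rpow_pos_of_pos (by positivity) _,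
    fun q Q hq hlim => ?_⟩
  have h1 := hq.tendsto_deficit_div h hlim hy hyl
  have h2 := ((h1.div h.tendsto_theta_div hy0.ne').rpow_const (p := α - 1)
    (Or.inl (div_pos hypos hy0).ne'))
  have hcα := (mul_pos h.const_pos h.pos).ne'
  have h3 := ((tendsto_mul_dphi_div h.asymp).comp (hq.tendsto_deficit_zero h)).div
    ((tendsto_mul_dphi_div h.asymp).comp h.tendsto_mul_theta) hcα
  rw [div_self hcα] at h3
  have h4 := h3.mul h2
  rw [one_mul] at h4
  refine h4.congr' ?_
  filter_upwards [eventually_unit] with s hs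
  have hθ := h.theta_pos hs.1 hs.2
  have hξ := (mul_pos hs.1 hθ).trans_le (hq.le_deficit h hs.1 hs.2)
  have e1 : deficit ν q s / s ^ (1 / (1 - α)) / (theta ν s / s ^ (α / (1 - α))) =
      deficit ν q s / (s * theta ν s) := by
    have := (rpow_pos_of_pos hs.1 (α / (1 - α))).ne'
    have := hs.1.ne'
    rw [h.exponent hs.1]
    field_simp
  simp only [Function.comp, Pi.div_apply]
  rw [e1, div_rpow hξ.le (mul_pos hs.1 hθ).le, Real.rpow_sub_one hξ.ne',
    Real.rpow_sub_one (mul_pos hs.1 hθ).ne']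
  have := rpow_pos_of_pos hξ α
  have := rpow_pos_of_pos (mul_pos hs.1 hθ) α
  have := hs.1.ne'
  by_cases hd : dphi ν (s * theta ν s) = 0
  · simp [hd]
  · field_simp

end

section

variable {ν : Measure ℕ} [IsProbabilityMeasure ν] {α c₁ s : ℝ} {q : ℝ → ℝ → ℝ≥0∞} {Q : ℝ → ℝ}

/-! ### The ratio of successive thresholds -/

lemma Regular.ae_R_pos (h : Regular ν α c₁) : ∀ᵐ η ∂law ν, 0 < R η := by
  have h0 := law_R_eq (ν := ν) h.zero h.two 0
  filter_upwards [measure_eq_zero_iff_ae_notMem.1 h0] with η hη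
  exact lt_of_le_of_ne (R_nonneg η) (Ne.symm hη)

/-- Layer cake for `(R/u)^κ` on `{R < u}`; the part with `t > 1` vanishes. -/
lemma Regular.lintegral_moment (h : Regular ν α c₁) {κ u : ℝ} (hκ : 0 < κ) (hu0 : 0 < u)
    (hu1 : u ≤ 1) : ∫⁻ η in {η | R η < u}, ofReal ((R η / u) ^ κ) ∂law ν =
      ofReal (theta ν u) * ∫⁻ t in Ioc (0 : ℝ) 1,
        ofReal (1 - theta ν (t * u) / theta ν u) * ofReal (κ * t ^ (κ - 1)) := by
  have hθ := h.theta_pos hu0 hu1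
  have h1 : ∀ x : ℝ, x ^ κ = ∫ t in (0 : ℝ)..x, κ * t ^ (κ - 1) := fun x => by
    rw [intervalIntegral.integral_const_mul, integral_rpow (Or.inl (by linarith)), sub_add_cancel,
      zero_rpow hκ.ne', sub_zero, mul_div_cancel₀ _ hκ.ne']
  have hf : Measurable fun η : Config => R η / u := measurable_R.div_const u
  simp_rw [h1]
  rw [lintegral_comp_eq_lintegral_meas_lt_mul _
    (Eventually.of_forall fun η => div_nonneg (R_nonneg η) hu0.le) hf.aemeasurable
    (fun t _ => (intervalIntegral.intervalIntegrable_rpow' (by linarith)).const_mul κ)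
    ((ae_restrict_mem measurableSet_Ioi).mono fun t ht =>
      mul_nonneg hκ.le (rpow_nonneg (le_of_lt ht) _)),
    ← lintegral_const_mul]
  swap
  · have hA : Measurable fun t => ofReal (1 - theta ν (t * u) / theta ν u) :=
      (measurable_const.sub ((measurable_theta.comp (measurable_id.mul_const u)).div_const
        _)).ennreal_ofReal
    have hB : Measurable fun t : ℝ => ofReal (κ * t ^ (κ - 1)) :=
      ((measurable_id.pow_const _).const_mul κ).ennreal_ofReal
    exact hA.mul hB
  have h2 : ∀ t, ((law ν).restrict {η | R η < u}) {η | t < R η / u} =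
      ofReal (theta ν u - theta ν (t * u)) := by
    intro t
    have hms : MeasurableSet {η | t < R η / u} := measurableSet_lt measurable_const hf
    have hset : {η | t < R η / u} ∩ {η | R η < u} = {η | R η < u} \ {η | R η ≤ t * u} := by
      ext η
      simp only [Set.mem_inter_iff, Set.mem_ofPred_eq, Set.mem_sdiff, not_le, lt_div_iff₀ hu0]
      tauto
    rw [Measure.restrict_apply hms, hset]
    rcases lt_or_ge t 1 with ht | ht
    · have hsub : {η | R η ≤ t * u} ⊆ {η | R η < u} := fun η h' =>
        lt_of_le_of_lt (α := ℝ) h' (by nlinarith)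
      rw [measure_sdiff hsub (measurableSet_R_le _).nullMeasurableSet (measure_ne_top _ _),
        real_R_lt h.zero h.two, ← ofReal_measureReal, ← ENNReal.ofReal_sub _ measureReal_nonneg]
      rfl
    · have hle : u ≤ t * u := by nlinarith
      rw [ENNReal.ofReal_of_nonpos (sub_nonpos.2 (theta_mono hle))]
      have : {η | R η < u} \ {η | R η ≤ t * u} = ∅ := Set.sdiff_eq_empty.2 fun η h' =>
        le_trans (le_of_lt (α := ℝ) h') hle
      rw [this, measure_empty]
  have h3 : ∀ t, ofReal (theta ν u - theta ν (t * u)) * ofReal (κ * t ^ (κ - 1)) =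
      ofReal (theta ν u) * (ofReal (1 - theta ν (t * u) / theta ν u) *
        ofReal (κ * t ^ (κ - 1))) := fun t => by
    rw [← mul_assoc, ← ofReal_mul hθ.le, mul_sub, mul_one, mul_div_cancel₀ _ hθ.ne']
  simp_rw [h2, h3]
  rw [← Set.Ioc_union_Ioi_eq_Ioi (zero_le_one (α := ℝ)), lintegral_union measurableSet_Ioi
    (Set.Ioc_disjoint_Ioi le_rfl)]
  have h4 : ∫⁻ t in Ioi (1 : ℝ), ofReal (theta ν u) *
      (ofReal (1 - theta ν (t * u) / theta ν u) * ofReal (κ * t ^ (κ - 1))) = 0 := by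
    rw [setLIntegral_congr_fun (g := fun _ => 0) measurableSet_Ioi, lintegral_zero]
    intro t ht
    have ht' : (1 : ℝ) < t := ht
    have hle : u ≤ t * u := by nlinarith
    dsimp only
    rw [ENNReal.ofReal_of_nonpos (p := 1 - theta ν (t * u) / theta ν u) (sub_nonpos.2
      ((one_le_div hθ).2 (theta_mono hle))), zero_mul, mul_zero]
  rw [h4, add_zero]

lemma Regular.tendsto_theta_ratio (h : Regular ν α c₁) {t : ℝ} (ht : 0 < t) :
    Tendsto (fun u => theta ν (t * u) / theta ν u) (𝓝[>] 0) (𝓝 (t ^ (α / (1 - α)))) := by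
  have h1 : Tendsto (fun x : ℝ => t * x) (𝓝[>] 0) (𝓝[>] 0) := by
    refine tendsto_nhdsWithin_iff.2 ⟨?_, ?_⟩
    · have : Continuous fun x : ℝ => t * x := by fun_prop
      simpa using (this.tendsto 0).mono_left (nhdsWithin_le_nhds (s := Ioi 0))
    · filter_upwards [self_mem_nhdsWithin] with x hx
      exact mul_pos ht hx
  have hy0 := (rpow_pos_of_pos h.const_pos (1 / (1 - α))).ne'
  have h2 := ((h.tendsto_theta_div.comp h1).div h.tendsto_theta_div hy0).mul_const
    (t ^ (α / (1 - α)))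
  rw [div_self hy0, one_mul] at h2
  refine h2.congr' ?_
  filter_upwards [eventually_unit] with s hs
  have := rpow_pos_of_pos hs.1 (α / (1 - α))
  have := rpow_pos_of_pos ht (α / (1 - α))
  have := h.theta_pos hs.1 hs.2
  simp only [Function.comp, Pi.div_apply]
  rw [Real.mul_rpow ht.le hs.1.le]
  field_simp

/-- This is the `κ`-th moment of a variable on `[0,1]` with distribution function `t^a`. -/
lemma lintegral_Ioc_rpow {a κ : ℝ} (ha : 0 < a) (hκ : 0 < κ) :
    ∫⁻ t in Ioc (0 : ℝ) 1, ofReal (1 - t ^ a) * ofReal (κ * t ^ (κ - 1)) =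
      ofReal (a / (a + κ)) := by
  have h1 : ∀ t ∈ Ioc (0 : ℝ) 1, ofReal (1 - t ^ a) * ofReal (κ * t ^ (κ - 1)) =
      ofReal (κ * t ^ (κ - 1) - κ * t ^ (a + κ - 1)) := by
    intro t ht
    rw [← ofReal_mul (sub_nonneg.2 (rpow_le_one ht.1.le ht.2 ha.le)),
      show a + κ - 1 = a + (κ - 1) by ring, Real.rpow_add ht.1]
    congr 1; ring
  have i1 : IntervalIntegrable (fun t : ℝ => κ * t ^ (κ - 1)) volume 0 1 :=
    (intervalIntegral.intervalIntegrable_rpow' (by linarith)).const_mul κ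
  have i2 : IntervalIntegrable (fun t : ℝ => κ * t ^ (a + κ - 1)) volume 0 1 :=
    (intervalIntegral.intervalIntegrable_rpow' (by linarith)).const_mul κ
  rw [setLIntegral_congr_fun measurableSet_Ioc h1, ← ofReal_integral_eq_lintegral_ofReal]
  · rw [← intervalIntegral.integral_of_le zero_le_one, intervalIntegral.integral_sub i1 i2,
      intervalIntegral.integral_const_mul, intervalIntegral.integral_const_mul,
      integral_rpow (Or.inl (by linarith)), integral_rpow (Or.inl (by linarith))]
    congr 1
    rw [sub_add_cancel, sub_add_cancel, Real.one_rpow, Real.one_rpow, zero_rpow hκ.ne',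
      zero_rpow (by positivity)]
    field_simp
    ring
  · exact (intervalIntegrable_iff_integrableOn_Ioc_of_le zero_le_one).1 (i1.sub i2)
  · refine (ae_restrict_mem measurableSet_Ioc).mono fun t ht => ?_
    have : t ^ (a + κ - 1) ≤ t ^ (κ - 1) :=
      Real.rpow_le_rpow_of_exponent_ge ht.1 ht.2 (by linarith)
    exact sub_nonneg.2 (mul_le_mul_of_nonneg_left this hκ.le)

/-- Given `R < u`, the ratio `R/u` has asymptotically the distribution function `t^(α/(1-α))`;
dominated convergence passes to its moments. The case `κ = 0` is exact and separate because the
layer-cake density degenerates. -/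
lemma Regular.eventually_moment (h : Regular ν α c₁) {κ ε : ℝ} (hκ : 0 ≤ κ) (hε : 0 < ε) :
    ∀ᶠ u in 𝓝[>] 0, ∫⁻ η in {η | R η < u}, ofReal ((R η / u) ^ κ) ∂law ν ≤
        ofReal (α / (1 - α) / (α / (1 - α) + κ) + ε) * ofReal (theta ν u) ∧
      ofReal (α / (1 - α) / (α / (1 - α) + κ) - ε) * ofReal (theta ν u) ≤
        ∫⁻ η in {η | R η < u}, ofReal ((R η / u) ^ κ) ∂law ν := by
  have ha : 0 < α / (1 - α) := div_pos h.pos (by linarith [h.lt_one])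
  set a := α / (1 - α)
  rcases hκ.eq_or_lt with rfl | hκ
  · refine Eventually.of_forall fun u => ?_
    simp only [Real.rpow_zero, ENNReal.ofReal_one, lintegral_one, Measure.restrict_apply_univ,
      real_R_lt h.zero h.two, add_zero, div_self ha.ne']
    constructor
    · refine le_mul_of_one_le_left (zero_le) ?_
      rw [ENNReal.one_le_ofReal]; linarith
    · refine mul_le_of_le_one_left (zero_le) ?_
      rw [ofReal_le_one]; linarith
  · have hlim : Tendsto (fun u => ∫⁻ t in Ioc (0 : ℝ) 1,
        ofReal (1 - theta ν (t * u) / theta ν u) * ofReal (κ * t ^ (κ - 1)))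
        (𝓝[>] 0) (𝓝 (ofReal (a / (a + κ)))) := by
      rw [← lintegral_Ioc_rpow ha hκ]
      refine tendsto_lintegral_filter_of_dominated_convergence
        (fun t => ofReal (κ * t ^ (κ - 1))) ?_ ?_ ?_ ?_
      · refine Eventually.of_forall fun u => ?_
        have hA : Measurable fun t => ofReal (1 - theta ν (t * u) / theta ν u) :=
          (measurable_const.sub ((measurable_theta.comp (measurable_id.mul_const u)).div_const
            _)).ennreal_ofReal
        have hB : Measurable fun t : ℝ => ofReal (κ * t ^ (κ - 1)) :=
          ((measurable_id.pow_const _).const_mul κ).ennreal_ofReal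
        exact hA.mul hB
      · refine Eventually.of_forall fun u => Eventually.of_forall fun t => ?_
        refine mul_le_of_le_one_left (zero_le) (ofReal_le_one.2 ?_)
        have := div_nonneg (theta_nonneg (ν := ν) (t * u)) (theta_nonneg (ν := ν) u)
        linarith
      · have i1 : IntervalIntegrable (fun t : ℝ => κ * t ^ (κ - 1)) volume 0 1 :=
          (intervalIntegral.intervalIntegrable_rpow' (by linarith)).const_mul κ
        rw [intervalIntegrable_iff_integrableOn_Ioc_of_le zero_le_one] at i1
        have := i1.lintegral_lt_top
        exact this.ne
      · filter_upwards [ae_restrict_mem measurableSet_Ioc] with t ht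
        refine ENNReal.Tendsto.mul_const ?_ (Or.inr ofReal_ne_top)
        exact ENNReal.tendsto_ofReal ((h.tendsto_theta_ratio ht.1).const_sub 1)
    have hn : 0 < a / (a + κ) := by positivity
    filter_upwards [hlim.eventually (gt_mem_nhds ((ENNReal.ofReal_lt_ofReal_iff
        (show 0 < a / (a + κ) + ε by positivity)).2 (lt_add_of_pos_right _ hε))),
      hlim.eventually (lt_mem_nhds ((ENNReal.ofReal_lt_ofReal_iff hn).2 (sub_lt_self _ hε))),
      eventually_unit] with u h1 h2 hu
    rw [h.lintegral_moment hκ hu.1 hu.2, mul_comm (ofReal (theta ν u))]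
    exact ⟨by gcongr, by gcongr⟩

lemma Regular.eventually_rate (h : Regular ν α c₁) {ε : ℝ} (hε : 0 < ε) :
    ∀ᶠ s in 𝓝[>] 0, ofReal s * rate ν unitq s ≤ ofReal (α + ε) ∧
      ofReal (α - ε) ≤ ofReal s * rate ν unitq s := by
  filter_upwards [h.tendsto_mul_dphi.eventually (gt_mem_nhds (show α < α + ε by linarith)),
    h.tendsto_mul_dphi.eventually (lt_mem_nhds (show α - ε < α by linarith)), eventually_unit]
    with s h1 h2 hs
  rw [h.rate_unitq hs.1 hs.2, ← ofReal_mul hs.1.le]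
  exact ⟨ofReal_le_ofReal h1.le, ofReal_le_ofReal h2.le⟩

lemma exists_level {p : ℝ → Prop} (h : ∀ᶠ s in 𝓝[>] (0 : ℝ), p s) :
    ∃ s₀, 0 < s₀ ∧ s₀ ≤ 1 ∧ ∀ s, 0 < s → s ≤ s₀ → p s := by
  obtain ⟨b, hb, hsub⟩ := mem_nhdsGT_iff_exists_Ioc_subset.1 h
  exact ⟨min b 1, lt_min hb one_pos, min_le_right _ _, fun s h0 h1 =>
    hsub ⟨h0, h1.trans (min_le_left _ _)⟩⟩

/-- The functional `Ψ` has the limiting mean `ℓ` given that the threshold is small. -/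
def Asymp (ν : Measure ℕ) (Ψ : Config → ℝ≥0∞) (ℓ : ℝ) : Prop :=
  ∀ ε, 0 < ε → ∃ s₀, 0 < s₀ ∧ ∀ g : ℝ → ℝ≥0∞, Measurable g → (∀ r, s₀ < r → g r = 0) →
    ∫⁻ η, g (R η) ∂law ν ≠ ∞ →
    ∫⁻ η, g (R η) * Ψ η ∂law ν ≤ ofReal (ℓ + ε) * ∫⁻ η, g (R η) ∂law ν ∧
    ofReal (ℓ - ε) * ∫⁻ η, g (R η) ∂law ν ≤ ∫⁻ η, g (R η) * Ψ η ∂law ν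

/-- The limiting moments of the ratio of successive thresholds. -/
def ratioMoment (α κ : ℝ) : ℝ := α + (1 - α) * (α / (1 - α) / (α / (1 - α) + κ))

lemma ofReal_rpow_div {x y κ : ℝ} (hx : 0 ≤ x) (hy : 0 ≤ y) :
    ofReal ((x / y) ^ κ) = ofReal (y ^ (-κ)) * ofReal (x ^ κ) := by
  rw [div_rpow hx hy, Real.rpow_neg hy, ← ofReal_mul (inv_nonneg.2
    (rpow_nonneg hy _)), div_eq_inv_mul]

/-- With limiting probability `α` the step keeps the threshold and the ratio is `1`; otherwise the
new threshold is a fresh one conditioned below the old. -/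
lemma Regular.asymp_ratio (h : Regular ν α c₁) {κ : ℝ} (hκ : 0 ≤ κ) :
    Asymp ν (fun η => ofReal ((R (next η) / R η) ^ κ)) (ratioMoment α κ) := by
  intro ε hε
  have ha : 0 < α / (1 - α) := div_pos h.pos (by linarith [h.lt_one])
  set a := α / (1 - α) with hadef
  set n := a / (a + κ) with hn
  have hn0 : 0 < n := by positivity
  have hn1 : n ≤ 1 := (div_le_one (by positivity)).2 (by linarith)
  obtain ⟨s₀, h0, h1, hs₀⟩ := exists_level ((h.eventually_moment hκ (half_pos hε)).and
    (h.eventually_rate (half_pos hε)))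
  refine ⟨s₀, h0, fun g hg hsupp hfin => ?_⟩
  set F : ℝ → ℝ≥0∞ := fun r => g r * ofReal (r ^ (-κ)) with hF
  have hFm : Measurable F := hg.mul (measurable_id.pow_const _).ennreal_ofReal
  have hFr : Measurable fun s => F s * rate ν unitq s := hFm.mul (measurable_rate measurable_unitq)
  have hgr : Measurable fun s => g s * rate ν unitq s := hg.mul (measurable_rate measurable_unitq)
  have hkm : Measurable fun r : ℝ => ofReal (r ^ κ) :=
    (measurable_id.pow_const _).ennreal_ofReal
  have hE := lintegral_next h.zero h.two hg (measurable_const (a := (1 : ℝ≥0∞)))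
  rw [lintegral_S_split hgr measurable_const] at hE
  have hy : ∀ u, ∫⁻ η in {η | R η < u}, (1 : ℝ≥0∞) ∂law ν = ofReal (theta ν u) := by
    intro u
    rw [setLIntegral_one, real_R_lt h.zero h.two]
  simp only [mul_one, hy] at hE
  set E := ∫⁻ η, g (R η) ∂law ν with hEdef
  set X := ∫⁻ η, ofReal (R η) * (g (R η) * rate ν unitq (R η)) ∂law ν with hX
  set Y := ∫⁻ u, g u * rate ν unitq u * ofReal (theta ν u) ∂unif with hY
  -- The power is split as `R^(-κ)`, absorbed into `g`, times the new threshold to the `κ`, absorbed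
  -- into the functional. `X` is the mass of the steps that keep the threshold, `Y` that of the
  -- others, so `E = X + Y`.
  have hT : ∫⁻ η, g (R η) * ofReal ((R (next η) / R η) ^ κ) ∂law ν =
      X + ∫⁻ u, g u * rate ν unitq u *
        ∫⁻ η in {η | R η < u}, ofReal ((R η / u) ^ κ) ∂law ν ∂unif := by
    have e1 : ∀ η, g (R η) * ofReal ((R (next η) / R η) ^ κ) =
        F (R η) * ofReal (R (next η) ^ κ) := fun η => by
      rw [ofReal_rpow_div (R_nonneg _) (R_nonneg _), hF, mul_assoc]
    simp_rw [e1]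
    rw [lintegral_next (K := fun η => ofReal (R η ^ κ)) h.zero h.two hFm
      (hkm.comp measurable_R), lintegral_S_split hFr hkm]
    congr 1
    · refine lintegral_congr_ae ?_
      filter_upwards [h.ae_R_pos] with η hη
      have : ofReal (R η ^ (-κ)) * ofReal (R η ^ κ) = 1 := by
        rw [← ofReal_rpow_div hη.le hη.le, div_self hη.ne', Real.one_rpow, ENNReal.ofReal_one]
      calc _ = ofReal (R η) * (g (R η) * rate ν unitq (R η)) *
            (ofReal (R η ^ (-κ)) * ofReal (R η ^ κ)) := by rw [hF]; ring
        _ = _ := by rw [this, mul_one]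
    · have hunif : ∀ᵐ u ∂unif, u ∈ Icc (0 : ℝ) 1 := ae_restrict_mem measurableSet_Icc
      refine lintegral_congr_ae ?_
      filter_upwards [hunif] with u hu
      simp_rw [ofReal_rpow_div (R_nonneg _) hu.1]
      have hkR : Measurable fun η => ofReal (R η ^ κ) := hkm.comp measurable_R
      rw [lintegral_const_mul _ hkR, hF]
      ring
  have hX1 : X ≤ ofReal (α + ε / 2) * E := by
    have hgR : Measurable fun η => g (R η) := hg.comp measurable_R
    rw [hX, hEdef, ← lintegral_const_mul _ hgR]
    refine lintegral_mono_ae ?_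
    filter_upwards [h.ae_R_pos] with η hη
    rcases le_or_gt (R η) s₀ with hle | hgt
    · calc _ = ofReal (R η) * rate ν unitq (R η) * g (R η) := by ring
        _ ≤ _ := by gcongr; exact (hs₀ _ hη hle).2.1
    · simp [hsupp _ hgt]
  have hX2 : ofReal (α - ε / 2) * E ≤ X := by
    have hgR : Measurable fun η => g (R η) := hg.comp measurable_R
    rw [hX, hEdef, ← lintegral_const_mul _ hgR]
    refine lintegral_mono_ae ?_
    filter_upwards [h.ae_R_pos] with η hη
    rcases le_or_gt (R η) s₀ with hle | hgt
    · calc _ ≤ ofReal (R η) * rate ν unitq (R η) * g (R η) := by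
            gcongr; exact (hs₀ _ hη hle).2.2
        _ = _ := by ring
    · simp [hsupp _ hgt]
  have hupos : ∀ᵐ u ∂unif, 0 < u := by
    have h1 : ∀ᵐ u ∂unif, u ∈ Icc (0 : ℝ) 1 := ae_restrict_mem measurableSet_Icc
    have h2 : ∀ᵐ u ∂unif, u ≠ 0 := measure_eq_zero_iff_ae_notMem.1 (unif_singleton 0)
    filter_upwards [h1, h2] with u h1 h2 using lt_of_le_of_ne h1.1 h2.symm
  have hYm : Measurable fun u => g u * rate ν unitq u * ofReal (theta ν u) :=
    hgr.mul measurable_theta.ennreal_ofReal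
  have hN1 : ∫⁻ u, g u * rate ν unitq u *
      ∫⁻ η in {η | R η < u}, ofReal ((R η / u) ^ κ) ∂law ν ∂unif ≤
      ofReal (n + ε / 2) * Y := by
    rw [hY, ← lintegral_const_mul _ hYm]
    refine lintegral_mono_ae ?_
    filter_upwards [hupos] with u hu
    rcases le_or_gt u s₀ with hle | hgt
    · calc _ ≤ g u * rate ν unitq u * (ofReal (n + ε / 2) * ofReal (theta ν u)) := by
            gcongr; exact (hs₀ _ hu hle).1.1
        _ = _ := by ring
    · simp [hsupp _ hgt]
  have hN2 : ofReal (n - ε / 2) * Y ≤ ∫⁻ u, g u * rate ν unitq u *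
      ∫⁻ η in {η | R η < u}, ofReal ((R η / u) ^ κ) ∂law ν ∂unif := by
    rw [hY, ← lintegral_const_mul _ hYm]
    refine lintegral_mono_ae ?_
    filter_upwards [hupos] with u hu
    rcases le_or_gt u s₀ with hle | hgt
    · calc _ = g u * rate ν unitq u * (ofReal (n - ε / 2) * ofReal (theta ν u)) := by
            ring
        _ ≤ _ := by gcongr; exact (hs₀ _ hu hle).1.2
    · simp [hsupp _ hgt]
  rw [hT]
  have hXf : X ≠ ∞ := fun h => hfin (by rw [hE, h, top_add])
  have hYf : Y ≠ ∞ := fun h => hfin (by rw [hE, h, add_top])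
  have hX0 := ENNReal.toReal_nonneg (a := X)
  have hY0 := ENNReal.toReal_nonneg (a := Y)
  rw [hE, ← ofReal_toReal hXf, ← ofReal_toReal hYf] at hX1 hX2
  rw [← ofReal_toReal hYf] at hN1 hN2
  rw [hE, ← ofReal_toReal hXf, ← ofReal_toReal hYf]
  set x := X.toReal
  set y := Y.toReal
  have hα := h.pos
  rw [← ofReal_add hX0 hY0, ← ofReal_mul (by positivity),
    ENNReal.ofReal_le_ofReal_iff (by positivity)] at hX1
  rw [← ofReal_add hX0 hY0, ← ENNReal.ofReal_mul' (by positivity),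
    ENNReal.ofReal_le_ofReal_iff hX0] at hX2
  have hm : ratioMoment α κ = α + (1 - α) * n := rfl
  have h1α := h.lt_one
  rw [← ofReal_add hX0 hY0]
  constructor
  · refine (add_le_add_right hN1 _).trans ?_
    rw [← ofReal_mul (by positivity), ← ofReal_add hX0 (by positivity),
      ← ofReal_mul (by rw [hm]; nlinarith)]
    refine ofReal_le_ofReal ?_
    rw [hm]
    have := mul_nonneg (sub_nonneg.2 hn1) (sub_nonneg.2 hX1)
    have := mul_nonneg hn0.le (mul_nonneg hε.le (add_nonneg hX0 hY0))
    nlinarith [mul_nonneg hε.le hX0]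
  · refine le_trans ?_ (add_le_add_right hN2 _)
    rw [← ENNReal.ofReal_mul' hY0, ← ENNReal.ofReal_mul' (add_nonneg hX0 hY0)]
    refine le_trans (ofReal_le_ofReal ?_) ENNReal.ofReal_add_le
    rw [hm]
    have := mul_nonneg (sub_nonneg.2 hn1) (sub_nonneg.2 hX2)
    have := mul_nonneg hn0.le (mul_nonneg hε.le (add_nonneg hX0 hY0))
    nlinarith [mul_nonneg hε.le hX0]

end

section

variable {ν : Measure ℕ} [IsProbabilityMeasure ν] {α c₁ s : ℝ} {q : ℝ → ℝ → ℝ≥0∞} {Q : ℝ → ℝ}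

/-! ### Geometric decay of the thresholds, and summable cluster weights -/

/-- Bounds the mean of `1 - bushProd q` from above by the relative change of the rate, which is
controlled by the first moment. It holds for any density `g` of small thresholds. -/
lemma Regular.exists_lintegral_le (h : Regular ν α c₁) : ∃ K, 0 < K ∧ ∃ s₀, 0 < s₀ ∧ s₀ ≤ 1 ∧
    ∀ q Q, EdgeFun q Q → Measurable Q → ∀ g : ℝ → ℝ≥0∞, Measurable g → (∀ r, s₀ < r → g r = 0) →
    ∫⁻ η, g (R η) ∂law ν ≤ ∫⁻ η, g (R η) * bushProd q η ∂law ν + ∫⁻ η, g (R η) *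
      ofReal (K * ((R η - Q (R η)) / R η ^ (1 / (1 - α)))) ∂law ν := by
  obtain ⟨K, hK, hev⟩ := h.exists_rate_le
  obtain ⟨s₀, h0, h1, hs₀⟩ := exists_level hev
  refine ⟨K, hK, s₀, h0, h1, fun q Q hq hQ g hg hsupp => ?_⟩
  have hkm : Measurable fun r : ℝ => ofReal (K * ((r - Q r) / r ^ (1 / (1 - α)))) :=
    (((measurable_id.sub hQ).div (measurable_id.pow_const _)).const_mul K).ennreal_ofReal
  have hgk : Measurable fun r => g r *
    ofReal (K * ((r - Q r) / r ^ (1 / (1 - α)))) := hg.mul hkm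
  have e1 := lintegral_next h.zero h.two hg (measurable_const (a := (1 : ℝ≥0∞)))
  have e2 := lintegral_next h.zero h.two hgk (measurable_const (a := (1 : ℝ≥0∞)))
  have e3 := lintegral_step h.zero hq.meas hg (measurable_const (a := (1 : ℝ≥0∞)))
  simp only [mul_one] at e1 e2 e3
  rw [e1, e2, e3, ← lintegral_add_left]
  · refine lintegral_mono_ae ?_
    filter_upwards [h.ae_R_pos] with η hη
    rcases le_or_gt (S η) s₀ with hle | hgt
    · have := hs₀ (S η) (hη.trans_le (R_le_S η)) hle q Q hq
      rw [rate] at this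
      calc _ ≤ g (S η) * (pgfDeriv ν (facMean ν q (S η)) + _) := by gcongr; exact this
        _ = _ := by rw [mul_add, ← mul_assoc]; rfl
    · simp [hsupp _ hgt]
  · have : Measurable fun s => g s * rate ν q s := hg.mul (measurable_rate hq.meas)
    exact this.comp measurable_S

lemma ratioMoment_lt_one (h : Regular ν α c₁) {κ : ℝ} (hκ : 0 < κ) : ratioMoment α κ < 1 := by
  have h1 : 0 < 1 - α := by linarith [h.lt_one]
  have ha : 0 < α / (1 - α) := div_pos h.pos h1
  have : α / (1 - α) / (α / (1 - α) + κ) < 1 := (div_lt_one (by positivity)).2 (by linarith)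
  rw [ratioMoment]
  nlinarith

lemma ratioMoment_pos (h : Regular ν α c₁) {κ : ℝ} (hκ : 0 ≤ κ) : 0 < ratioMoment α κ := by
  have h1 : 0 < 1 - α := by linarith [h.lt_one]
  have ha : 0 < α / (1 - α) := div_pos h.pos h1
  have := h.pos
  rw [ratioMoment]
  positivity

/-- Each step multiplies the `κ`-th moment by nearly `ratioMoment α κ < 1`. The induction closes
since a density supported on small thresholds stays so. -/
lemma Regular.exists_contraction (h : Regular ν α c₁) {κ : ℝ} (hκ : 0 < κ) :
    ∃ ρ, 0 < ρ ∧ ρ < 1 ∧ ∃ s₀, 0 < s₀ ∧ ∀ g : ℝ → ℝ≥0∞, Measurable g → (∀ r, s₀ < r → g r = 0) →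
      ∫⁻ η, g (R η) * ofReal (R η ^ κ) ∂law ν ≠ ∞ → ∀ n,
      ∫⁻ η, g (R η) * ofReal (R (next^[n] η) ^ κ) ∂law ν ≤
        ofReal ρ ^ n * ∫⁻ η, g (R η) * ofReal (R η ^ κ) ∂law ν := by
  have hm1 := ratioMoment_lt_one h hκ
  have hm0 := ratioMoment_pos h hκ.le
  obtain ⟨s₀, h0, hs₀⟩ := h.asymp_ratio hκ.le ((1 - ratioMoment α κ) / 2) (by linarith)
  refine ⟨ratioMoment α κ + (1 - ratioMoment α κ) / 2, by linarith, by linarith, s₀, h0,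
    fun g hg hsupp hfin n => ?_⟩
  have hkm : Measurable fun r : ℝ => ofReal (r ^ κ) :=
    (measurable_id.pow_const _).ennreal_ofReal
  induction n with
  | zero => simp
  | succ n ih =>
    have hd : Measurable fun r => dens ν n g r * ofReal (r ^ κ) :=
      (measurable_dens n hg).mul hkm
    have hsp : ∀ r, s₀ < r → dens ν n g r * ofReal (r ^ κ) = 0 := fun r hr => by
      rw [dens_eq_zero n hsupp r hr, zero_mul]
    have e1 := lintegral_dens h.zero h.two n hg (K := fun η => ofReal (R η ^ κ))
      (hkm.comp measurable_R) (rootFree_R.comp_left fun r => ofReal (r ^ κ))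
    have e2 := lintegral_dens h.zero h.two n hg (K := fun η => ofReal (R (next η) ^ κ))
      (hkm.comp (measurable_R.comp measurable_next))
      (RootFree.comp_next fun η => ofReal (R η ^ κ))
    have hf : ∫⁻ η, dens ν n g (R η) * ofReal (R η ^ κ) ∂law ν ≠ ∞ := by
      rw [← e1]
      exact ne_top_of_le_ne_top (ENNReal.mul_ne_top (by simp) hfin) ih
    have := (hs₀ _ hd hsp hf).1
    simp_rw [iterate_succ_apply']
    rw [e2]
    calc _ = ∫⁻ η, dens ν n g (R η) * ofReal (R η ^ κ) *
            ofReal ((R (next η) / R η) ^ κ) ∂law ν := by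
          refine lintegral_congr_ae ?_
          filter_upwards [h.ae_R_pos] with η hη
          rw [mul_assoc, ← ofReal_mul (rpow_nonneg hη.le _), ← Real.mul_rpow hη.le
            (div_nonneg (R_nonneg _) hη.le), mul_div_cancel₀ _ hη.ne']
      _ ≤ _ := this
      _ ≤ _ := by
          rw [← e1, pow_succ', mul_assoc]
          gcongr

lemma Regular.criticalProb_eq (h : Regular ν α c₁) : criticalProb ν = 0 := by
  have h0 : 0 ≤ criticalProb ν := inv_nonneg.2 (integral_nonneg fun n => n.cast_nonneg)
  have h1 := criticalProb_le_one (ν := ν) h.zero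
  by_contra hne
  exact (h.theta_pos (lt_of_le_of_ne h0 (Ne.symm hne)) h1).ne' (theta_criticalProb h.zero h.two h1)

/-- A property that holds once the threshold is small enough holds along the backbone from some
vertex on. -/
lemma Regular.ae_exists_iterate (h : Regular ν α c₁) {s₀ : ℝ} (h0 : 0 < s₀) {p : Config → Prop}
    (hp : ∀ᵐ η ∂law ν, R η ≤ s₀ → p η) : ∀ᵐ η ∂law ν, ∃ n, p (next^[n] η) := by
  have h1 : ∀ᵐ η ∂law ν, ∀ n, R (next^[n] η) ≤ s₀ → p (next^[n] η) :=
    ae_all_iff.2 fun n => ae_iterate h.zero h.two hp n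
  filter_upwards [h1, tendsto_R_iterate h.zero h.two] with η h1 h2
  rw [h.criticalProb_eq] at h2
  obtain ⟨n, hn⟩ := (h2.eventually (gt_mem_nhds h0)).exists
  exact ⟨n, h1 n hn.le⟩

lemma lintegral_indicator_R_ne_top (s₀ : ℝ) :
    ∫⁻ η, (Iic s₀).indicator 1 (R η) ∂law ν ≠ ∞ := by
  refine ne_top_of_le_ne_top ENNReal.one_ne_top ?_
  have : ∫⁻ _, (1 : ℝ≥0∞) ∂law ν = 1 := by simp
  rw [← this]
  exact lintegral_mono fun η => Set.indicator_le_self' (f := (1 : ℝ → ℝ≥0∞)) (fun _ _ => zero_le) _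

lemma summable_of_tsum_lintegral_ne_top {f : ℕ → Config → ℝ} {s₀ : ℝ}
    (hf : ∀ n, Measurable (f n)) (hf0 : ∀ᵐ η ∂law ν, ∀ n, 0 ≤ f n η)
    (hsum : ∑' n, ∫⁻ η, (Iic s₀).indicator 1 (R η) * ofReal (f n η) ∂law ν ≠ ∞) :
    ∀ᵐ η ∂law ν, R η ≤ s₀ → Summable fun n => f n η := by
  have hm : Measurable fun η => (Iic s₀).indicator (1 : ℝ → ℝ≥0∞) (R η) :=
    (measurable_one.indicator measurableSet_Iic).comp measurable_R
  have hmf : ∀ n, Measurable fun η => (Iic s₀).indicator (1 : ℝ → ℝ≥0∞) (R η) *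
      ofReal (f n η) := fun n => hm.mul (hf n).ennreal_ofReal
  rw [← lintegral_tsum fun n => (hmf n).aemeasurable] at hsum
  filter_upwards [ae_lt_top (Measurable.tsum hmf) hsum,
    hf0] with η h1 h2 hη
  simp only [Set.indicator_of_mem (Set.mem_Iic.2 hη), Pi.one_apply, one_mul] at h1
  have := ENNReal.summable_toReal h1.ne
  simpa only [ENNReal.toReal_ofReal (h2 _)] using this

/-- Summable means on the event of a small initial threshold; since thresholds tend to zero, the
event occurs from some backbone vertex on. -/
lemma Regular.ae_summable_rpow (h : Regular ν α c₁) {κ : ℝ} (hκ : 0 < κ) :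
    ∀ᵐ η ∂law ν, Summable fun n => R (next^[n] η) ^ κ := by
  obtain ⟨ρ, hρ0, hρ1, s₀, h0, hs₀⟩ := h.exists_contraction hκ
  have hg : Measurable ((Iic s₀).indicator (1 : ℝ → ℝ≥0∞)) :=
    measurable_one.indicator measurableSet_Iic
  have hsupp : ∀ r, s₀ < r → (Iic s₀).indicator (1 : ℝ → ℝ≥0∞) r = 0 := fun r hr =>
    Set.indicator_of_notMem (by simpa using hr) _
  have hfin : ∫⁻ η, (Iic s₀).indicator 1 (R η) * ofReal (R η ^ κ) ∂law ν ≠ ∞ :=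
    ne_top_of_le_ne_top (lintegral_indicator_R_ne_top (ν := ν) s₀) (lintegral_mono fun η =>
      mul_le_of_le_one_right (zero_le) (ofReal_le_one.2
        (rpow_le_one (R_nonneg _) (R_le_one _) hκ.le)))
  have key := summable_of_tsum_lintegral_ne_top (ν := ν) (s₀ := s₀)
    (f := fun n η => R (next^[n] η) ^ κ)
    (fun n => (measurable_R.comp (measurable_iterate_next n)).pow_const _)
    (Eventually.of_forall fun η n => rpow_nonneg (R_nonneg _) _) (by
      refine ne_top_of_le_ne_top ?_ (ENNReal.tsum_le_tsum (hs₀ _ hg hsupp hfin))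
      rw [ENNReal.tsum_mul_right, ENNReal.tsum_geometric]
      refine ENNReal.mul_ne_top (ENNReal.inv_ne_top.2 (tsub_pos_of_lt ?_).ne') hfin
      exact ENNReal.ofReal_lt_one.2 hρ1)
  filter_upwards [h.ae_exists_iterate h0 key] with η ⟨n, hn⟩
  exact (summable_nat_add_iff (f := fun i => R (next^[i] η) ^ κ) n).1
    (hn.congr fun i => by rw [Function.iterate_add_apply])

/-- The edge functional that yields the exponential moments of the total weight. -/
lemma edgeFun_exp {A : ℝ → ℝ} (hA : Measurable A) (hA0 : ∀ s, 0 < s → s ≤ 1 → 0 < A s) :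
    EdgeFun (fun s u => ofReal (exp (-A s * u)))
      (fun s => (1 - exp (-(A s * s))) / A s) := by
  have hint : ∀ s, 0 < s → s ≤ 1 → ∫ u in (0 : ℝ)..s, exp (-A s * u) =
      (1 - exp (-(A s * s))) / A s := fun s h0 h1 => by
    have hne := (hA0 s h0 h1).ne'
    have hd : ∀ u ∈ Set.uIcc 0 s, HasDerivAt (fun u => -exp (-A s * u) / A s)
        (exp (-A s * u)) u := fun u _ => by
      refine (((((hasDerivAt_id u).const_mul (-A s)).exp).neg).div_const (A s)).congr_deriv ?_
      simp only [id]
      field_simp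
    rw [intervalIntegral.integral_eq_sub_of_hasDerivAt hd
      (Continuous.intervalIntegrable (by fun_prop) _ _), mul_zero, Real.exp_zero, neg_mul]
    ring
  have h01 : ∀ s, 0 < s → s ≤ 1 → 0 ≤ (1 - exp (-(A s * s))) / A s := fun s h0 h1 => by
    have hp := hA0 s h0 h1
    have : exp (-(A s * s)) ≤ 1 := exp_le_one_iff.2 (by nlinarith)
    exact div_nonneg (by linarith) hp.le
  refine ⟨?_, fun s h0 h1 => ?_, h01, fun s h0 h1 => ?_⟩
  · exact (measurable_exp.comp (((hA.comp measurable_fst).neg).mul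
      measurable_snd)).ennreal_ofReal
  · rw [← ofReal_integral_eq_lintegral_ofReal, integral_Icc_eq_integral_Ioc,
      ← intervalIntegral.integral_of_le h0.le, hint s h0 h1]
    · exact (Continuous.integrableOn_Icc (by fun_prop))
    · exact Eventually.of_forall fun u => (exp_pos _).le
  · have hp := hA0 s h0 h1
    rw [div_le_iff₀ hp]
    linarith [Real.add_one_le_exp (-(A s * s))]

lemma measurable_edgeFun_exp {A : ℝ → ℝ} (hA : Measurable A) :
    Measurable fun s => (1 - exp (-(A s * s))) / A s :=
  ((measurable_exp.comp (hA.mul measurable_id).neg).const_sub 1).div hA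

lemma exp_neg_le {x : ℝ} (hx : 0 ≤ x) : exp (-x) ≤ 1 - x + x ^ 2 / 2 := by
  have h := Real.quadratic_le_exp_of_nonneg hx
  rw [Real.exp_neg, inv_le_comm₀ (exp_pos x) (by nlinarith [sq_nonneg (x - 1)])]
  refine le_trans ?_ h
  rw [inv_le_comm₀ (by nlinarith [sq_nonneg (x - 1)]) (by positivity),
    inv_le_iff_one_le_mul₀ (by positivity)]
  nlinarith [sq_nonneg (x ^ 2)]

lemma sub_edgeFun_exp_le {a s : ℝ} (ha : 0 < a) (hs : 0 ≤ s) :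
    s - (1 - exp (-(a * s))) / a ≤ a * s ^ 2 / 2 := by
  have h := exp_neg_le (mul_nonneg ha.le hs)
  rw [sub_le_iff_le_add, ← sub_le_iff_le_add', le_div_iff₀ ha]
  nlinarith

/-- Only a subtraction, but in `ℝ≥0∞` it needs the finiteness of the cancelled term. -/
lemma lintegral_one_sub_exp_le {g : ℝ → ℝ≥0∞} {Y : Config → ℝ} {k : Config → ℝ≥0∞}
    (hg : Measurable g) (hY : Measurable Y) (hY0 : ∀ᵐ η ∂law ν, 0 ≤ Y η)
    (hfin : ∫⁻ η, g (R η) ∂law ν ≠ ∞)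
    (h : ∫⁻ η, g (R η) ∂law ν ≤ ∫⁻ η, g (R η) * ofReal (exp (-Y η)) ∂law ν +
      ∫⁻ η, g (R η) * k η ∂law ν) :
    ∫⁻ η, g (R η) * ofReal (1 - exp (-Y η)) ∂law ν ≤
      ∫⁻ η, g (R η) * k η ∂law ν := by
  have hgY : Measurable fun η => g (R η) * ofReal (exp (-Y η)) :=
    (hg.comp measurable_R).mul (measurable_exp.comp hY.neg).ennreal_ofReal
  have hsplit : ∫⁻ η, g (R η) ∂law ν =
      ∫⁻ η, g (R η) * ofReal (exp (-Y η)) ∂law ν +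
      ∫⁻ η, g (R η) * ofReal (1 - exp (-Y η)) ∂law ν := by
    rw [← lintegral_add_left hgY]
    refine lintegral_congr_ae ?_
    filter_upwards [hY0] with η hη
    rw [← mul_add, ← ofReal_add (exp_pos _).le (sub_nonneg.2
      (exp_le_one_iff.2 (by linarith)))]
    simp
  have hA : ∫⁻ η, g (R η) * ofReal (exp (-Y η)) ∂law ν ≠ ∞ := by
    refine ne_top_of_le_ne_top hfin ?_
    rw [hsplit]; exact le_self_add
  refine (ENNReal.add_le_add_iff_left hA).1 ?_
  rw [← hsplit]
  exact h

lemma Regular.ae_summable_bw (h : Regular ν α c₁) (hα : α < 1 / 2) :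
    ∀ᵐ η ∂law ν, Summable fun n => bw (next^[n] η) := by
  have h1α : 0 < 1 - α := by linarith
  -- For the weight functional `s - Q s ≤ s²/2`, and `2 - 1/(1-α)` equals this `κ`. It is positive
  -- exactly when `α < 1/2`.
  set κ : ℝ := 1 - α / (1 - α) with hκdef
  have hκ : 0 < κ := by rw [hκdef, sub_pos, div_lt_one h1α]; linarith
  obtain ⟨ρ, hρ0, hρ1, s₁, hs1, hcon⟩ := h.exists_contraction hκ
  obtain ⟨K, hK, s₂, hs2, hs2', hle⟩ := h.exists_lintegral_le
  have hq := edgeFun_exp (A := fun _ => 1) measurable_const (fun _ _ _ => one_pos)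
  have hQ := measurable_edgeFun_exp (A := fun _ => 1) measurable_const
  set s₀ := min s₁ s₂
  set g := (Iic s₀).indicator (1 : ℝ → ℝ≥0∞) with hgdef
  have hg : Measurable g := measurable_one.indicator measurableSet_Iic
  have hsupp : ∀ r, s₀ < r → g r = 0 := fun r hr =>
    Set.indicator_of_notMem (by simpa using hr) _
  have hfin := lintegral_indicator_R_ne_top (ν := ν) s₀
  have hfin2 : ∫⁻ η, g (R η) * ofReal (R η ^ κ) ∂law ν ≠ ∞ :=
    ne_top_of_le_ne_top hfin (lintegral_mono fun η =>
      mul_le_of_le_one_right (zero_le) (ofReal_le_one.2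
        (rpow_le_one (R_nonneg _) (R_le_one _) hκ.le)))
  have hkm : Measurable fun r : ℝ => ofReal (r ^ κ) :=
    (measurable_id.pow_const _).ennreal_ofReal
  have hnt : ∀ᵐ η ∂law ν, ∀ n, NoTie (next^[n] η) := ae_all_iff.2 fun n =>
    ae_iterate h.zero h.two (ae_noTie h.zero h.two) n
  have hem : Measurable fun η => ofReal (1 - exp (-bw η)) :=
    ((measurable_exp.comp measurable_bw.neg).const_sub 1).ennreal_ofReal
  have hbound : ∀ n, ∫⁻ η, g (R η) * ofReal (1 - exp (-bw (next^[n] η))) ∂law ν ≤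
      ofReal K * (ofReal ρ ^ n *
        ∫⁻ η, g (R η) * ofReal (R η ^ κ) ∂law ν) := by
    intro n
    have hd := measurable_dens (ν := ν) n hg
    have e1 := lintegral_dens h.zero h.two n hg (K := fun η => ofReal (R η ^ κ))
      (hkm.comp measurable_R) (rootFree_R.comp_left fun r => ofReal (r ^ κ))
    have e0 := lintegral_dens h.zero h.two n hg (K := fun η => 1) measurable_const (fun _ => rfl)
    have e2 := lintegral_dens h.zero h.two n hg
      (K := fun η => ofReal (1 - exp (-bw η))) hem
      (rootFree_bw.comp_left fun x => ofReal (1 - exp (-x)))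
    simp only [mul_one] at e0
    have h1 := hle _ _ hq hQ _ hd fun r hr => dens_eq_zero n hsupp r ((min_le_right _ _).trans_lt hr)
    have hfin' : ∫⁻ η, dens ν n g (R η) ∂law ν ≠ ∞ := by rw [← e0]; exact hfin
    have hbp : ∀ᵐ η ∂law ν, bushProd (fun _ u => ofReal (exp (-1 * u))) η =
        ofReal (exp (-bw η)) := by
      filter_upwards [ae_noTie h.zero h.two] with η hη
      have := bushProd_exp' hη (fun _ => -1) (fun _ => 0)
      simpa using this
    have hb0 : ∀ᵐ η ∂law ν, 0 ≤ bw η := by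
      filter_upwards [ae_noTie h.zero h.two] with η hη using bw_nonneg hη
    have h2 : ∫⁻ η, dens ν n g (R η) * ofReal (1 - exp (-bw η)) ∂law ν ≤
        ∫⁻ η, dens ν n g (R η) * ofReal (K * R η ^ κ) ∂law ν := by
      refine lintegral_one_sub_exp_le hd measurable_bw hb0 hfin' ?_
      refine h1.trans (add_le_add (lintegral_mono_ae ?_) (lintegral_mono_ae ?_))
      · filter_upwards [hbp] with η hη
        rw [hη]
      · filter_upwards [h.ae_R_pos] with η hη
        gcongr
        have hk := sub_edgeFun_exp_le one_pos hη.le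
        have hp := rpow_pos_of_pos hη (1 / (1 - α))
        rw [div_le_iff₀ hp, h.exponent hη, hκdef]
        have : R η ^ (1 - α / (1 - α)) * (R η * R η ^ (α / (1 - α))) = R η ^ 2 := by
          rw [mul_left_comm, ← Real.rpow_add hη, sub_add_cancel, Real.rpow_one, sq]
        rw [this]
        nlinarith [sq_nonneg (R η)]
    rw [e2]
    refine h2.trans ?_
    have h3 := hcon g hg (fun r hr => hsupp r ((min_le_left _ _).trans_lt hr)) hfin2 n
    rw [e1] at h3
    calc _ = ofReal K * ∫⁻ η, dens ν n g (R η) * ofReal (R η ^ κ) ∂law ν := by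
          have hm : Measurable fun η => dens ν n g (R η) * ofReal (R η ^ κ) :=
            (hd.mul hkm).comp measurable_R
          rw [← lintegral_const_mul _ hm]
          exact lintegral_congr fun η => by rw [ofReal_mul hK.le]; ring
      _ ≤ _ := by gcongr
  have key := summable_of_tsum_lintegral_ne_top (ν := ν) (s₀ := s₀)
    (f := fun n η => 1 - exp (-bw (next^[n] η)))
    (fun n => (measurable_exp.comp
      (measurable_bw.comp (measurable_iterate_next n)).neg).const_sub 1)
    (by
      filter_upwards [hnt] with η hη n
      exact sub_nonneg.2 (exp_le_one_iff.2 (by linarith [bw_nonneg (hη n)]))) (by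
      refine ne_top_of_le_ne_top ?_ (ENNReal.tsum_le_tsum hbound)
      rw [ENNReal.tsum_mul_left, ENNReal.tsum_mul_right, ENNReal.tsum_geometric]
      refine ENNReal.mul_ne_top ofReal_ne_top
        (ENNReal.mul_ne_top (ENNReal.inv_ne_top.2 (tsub_pos_of_lt ?_).ne') hfin2)
      exact ENNReal.ofReal_lt_one.2 hρ1)
  filter_upwards [h.ae_exists_iterate (lt_min hs1 hs2) key, hnt] with η ⟨n, hn⟩ hη
  have hn' := (summable_nat_add_iff (f := fun i => 1 - exp (-bw (next^[i] η))) n).1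
    (hn.congr fun i => by rw [Function.iterate_add_apply])
  have h0 := hn'.tendsto_atTop_zero
  have hev : ∀ᶠ i in atTop, 1 - exp (-bw (next^[i] η)) < 1 / 2 :=
    h0.eventually (gt_mem_nhds (by norm_num))
  -- Once `1 - exp(-b) < 1/2`, the bound `b exp(-b) ≤ 1 - exp(-b)` gives `b ≤ 2(1 - exp(-b))`.
  refine Summable.of_norm_bounded_eventually_nat (hn'.mul_left 2) ?_
  filter_upwards [hev] with i hi
  have hb := bw_nonneg (hη i)
  rw [norm_of_nonneg hb]
  set b := bw (next^[i] η)
  have e1 := Real.add_one_le_exp b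
  have e2 : exp (-b) * exp b = 1 := by rw [← Real.exp_add]; simp
  have := exp_pos (-b)
  nlinarith

lemma Regular.ae_tendsto_weightSum (h : Regular ν α c₁) (hα : α < 1 / 2) :
    ∀ᵐ η ∂law ν, ∃ z, Tendsto (fun k => weightSum k η) atTop (𝓝 z) := by
  filter_upwards [h.ae_summable_bw hα, h.ae_summable_rpow one_pos] with η h1 h2
  have h3 : Summable fun j => wt (next^[j + 1] η) [] := by
    refine Summable.of_nonneg_of_le (fun j => wt_nonneg _ _) (fun j => ?_) h2
    rw [Real.rpow_one]
    exact wt_iterate_succ_le η j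
  exact ⟨_, ((tendsto_add_atTop_iff_nat 1).2 h1.hasSum.tendsto_sum_nat).add
    h3.hasSum.tendsto_sum_nat⟩

end

section

variable {ν : Measure ℕ} [IsProbabilityMeasure ν] {α c₁ s : ℝ} {q : ℝ → ℝ → ℝ≥0∞} {Q : ℝ → ℝ}

/-! ### Limiting means of products along the backbone -/

lemma EdgeFun.eventually_rate_le (h : Regular ν α c₁) (hq : EdgeFun q Q) {L : ℝ}
    (hL : Tendsto (fun s => dphi ν (deficit ν q s) / dphi ν (s * theta ν s)) (𝓝[>] 0) (𝓝 L))
    {ε : ℝ} (hε : 0 < ε) (hεL : ε < L) :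
    ∀ᶠ s in 𝓝[>] 0, rate ν q s ≤ ofReal (L + ε) * rate ν unitq s ∧
      ofReal (L - ε) * rate ν unitq s ≤ rate ν q s := by
  filter_upwards [eventually_unit, hL.eventually (gt_mem_nhds (show L < L + ε by linarith)),
    hL.eventually (lt_mem_nhds (show L - ε < L by linarith)),
    h.tendsto_mul_dphi.eventually (lt_mem_nhds h.pos)] with s hs h1 h2 h3
  have hd : 0 < dphi ν (s * theta ν s) := pos_of_mul_pos_right h3 hs.1.le
  rw [hq.rate_eq h hs.1 hs.2, h.rate_unitq hs.1 hs.2, ← ofReal_mul (by linarith),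
    ← ofReal_mul (by linarith)]
  exact ⟨ofReal_le_ofReal ((div_lt_iff₀ hd).1 h1).le,
    ofReal_le_ofReal ((lt_div_iff₀ hd).1 h2).le⟩

lemma exists_mul_close {x y z ε : ℝ} (hx : 0 < x) (hy : 0 < y) (hz : 0 < z) (hε : 0 < ε) :
    ∃ δ, 0 < δ ∧ δ < x ∧ δ < y ∧ δ < z ∧ (x + δ) * (y + δ) * (z + δ) ≤ x * y * z + ε ∧
      x * y * z - ε ≤ (x - δ) * (y - δ) * (z - δ) := by
  have h1 : Tendsto (fun δ : ℝ => (x + δ) * (y + δ) * (z + δ)) (𝓝[>] 0) (𝓝 (x * y * z)) := by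
    have : Continuous fun δ : ℝ => (x + δ) * (y + δ) * (z + δ) := by fun_prop
    simpa using (this.tendsto 0).mono_left (nhdsWithin_le_nhds (s := Ioi 0))
  have h2 : Tendsto (fun δ : ℝ => (x - δ) * (y - δ) * (z - δ)) (𝓝[>] 0) (𝓝 (x * y * z)) := by
    have : Continuous fun δ : ℝ => (x - δ) * (y - δ) * (z - δ) := by fun_prop
    simpa using (this.tendsto 0).mono_left (nhdsWithin_le_nhds (s := Ioi 0))
  obtain ⟨δ, ⟨h3, h4⟩, h5, h6⟩ := ((h1.eventually (gt_mem_nhds (lt_add_of_pos_right _ hε))).and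
    (h2.eventually (lt_mem_nhds (sub_lt_self _ hε)))).and
    (Ioo_mem_nhdsGT (lt_min hx (lt_min hy hz))) |>.exists
  simp only [lt_min_iff] at h6
  exact ⟨δ, h5, h6.1, h6.2.1, h6.2.2, h3.le, h4.le⟩

/-- The exact one-step formula shows that `q` acts only by the factor `rate q / rate 1`, which tends
to `L`. What remains is the step with `q = 1`, so the limits of the bush, the ratio and the later
functional multiply: this is asymptotic independence. -/
lemma Regular.asymp_step (h : Regular ν α c₁) (hq : EdgeFun q Q) {L : ℝ} (hL0 : 0 < L)
    (hL : Tendsto (fun s => dphi ν (deficit ν q s) / dphi ν (s * theta ν s)) (𝓝[>] 0) (𝓝 L))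
    {κ : ℝ} (hκ : 0 ≤ κ) {Ψ : Config → ℝ≥0∞} (hΨ : Measurable Ψ) (hfree : RootFree Ψ) {ℓ : ℝ}
    (hℓ : 0 < ℓ) (hA : Asymp ν Ψ ℓ) :
    Asymp ν (fun η => bushProd q η * ofReal ((R (next η) / R η) ^ κ) * Ψ (next η))
      (L * ratioMoment α κ * ℓ) := by
  intro ε hε
  have hm := ratioMoment_pos h hκ
  obtain ⟨δ, hδ, hδL, hδm, hδl, hup, hlow⟩ := exists_mul_close hL0 hm hℓ hε
  obtain ⟨s₁, h1, -, hs₁⟩ := exists_level (hq.eventually_rate_le h hL hδ hδL)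
  obtain ⟨s₂, h2, hs₂⟩ := h.asymp_ratio hκ δ hδ
  obtain ⟨s₃, h3, hs₃⟩ := hA δ hδ
  refine ⟨min s₁ (min s₂ s₃), by positivity, fun g hg hsupp hfin => ?_⟩
  set F : ℝ → ℝ≥0∞ := fun r => g r * ofReal (r ^ (-κ)) with hF
  have hkm : Measurable fun r : ℝ => ofReal (r ^ κ) :=
    (measurable_id.pow_const _).ennreal_ofReal
  have hFm : Measurable F := hg.mul (measurable_id.pow_const _).ennreal_ofReal
  have hFs : ∀ r, min s₁ (min s₂ s₃) < r → F r = 0 := fun r hr => by rw [hF]; simp [hsupp r hr]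
  have hkR : Measurable fun η => ofReal (R η ^ κ) := hkm.comp measurable_R
  have hkf : RootFree fun η => ofReal (R η ^ κ) :=
    rootFree_R.comp_left fun r => ofReal (r ^ κ)
  set H : Config → ℝ≥0∞ := fun η => ofReal (R η ^ κ) * Ψ η with hH
  have hHm : Measurable H := hkR.mul hΨ
  have hHf : RootFree H := fun η => by simp only [hH]; rw [hfree η, rootFree_R η]
  have e1 : ∀ η, g (R η) * (bushProd q η * ofReal ((R (next η) / R η) ^ κ) *
      Ψ (next η)) = F (R η) * bushProd q η * H (next η) := fun η => by
    rw [ofReal_rpow_div (R_nonneg _) (R_nonneg _), hF, hH]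
    ring
  have e2 : ∀ η, g (R η) * ofReal ((R (next η) / R η) ^ κ) =
      F (R η) * ofReal (R (next η) ^ κ) := fun η => by
    rw [ofReal_rpow_div (R_nonneg _) (R_nonneg _), hF, mul_assoc]
  have i1 := lintegral_step h.zero hq.meas hFm hHm
  have i2 := lintegral_next h.zero h.two hFm hHm
  -- The weighted density after one step has total mass equal to the mean of `g` times the ratio
  -- power. Both hypotheses on limiting means are thus applied in succession.
  have i3 := lintegral_evol h.zero h.two hFm hHm hHf
  have i4 := lintegral_evol h.zero h.two hFm hkR hkf
  have a1 := hs₂ g hg (fun r hr => hsupp r ((min_le_right _ _).trans (min_le_left _ _) |>.trans_lt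
    hr)) hfin
  simp_rw [e2] at a1
  have hGm : Measurable fun r => evol ν unitq F r * ofReal (r ^ κ) :=
    (measurable_evol measurable_unitq hFm).mul hkm
  have hfin' : ∫⁻ η, evol ν unitq F (R η) * ofReal (R η ^ κ) ∂law ν ≠ ∞ := by
    rw [← i4]
    exact ne_top_of_le_ne_top (ENNReal.mul_ne_top ofReal_ne_top hfin) a1.1
  have a2 := hs₃ _ hGm (fun r hr => by
    rw [evol_eq_zero hFs (((min_le_right _ _).trans (min_le_right _ _)).trans_lt hr), zero_mul])
    hfin'
  simp_rw [mul_assoc] at a2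
  rw [← i4, ← i3] at a2
  simp_rw [e1]
  rw [i1]
  set E := ∫⁻ η, g (R η) ∂law ν
  set E2 := ∫⁻ η, F (R η) * ofReal (R (next η) ^ κ) ∂law ν
  set E3 := ∫⁻ η, F (R η) * H (next η) ∂law ν
  have hmR : Measurable fun η => F (S η) * rate ν unitq (S η) * H η :=
    ((hFm.comp measurable_S).mul ((measurable_rate measurable_unitq).comp measurable_S)).mul hHm
  constructor
  · calc _ ≤ ofReal (L + δ) * E3 := by
          rw [i2, ← lintegral_const_mul _ hmR]
          refine lintegral_mono_ae ?_
          filter_upwards [h.ae_R_pos] with η hη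
          rcases le_or_gt (S η) (min s₁ (min s₂ s₃)) with hle | hgt
          · have := (hs₁ (S η) (hη.trans_le (R_le_S η)) (hle.trans (min_le_left _ _))).1
            calc _ ≤ F (S η) * H η * (ofReal (L + δ) * rate ν unitq (S η)) := by
                  gcongr; exact this
              _ = _ := by ring
          · simp [hFs _ hgt]
      _ ≤ ofReal (L + δ) * (ofReal (ℓ + δ) * (ofReal
          (ratioMoment α κ + δ) * E)) := by gcongr; exact a2.1.trans (by gcongr; exact a1.1)
      _ = ofReal ((L + δ) * (ratioMoment α κ + δ) * (ℓ + δ)) * E := by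
          rw [ofReal_mul (by positivity), ofReal_mul (by positivity)]; ring
      _ ≤ _ := by gcongr
  · calc _ ≤ ofReal ((L - δ) * (ratioMoment α κ - δ) * (ℓ - δ)) * E := by gcongr
      _ = ofReal (L - δ) * (ofReal (ℓ - δ) * (ofReal
          (ratioMoment α κ - δ) * E)) := by
          rw [ofReal_mul (mul_nonneg (by linarith) (by linarith)),
            ofReal_mul (by linarith)]; ring
      _ ≤ ofReal (L - δ) * E3 := by
          gcongr; exact le_trans (by gcongr; exact a1.2) a2.2
      _ ≤ _ := by
          rw [i2, ← lintegral_const_mul _ hmR]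
          refine lintegral_mono_ae ?_
          filter_upwards [h.ae_R_pos] with η hη
          rcases le_or_gt (S η) (min s₁ (min s₂ s₃)) with hle | hgt
          · have := (hs₁ (S η) (hη.trans_le (R_le_S η)) (hle.trans (min_le_left _ _))).2
            calc _ = F (S η) * H η * (ofReal (L - δ) * rate ν unitq (S η)) := by ring
              _ ≤ _ := by gcongr; exact this
          · simp [hFs _ hgt]

lemma asymp_one : Asymp ν (fun _ => 1) 1 := by
  intro ε hε
  refine ⟨1, one_pos, fun g _ _ _ => ?_⟩
  simp only [mul_one]
  constructor
  · exact le_mul_of_one_le_left (zero_le) (ENNReal.one_le_ofReal.2 (by linarith))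
  · exact mul_le_of_le_one_left (zero_le) (ofReal_le_one.2 (by linarith))

lemma Asymp.congr {Ψ Ψ' : Config → ℝ≥0∞} {ℓ : ℝ} (hA : Asymp ν Ψ ℓ)
    (h : ∀ᵐ η ∂law ν, Ψ η = Ψ' η) : Asymp ν Ψ' ℓ := by
  intro ε hε
  obtain ⟨s₀, h0, hs₀⟩ := hA ε hε
  refine ⟨s₀, h0, fun g hg hsupp hfin => ?_⟩
  have : ∫⁻ η, g (R η) * Ψ' η ∂law ν = ∫⁻ η, g (R η) * Ψ η ∂law ν :=
    lintegral_congr_ae (by filter_upwards [h] with η hη; rw [hη])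
  rw [this]
  exact hs₀ g hg hsupp hfin

lemma Regular.tendsto_measure_R (h : Regular ν α c₁) {s₀ : ℝ} (h0 : 0 < s₀) :
    Tendsto (fun n => law ν {η | s₀ < R (next^[n] η)}) atTop (𝓝 0) := by
  have hm : ∀ n, MeasurableSet {η | s₀ < R (next^[n] η)} := fun n =>
    measurableSet_lt measurable_const (measurable_R.comp (measurable_iterate_next n))
  have h1 : Tendsto (fun n => ∫⁻ η, {η | s₀ < R (next^[n] η)}.indicator 1 η ∂law ν) atTop
      (𝓝 (∫⁻ _, 0 ∂law ν)) := by
    refine tendsto_lintegral_of_dominated_convergence (fun _ => 1)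
      (fun n => measurable_one.indicator (hm n))
      (fun n => Eventually.of_forall fun η => Set.indicator_le_self' (fun _ _ => zero_le) _)
      (by simp) ?_
    filter_upwards [tendsto_R_iterate h.zero h.two] with η hη
    rw [h.criticalProb_eq] at hη
    refine tendsto_const_nhds.congr' ?_
    filter_upwards [hη.eventually (gt_mem_nhds h0)] with n hn
    rw [Set.indicator_of_notMem]
    simpa using hn.le
  simpa only [lintegral_indicator_one (hm _), lintegral_zero] using h1

/-- The mean of a functional at a late vertex of the backbone tends to its limiting mean. -/
lemma Regular.tendsto_of_asymp (h : Regular ν α c₁) {Ψ : Config → ℝ≥0∞} (hΨ : Measurable Ψ)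
    (hfree : RootFree Ψ) (hle : ∀ᵐ η ∂law ν, Ψ η ≤ 1) {ℓ : ℝ} (hℓ : 0 < ℓ) (hA : Asymp ν Ψ ℓ) :
    Tendsto (fun n => ∫⁻ η, Ψ (next^[n] η) ∂law ν) atTop (𝓝 (ofReal ℓ)) := by
  have hone : ∀ n, ∫⁻ η, dens ν n 1 (R η) ∂law ν = 1 := fun n => by
    have := lintegral_dens h.zero h.two n (g := 1) measurable_one (K := fun η => 1)
      measurable_const (fun _ => rfl)
    simpa using this.symm
  have hdens : ∀ n, ∫⁻ η, Ψ (next^[n] η) ∂law ν = ∫⁻ η, dens ν n 1 (R η) * Ψ η ∂law ν :=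
    fun n => by
      have := lintegral_dens h.zero h.two n (g := 1) measurable_one hΨ hfree
      simpa using this
  have key : ∀ ε, 0 < ε → ∀ᶠ n in atTop,
      ∫⁻ η, Ψ (next^[n] η) ∂law ν ≤ ofReal (ℓ + ε) + ofReal ε ∧
      ofReal (ℓ - ε) ≤ ∫⁻ η, Ψ (next^[n] η) ∂law ν +
        ofReal (ℓ - ε) * ofReal ε := by
    intro ε hε
    obtain ⟨s₀, h0, hs₀⟩ := hA ε hε
    filter_upwards [(h.tendsto_measure_R h0).eventually (gt_mem_nhds (ENNReal.ofReal_pos.2 hε))]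
      with n hn
    have hd := measurable_dens (ν := ν) n (g := 1) measurable_one
    -- The density of the late vertex is split at `s₀`; the mass above `s₀` is the probability of a
    -- threshold that has not yet fallen, hence small.
    set g := (Iic s₀).indicator (dens ν n 1) with hg
    set g' := (Ioi s₀).indicator (dens ν n 1) with hg'
    have hgm : Measurable g := hd.indicator measurableSet_Iic
    have hgm' : Measurable g' := hd.indicator measurableSet_Ioi
    have hsum : ∀ r, dens ν n 1 r = g r + g' r := fun r => by
      rw [hg, hg', ← Set.compl_Iic]
      exact (congrFun (Set.indicator_self_add_compl (Iic s₀) (dens ν n 1)) r).symm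
    have hp : ∫⁻ η, g' (R η) ∂law ν ≤ ofReal ε := by
      have := lintegral_dens h.zero h.two n (g := 1) measurable_one
        (K := fun η => (Ioi s₀).indicator 1 (R η))
        ((measurable_one.indicator measurableSet_Ioi).comp measurable_R)
        (rootFree_R.comp_left _)
      have e : ∀ η, dens ν n 1 (R η) * (Ioi s₀).indicator 1 (R η) = g' (R η) := fun η => by
        by_cases hη : R η ∈ Ioi s₀ <;> simp [hg', hη]
      simp_rw [e] at this
      rw [← this]
      refine le_trans (le_of_eq ?_) hn.le
      have hms : MeasurableSet {η | s₀ < R (next^[n] η)} :=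
        measurableSet_lt measurable_const (measurable_R.comp (measurable_iterate_next n))
      rw [← lintegral_indicator_one hms]
      refine lintegral_congr fun η => ?_
      by_cases hη : s₀ < R (next^[n] η) <;> simp [hη, Set.indicator]
    have h1 : ∫⁻ η, g (R η) ∂law ν + ∫⁻ η, g' (R η) ∂law ν = 1 := by
      have hgR : Measurable fun η => g (R η) := hgm.comp measurable_R
      rw [← lintegral_add_left hgR, ← hone n]
      exact lintegral_congr fun η => (hsum _).symm
    have hle1 : ∫⁻ η, g (R η) ∂law ν ≤ 1 := by rw [← h1]; exact le_self_add
    have h2 := hs₀ g hgm (fun r hr => Set.indicator_of_notMem (by simpa using hr) _)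
      (ne_top_of_le_ne_top ENNReal.one_ne_top hle1)
    have h3 : ∫⁻ η, Ψ (next^[n] η) ∂law ν = ∫⁻ η, g (R η) * Ψ η ∂law ν +
        ∫⁻ η, g' (R η) * Ψ η ∂law ν := by
      have hgR : Measurable fun η => g (R η) * Ψ η := (hgm.comp measurable_R).mul hΨ
      rw [hdens n, ← lintegral_add_left hgR]
      exact lintegral_congr fun η => by rw [hsum, add_mul]
    rw [h3]
    constructor
    · refine add_le_add (h2.1.trans (mul_le_of_le_one_right (zero_le) hle1)) (le_trans ?_ hp)
      refine lintegral_mono_ae ?_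
      filter_upwards [hle] with η hη using mul_le_of_le_one_right (zero_le) hη
    · calc _ = ofReal (ℓ - ε) * (∫⁻ η, g (R η) ∂law ν + ∫⁻ η, g' (R η) ∂law ν) := by
            rw [h1, mul_one]
        _ = ofReal (ℓ - ε) * ∫⁻ η, g (R η) ∂law ν +
            ofReal (ℓ - ε) * ∫⁻ η, g' (R η) ∂law ν := mul_add _ _ _
        _ ≤ _ := by
          gcongr
          exact h2.2.trans le_self_add
  refine (ENNReal.tendsto_nhds ofReal_ne_top).2 fun e he => ?_
  rcases eq_or_ne e ∞ with rfl | hetop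
  · exact Eventually.of_forall fun n => by simp
  lift e to NNReal using hetop
  have he : 0 < (e : ℝ) := by exact_mod_cast he
  -- The upper error is `2ε`; below, `(ℓ-ε)(1-ε) ≥ ℓ - ε(1+ℓ)`, and `ε ≤ ℓ` keeps the lower bound
  -- meaningful.
  set ε := min (e / 2 : ℝ) (min ℓ (e / (1 + ℓ))) with hεdef
  have hε : 0 < ε := by positivity
  have hε1 : ε ≤ e / 2 := min_le_left _ _
  have hε2 : ε ≤ ℓ := (min_le_right _ _).trans (min_le_left _ _)
  have hε3 : ε ≤ e / (1 + ℓ) := (min_le_right _ _).trans (min_le_right _ _)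
  rw [le_div_iff₀ (by positivity)] at hε3
  filter_upwards [key ε hε] with n hn
  set x := ∫⁻ η, Ψ (next^[n] η) ∂law ν
  have hx : x ≠ ∞ := ne_top_of_le_ne_top (by simp) hn.1
  rw [← ofReal_toReal hx] at hn ⊢
  have hx0 := ENNReal.toReal_nonneg (a := x)
  rw [← ofReal_add (by positivity) hε.le, ENNReal.ofReal_le_ofReal_iff (by positivity),
    ← ofReal_mul (by linarith), ← ofReal_add hx0 (mul_nonneg (by linarith) hε.le),
    ENNReal.ofReal_le_ofReal_iff (add_nonneg hx0 (mul_nonneg (by linarith) hε.le))] at hn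
  rw [← ENNReal.ofReal_coe_nnreal, ← ENNReal.ofReal_sub _ he.le, ← ofReal_add hℓ.le he.le]
  refine ⟨ofReal_le_ofReal ?_, ofReal_le_ofReal ?_⟩
  · nlinarith [hn.2]
  · linarith [hn.1]

end

section

variable {ν : Measure ℕ} [IsProbabilityMeasure ν] {α c₁ s : ℝ} {q : ℝ → ℝ → ℝ≥0∞} {Q : ℝ → ℝ}

/-! ### Laplace transforms of the rescaled bushes -/

lemma Regular.exponent_pos (h : Regular ν α c₁) : 0 < α / (1 - α) :=
  div_pos h.pos (by linarith [h.lt_one])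

lemma tendsto_rpow_zero {a : ℝ} (ha : 0 < a) : Tendsto (fun s : ℝ => s ^ a) (𝓝[>] 0) (𝓝 0) := by
  have := (Real.continuousAt_rpow_const 0 a (Or.inr ha.le)).tendsto
  rw [zero_rpow ha.ne'] at this
  exact this.mono_left nhdsWithin_le_nhds

/-- Each edge is charged the same amount, whatever its weight, so this functional sees the bush size
only; its scaled first moment tends to `l`. -/
lemma Regular.edgeFun_size (h : Regular ν α c₁) {l : ℝ} (hl : 0 ≤ l) :
    EdgeFun (fun s _ => ofReal (exp (-l * s ^ (α / (1 - α)))))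
      (fun s => s * exp (-l * s ^ (α / (1 - α)))) ∧
    Tendsto (fun s => (s - s * exp (-l * s ^ (α / (1 - α)))) / s ^ (1 / (1 - α)))
      (𝓝[>] 0) (𝓝 l) := by
  have ha := h.exponent_pos
  set a := α / (1 - α) with hadef
  refine ⟨⟨?_, fun s h0 h1 => ?_, fun s h0 h1 => by positivity, fun s h0 h1 => ?_⟩, ?_⟩
  · exact (measurable_exp.comp
      ((measurable_fst.pow_const a).const_mul (-l))).ennreal_ofReal
  · rw [lintegral_const, Measure.restrict_apply_univ, Real.volume_Icc, sub_zero,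
      ← ofReal_mul (exp_pos _).le, mul_comm]
  · refine mul_le_of_le_one_right h0.le (exp_le_one_iff.2 ?_)
    have := mul_nonneg hl (rpow_nonneg h0.le a)
    linarith
  · have hd : HasDerivAt (fun y : ℝ => 1 - exp (-l * y)) l 0 := by
      have := (((hasDerivAt_id (0 : ℝ)).const_mul (-l)).exp).const_sub 1
      simpa using this
    have h1 := (hasDerivAt_iff_tendsto_slope.1 hd).mono_left
      (nhdsWithin_mono 0 (show Ioi (0 : ℝ) ⊆ {0}ᶜ from fun x hx => ne_of_gt hx))
    have h2 : Tendsto (fun s : ℝ => s ^ a) (𝓝[>] 0) (𝓝[>] 0) :=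
      tendsto_nhdsWithin_iff.2 ⟨tendsto_rpow_zero ha, by
        filter_upwards [self_mem_nhdsWithin] with s hs using rpow_pos_of_pos hs a⟩
    refine (h1.comp h2).congr' ?_
    filter_upwards [eventually_unit] with s hs
    rw [h.exponent hs.1, ← hadef, Function.comp_apply, slope_def_field]
    have := rpow_pos_of_pos hs.1 a
    have := hs.1
    simp only [mul_zero, Real.exp_zero, sub_self, sub_zero]
    field_simp

lemma tendsto_exp_taylor : Tendsto (fun x : ℝ => (x - 1 + exp (-x)) / x ^ 2) (𝓝[>] 0)
    (𝓝 (1 / 2)) := by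
  have hup : Tendsto (fun x : ℝ => 1 / 2 - x) (𝓝[>] 0) (𝓝 (1 / 2)) := by
    have : Continuous fun x : ℝ => 1 / 2 - x := by fun_prop
    simpa using (this.tendsto 0).mono_left (nhdsWithin_le_nhds (s := Ioi 0))
  refine tendsto_of_tendsto_of_tendsto_of_le_of_le' hup tendsto_const_nhds ?_ ?_
  · filter_upwards [eventually_unit] with x hx
    have := (abs_le.1 (Real.exp_bound (x := -x) (by rw [abs_neg, abs_of_pos hx.1]; exact hx.2)
      (n := 3) (by norm_num))).1
    simp [Finset.sum_range_succ, Nat.factorial, abs_of_pos hx.1] at this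
    rw [le_div_iff₀ (by have := hx.1; positivity)]
    have := hx.1
    nlinarith [pow_pos hx.1 3]
  · filter_upwards [eventually_unit] with x hx
    rw [div_le_iff₀ (by have := hx.1; positivity)]
    linarith [exp_neg_le hx.1.le]

/-- Weights uniform on `[0, s]` have mean `s/2`, whence the limit `l/2`, the source of the factor
`1/2` in the theorem. The bound valid for all `s` serves the uniform estimates; `l = 0` is separate
because `Q` is a quotient by the coefficient. -/
lemma Regular.exists_edgeFun_weight (h : Regular ν α c₁) {l : ℝ} (hl : 0 ≤ l) :
    ∃ Q : ℝ → ℝ, Measurable Q ∧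
    EdgeFun (fun s u => ofReal (exp (-(l * s ^ (α / (1 - α) - 1)) * u))) Q ∧
    Tendsto (fun s => (s - Q s) / s ^ (1 / (1 - α))) (𝓝[>] 0) (𝓝 (l / 2)) ∧
    ∀ s, 0 < s → (s - Q s) / s ^ (1 / (1 - α)) ≤ l / 2 := by
  have ha := h.exponent_pos
  set a := α / (1 - α) with hadef
  rcases hl.eq_or_lt with rfl | hl
  · refine ⟨id, measurable_id, ⟨?_, fun s h0 h1 => ?_, fun s h0 _ => h0.le, fun s _ _ => le_rfl⟩,
      ?_, fun s h0 => ?_⟩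
    · simp only [zero_mul, neg_zero, Real.exp_zero]
      exact measurable_const
    · simp
    · simp
    · simp
  · have hA : Measurable fun s : ℝ => l * s ^ (a - 1) := (measurable_id.pow_const _).const_mul l
    have hA0 : ∀ s : ℝ, 0 < s → 0 < l * s ^ (a - 1) := fun s h0 =>
      mul_pos hl (rpow_pos_of_pos h0 _)
    have hmul : ∀ s : ℝ, 0 < s → l * s ^ (a - 1) * s = l * s ^ a := fun s h0 => by
      rw [mul_assoc, ← Real.rpow_add_one h0.ne', sub_add_cancel]
    refine ⟨_, measurable_edgeFun_exp hA, edgeFun_exp hA fun s h0 _ => hA0 s h0, ?_,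
      fun s h0 => ?_⟩
    · have h2 : Tendsto (fun s : ℝ => l * s ^ a) (𝓝[>] 0) (𝓝[>] 0) :=
        tendsto_nhdsWithin_iff.2 ⟨by simpa using (tendsto_rpow_zero ha).const_mul l, by
          filter_upwards [self_mem_nhdsWithin] with s hs using mul_pos hl (rpow_pos_of_pos hs a)⟩
      have h3 := (tendsto_exp_taylor.comp h2).const_mul l
      rw [mul_one_div] at h3
      refine h3.congr' ?_
      filter_upwards [eventually_unit] with s hs
      have hp := rpow_pos_of_pos hs.1 a
      have hs0 := hs.1
      simp only [Function.comp]
      rw [h.exponent hs.1, hmul s hs.1, Real.rpow_sub_one hs.1.ne']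
      field_simp
      ring
    · have h1 := sub_edgeFun_exp_le (hA0 s h0) h0.le
      rw [div_le_iff₀ (rpow_pos_of_pos h0 _), h.exponent h0, ← hadef]
      refine h1.trans (le_of_eq ?_)
      rw [Real.rpow_sub_one h0.ne']
      field_simp

/-- The rescaled weight of a bush. -/
def scaledBush (α : ℝ) (η : Config) : ℝ := R η ^ (α / (1 - α) - 1) * bw η

lemma measurable_scaledBush : Measurable (scaledBush α) :=
  (measurable_R.pow_const _).mul measurable_bw

lemma rootFree_scaledBush : RootFree (scaledBush α) := fun η => by
  rw [scaledBush, rootFree_R η, rootFree_bw η, scaledBush]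

lemma scaledBush_nonneg {η : Config} (h : NoTie η) : 0 ≤ scaledBush α η :=
  mul_nonneg (rpow_nonneg (R_nonneg _) _) (bw_nonneg h)

lemma bushProd_scaledBush {η : Config} (h : NoTie η) (l : ℝ) :
    bushProd (fun s u => ofReal (exp (-(l * s ^ (α / (1 - α) - 1)) * u))) η =
      ofReal (exp (-(l * scaledBush α η))) := by
  have := bushProd_exp' h (fun s => -(l * s ^ (α / (1 - α) - 1))) (fun _ => 0)
  simp only [add_zero, zero_mul] at this
  rw [this, scaledBush]
  congr 2
  ring

lemma bushProd_size {η : Config} (h : NoTie η) (l a : ℝ) :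
    bushProd (fun s _ => ofReal (exp (-l * s ^ a))) η =
      ofReal (exp (-l * (R η ^ a * bs η))) := by
  have := bushProd_exp' h (fun s => 0) (fun s => -l * s ^ a)
  simp only [zero_add, zero_mul] at this
  rw [this, mul_assoc]

lemma Regular.asymp_bushProd (h : Regular ν α c₁) (hq : EdgeFun q Q) {L : ℝ} (hL0 : 0 < L)
    (hL : Tendsto (fun s => dphi ν (deficit ν q s) / dphi ν (s * theta ν s)) (𝓝[>] 0) (𝓝 L)) :
    Asymp ν (bushProd q) L := by
  have h1 := h.asymp_step hq hL0 hL le_rfl measurable_const (fun _ => rfl) one_pos asymp_one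
  have h2 : ratioMoment α 0 = 1 := by
    rw [ratioMoment, add_zero, div_self h.exponent_pos.ne']; ring
  rw [h2, mul_one, mul_one] at h1
  simpa using h1

variable {Ω' : Type*} [MeasurableSpace Ω'] {μ' : Measure Ω'} [IsProbabilityMeasure μ'] {Z : Ω' → ℝ}

lemma laplace_pos (hZ : AEMeasurable Z μ') (hZ0 : ∀ᵐ ω ∂μ', 0 ≤ Z ω) {l : ℝ} (hl : 0 ≤ l) :
    0 < ∫ ω, exp (-l * Z ω) ∂μ' := by
  refine integral_exp_pos ?_
  refine Integrable.of_bound (C := 1)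
    (measurable_exp.comp_aemeasurable (hZ.const_mul _)).aestronglyMeasurable ?_
  filter_upwards [hZ0] with ω h
  rw [norm_of_nonneg (exp_pos _).le]
  exact exp_le_one_iff.2 (by nlinarith)

/-- If the rescaled bush sizes converge, the Laplace transform of the limit determines the limiting
rates. -/
lemma Regular.rate_limit_of_tendsto (h : Regular ν α c₁)
    (hZ : TendstoInDistribution (fun k η => R (next^[k] η) ^ (α / (1 - α)) *
      (bs (next^[k] η) + 1)) atTop Z (fun _ => law ν) μ') :
    (∀ᵐ ω ∂μ', 0 ≤ Z ω) ∧ ∀ l, 0 ≤ l → ∀ q Q, EdgeFun q Q →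
      Tendsto (fun s => (s - Q s) / s ^ (1 / (1 - α))) (𝓝[>] 0) (𝓝 l) →
      Tendsto (fun s => dphi ν (deficit ν q s) / dphi ν (s * theta ν s)) (𝓝[>] 0)
        (𝓝 (∫ ω, exp (-l * Z ω) ∂μ')) := by
  have ha := h.exponent_pos
  set a := α / (1 - α) with hadef
  set Y : ℕ → Config → ℝ := fun k η => R (next^[k] η) ^ a * (bs (next^[k] η) + 1) with hY
  have hlim : ∀ f : BoundedContinuousFunction ℝ ℝ, Tendsto (fun k => ∫ η, f (Y k η) ∂law ν) atTop
      (𝓝 (∫ ω, f (Z ω) ∂μ')) := by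
    intro f
    have h1 := (ProbabilityMeasure.tendsto_iff_forall_integral_tendsto.1 hZ.tendsto) f
    simp only [ProbabilityMeasure.coe_mk] at h1
    rw [integral_map hZ.aemeasurable_limit f.continuous.aestronglyMeasurable] at h1
    refine h1.congr fun k => ?_
    rw [integral_map (hZ.forall_aemeasurable k) f.continuous.aestronglyMeasurable]
  have hY0 : ∀ k, ∀ᵐ η ∂law ν, 0 ≤ Y k η := fun k => by
    filter_upwards [ae_iterate h.zero h.two (ae_noTie h.zero h.two) k] with η hη
    exact mul_nonneg (rpow_nonneg (R_nonneg _) _) (by linarith [bs_nonneg hη])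
  have hZ0 : ∀ᵐ ω ∂μ', 0 ≤ Z ω := by
    let f : BoundedContinuousFunction ℝ ℝ := BoundedContinuousFunction.ofNormedAddCommGroup
      (fun x => max 0 (min 1 (-x))) (by fun_prop) 1 fun x => by
        rw [norm_of_nonneg (le_max_left _ _)]
        exact max_le zero_le_one (min_le_left _ _)
    have h1 := hlim f
    have h2 : ∀ k, ∫ η, f (Y k η) ∂law ν = 0 := fun k => by
      refine integral_eq_zero_of_ae ?_
      filter_upwards [hY0 k] with η hη
      exact max_eq_left ((min_le_right _ _).trans (by linarith))
    simp_rw [h2] at h1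
    have h3 : ∫ ω, f (Z ω) ∂μ' = 0 := tendsto_nhds_unique h1 tendsto_const_nhds
    have hf0 : 0 ≤ fun ω => f (Z ω) := fun ω => le_max_left _ _
    rw [integral_eq_zero_iff_of_nonneg hf0] at h3
    · filter_upwards [h3] with ω hω
      by_contra! hneg
      have : 0 < f (Z ω) := lt_max_of_lt_right (lt_min one_pos (by linarith))
      exact this.ne' hω
    · exact Integrable.of_bound (C := ‖f‖) (f.continuous.measurable.comp_aemeasurable
        hZ.aemeasurable_limit).aestronglyMeasurable (Eventually.of_forall fun ω => f.norm_coe_le_norm _)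
  refine ⟨hZ0, fun l hl q Q hq hqlim => ?_⟩
  obtain ⟨L, hL, hLlim⟩ := h.exists_rate_limit hl
  -- The limit `L` is the same for all functionals with first moment `l`, so it may be identified
  -- through the one that counts edges, whose limiting mean is known from the hypothesis.
  suffices L = ∫ ω, exp (-l * Z ω) ∂μ' by rw [← this]; exact hLlim q Q hq hqlim
  obtain ⟨he, helim⟩ := h.edgeFun_size hl
  have hLr := hLlim _ _ he helim
  have hA := h.asymp_bushProd he hL hLr
  set q₀ : ℝ → ℝ → ℝ≥0∞ := fun s _ => ofReal (exp (-l * s ^ (α / (1 - α)))) with hq₀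
  have hae : ∀ᵐ η ∂law ν, bushProd q₀ η = ofReal (exp (-l * (R η ^ a * bs η))) := by
    filter_upwards [ae_noTie h.zero h.two] with η hη using bushProd_size hη l a
  have hle : ∀ᵐ η ∂law ν, bushProd q₀ η ≤ 1 := by
    filter_upwards [hae, ae_noTie h.zero h.two] with η h1 h2
    rw [h1]
    refine ofReal_le_one.2 (exp_le_one_iff.2 ?_)
    have := mul_nonneg hl (mul_nonneg (rpow_nonneg (R_nonneg η) a) (bs_nonneg h2))
    linarith
  have h1 := h.tendsto_of_asymp (measurable_bushProd he.meas) rootFree_bushProd hle hL hA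
  have h2 := (ENNReal.tendsto_toReal ofReal_ne_top).comp h1
  rw [ENNReal.toReal_ofReal hL.le] at h2
  have e1 : ∀ k, (∫⁻ η, bushProd q₀ (next^[k] η) ∂law ν).toReal =
      ∫ η, exp (-l * (R (next^[k] η) ^ a * bs (next^[k] η))) ∂law ν := fun k => by
    rw [integral_eq_lintegral_of_nonneg_ae (Eventually.of_forall fun _ => (exp_pos _).le)]
    · congr 1
      refine lintegral_congr_ae ?_
      exact ae_iterate h.zero h.two hae k
    · refine (measurable_exp.comp (Measurable.const_mul ?_ (-l))).aestronglyMeasurable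
      exact ((measurable_R.comp (measurable_iterate_next k)).pow_const a).mul
        (measurable_bs.comp (measurable_iterate_next k))
  simp only [Function.comp_def, e1] at h2
  let f : BoundedContinuousFunction ℝ ℝ := BoundedContinuousFunction.ofNormedAddCommGroup
    (fun x => exp (-l * max 0 x)) (by fun_prop) 1 fun x => by
      rw [norm_of_nonneg (exp_pos _).le]
      refine exp_le_one_iff.2 ?_
      have := mul_nonneg hl (le_max_left 0 x)
      linarith
  have h3 := hlim f
  have h4 : ∫ ω, f (Z ω) ∂μ' = ∫ ω, exp (-l * Z ω) ∂μ' := by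
    refine integral_congr_ae ?_
    filter_upwards [hZ0] with ω hω
    change exp (-l * max 0 (Z ω)) = _
    rw [max_eq_right hω]
  rw [h4] at h3
  refine tendsto_nhds_unique h2 (tendsto_of_tendsto_of_dist h3 ?_)
  -- The hypothesis counts the backbone vertex as well as the bush; the extra `1` is multiplied by a
  -- power of the threshold that tends to zero.
  have hRa : Tendsto (fun k => ∫ η, l * R (next^[k] η) ^ a ∂law ν) atTop (𝓝 0) := by
    have : Tendsto (fun k => ∫ η, l * R (next^[k] η) ^ a ∂law ν) atTop
        (𝓝 (∫ _, (0 : ℝ) ∂law ν)) := by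
      refine tendsto_integral_of_dominated_convergence (fun _ => l) (fun k =>
        (((measurable_R.comp (measurable_iterate_next k)).pow_const a).const_mul
          l).aestronglyMeasurable) (integrable_const _) (fun k => Eventually.of_forall fun η => ?_) ?_
      · rw [norm_of_nonneg (mul_nonneg hl (rpow_nonneg (R_nonneg _) _))]
        exact mul_le_of_le_one_right hl (rpow_le_one (R_nonneg _) (R_le_one _) ha.le)
      · filter_upwards [tendsto_R_iterate h.zero h.two] with η hη
        rw [h.criticalProb_eq] at hη
        have := (hη.rpow_const (p := a) (Or.inr ha.le)).const_mul l
        rwa [zero_rpow ha.ne', mul_zero] at this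
    simpa using this
  refine squeeze_zero (fun _ => dist_nonneg) (fun k => ?_) hRa
  have hbm : Measurable fun η => R (next^[k] η) ^ a * bs (next^[k] η) :=
    ((measurable_R.comp (measurable_iterate_next k)).pow_const a).mul
      (measurable_bs.comp (measurable_iterate_next k))
  have hYm : Measurable (Y k) := ((measurable_R.comp (measurable_iterate_next k)).pow_const a).mul
      ((measurable_bs.comp (measurable_iterate_next k)).add_const 1)
  have i1 : Integrable (fun η => f (Y k η)) (law ν) :=
    Integrable.of_bound (C := ‖f‖) (f.continuous.measurable.comp hYm).aestronglyMeasurable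
      (Eventually.of_forall fun ω => f.norm_coe_le_norm _)
  have hnt := ae_iterate h.zero h.two (ae_noTie h.zero h.two) k
  have i2 : Integrable (fun η => exp (-l * (R (next^[k] η) ^ a * bs (next^[k] η))))
      (law ν) := by
    refine Integrable.of_bound (C := 1) (measurable_exp.comp
      (hbm.const_mul (-l))).aestronglyMeasurable ?_
    filter_upwards [hnt] with η hη
    rw [norm_of_nonneg (exp_pos _).le]
    refine exp_le_one_iff.2 ?_
    have := mul_nonneg hl (mul_nonneg (rpow_nonneg (R_nonneg (next^[k] η)) a) (bs_nonneg hη))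
    linarith
  rw [dist_eq_norm, ← integral_sub i1 i2]
  refine norm_integral_le_of_norm_le ?_ ?_
  · refine Integrable.of_bound (C := l) (((measurable_R.comp
      (measurable_iterate_next k)).pow_const a).const_mul l).aestronglyMeasurable
      (Eventually.of_forall fun η => ?_)
    rw [norm_of_nonneg (mul_nonneg hl (rpow_nonneg (R_nonneg _) _))]
    exact mul_le_of_le_one_right hl (rpow_le_one (R_nonneg _) (R_le_one _) ha.le)
  · filter_upwards [hY0 k, hnt] with η h5 h6
    change ‖exp (-l * max 0 (Y k η)) - _‖ ≤ _
    rw [max_eq_right h5]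
    have hr := rpow_nonneg (R_nonneg (next^[k] η)) a
    set r := R (next^[k] η) ^ a
    set b := bs (next^[k] η)
    have e : -l * Y k η = -l * (r * b) + -(l * r) := by simp only [hY]; ring
    have hx : exp (-l * (r * b)) ≤ 1 := by
      refine exp_le_one_iff.2 ?_
      have := mul_nonneg hl (mul_nonneg hr (bs_nonneg h6))
      linarith
    have hx0 := exp_pos (-l * (r * b))
    have hy := Real.add_one_le_exp (-(l * r))
    have hy1 : exp (-(l * r)) ≤ 1 := exp_le_one_iff.2 (by nlinarith)
    rw [e, Real.exp_add, Real.norm_eq_abs, abs_le]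
    constructor <;> nlinarith

end

section

/-! ### Weak convergence through test functions -/

section General

variable {Ω Ω' E : Type*} [MeasurableSpace Ω] [MeasurableSpace Ω'] [TopologicalSpace E]
  [MeasurableSpace E] {μ : Measure Ω} [IsProbabilityMeasure μ] {μ' : Measure Ω'}
  [IsProbabilityMeasure μ'] {Y : ℕ → Ω → E} {Z : Ω' → E}

lemma tendsto_integral_of_tendstoInDistribution [OpensMeasurableSpace E]
    (h : TendstoInDistribution Y atTop Z (fun _ => μ) μ') (f : BoundedContinuousFunction E ℝ) :
    Tendsto (fun k => ∫ ω, f (Y k ω) ∂μ) atTop (𝓝 (∫ ω, f (Z ω) ∂μ')) := by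
  have h1 := (ProbabilityMeasure.tendsto_iff_forall_integral_tendsto.1 h.tendsto) f
  simp only [ProbabilityMeasure.coe_mk] at h1
  rw [integral_map h.aemeasurable_limit f.continuous.measurable.aestronglyMeasurable] at h1
  refine h1.congr fun k => ?_
  rw [integral_map (h.forall_aemeasurable k) f.continuous.measurable.aestronglyMeasurable]

lemma tendstoInDistribution_of_tendsto_integral [OpensMeasurableSpace E]
    (hY : ∀ k, AEMeasurable (Y k) μ) (hZ : AEMeasurable Z μ')
    (h : ∀ f : BoundedContinuousFunction E ℝ,
      Tendsto (fun k => ∫ ω, f (Y k ω) ∂μ) atTop (𝓝 (∫ ω, f (Z ω) ∂μ'))) :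
    TendstoInDistribution Y atTop Z (fun _ => μ) μ' := by
  refine ⟨hY, hZ, ProbabilityMeasure.tendsto_iff_forall_integral_tendsto.2 fun f => ?_⟩
  simp only [ProbabilityMeasure.coe_mk]
  rw [integral_map hZ f.continuous.measurable.aestronglyMeasurable]
  refine (h f).congr fun k => ?_
  rw [integral_map (hY k) f.continuous.measurable.aestronglyMeasurable]

/-- On a compact space, convergence in distribution follows from the convergence of the means of the
functions of a point-separating submonoid. -/
lemma tendstoInDistribution_of_submonoid [CompactSpace E] [OpensMeasurableSpace E]
    (hY : ∀ k, AEMeasurable (Y k) μ) (hZ : AEMeasurable Z μ') (M : Submonoid C(E, ℝ))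
    (hsep : ∀ x y, x ≠ y → ∃ f ∈ M, f x ≠ f y)
    (h : ∀ f ∈ M, Tendsto (fun k => ∫ ω, f (Y k ω) ∂μ) atTop (𝓝 (∫ ω, f (Z ω) ∂μ'))) :
    TendstoInDistribution Y atTop Z (fun _ => μ) μ' := by
  have hint : ∀ (f : C(E, ℝ)) (k : ℕ), Integrable (fun ω => f (Y k ω)) μ := fun f k =>
    Integrable.of_bound (C := ‖f‖) (f.continuous.measurable.comp_aemeasurable
      (hY k)).aestronglyMeasurable (Eventually.of_forall fun ω => f.norm_coe_le_norm _)
  have hint' : ∀ f : C(E, ℝ), Integrable (fun ω => f (Z ω)) μ' := fun f =>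
    Integrable.of_bound (C := ‖f‖) (f.continuous.measurable.comp_aemeasurable
      hZ).aestronglyMeasurable (Eventually.of_forall fun ω => f.norm_coe_le_norm _)
  have hspan : ∀ f ∈ Submodule.span ℝ (M : Set C(E, ℝ)),
      Tendsto (fun k => ∫ ω, f (Y k ω) ∂μ) atTop (𝓝 (∫ ω, f (Z ω) ∂μ')) := by
    intro f hf
    induction hf using Submodule.span_induction with
    | mem f hf => exact h f hf
    | zero => simp
    | add f g _ _ hf hg =>
      simp only [ContinuousMap.add_apply]
      rw [integral_add (hint' f) (hint' g)]
      simp_rw [integral_add (hint f _) (hint g _)]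
      exact hf.add hg
    | smul c f _ hf =>
      simp only [ContinuousMap.smul_apply, smul_eq_mul, integral_const_mul]
      exact hf.const_mul c
  have hsep' : (Algebra.adjoin ℝ (M : Set C(E, ℝ))).SeparatesPoints := fun x y hxy => by
    obtain ⟨f, hf, hne⟩ := hsep x y hxy
    exact ⟨f, ⟨f, Algebra.subset_adjoin hf, rfl⟩, hne⟩
  refine tendstoInDistribution_of_tendsto_integral hY hZ fun f => ?_
  refine Metric.tendsto_atTop.2 fun ε hε => ?_
  -- Stone-Weierstrass; the algebra generated by a submonoid is its linear span, so convergence of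
  -- means extends to the approximants by linearity.
  obtain ⟨⟨g, hg⟩, hgf⟩ := ContinuousMap.exists_mem_subalgebra_near_continuousMap_of_separatesPoints
    _ hsep' (f : C(E, ℝ)) (ε / 3) (by positivity)
  have hg' : g ∈ Submodule.span ℝ (M : Set C(E, ℝ)) := by
    have : g ∈ Subalgebra.toSubmodule (Algebra.adjoin ℝ (M : Set C(E, ℝ))) := hg
    rwa [Algebra.adjoin_eq_span, Submonoid.closure_eq] at this
  obtain ⟨N, hN⟩ := Metric.tendsto_atTop.1 (hspan g hg') (ε / 3) (by positivity)
  refine ⟨N, fun k hk => ?_⟩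
  have hfg : ∀ x, ‖f x - g x‖ ≤ ε / 3 := fun x => by
    rw [norm_sub_rev]
    exact ((g - (f : C(E, ℝ))).norm_coe_le_norm x).trans hgf.le
  have h1 : dist (∫ ω, f (Y k ω) ∂μ) (∫ ω, g (Y k ω) ∂μ) ≤ ε / 3 := by
    have hf : Integrable (fun ω => f (Y k ω)) μ := hint (f : C(E, ℝ)) k
    rw [dist_eq_norm, ← integral_sub hf (hint g k)]
    refine (norm_integral_le_of_norm_le_const (Eventually.of_forall fun ω => hfg (Y k ω))).trans ?_
    simp
  have h2 : dist (∫ ω, g (Z ω) ∂μ') (∫ ω, f (Z ω) ∂μ') ≤ ε / 3 := by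
    have hf : Integrable (fun ω => f (Z ω)) μ' := hint' (f : C(E, ℝ))
    rw [dist_comm, dist_eq_norm, ← integral_sub hf (hint' g)]
    refine (norm_integral_le_of_norm_le_const (Eventually.of_forall fun ω => hfg (Z ω))).trans ?_
    simp
  have h3 := hN k hk
  have h4 := dist_triangle4 (∫ ω, f (Y k ω) ∂μ) (∫ ω, g (Y k ω) ∂μ) (∫ ω, g (Z ω) ∂μ')
    (∫ ω, f (Z ω) ∂μ')
  linarith

end General

variable {ν : Measure ℕ} [IsProbabilityMeasure ν] {α c₁ : ℝ}

/-! ### Joint convergence of the rescaled bushes and the threshold ratios -/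

/-- A sequence of pairs in the unit square. -/
abbrev Cube (J : ℕ) : Type := Fin J → unitInterval × unitInterval

/-- A monomial on a cube. -/
def monomial {J : ℕ} (n m : Fin J → ℕ) : C(Cube J, ℝ) where
  toFun x := ∏ j, ((x j).1 : ℝ) ^ n j * ((x j).2 : ℝ) ^ m j
  continuous_toFun := by fun_prop

lemma factor_nonneg {J : ℕ} (n m : Fin J → ℕ) (x : Cube J) (j : Fin J) :
    0 ≤ ((x j).1 : ℝ) ^ n j * ((x j).2 : ℝ) ^ m j :=
  mul_nonneg (pow_nonneg (x j).1.2.1 _) (pow_nonneg (x j).2.2.1 _)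

lemma monomial_nonneg {J : ℕ} (n m : Fin J → ℕ) (x : Cube J) : 0 ≤ monomial n m x := by
  rw [monomial, ContinuousMap.coe_mk]
  exact Finset.prod_nonneg fun j _ => factor_nonneg n m x j

/-- The monomials on a cube. -/
def monomials (J : ℕ) : Submonoid C(Cube J, ℝ) where
  carrier := Set.range fun p : (Fin J → ℕ) × (Fin J → ℕ) => monomial p.1 p.2
  one_mem' := ⟨(0, 0), by ext x; simp [monomial]⟩
  mul_mem' := by
    rintro _ _ ⟨p, rfl⟩ ⟨p', rfl⟩
    refine ⟨(p.1 + p'.1, p.2 + p'.2), ?_⟩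
    ext x
    simp only [monomial, ContinuousMap.coe_mk, ContinuousMap.mul_apply, ← Finset.prod_mul_distrib,
      Pi.add_apply, pow_add]
    exact prod_congr rfl fun j _ => by ring

lemma monomials_separate {J : ℕ} (x y : Cube J) (hxy : x ≠ y) :
    ∃ f ∈ monomials J, f x ≠ f y := by
  obtain ⟨j, hj⟩ := Function.ne_iff.1 hxy
  have e1 : ∀ z : Cube J, monomial (Pi.single j 1) 0 z = (z j).1 := fun z => by
    simp only [monomial, ContinuousMap.coe_mk, Pi.zero_apply, pow_zero, mul_one]
    rw [Finset.prod_eq_single j]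
    · simp
    · intro i _ hi; simp [Pi.single_eq_of_ne hi]
    · simp
  have e2 : ∀ z : Cube J, monomial 0 (Pi.single j 1) z = (z j).2 := fun z => by
    simp only [monomial, ContinuousMap.coe_mk, Pi.zero_apply, pow_zero, one_mul]
    rw [Finset.prod_eq_single j]
    · simp
    · intro i _ hi; simp [Pi.single_eq_of_ne hi]
    · simp
  by_cases h1 : (x j).1 = (y j).1
  · refine ⟨_, ⟨(0, Pi.single j 1), rfl⟩, ?_⟩
    rw [e2, e2]
    exact fun h => hj (Prod.ext h1 (Subtype.ext h))
  · refine ⟨_, ⟨(Pi.single j 1, 0), rfl⟩, ?_⟩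
    rw [e1, e1]
    exact fun h => h1 (Subtype.ext h)

/-- The pair of a nonnegative number, mapped to the unit interval, and a ratio. -/
def toSquare (d r : ℝ) : unitInterval × unitInterval :=
  (Set.projIcc 0 1 zero_le_one (exp (-d)), Set.projIcc 0 1 zero_le_one r)

lemma continuous_toSquare : Continuous fun p : ℝ × ℝ => toSquare p.1 p.2 := by
  unfold toSquare
  exact (continuous_projIcc.comp (Real.continuous_exp.comp continuous_fst.neg)).prodMk
    (continuous_projIcc.comp continuous_snd)

lemma toSquare_fst {d r : ℝ} (hd : 0 ≤ d) : ((toSquare d r).1 : ℝ) = exp (-d) := by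
  rw [toSquare, Set.projIcc_of_mem zero_le_one
    ⟨(exp_pos _).le, exp_le_one_iff.2 (by linarith)⟩]

lemma toSquare_snd {d r : ℝ} (hr : r ∈ Icc (0 : ℝ) 1) : ((toSquare d r).2 : ℝ) = r := by
  rw [toSquare, Set.projIcc_of_mem zero_le_one hr]

lemma ratio_mem (η : Config) : R (next η) / R η ∈ Icc (0 : ℝ) 1 :=
  ⟨div_nonneg (R_nonneg _) (R_nonneg _), div_le_one_of_le₀ (R_next_le η) (R_nonneg _)⟩

/-- The rescaled bushes and the threshold ratios at the first vertices of the backbone. -/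
def window (α : ℝ) (J : ℕ) (η : Config) : Cube J := fun j =>
  toSquare (scaledBush α (next^[j] η)) (R (next (next^[j] η)) / R (next^[j] η))

lemma measurable_window (J : ℕ) : Measurable (window α J) :=
  measurable_pi_lambda _ fun j => continuous_toSquare.measurable.comp
    ((measurable_scaledBush.comp (measurable_iterate_next j)).prodMk
      ((measurable_R.comp (measurable_next.comp (measurable_iterate_next j))).div
        (measurable_R.comp (measurable_iterate_next j))))

/-- `Λ` gives the limiting rates of all edge functionals. -/
def RateLimit (ν : Measure ℕ) (α : ℝ) (Λ : ℝ → ℝ) : Prop := ∀ l, 0 ≤ l → 0 < Λ l ∧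
  ∀ q Q, EdgeFun q Q → Tendsto (fun s => (s - Q s) / s ^ (1 / (1 - α))) (𝓝[>] 0) (𝓝 l) →
    Tendsto (fun s => dphi ν (deficit ν q s) / dphi ν (s * theta ν s)) (𝓝[>] 0) (𝓝 (Λ l))

/-- The product of powers of the rescaled bushes and the threshold ratios along the backbone. -/
def backboneProd (α : ℝ) (n m : ℕ → ℕ) (J : ℕ) (η : Config) : ℝ≥0∞ :=
  ∏ j ∈ range J, (ofReal (exp (-(n j * scaledBush α (next^[j] η)))) *
    ofReal ((R (next (next^[j] η)) / R (next^[j] η)) ^ (m j : ℝ)))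

lemma measurable_backboneProd (n m : ℕ → ℕ) (J : ℕ) : Measurable (backboneProd α n m J) := by
  refine Finset.measurable_fun_prod _ fun j _ => ?_
  have h1 : Measurable fun η => ofReal (exp (-(n j * scaledBush α (next^[j] η)))) :=
    (measurable_exp.comp ((measurable_scaledBush.comp
      (measurable_iterate_next j)).const_mul _).neg).ennreal_ofReal
  have h2 : Measurable fun η => ofReal ((R (next (next^[j] η)) / R (next^[j] η)) ^
      (m j : ℝ)) :=
    (((measurable_R.comp (measurable_next.comp (measurable_iterate_next j))).div
        (measurable_R.comp (measurable_iterate_next j))).pow_const _).ennreal_ofReal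
  exact h1.mul h2

lemma rootFree_backboneProd (n m : ℕ → ℕ) (J : ℕ) : RootFree (backboneProd α n m J) := fun η => by
  refine prod_congr rfl fun j _ => ?_
  have h1 : scaledBush α (next^[j] (keep {(true, [])}ᶜ η)) = scaledBush α (next^[j] η) :=
    rootFree_scaledBush.iterate j η
  have h2 : R (next^[j] (keep {(true, [])}ᶜ η)) = R (next^[j] η) := rootFree_R.iterate j η
  have h3 : R (next (next^[j] (keep {(true, [])}ᶜ η))) = R (next (next^[j] η)) :=
    (RootFree.comp_next R).iterate j η
  rw [h1, h2, h3]

lemma backboneProd_succ (n m : ℕ → ℕ) (J : ℕ) (η : Config) :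
    backboneProd α n m (J + 1) η = ofReal (exp (-(n 0 * scaledBush α η))) *
      ofReal ((R (next η) / R η) ^ (m 0 : ℝ)) *
        backboneProd α (fun j => n (j + 1)) (fun j => m (j + 1)) J (next η) := by
  rw [backboneProd, Finset.prod_range_succ', mul_comm]
  rfl

lemma backboneProd_le_one {η : Config} (h : ∀ j, NoTie (next^[j] η)) (n m : ℕ → ℕ) (J : ℕ) :
    backboneProd α n m J η ≤ 1 := by
  refine Finset.prod_le_one' fun j _ => mul_le_one' (ofReal_le_one.2
    (exp_le_one_iff.2 ?_)) (ofReal_le_one.2 ?_)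
  · have := mul_nonneg (n j).cast_nonneg (scaledBush_nonneg (α := α) (h j))
    linarith
  · exact rpow_le_one (ratio_mem _).1 (ratio_mem _).2 (m j).cast_nonneg

/-- Induction along the backbone with `asymp_step`. The bush weight at parameter `n j` has the
scaled first moment `n j / 2`, hence the argument of `Λ`. -/
lemma Regular.asymp_backboneProd (h : Regular ν α c₁) {Λ : ℝ → ℝ} (hΛ : RateLimit ν α Λ)
    (n m : ℕ → ℕ) (J : ℕ) : Asymp ν (backboneProd α n m J)
      (∏ j ∈ range J, (Λ (n j / 2) * ratioMoment α (m j))) := by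
  induction J generalizing n m with
  | zero =>
    have : backboneProd α n m 0 = fun _ => 1 := funext fun η => by simp [backboneProd]
    rw [this, Finset.prod_range_zero]
    exact asymp_one
  | succ J ih =>
    obtain ⟨Q, -, hq, hQ, -⟩ := h.exists_edgeFun_weight (n 0).cast_nonneg
    obtain ⟨h1, h2⟩ := hΛ (n 0 / 2) (by positivity)
    have h3 := h.asymp_step hq h1 (h2 _ _ hq hQ) (m 0).cast_nonneg
      (measurable_backboneProd (fun j => n (j + 1)) (fun j => m (j + 1)) J)
      (rootFree_backboneProd _ _ J) (Finset.prod_pos fun j _ => mul_pos (hΛ _ (by positivity)).1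
        (ratioMoment_pos h (Nat.cast_nonneg _))) (ih (fun j => n (j + 1)) fun j => m (j + 1))
    rw [Finset.prod_range_succ', mul_comm]
    refine h3.congr ?_
    filter_upwards [ae_noTie h.zero h.two] with η hη
    rw [backboneProd_succ, bushProd_scaledBush hη]

lemma Regular.tendsto_integral_monomial (h : Regular ν α c₁) {Λ : ℝ → ℝ} (hΛ : RateLimit ν α Λ)
    {J : ℕ} (n m : Fin J → ℕ) :
    Tendsto (fun k => ∫ η, monomial n m (window α J (next^[k] η)) ∂law ν) atTop
      (𝓝 (∏ j, (Λ (n j / 2) * ratioMoment α (m j)))) := by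
  set n' : ℕ → ℕ := fun j => if hj : j < J then n ⟨j, hj⟩ else 0
  set m' : ℕ → ℕ := fun j => if hj : j < J then m ⟨j, hj⟩ else 0
  have en : ∀ j : Fin J, n' j = n j := fun j => by simp [n']
  have em : ∀ j : Fin J, m' j = m j := fun j => by simp [m']
  have hnt : ∀ᵐ η ∂law ν, ∀ j, NoTie (next^[j] η) := ae_all_iff.2 fun j =>
    ae_iterate h.zero h.two (ae_noTie h.zero h.two) j
  have hpos : 0 < ∏ j ∈ range J, (Λ (n' j / 2) * ratioMoment α (m' j)) :=
    Finset.prod_pos fun j _ => mul_pos (hΛ _ (by positivity)).1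
      (ratioMoment_pos h (Nat.cast_nonneg _))
  have h1 := h.tendsto_of_asymp (measurable_backboneProd n' m' J) (rootFree_backboneProd n' m' J)
    (by filter_upwards [hnt] with η hη using backboneProd_le_one hη n' m' J) hpos
    (h.asymp_backboneProd hΛ n' m' J)
  have h2 := (ENNReal.tendsto_toReal ofReal_ne_top).comp h1
  rw [ENNReal.toReal_ofReal hpos.le, ← Fin.prod_univ_eq_prod_range
    (fun j => Λ (n' j / 2) * ratioMoment α (m' j))] at h2
  simp only [en, em] at h2
  refine h2.congr fun k => ?_
  rw [Function.comp_apply, integral_eq_lintegral_of_nonneg_ae]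
  · congr 1
    refine lintegral_congr_ae (ae_iterate h.zero h.two (p := fun η => backboneProd α n' m' J η =
      ofReal (monomial n m (window α J η))) ?_ k)
    filter_upwards [hnt] with η hη
    simp only [monomial, ContinuousMap.coe_mk]
    rw [ENNReal.ofReal_prod_of_nonneg (fun j _ => factor_nonneg n m (window α J η) j), backboneProd, ← Fin.prod_univ_eq_prod_range
      (fun j => ofReal (exp (-(n' j * scaledBush α (next^[j] η)))) *
        ofReal ((R (next (next^[j] η)) / R (next^[j] η)) ^ (m' j : ℝ)))]
    refine prod_congr rfl fun j _ => ?_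
    rw [window, toSquare_fst (scaledBush_nonneg (hη j)), toSquare_snd (ratio_mem _), en, em,
      ← ofReal_mul (exp_pos _).le, ← Real.exp_nat_mul, Real.rpow_natCast, mul_neg]
  · exact Eventually.of_forall fun η => monomial_nonneg n m _
  · exact ((monomial n m).continuous.measurable.comp ((measurable_window J).comp
      (measurable_iterate_next k))).aestronglyMeasurable

/-! ### The limiting ratios -/

lemma isProbabilityMeasure_ratioLaw (hα : 0 ≤ α) (hα1 : α ≤ 1) :
    IsProbabilityMeasure (ratioLaw α) := by
  refine ⟨?_⟩
  have hm : Measurable fun u : ℝ => u ^ ((1 - α) / α) := measurable_id.pow_const _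
  rw [ratioLaw, Measure.add_apply, Measure.smul_apply, Measure.smul_apply,
    Measure.map_apply hm MeasurableSet.univ]
  simp only [measure_univ, smul_eq_mul, mul_one, Set.preimage_univ, Measure.restrict_apply_univ,
    Real.volume_Icc, sub_zero, ENNReal.ofReal_one]
  rw [← ofReal_add hα (by linarith)]
  simp

lemma ae_ratioLaw_mem (hα : 0 < α) (hα1 : α < 1) : ∀ᵐ x ∂(ratioLaw α), x ∈ Icc (0 : ℝ) 1 := by
  have hm : Measurable fun u : ℝ => u ^ ((1 - α) / α) := measurable_id.pow_const _
  rw [ratioLaw, ae_add_measure_iff]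
  constructor
  · refine Measure.ae_smul_measure ?_ _
    exact (ae_dirac_iff (p := fun x => x ∈ Icc (0 : ℝ) 1) measurableSet_Icc).2
      ⟨zero_le_one, le_rfl⟩
  · refine Measure.ae_smul_measure ?_ _
    refine (ae_map_iff (p := fun x => x ∈ Icc (0 : ℝ) 1) hm.aemeasurable measurableSet_Icc).2 ?_
    filter_upwards [ae_restrict_mem measurableSet_Icc] with u hu
    exact ⟨rpow_nonneg hu.1 _, rpow_le_one hu.1 hu.2 (div_nonneg (by linarith) hα.le)⟩

/-- Matches the moments found along the backbone with those of the mixture law of `P_i`. -/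
lemma integral_ratioLaw (hα : 0 < α) (hα1 : α < 1) {κ : ℝ} (hκ : 0 ≤ κ) :
    ∫ x, x ^ κ ∂(ratioLaw α) = ratioMoment α κ := by
  have h1α : 0 < 1 - α := by linarith
  have hm : Measurable fun u : ℝ => u ^ ((1 - α) / α) := measurable_id.pow_const _
  have hk : Measurable fun u : ℝ => u ^ κ := measurable_id.pow_const _
  have hi : Integrable (fun x : ℝ => x ^ κ) (ratioLaw α) := by
    have := isProbabilityMeasure_ratioLaw hα.le hα1.le
    refine Integrable.of_bound (C := 1) hk.aestronglyMeasurable ?_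
    filter_upwards [ae_ratioLaw_mem hα hα1] with x hx
    rw [norm_of_nonneg (rpow_nonneg hx.1 _)]
    exact rpow_le_one hx.1 hx.2 hκ
  rw [ratioLaw] at hi ⊢
  rw [integral_add_measure hi.left_of_add_measure hi.right_of_add_measure, integral_smul_measure,
    integral_smul_measure, integral_dirac, integral_map hm.aemeasurable hk.aestronglyMeasurable,
    ENNReal.toReal_ofReal hα.le, ENNReal.toReal_ofReal h1α.le, Real.one_rpow, smul_eq_mul,
    smul_eq_mul, mul_one, ratioMoment]
  congr 2
  have he : 0 ≤ (1 - α) / α * κ := mul_nonneg (div_nonneg h1α.le hα.le) hκ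
  rw [integral_Icc_eq_integral_Ioc, ← intervalIntegral.integral_of_le zero_le_one,
    intervalIntegral.integral_congr (g := fun u : ℝ => u ^ ((1 - α) / α * κ)),
    integral_rpow (Or.inl (by linarith)), Real.one_rpow, zero_rpow (by linarith)]
  · field_simp
    ring
  · intro u hu
    rw [Set.uIcc_of_le zero_le_one] at hu
    exact (Real.rpow_mul hu.1 _ _).symm

variable {Ω' Ω'' : Type*} [MeasurableSpace Ω'] {μ' : Measure Ω'} [IsProbabilityMeasure μ']
  [MeasurableSpace Ω''] {μ'' : Measure Ω''} [IsProbabilityMeasure μ''] {Z : Ω' → ℝ}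

/-- The joint law of the rescaled bushes and the threshold ratios converges to a product law. -/
lemma Regular.tendsto_window (h : Regular ν α c₁)
    (hΛ : RateLimit ν α fun l => ∫ ω, exp (-l * Z ω) ∂μ') (hZ : AEMeasurable Z μ')
    (hZ0 : ∀ᵐ ω ∂μ', 0 ≤ Z ω) {J : ℕ} {P Zc : Fin J → Ω'' → ℝ}
    (hP : ∀ i, HasLaw (P i) (ratioLaw α) μ'') (hZc : ∀ j, HasLaw (Zc j) (μ'.map Z) μ'')
    (hind : iIndepFun (Sum.elim P Zc) μ'') :
    TendstoInDistribution (fun k η => window α J (next^[k] η)) atTop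
      (fun ω j => toSquare (Zc j ω / 2) (P j ω)) (fun _ => law ν) μ'' := by
  have hm : ∀ i, AEMeasurable (Sum.elim P Zc i) μ'' := by
    rintro (i | i)
    · exact (hP i).aemeasurable
    · exact (hZc i).aemeasurable
  refine tendstoInDistribution_of_submonoid
    (fun k => ((measurable_window J).comp (measurable_iterate_next k)).aemeasurable)
    (aemeasurable_pi_lambda _ fun j => continuous_toSquare.measurable.comp_aemeasurable
      (((hZc j).aemeasurable.div_const 2).prodMk (hP j).aemeasurable)) (monomials J)
    monomials_separate ?_
  rintro _ ⟨⟨n, m⟩, rfl⟩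
  -- What is left is that the independent limit has the same mixed moments: a power of `exp(-Z/2)`
  -- has the Laplace transform of `Z` as its mean.
  convert h.tendsto_integral_monomial hΛ n m using 2
  have hP01 : ∀ᵐ ω ∂μ'', ∀ j, P j ω ∈ Icc (0 : ℝ) 1 := ae_all_iff.2 fun j => by
    have := ae_ratioLaw_mem h.pos h.lt_one
    rw [← (hP j).map_eq] at this
    exact ae_of_ae_map (hP j).aemeasurable this
  have hZc0 : ∀ᵐ ω ∂μ'', ∀ j, 0 ≤ Zc j ω := ae_all_iff.2 fun j => by
    have : ∀ᵐ x ∂(μ'.map Z), 0 ≤ x := (ae_map_iff hZ measurableSet_Ici).2 hZ0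
    rw [← (hZc j).map_eq] at this
    exact ae_of_ae_map (hZc j).aemeasurable this
  set f : Fin J ⊕ Fin J → ℝ → ℝ := Sum.elim (fun j x => x ^ m j)
    (fun j x => exp (-(n j / 2) * x)) with hf
  have hfm : ∀ i, Measurable (f i) := by
    rintro (j | j)
    · exact measurable_id.pow_const _
    · exact measurable_exp.comp (measurable_id.const_mul _)
  have h1 := hind.integral_fun_prod_comp (f := f) hm (fun i => (hfm i).aestronglyMeasurable)
  rw [Fintype.prod_sum_type] at h1
  simp only [Fintype.prod_sum_type, hf, Sum.elim_inl, Sum.elim_inr] at h1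
  rw [Finset.prod_mul_distrib]
  have e1 : ∀ j, ∫ ω, P j ω ^ m j ∂μ'' = ratioMoment α (m j) := fun j => by
    have hk : Measurable fun x : ℝ => x ^ (m j : ℝ) := measurable_id.pow_const _
    rw [← integral_ratioLaw h.pos h.lt_one (m j).cast_nonneg, ← (hP j).map_eq,
      integral_map (hP j).aemeasurable hk.aestronglyMeasurable]
    simp
  have e2 : ∀ j, ∫ ω, exp (-(n j / 2) * Zc j ω) ∂μ'' =
      ∫ ω, exp (-(n j / 2) * Z ω) ∂μ' := fun j => by
    have hme : Measurable fun x : ℝ => exp (-((n j : ℝ) / 2) * x) :=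
      measurable_exp.comp (measurable_id.const_mul _)
    rw [← integral_map (hZc j).aemeasurable hme.aestronglyMeasurable, (hZc j).map_eq,
      integral_map hZ hme.aestronglyMeasurable]
  simp only [e1, e2] at h1
  rw [mul_comm, ← h1]
  refine integral_congr_ae ?_
  filter_upwards [hP01, hZc0] with ω h2 h3
  simp only [monomial, ContinuousMap.coe_mk]
  rw [← Finset.prod_mul_distrib]
  refine prod_congr rfl fun j _ => ?_
  rw [toSquare_fst (by linarith [h3 j]), toSquare_snd (h2 j), mul_comm, ← Real.exp_nat_mul]
  congr 2
  ring

end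

section

/-! ### Approximation and change of space for convergence in distribution -/

section General

variable {Ω Ω' : Type*} [MeasurableSpace Ω] [MeasurableSpace Ω'] {μ : Measure Ω}
  [IsProbabilityMeasure μ] {μ' : Measure Ω'} [IsProbabilityMeasure μ']

/-- Convergence in distribution of variables with convergent approximations. -/
lemma tendstoInDistribution_of_approx {E : Type*} [PseudoMetricSpace E] [MeasurableSpace E]
    [OpensMeasurableSpace E] {Y : ℕ → Ω → E} {X : ℕ → ℕ → Ω → E} {V : ℕ → Ω' → E} {Z : Ω' → E}
    (hY : ∀ k, AEMeasurable (Y k) μ) (hZ : AEMeasurable Z μ')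
    (hX : ∀ᶠ J in atTop, TendstoInDistribution (X J) atTop (V J) (fun _ => μ) μ')
    (hV : ∀ᵐ ω ∂μ', Tendsto (fun J => V J ω) atTop (𝓝 (Z ω)))
    (h : ∀ ε : ℝ, 0 < ε → ∀ᶠ J in atTop, ∀ᶠ k in atTop,
      ∫⁻ ω, ofReal (min 1 (dist (Y k ω) (X J k ω))) ∂μ ≤ ofReal ε) :
    TendstoInDistribution Y atTop Z (fun _ => μ) μ' := by
  refine ⟨hY, hZ, tendsto_iff_forall_lipschitz_integral_tendsto.2 ?_⟩
  rintro f ⟨C, hC⟩ ⟨L, hL⟩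
  simp only [ProbabilityMeasure.coe_mk]
  have hC0 : 0 ≤ C := by
    obtain ⟨ω⟩ : Nonempty Ω := nonempty_of_isProbabilityMeasure μ
    exact dist_nonneg.trans (hC (Y 0 ω) (Y 0 ω))
  set F := BoundedContinuousFunction.mkOfBound ⟨f, hL.continuous⟩ C hC with hF
  rw [integral_map hZ hL.continuous.measurable.aestronglyMeasurable]
  have hYi : ∀ k, ∫ x, f x ∂(μ.map (Y k)) = ∫ ω, F (Y k ω) ∂μ := fun k =>
    integral_map (hY k) hL.continuous.measurable.aestronglyMeasurable
  simp only [hYi]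
  have hint : ∀ (Y' : Ω → E), AEMeasurable Y' μ → Integrable (fun ω => F (Y' ω)) μ := fun Y' hY' =>
    Integrable.of_bound (C := ‖F‖) (F.continuous.measurable.comp_aemeasurable
      hY').aestronglyMeasurable (Eventually.of_forall fun ω => F.norm_coe_le_norm _)
  have hVF : Tendsto (fun J => ∫ ω, F (V J ω) ∂μ') atTop (𝓝 (∫ ω, F (Z ω) ∂μ')) := by
    obtain ⟨J₀, hJ₀⟩ := eventually_atTop.1 hX
    refine (tendsto_add_atTop_iff_nat J₀).1 (tendsto_integral_of_dominated_convergence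
      (fun _ => ‖F‖) (fun J => (F.continuous.measurable.comp_aemeasurable
        (hJ₀ (J + J₀) (by omega)).aemeasurable_limit).aestronglyMeasurable) (integrable_const _)
      (fun J => Eventually.of_forall fun ω => F.norm_coe_le_norm _) ?_)
    filter_upwards [hV] with ω hω
    exact (tendsto_add_atTop_iff_nat J₀).2 ((F.continuous.tendsto _).comp hω)
  refine Metric.tendsto_atTop'.2 fun δ hδ => ?_
  -- `C` bounds the oscillation of `f` and `L` its Lipschitz constant, so differences of `f` are at
  -- most `c * min 1 dist`.
  set c : ℝ := max (max C L) 1 with hc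
  have hc0 : 0 < c := lt_max_of_lt_right one_pos
  obtain ⟨J, h1, h2, h3⟩ := (hX.and ((h (δ / (4 * c)) (by positivity)).and
    (hVF.eventually (Metric.ball_mem_nhds _ (show 0 < δ / 4 by positivity))))).exists
  have h4 := (tendsto_integral_of_tendstoInDistribution h1 F).eventually
    (Metric.ball_mem_nhds _ (show 0 < δ / 4 by positivity))
  obtain ⟨N, hN⟩ := eventually_atTop.1 (h2.and h4)
  refine ⟨N, fun k hk => ?_⟩
  obtain ⟨h5, h6⟩ := hN k hk.le
  have h7 : dist (∫ ω, F (Y k ω) ∂μ) (∫ ω, F (X J k ω) ∂μ) ≤ δ / 4 := by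
    rw [dist_eq_norm, ← integral_sub (hint _ (hY k)) (hint _ (h1.forall_aemeasurable k))]
    refine (norm_integral_le_lintegral_norm _).trans (ENNReal.toReal_le_of_le_ofReal
      (by positivity) ?_)
    calc _ ≤ ∫⁻ ω, ofReal c * ofReal (min 1 (dist (Y k ω) (X J k ω))) ∂μ := by
          refine lintegral_mono fun ω => ?_
          rw [← ofReal_mul hc0.le]
          refine ofReal_le_ofReal ?_
          rw [← dist_eq_norm, mul_min_of_nonneg _ _ hc0.le, mul_one]
          refine le_min ((hC _ _).trans ((le_max_left _ _).trans (le_max_left _ _)))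
            ((hL.dist_le_mul _ _).trans ?_)
          gcongr
          exact (le_max_right _ _).trans (le_max_left _ _)
      _ ≤ ofReal c * ofReal (δ / (4 * c)) := by
          rw [lintegral_const_mul' _ _ ofReal_ne_top]
          gcongr
      _ = _ := by
          rw [← ofReal_mul hc0.le]
          congr 1
          field_simp
  have h8 := dist_triangle4 (∫ ω, F (Y k ω) ∂μ) (∫ ω, F (X J k ω) ∂μ) (∫ ω, F (V J ω) ∂μ')
    (∫ ω, F (Z ω) ∂μ')
  change dist (∫ ω, F (Y k ω) ∂μ) (∫ ω, F (Z ω) ∂μ') < δ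
  linarith

/-- Convergence in distribution can be checked after a map that induces the topology on a set in
which all variables lie. -/
lemma tendstoInDistribution_of_isInducing {E E' : Type*} [TopologicalSpace E] [MeasurableSpace E]
    [OpensMeasurableSpace E] [TopologicalSpace E'] [MeasurableSpace E'] [OpensMeasurableSpace E']
    [HasOuterApproxClosed E'] {Y : ℕ → Ω → E} {Z : Ω' → E} {φ : E → E'} {A : Set E}
    (hφ : Topology.IsInducing (A.domRestrict φ))
    (hY : ∀ k, AEMeasurable (Y k) μ) (hZ : AEMeasurable Z μ') (hYA : ∀ k, ∀ᵐ ω ∂μ, Y k ω ∈ A)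
    (hZA : ∀ᵐ ω ∂μ', Z ω ∈ A)
    (h : TendstoInDistribution (fun k ω => φ (Y k ω)) atTop (fun ω => φ (Z ω)) (fun _ => μ) μ') :
    TendstoInDistribution Y atTop Z (fun _ => μ) μ' := by
  refine ⟨hY, hZ, tendsto_of_forall_isOpen_le_liminf' fun G hG => ?_⟩
  obtain ⟨O, hO, hOG⟩ := hφ.isOpen_iff.1 (hG.preimage continuous_subtype_val)
  have hmem : ∀ x ∈ A, φ x ∈ O ↔ x ∈ G := fun x hx => by
    have := congrArg (fun s => (⟨x, hx⟩ : A) ∈ s) hOG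
    simpa using this
  -- Portmanteau for open sets: within `A` every open set is the preimage of an open set under `φ`,
  -- and nothing outside `A` is charged.
  have h1 := ProbabilityMeasure.le_liminf_measure_open_of_tendsto h.tendsto hO
  simp only [ProbabilityMeasure.coe_mk] at h1 ⊢
  rw [Measure.map_apply_of_aemeasurable hZ hG.measurableSet]
  rw [Measure.map_apply_of_aemeasurable h.aemeasurable_limit hO.measurableSet] at h1
  have e1 : μ' (Z ⁻¹' G) = μ' ((fun ω => φ (Z ω)) ⁻¹' O) := measure_congr (by
    filter_upwards [hZA] with ω hω
    exact propext (hmem _ hω).symm)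
  have e2 : ∀ k, μ.map (Y k) G = μ.map (fun ω => φ (Y k ω)) O := fun k => by
    rw [Measure.map_apply_of_aemeasurable (hY k) hG.measurableSet,
      Measure.map_apply_of_aemeasurable (h.forall_aemeasurable k) hO.measurableSet]
    refine measure_congr ?_
    filter_upwards [hYA k] with ω hω
    exact propext (hmem _ hω).symm
  rw [e1]
  simp only [e2]
  exact h1

end General

variable {ν : Measure ℕ} [IsProbabilityMeasure ν] {α c₁ : ℝ}

/-- The sequences of pairs of a nonnegative number and a number in the unit interval. -/
def admissible (J : ℕ) : Set (Fin J → ℝ × ℝ) :=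
  {x | ∀ j, 0 ≤ (x j).1 ∧ (x j).2 ∈ Icc (0 : ℝ) 1}

/-- On nonnegative numbers `exp(-d)` is positive and `-log` inverts it continuously. Hence
convergence on the compact cube transfers back to the unbounded variables. -/
lemma isInducing_toSquare (J : ℕ) : Topology.IsInducing
    ((admissible J).domRestrict fun x j => toSquare (x j).1 (x j).2) := by
  set f : admissible J → Cube J := (admissible J).domRestrict fun x j => toSquare (x j).1 (x j).2 with hf
  have hfc : Continuous f := by
    have hj : ∀ j, Continuous fun x : admissible J => x.1 j := fun j =>
      (continuous_apply j).comp continuous_subtype_val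
    have hjs : ∀ j, Continuous fun x : admissible J => toSquare (x.1 j).1 (x.1 j).2 := fun j =>
      continuous_toSquare.comp (hj j)
    exact continuous_pi hjs
  refine Topology.isInducing_iff_nhds.2 fun x => le_antisymm (hfc.tendsto x).le_comap ?_
  suffices hg : ∀ j, Tendsto (fun y : admissible J => y.1 j) (comap f (𝓝 (f x))) (𝓝 (x.1 j)) from
    tendsto_id'.1 (tendsto_subtype_rng.2 (tendsto_pi_nhds.2 hg))
  intro j
  have h0 : Tendsto f (comap f (𝓝 (f x))) (𝓝 (f x)) := tendsto_comap
  have h1 := tendsto_pi_nhds.1 h0 j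
  have e1 : ∀ y : admissible J, -Real.log ((f y j).1 : ℝ) = (y.1 j).1 := fun y => by
    simp only [hf, Set.domRestrict_apply]
    rw [toSquare_fst (y.2 j).1, Real.log_exp, neg_neg]
  have e2 : ∀ y : admissible J, ((f y j).2 : ℝ) = (y.1 j).2 := fun y => by
    simp only [hf, Set.domRestrict_apply]
    rw [toSquare_snd (y.2 j).2]
  have hne : ((f x j).1 : ℝ) ≠ 0 := by
    simp only [hf, Set.domRestrict_apply]
    rw [toSquare_fst (x.2 j).1]
    exact (exp_pos _).ne'
  have h2 := ((continuous_subtype_val.tendsto _).comp ((continuous_fst.tendsto _).comp h1)).log hne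
  have h3 := (continuous_subtype_val.tendsto _).comp ((continuous_snd.tendsto _).comp h1)
  have h4 := h2.neg.prodMk_nhds h3
  simp only [Function.comp_apply, e1, e2] at h4
  exact h4

/-- The rescaled bushes and the threshold ratios at the first vertices of the backbone. -/
def bushWindow (α : ℝ) (J : ℕ) (η : Config) : Fin J → ℝ × ℝ := fun j =>
  (scaledBush α (next^[j] η), R (next (next^[j] η)) / R (next^[j] η))

lemma measurable_bushWindow (J : ℕ) : Measurable (bushWindow α J) :=
  measurable_pi_lambda _ fun j => (measurable_scaledBush.comp (measurable_iterate_next j)).prodMk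
    ((measurable_R.comp (measurable_next.comp (measurable_iterate_next j))).div
      (measurable_R.comp (measurable_iterate_next j)))

section Window

variable {Ω' Ω'' : Type*} [MeasurableSpace Ω'] {μ' : Measure Ω'} [IsProbabilityMeasure μ']
  [MeasurableSpace Ω''] {μ'' : Measure Ω''} [IsProbabilityMeasure μ''] {Z : Ω' → ℝ}

lemma ae_mem_of_hasLaw_ratioLaw (hα : 0 < α) (hα1 : α < 1) {ι : Type*} [Countable ι]
    {P : ι → Ω'' → ℝ} (hP : ∀ i, HasLaw (P i) (ratioLaw α) μ'') :
    ∀ᵐ ω ∂μ'', ∀ j, P j ω ∈ Icc (0 : ℝ) 1 := ae_all_iff.2 fun j => by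
  have := ae_ratioLaw_mem hα hα1
  rw [← (hP j).map_eq] at this
  exact ae_of_ae_map (hP j).aemeasurable this

lemma ae_nonneg_of_hasLaw (hZ : AEMeasurable Z μ') (hZ0 : ∀ᵐ ω ∂μ', 0 ≤ Z ω) {ι : Type*}
    [Countable ι] {Zc : ι → Ω'' → ℝ} (hZc : ∀ j, HasLaw (Zc j) (μ'.map Z) μ'') :
    ∀ᵐ ω ∂μ'', ∀ j, 0 ≤ Zc j ω := ae_all_iff.2 fun j => by
  have : ∀ᵐ x ∂(μ'.map Z), 0 ≤ x := (ae_map_iff hZ measurableSet_Ici).2 hZ0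
  rw [← (hZc j).map_eq] at this
  exact ae_of_ae_map (hZc j).aemeasurable this

lemma Regular.tendsto_bushWindow (h : Regular ν α c₁)
    (hΛ : RateLimit ν α fun l => ∫ ω, exp (-l * Z ω) ∂μ') (hZ : AEMeasurable Z μ')
    (hZ0 : ∀ᵐ ω ∂μ', 0 ≤ Z ω) {J : ℕ} {P Zc : Fin J → Ω'' → ℝ}
    (hP : ∀ i, HasLaw (P i) (ratioLaw α) μ'') (hZc : ∀ j, HasLaw (Zc j) (μ'.map Z) μ'')
    (hind : iIndepFun (Sum.elim P Zc) μ'') :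
    TendstoInDistribution (fun k η => bushWindow α J (next^[k] η)) atTop
      (fun ω j => (Zc j ω / 2, P j ω)) (fun _ => law ν) μ'' := by
  refine tendstoInDistribution_of_isInducing (isInducing_toSquare J)
    (fun k => ((measurable_bushWindow J).comp (measurable_iterate_next k)).aemeasurable)
    (aemeasurable_pi_lambda _ fun j => ((hZc j).aemeasurable.div_const 2).prodMk
      (hP j).aemeasurable) (fun k => ?_) ?_ (h.tendsto_window hΛ hZ hZ0 hP hZc hind)
  · refine ae_iterate h.zero h.two (p := fun η => bushWindow α J η ∈ admissible J) ?_ k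
    have hnt : ∀ᵐ η ∂law ν, ∀ j, NoTie (next^[j] η) := ae_all_iff.2 fun j =>
      ae_iterate h.zero h.two (ae_noTie h.zero h.two) j
    filter_upwards [hnt] with η hη j
    exact ⟨scaledBush_nonneg (hη j), ratio_mem _⟩
  · filter_upwards [ae_mem_of_hasLaw_ratioLaw h.pos h.lt_one hP,
      ae_nonneg_of_hasLaw hZ hZ0 hZc] with ω h1 h2 j
    exact ⟨by linarith [h2 j], h1 j⟩

end Window

/-! ### The contribution of the early bushes -/

/-- The scaling makes the first-moment bound at most `l/2` at every level, so the estimate is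
uniform in the vertex: the rescaled bushes are tight along the backbone. -/
lemma Regular.exists_lintegral_scaledBush_le (h : Regular ν α c₁) : ∃ K, 0 < K ∧ ∃ s₀, 0 < s₀ ∧
    ∀ s, s ≤ s₀ → ∀ l, 0 ≤ l → ∀ n, ∫⁻ η, (Iic s).indicator 1 (R (next^[n] η)) *
      ofReal (1 - exp (-(l * scaledBush α (next^[n] η)))) ∂law ν ≤
        ofReal (K * l) := by
  obtain ⟨K, hK, s₀, h0, h1, hle⟩ := h.exists_lintegral_le
  refine ⟨K, hK, s₀, h0, fun s hs l hl n => ?_⟩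
  obtain ⟨Q, hQm, hq, -, hQ⟩ := h.exists_edgeFun_weight hl
  have hd := measurable_dens (ν := ν) n (g := 1) measurable_one
  have hI : Measurable ((Iic s).indicator (1 : ℝ → ℝ≥0∞)) :=
    measurable_one.indicator measurableSet_Iic
  have hem : Measurable fun η => ofReal (1 - exp (-(l * scaledBush α η))) :=
    ((measurable_exp.comp (measurable_scaledBush.const_mul l).neg).const_sub 1).ennreal_ofReal
  set g : ℝ → ℝ≥0∞ := fun r => dens ν n 1 r * (Iic s).indicator 1 r with hg
  have hgm : Measurable g := hd.mul hI
  have hIem : Measurable fun η => (Iic s).indicator (1 : ℝ → ℝ≥0∞) (R η) *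
    ofReal (1 - exp (-(l * scaledBush α η))) := (hI.comp measurable_R).mul hem
  have hfree : RootFree fun η => (Iic s).indicator (1 : ℝ → ℝ≥0∞) (R η) *
      ofReal (1 - exp (-(l * scaledBush α η))) := fun η => by
    have h1 := rootFree_R η
    have h2 : scaledBush α (keep {(true, [])}ᶜ η) = scaledBush α η := rootFree_scaledBush η
    simp only [h1, h2]
  have e1 := lintegral_dens h.zero h.two n (g := 1) measurable_one hIem hfree
  have e0 := lintegral_dens h.zero h.two n (g := 1) measurable_one
    (K := fun η => (Iic s).indicator 1 (R η)) (hI.comp measurable_R)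
    (rootFree_R.comp_left fun r => (Iic s).indicator (1 : ℝ → ℝ≥0∞) r)
  simp only [Pi.one_apply, one_mul] at e1 e0
  have hg1 : ∫⁻ η, g (R η) ∂law ν ≤ 1 := by
    rw [hg, ← e0]
    have : ∫⁻ _, (1 : ℝ≥0∞) ∂law ν = 1 := by simp
    rw [← this]
    exact lintegral_mono fun η => Set.indicator_le_self' (f := (1 : ℝ → ℝ≥0∞))
      (fun _ _ => zero_le) _
  have h2 := hle _ _ hq hQm g hgm fun r hr => by
    rw [hg]
    simp only
    rw [Set.indicator_of_notMem (by simpa using hs.trans_lt hr), mul_zero]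
  rw [e1]
  calc _ = ∫⁻ η, g (R η) * ofReal (1 - exp (-(l * scaledBush α η))) ∂law ν :=
        lintegral_congr fun η => by rw [hg, mul_assoc]
    _ ≤ ∫⁻ η, g (R η) * ofReal (K * l) ∂law ν := by
        refine lintegral_one_sub_exp_le hgm (measurable_scaledBush.const_mul l) ?_
          (ne_top_of_le_ne_top ENNReal.one_ne_top hg1) (h2.trans (add_le_add
            (lintegral_mono_ae ?_) (lintegral_mono_ae ?_)))
        · filter_upwards [ae_noTie h.zero h.two] with η hη using mul_nonneg hl (scaledBush_nonneg hη)
        · filter_upwards [ae_noTie h.zero h.two] with η hη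
          rw [bushProd_scaledBush hη]
        · filter_upwards [h.ae_R_pos] with η hη
          gcongr
          exact (hQ _ hη).trans (by linarith)
    _ ≤ _ := by
        rw [lintegral_mul_const' _ _ ofReal_ne_top]
        exact mul_le_of_le_one_left (zero_le) hg1

/-- The contraction applied to the density at vertex `n`, tilted by `r^(-κ)`, so that its `κ`-th
moment is at most `1`. -/
lemma Regular.exists_lintegral_ratio_le (h : Regular ν α c₁) {κ : ℝ} (hκ : 0 < κ) :
    ∃ ρ, 0 < ρ ∧ ρ < 1 ∧ ∃ s₀, 0 < s₀ ∧ ∀ s, s ≤ s₀ → ∀ n j,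
      ∫⁻ η, (Iic s).indicator 1 (R (next^[n] η)) *
        ofReal ((R (next^[j] (next^[n] η)) / R (next^[n] η)) ^ κ) ∂law ν ≤
        ofReal ρ ^ j := by
  obtain ⟨ρ, hρ0, hρ1, s₀, h0, hcon⟩ := h.exists_contraction hκ
  refine ⟨ρ, hρ0, hρ1, s₀, h0, fun s hs n j => ?_⟩
  have hd := measurable_dens (ν := ν) n (g := 1) measurable_one
  have hI : Measurable ((Iic s).indicator (1 : ℝ → ℝ≥0∞)) :=
    measurable_one.indicator measurableSet_Iic
  have hkm : Measurable fun r : ℝ => ofReal (r ^ κ) :=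
    (measurable_id.pow_const _).ennreal_ofReal
  set g : ℝ → ℝ≥0∞ := fun r => dens ν n 1 r * (Iic s).indicator 1 r *
    ofReal (r ^ (-κ)) with hg
  have hgm : Measurable g := (hd.mul hI).mul (measurable_id.pow_const _).ennreal_ofReal
  have hKm : Measurable fun η => (Iic s).indicator (1 : ℝ → ℝ≥0∞) (R η) *
      ofReal ((R (next^[j] η) / R η) ^ κ) := by
    have h1 : Measurable fun η => ofReal ((R (next^[j] η) / R η) ^ κ) :=
      hkm.comp ((measurable_R.comp (measurable_iterate_next j)).div measurable_R)
    exact (hI.comp measurable_R).mul h1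
  have hfree : RootFree fun η => (Iic s).indicator (1 : ℝ → ℝ≥0∞) (R η) *
      ofReal ((R (next^[j] η) / R η) ^ κ) := fun η => by
    have h1 : R (next^[j] (keep {(true, [])}ᶜ η)) = R (next^[j] η) := rootFree_R.iterate j η
    have h2 := rootFree_R η
    simp only [h1, h2]
  have e1 := lintegral_dens h.zero h.two n (g := 1) measurable_one hKm hfree
  have e0 := lintegral_dens h.zero h.two n (g := 1) measurable_one
    (K := fun η => (Iic s).indicator 1 (R η)) (hI.comp measurable_R)
    (rootFree_R.comp_left fun r => (Iic s).indicator (1 : ℝ → ℝ≥0∞) r)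
  simp only [Pi.one_apply, one_mul] at e1 e0
  have hg1 : ∫⁻ η, g (R η) * ofReal (R η ^ κ) ∂law ν ≤ 1 := by
    calc _ = ∫⁻ η, dens ν n 1 (R η) * (Iic s).indicator 1 (R η) ∂law ν := by
          refine lintegral_congr_ae ?_
          filter_upwards [h.ae_R_pos] with η hη
          rw [hg]
          simp only
          rw [mul_assoc, ← ofReal_mul (rpow_nonneg hη.le _), ← Real.rpow_add hη,
            neg_add_cancel, Real.rpow_zero, ENNReal.ofReal_one, mul_one]
      _ = _ := e0.symm
      _ ≤ ∫⁻ _, (1 : ℝ≥0∞) ∂law ν := lintegral_mono fun η =>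
          Set.indicator_le_self' (f := (1 : ℝ → ℝ≥0∞)) (fun _ _ => zero_le) _
      _ = 1 := by simp
  have h2 := hcon g hgm (fun r hr => by
    rw [hg]
    simp only
    rw [Set.indicator_of_notMem (by simpa using hs.trans_lt hr), mul_zero, zero_mul])
    (ne_top_of_le_ne_top ENNReal.one_ne_top hg1) j
  rw [e1]
  calc _ = ∫⁻ η, g (R η) * ofReal (R (next^[j] η) ^ κ) ∂law ν := by
        refine lintegral_congr_ae ?_
        filter_upwards [h.ae_R_pos] with η hη
        rw [hg]
        simp only
        rw [mul_assoc _ _ (ofReal (R (next^[j] η) ^ κ)),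
          ← ofReal_mul (rpow_nonneg hη.le _), div_rpow (R_nonneg _) hη.le,
          Real.rpow_neg hη.le, div_eq_inv_mul, ← mul_assoc]
    _ ≤ _ := h2
    _ ≤ _ := mul_le_of_le_one_right (zero_le) hg1

/-- The rescaled weights of the early bushes are negligible. -/
lemma Regular.exists_lintegral_min_le (h : Regular ν α c₁) {κ : ℝ} (hκ : 0 < κ) :
    ∃ K, 0 < K ∧ ∃ σ, 0 < σ ∧ σ < 1 ∧ ∃ s₀, 0 < s₀ ∧ ∀ n j,
      ∫⁻ η, (Iic s₀).indicator 1 (R (next^[n] η)) * ofReal (min 1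
        ((R (next^[j] (next^[n] η)) / R (next^[n] η)) ^ κ * scaledBush α (next^[n] η))) ∂law ν ≤
        ofReal (K * σ ^ j) := by
  obtain ⟨K, hK, s₁, h1, hA⟩ := h.exists_lintegral_scaledBush_le
  obtain ⟨ρ, hρ0, hρ1, s₂, h2, hB⟩ := h.exists_lintegral_ratio_le hκ
  refine ⟨1 + 2 * K, by positivity, √ρ, Real.sqrt_pos.2 hρ0, by
    rw [Real.sqrt_lt' one_pos]; simpa using hρ1, min s₁ s₂, lt_min h1 h2, fun n j => ?_⟩
  -- The geometric mean scale balances the two errors: `ρ^j / l = l`, so each is of order `√ρ ^ j`.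
  set l := √ρ ^ j with hl
  have hl0 : 0 < l := pow_pos (Real.sqrt_pos.2 hρ0) j
  have hll : ρ ^ j = l * l := by rw [hl, ← mul_pow, Real.mul_self_sqrt hρ0.le]
  have hAn := hA _ (min_le_left s₁ s₂) l hl0.le n
  have hBn := hB _ (min_le_right s₁ s₂) n j
  set I : Config → ℝ≥0∞ := fun η => (Iic (min s₁ s₂)).indicator 1 (R (next^[n] η)) with hI
  set x : Config → ℝ := fun η => (R (next^[j] (next^[n] η)) / R (next^[n] η)) ^ κ with hx
  set D : Config → ℝ := fun η => scaledBush α (next^[n] η) with hD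
  have hIm : Measurable I := (measurable_one.indicator measurableSet_Iic).comp
    (measurable_R.comp (measurable_iterate_next n))
  have hxm : Measurable x := ((measurable_R.comp ((measurable_iterate_next j).comp
    (measurable_iterate_next n))).div (measurable_R.comp (measurable_iterate_next n))).pow_const _
  have hx0 : ∀ η, 0 ≤ x η := fun η => rpow_nonneg (div_nonneg (R_nonneg _) (R_nonneg _)) _
  -- If `D ≤ 1/l`, use `x D ≤ x/l`; if `D > 1/l`, then `1 - exp(-l D) ≥ 1/2` and the second term is
  -- at least `1`.
  have hpt : ∀ η, min 1 (x η * D η) ≤ l⁻¹ * x η + 2 * (1 - exp (-(l * D η))) ∨ D η < 0 := by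
    intro η
    by_cases hD0 : D η < 0
    · exact Or.inr hD0
    refine Or.inl ?_
    rw [not_lt] at hD0
    have hx0 := hx0 η
    have he : exp (-(l * D η)) ≤ 1 := exp_le_one_iff.2 (by have := mul_nonneg hl0.le hD0; linarith)
    rcases le_or_gt (D η) l⁻¹ with hle | hgt
    · refine (min_le_right _ _).trans ?_
      nlinarith
    · refine (min_le_left _ _).trans ?_
      have h3 : 1 < l * D η := by rwa [inv_lt_iff_one_lt_mul₀' hl0] at hgt
      have h4 : exp (-(l * D η)) ≤ exp (-1) := Real.exp_le_exp.2 (by linarith)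
      have h5 : exp (-1) ≤ 1 / 2 := by
        rw [Real.exp_neg, inv_le_comm₀ (exp_pos _) (by norm_num)]
        have := Real.add_one_le_exp (1 : ℝ)
        norm_num at this ⊢
        linarith
      have : 0 ≤ l⁻¹ * x η := mul_nonneg (by positivity) hx0
      linarith
  have hIx : Measurable fun η => ofReal l⁻¹ * (I η * ofReal (x η)) :=
    (hIm.mul hxm.ennreal_ofReal).const_mul _
  calc _ ≤ ∫⁻ η, (ofReal l⁻¹ * (I η * ofReal (x η)) +
        2 * (I η * ofReal (1 - exp (-(l * D η))))) ∂law ν := by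
        refine lintegral_mono_ae ?_
        filter_upwards [ae_iterate h.zero h.two (ae_noTie h.zero h.two) n] with η hη
        have hD0 : 0 ≤ D η := scaledBush_nonneg hη
        have h3 := (hpt η).resolve_right hD0.not_gt
        have he : exp (-(l * D η)) ≤ 1 := exp_le_one_iff.2 (by
          have := mul_nonneg hl0.le hD0
          linarith)
        calc I η * ofReal (min 1 (x η * D η)) ≤ I η * (ofReal l⁻¹ *
              ofReal (x η) + 2 * ofReal (1 - exp (-(l * D η)))) := by
              gcongr
              have h2 : (2 : ℝ≥0∞) = ofReal 2 := by simp
              rw [h2, ← ofReal_mul (by positivity), ← ofReal_mul (by norm_num),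
                ← ofReal_add (mul_nonneg (by positivity) (hx0 η)) (by linarith)]
              exact ofReal_le_ofReal h3
          _ = _ := by ring
    _ ≤ ofReal l⁻¹ * ofReal ρ ^ j + 2 * ofReal (K * l) := by
        rw [lintegral_add_left hIx, lintegral_const_mul' _ _ ofReal_ne_top,
          lintegral_const_mul' _ _ (by simp)]
        gcongr
    _ = _ := by
        have h2 : (2 : ℝ≥0∞) = ofReal 2 := by simp
        rw [← ENNReal.ofReal_pow hρ0.le, hll, ← ofReal_mul (by positivity), h2,
          ← ofReal_mul (by norm_num), ← ofReal_add (by positivity) (by positivity)]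
        congr 1
        field_simp

end

section

variable {ν : Measure ℕ} [IsProbabilityMeasure ν] {α c₁ : ℝ}

/-! ### The rescaled weights of the cut clusters -/

/-- The entry of a window at distance `u` from its end. -/
def fromEnd (J : ℕ) (x : Fin J → ℝ × ℝ) (u : ℕ) : ℝ × ℝ :=
  if h : J - u < J then x ⟨J - u, h⟩ else 0

lemma continuous_fromEnd (J u : ℕ) : Continuous fun x => fromEnd J x u := by
  by_cases h : J - u < J
  · simp only [fromEnd, h, dite_true]
    exact continuous_apply _
  · simp only [fromEnd, h, dite_false]
    exact continuous_const

lemma fromEnd_of_le {J u : ℕ} (x : ℕ → ℝ × ℝ) (h1 : 1 ≤ u) (h2 : u ≤ J) :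
    fromEnd J (fun j => x j) u = x (J - u) := by
  rw [fromEnd, dif_pos (by omega)]

/-- The contribution of the bush at distance `n` from the end of a window. -/
def windowTerm (κ : ℝ) (J : ℕ) (x : Fin J → ℝ × ℝ) (n : ℕ) : ℝ :=
  (∏ u ∈ Finset.Icc 1 n, (fromEnd J x u).2) ^ κ * (fromEnd J x n).1

lemma continuous_windowTerm {κ : ℝ} (hκ : 0 ≤ κ) (J n : ℕ) :
    Continuous fun x => windowTerm κ J x n := by
  have h1 : Continuous fun x => ∏ u ∈ Finset.Icc 1 n, (fromEnd J x u).2 :=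
    continuous_finsetProd _ fun u _ => continuous_snd.comp (continuous_fromEnd J u)
  exact (h1.rpow_const fun _ => Or.inr hκ).mul (continuous_fst.comp (continuous_fromEnd J n))

/-- The window covers the vertices `k - J` to `k - 1`, so the entry at distance `u` from the end is
the vertex `k - u`, and the threshold ratios telescope to `R_k / R_(k-n)`. With this `κ` the
rescaling by `R_(k-n)` cancels. -/
lemma windowTerm_bushWindow {κ : ℝ} (hκ : κ = α / (1 - α) - 1) {J n k : ℕ} (h1 : 1 ≤ n)
    (h2 : n ≤ J) (h3 : J ≤ k) {η : Config} (hη : ∀ j, 0 < R (next^[j] η)) :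
    windowTerm κ J (bushWindow α J (next^[k - J] η)) n =
      (R (next^[k] η) / R (next^[k - n] η)) ^ κ * scaledBush α (next^[k - n] η) ∧
    (R (next^[k] η) / R (next^[k - n] η)) ^ κ * scaledBush α (next^[k - n] η) =
      R (next^[k] η) ^ κ * bw (next^[k - n] η) := by
  have hiter : ∀ u, u ≤ J → next^[J - u] (next^[k - J] η) = next^[k - u] η := fun u hu => by
    rw [← Function.iterate_add_apply]
    congr 1
    omega
  have hfe : ∀ u, 1 ≤ u → u ≤ J → fromEnd J (bushWindow α J (next^[k - J] η)) u =
      (scaledBush α (next^[k - u] η), R (next^[k - u + 1] η) / R (next^[k - u] η)) :=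
    fun u hu1 hu2 => by
      have := fromEnd_of_le (J := J) (fun j => (scaledBush α (next^[j] (next^[k - J] η)),
        R (next (next^[j] (next^[k - J] η))) / R (next^[j] (next^[k - J] η)))) hu1 hu2
      rw [hiter u hu2, ← iterate_succ_apply' next] at this
      exact this
  have hprod : ∀ n, n ≤ J → ∏ u ∈ Finset.Icc 1 n,
      (fromEnd J (bushWindow α J (next^[k - J] η)) u).2 =
        R (next^[k] η) / R (next^[k - n] η) := fun n hn => by
    induction n with
    | zero => simp [div_self (hη k).ne']
    | succ n ih =>
      rw [Finset.prod_Icc_succ_top (by omega), ih (by omega), hfe _ (by omega) hn]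
      simp only
      rw [show k - (n + 1) + 1 = k - n by omega, div_mul_div_cancel₀ (hη _).ne']
  constructor
  · rw [windowTerm, hprod n h2, hfe n h1 h2]
  · rw [scaledBush, ← hκ, ← mul_assoc, div_rpow (hη _).le (hη _).le, div_mul_cancel₀]
    exact (rpow_pos_of_pos (hη _) _).ne'

lemma ofReal_min_one_add_le {x y : ℝ} (hx : 0 ≤ x) (hy : 0 ≤ y) :
    ofReal (min 1 (x + y)) ≤ ofReal (min 1 x) + ofReal (min 1 y) := by
  rw [← ofReal_add (le_min zero_le_one hx) (le_min zero_le_one hy)]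
  refine ofReal_le_ofReal ?_
  rcases le_total 1 x with h3 | h3 <;> rcases le_total 1 y with h4 | h4 <;>
    simp only [min_eq_left h3, min_eq_left h4, min_eq_right h3, min_eq_right h4]
  · exact (min_le_left _ _).trans (by norm_num)
  · exact (min_le_left _ _).trans (by linarith)
  · exact (min_le_left _ _).trans (by linarith)
  · exact min_le_right _ _

lemma ofReal_min_one_sum_le {ι : Type*} (s : Finset ι) {f : ι → ℝ} (hf : ∀ i ∈ s, 0 ≤ f i) :
    ofReal (min 1 (∑ i ∈ s, f i)) ≤ ∑ i ∈ s, ofReal (min 1 (f i)) := by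
  classical
  induction s using Finset.induction_on with
  | empty => simp
  | insert a s ha ih =>
    rw [Finset.sum_insert ha, Finset.sum_insert ha]
    exact (ofReal_min_one_add_le (hf a (Finset.mem_insert_self _ _)) (sum_nonneg fun i hi =>
      hf i (Finset.mem_insert_of_mem hi))).trans
        (add_le_add le_rfl (ih fun i hi => hf i (Finset.mem_insert_of_mem hi)))

lemma summable_of_summable_min_one {f : ℕ → ℝ} (hf : ∀ n, 0 ≤ f n)
    (h : Summable fun n => min 1 (f n)) : Summable f := by
  refine Summable.of_norm_bounded_eventually_nat h ?_
  filter_upwards [h.tendsto_atTop_zero.eventually (gt_mem_nhds one_pos)] with n hn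
  rw [norm_of_nonneg (hf n)]
  rcases min_lt_iff.1 hn with h1 | h1
  · exact absurd h1 (lt_irrefl _)
  · exact le_min h1.le le_rfl

lemma summable_of_lintegral_min_one_le {Ω : Type*} [MeasurableSpace Ω] {μ : Measure Ω}
    {f : ℕ → Ω → ℝ} (hf : ∀ n, AEMeasurable (f n) μ) (hf0 : ∀ᵐ ω ∂μ, ∀ n, 0 ≤ f n ω) {g : ℕ → ℝ}
    (hg : Summable g) (hg0 : ∀ n, 0 ≤ g n)
    (h : ∀ n, ∫⁻ ω, ofReal (min 1 (f n ω)) ∂μ ≤ ofReal (g n)) :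
    ∀ᵐ ω ∂μ, Summable fun n => f n ω := by
  have hm : ∀ n, AEMeasurable (fun ω => ofReal (min 1 (f n ω))) μ := fun n =>
    (aemeasurable_const.min (hf n)).ennreal_ofReal
  have hfin : ∫⁻ ω, ∑' n, ofReal (min 1 (f n ω)) ∂μ ≠ ∞ := by
    rw [lintegral_tsum hm]
    refine ne_top_of_le_ne_top ?_ (ENNReal.tsum_le_tsum h)
    rw [← ENNReal.ofReal_tsum_of_nonneg hg0 hg]
    exact ofReal_ne_top
  filter_upwards [ae_lt_top' (AEMeasurable.tsum hm) hfin, hf0] with ω h1 h2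
  refine summable_of_summable_min_one h2 ?_
  have := ENNReal.summable_toReal h1.ne
  simpa only [ENNReal.toReal_ofReal (le_min zero_le_one (h2 _))] using this

section

variable {Ω' Ω'' : Type*} [MeasurableSpace Ω'] {μ' : Measure Ω'} [IsProbabilityMeasure μ']
  [MeasurableSpace Ω''] {μ'' : Measure Ω''} [IsProbabilityMeasure μ''] {Z : Ω' → ℝ}
  {P Zc : ℕ → Ω'' → ℝ}

/-- The limit sequences are read backwards from the vertex `k`, as in the series; for an independent
identically distributed family the reversal does not change the law. -/
lemma Regular.tendsto_shifted_bushWindow (h : Regular ν α c₁)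
    (hΛ : RateLimit ν α fun l => ∫ ω, exp (-l * Z ω) ∂μ') (hZ : AEMeasurable Z μ')
    (hZ0 : ∀ᵐ ω ∂μ', 0 ≤ Z ω) (hP : ∀ i, HasLaw (P i) (ratioLaw α) μ'')
    (hZc : ∀ j, HasLaw (Zc j) (μ'.map Z) μ'') (hind : iIndepFun (Sum.elim P Zc) μ'') (J : ℕ) :
    TendstoInDistribution (fun k η => bushWindow α J (next^[k - J] η)) atTop
      (fun ω (j : Fin J) => (Zc (J - j) ω / 2, P (J - j) ω)) (fun _ => law ν) μ'' := by
  have hinj : Function.Injective (Sum.map (fun j : Fin J => J - (j : ℕ)) fun j : Fin J =>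
      J - (j : ℕ)) := Sum.map_injective.2 ⟨fun i j hij => by
        have : J - (i : ℕ) = J - (j : ℕ) := hij
        omega, fun i j hij => by
        have : J - (i : ℕ) = J - (j : ℕ) := hij
        omega⟩
  have h1 := hind.precomp hinj
  have h2 : iIndepFun (Sum.elim (fun j : Fin J => P (J - j)) fun j : Fin J => Zc (J - j)) μ'' := by
    refine h1.congr ?_ 
    rintro (j | j) <;> rfl
  have h3 := h.tendsto_bushWindow hΛ hZ hZ0 (fun j : Fin J => hP (J - j))
    (fun j : Fin J => hZc (J - j)) h2
  exact ⟨fun k => h3.forall_aemeasurable (k - J), h3.aemeasurable_limit,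
    h3.tendsto.comp (tendsto_sub_atTop_nat J)⟩

lemma windowTerm_limit {J n : ℕ} (h1 : 1 ≤ n) (h2 : n ≤ J) (p z : ℕ → ℝ) :
    windowTerm (α / (1 - α) - 1) J (fun j => (z (J - j) / 2, p (J - j))) n =
      seriesTerm α p z n / 2 := by
  have hfe : ∀ u, 1 ≤ u → u ≤ J → fromEnd J (fun j => (z (J - j) / 2, p (J - j))) u =
      (z u / 2, p u) := fun u hu1 hu2 => by
    have := fromEnd_of_le (J := J) (fun j => (z (J - j) / 2, p (J - j))) hu1 hu2
    rwa [show J - (J - u) = u by omega] at this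
  rw [windowTerm, seriesTerm, hfe n h1 h2, mul_div_assoc,
    prod_congr rfl fun u hu => by
      rw [hfe u (Finset.mem_Icc.1 hu).1 ((Finset.mem_Icc.1 hu).2.trans h2)]]

lemma Regular.ae_R_iterate_pos (h : Regular ν α c₁) :
    ∀ᵐ η ∂law ν, ∀ j, 0 < R (next^[j] η) :=
  ae_all_iff.2 fun j => ae_iterate h.zero h.two h.ae_R_pos j

lemma Regular.ae_noTie_iterate (h : Regular ν α c₁) :
    ∀ᵐ η ∂law ν, ∀ j, NoTie (next^[j] η) :=
  ae_all_iff.2 fun j => ae_iterate h.zero h.two (ae_noTie h.zero h.two) j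

lemma seriesTerm_nonneg {p z : ℕ → ℝ} (hp : ∀ j, p j ∈ Icc (0 : ℝ) 1) (hz : ∀ j, 0 ≤ z j)
    (n : ℕ) : 0 ≤ seriesTerm α p z n :=
  mul_nonneg (rpow_nonneg (Finset.prod_nonneg fun u _ => (hp u).1) _) (hz n)

lemma aemeasurable_seriesTerm (hP : ∀ i, AEMeasurable (P i) μ'') (hZc : ∀ j, AEMeasurable (Zc j) μ'')
    (n : ℕ) : AEMeasurable (fun ω => seriesTerm α (fun i => P i ω) (fun j => Zc j ω) n) μ'' :=
  ((Finset.aemeasurable_fun_prod _ fun u _ => hP u).pow_const _).mul (hZc n)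

/-- A term of the limit series is the limit in law of a window term, so it inherits the geometric
bound. The event of a threshold above `s₀`, on which that bound is not available, has vanishing
probability. -/
lemma Regular.lintegral_seriesTerm_le (h : Regular ν α c₁) (hα : 1 / 2 < α)
    (hΛ : RateLimit ν α fun l => ∫ ω, exp (-l * Z ω) ∂μ') (hZ : AEMeasurable Z μ')
    (hZ0 : ∀ᵐ ω ∂μ', 0 ≤ Z ω) (hP : ∀ i, HasLaw (P i) (ratioLaw α) μ'')
    (hZc : ∀ j, HasLaw (Zc j) (μ'.map Z) μ'') (hind : iIndepFun (Sum.elim P Zc) μ'')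
    {K s₀ σ : ℝ} (h0 : 0 < s₀) (n : ℕ) (hn : 1 ≤ n)
    (hle : ∀ i, ∫⁻ η, (Iic s₀).indicator 1 (R (next^[i] η)) * ofReal (min 1
      ((R (next^[n] (next^[i] η)) / R (next^[i] η)) ^ (α / (1 - α) - 1) *
        scaledBush α (next^[i] η))) ∂law ν ≤ ofReal (K * σ ^ n)) :
    ∫⁻ ω, ofReal (min 1 (seriesTerm α (fun i => P i ω) (fun j => Zc j ω) n / 2)) ∂μ'' ≤
      ofReal (K * σ ^ n) := by
  have h1α : 0 < 1 - α := by have := h.lt_one; linarith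
  have hκ : 0 ≤ α / (1 - α) - 1 := by
    rw [sub_nonneg, le_div_iff₀ h1α]; linarith
  have hc : Continuous fun x => max 0 (min 1 (windowTerm (α / (1 - α) - 1) n x n)) :=
    continuous_const.max (continuous_const.min (continuous_windowTerm hκ n n))
  set f : BoundedContinuousFunction (Fin n → ℝ × ℝ) ℝ :=
    BoundedContinuousFunction.ofNormedAddCommGroup _ hc 1 fun x => by
      rw [norm_of_nonneg (le_max_left _ _)]
      exact max_le zero_le_one (min_le_left _ _) with hf
  have hfx : ∀ x, f x = max 0 (min 1 (windowTerm (α / (1 - α) - 1) n x n)) := fun x => rfl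
  have hf0 : ∀ x, 0 ≤ f x := fun x => le_max_left _ _
  have h1 := tendsto_integral_of_tendstoInDistribution
    (h.tendsto_shifted_bushWindow hΛ hZ hZ0 hP hZc hind n) f
  have hfm := f.continuous.measurable
  have hm := (h.tendsto_shifted_bushWindow hΛ hZ hZ0 hP hZc hind n).aemeasurable_limit
  have h2 : Tendsto (fun k => ofReal (∫ η, f (bushWindow α n (next^[k - n] η)) ∂law ν))
      atTop (𝓝 (ofReal (∫ ω, f fun j => (Zc (n - j) ω / 2, P (n - j) ω) ∂μ''))) :=
    (ENNReal.continuous_ofReal.tendsto _).comp h1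
  have hint : Integrable (fun ω => f fun j => (Zc (n - j) ω / 2, P (n - j) ω)) μ'' :=
    Integrable.of_bound (C := ‖f‖) (hfm.comp_aemeasurable hm).aestronglyMeasurable
      (Eventually.of_forall fun ω => f.norm_coe_le_norm _)
  have hint' : ∀ k, Integrable (fun η => f (bushWindow α n (next^[k - n] η))) (law ν) := fun k =>
    Integrable.of_bound (C := ‖f‖) (hfm.comp ((measurable_bushWindow n).comp
      (measurable_iterate_next _))).aestronglyMeasurable
      (Eventually.of_forall fun ω => f.norm_coe_le_norm _)
  rw [ofReal_integral_eq_lintegral_ofReal hint (Eventually.of_forall fun _ => hf0 _)] at h2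
  have h3 : ∫⁻ ω, ofReal (min 1 (seriesTerm α (fun i => P i ω) (fun j => Zc j ω) n / 2))
      ∂μ'' ≤ ∫⁻ ω, ofReal (f fun j => (Zc (n - j) ω / 2, P (n - j) ω)) ∂μ'' := by
    refine lintegral_mono fun ω => ofReal_le_ofReal ?_
    rw [hfx, windowTerm_limit hn le_rfl (fun i => P i ω) (fun j => Zc j ω)]
    exact le_max_right _ _
  refine h3.trans ?_
  have h4 := ((h.tendsto_measure_R h0).comp (tendsto_sub_atTop_nat n)).const_add
    (ofReal (K * σ ^ n))
  rw [add_zero] at h4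
  refine le_of_tendsto_of_tendsto h2 h4 ?_
  filter_upwards [eventually_ge_atTop n] with k hk
  rw [ofReal_integral_eq_lintegral_ofReal (hint' k) (Eventually.of_forall fun _ => hf0 _)]
  have hms : MeasurableSet {η | s₀ < R (next^[k - n] η)} :=
    measurableSet_lt measurable_const (measurable_R.comp (measurable_iterate_next _))
  have hmi : Measurable fun η => {η | s₀ < R (next^[k - n] η)}.indicator (1 : Config → ℝ≥0∞) η :=
    measurable_one.indicator hms
  calc _ ≤ ∫⁻ η, ({η | s₀ < R (next^[k - n] η)}.indicator 1 η +
        (Iic s₀).indicator 1 (R (next^[k - n] η)) * ofReal (min 1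
        ((R (next^[n] (next^[k - n] η)) / R (next^[k - n] η)) ^ (α / (1 - α) - 1) *
        scaledBush α (next^[k - n] η)))) ∂law ν := by
        refine lintegral_mono_ae ?_
        filter_upwards [h.ae_R_iterate_pos, h.ae_noTie_iterate] with η hη hη'
        rw [hfx, (windowTerm_bushWindow rfl hn le_rfl hk hη).1,
          ← Function.iterate_add_apply, show n + (k - n) = k by omega]
        rcases le_or_gt (R (next^[k - n] η)) s₀ with hle | hgt
        · rw [Set.indicator_of_mem (Set.mem_Iic.2 hle), Pi.one_apply, one_mul, max_eq_right]
          · exact le_add_self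
          · exact le_min zero_le_one (mul_nonneg (rpow_nonneg (div_nonneg (R_nonneg _)
              (R_nonneg _)) _) (scaledBush_nonneg (hη' _)))
        · rw [Set.indicator_of_mem (s := {η | s₀ < R (next^[k - n] η)}) hgt, Pi.one_apply]
          refine le_trans ?_ le_self_add
          exact ofReal_le_one.2 (max_le zero_le_one (min_le_left _ _))
    _ ≤ _ := by
        rw [lintegral_add_left hmi, lintegral_indicator_one hms, add_comm]
        exact add_le_add (hle (k - n)) le_rfl

end

end

/-! ### The bushes above a fixed level, and the joint limit of the cut weights -/

section

variable {ν : Measure ℕ} [IsProbabilityMeasure ν] {α c₁ : ℝ}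

/-- The weights along the backbone and of the bushes above the level `s`. -/
def coarseWeight (s : ℝ) (j : ℕ) (η : Config) : ℝ :=
  wt (next^[j + 1] η) [] + (Ioi s).indicator 1 (R (next^[j] η)) * bw (next^[j] η)

lemma measurable_coarseWeight (s : ℝ) (j : ℕ) : Measurable (coarseWeight s j) := by
  have h1 : Measurable fun η => (Ioi s).indicator (1 : ℝ → ℝ) (R (next^[j] η)) :=
    (measurable_one.indicator measurableSet_Ioi).comp
      (measurable_R.comp (measurable_iterate_next j))
  exact ((measurable_wt []).comp (measurable_iterate_next (j + 1))).add
    (h1.mul (measurable_bw.comp (measurable_iterate_next j)))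

lemma coarseWeight_nonneg {s : ℝ} {j : ℕ} {η : Config} (h : NoTie (next^[j] η)) :
    0 ≤ coarseWeight s j η :=
  add_nonneg (wt_nonneg _ _) (mul_nonneg (Set.indicator_nonneg (fun _ _ => zero_le_one) _)
    (bw_nonneg h))

/-- Only finitely many bushes have a level above `s`, and backbone weights are dominated by the
summable thresholds. -/
lemma Regular.ae_summable_coarseWeight (h : Regular ν α c₁) {s : ℝ} (hs : 0 < s) :
    ∀ᵐ η ∂law ν, Summable fun j => coarseWeight s j η := by
  filter_upwards [h.ae_summable_rpow one_pos, tendsto_R_iterate h.zero h.two] with η h1 h2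
  rw [h.criticalProb_eq] at h2
  refine Summable.of_norm_bounded_eventually_nat h1 ?_
  filter_upwards [h2.eventually (gt_mem_nhds hs)] with j hj
  rw [coarseWeight, Set.indicator_of_notMem (by simpa using hj.le), zero_mul, add_zero,
    norm_of_nonneg (wt_nonneg _ _), Real.rpow_one]
  exact wt_iterate_succ_le η j

/-- The total weight along the backbone and of the bushes above the level `s`. -/
def coarseTotal (s : ℝ) (η : Config) : ℝ := (∑' j, ofReal (coarseWeight s j η)).toReal

lemma measurable_coarseTotal (s : ℝ) : Measurable (coarseTotal s) :=
  (Measurable.tsum fun j => (measurable_coarseWeight s j).ennreal_ofReal).ennreal_toReal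

lemma sum_coarseWeight_le {s : ℝ} {η : Config} (h : ∀ j, NoTie (next^[j] η))
    (hs : Summable fun j => coarseWeight s j η) (k : ℕ) :
    ∑ j ∈ range k, coarseWeight s j η ≤ coarseTotal s η := by
  rw [coarseTotal, ← ENNReal.ofReal_tsum_of_nonneg (fun j => coarseWeight_nonneg (h j)) hs,
    ENNReal.toReal_ofReal (tsum_nonneg fun j => coarseWeight_nonneg (h j))]
  exact hs.sum_le_tsum _ fun j _ => coarseWeight_nonneg (h j)

/-- The coarse weight does not depend on `k`, and the prefactor `R_k^κ` tends to zero. -/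
lemma Regular.tendsto_lintegral_coarseTotal (h : Regular ν α c₁) (s : ℝ) {κ : ℝ}
    (hκ : 0 < κ) : Tendsto (fun k => ∫⁻ η, ofReal
      (min 1 (R (next^[k] η) ^ κ * coarseTotal s η)) ∂law ν) atTop (𝓝 0) := by
  have h1 : Tendsto (fun k => ∫⁻ η, ofReal
      (min 1 (R (next^[k] η) ^ κ * coarseTotal s η)) ∂law ν) atTop
      (𝓝 (∫⁻ _, 0 ∂law ν)) := by
    refine tendsto_lintegral_of_dominated_convergence (fun _ => 1) (fun k => ?_) (fun k =>
      Eventually.of_forall fun η => ofReal_le_one.2 (min_le_left _ _)) (by simp) ?_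
    · exact (measurable_const.min (((measurable_R.comp (measurable_iterate_next k)).pow_const
        _).mul (measurable_coarseTotal s))).ennreal_ofReal
    · filter_upwards [tendsto_R_iterate h.zero h.two] with η hη
      rw [h.criticalProb_eq] at hη
      have h2 := (tendsto_const_nhds (x := (1 : ℝ))).min
        ((hη.rpow_const (Or.inr hκ.le)).mul_const (coarseTotal s η))
      rw [zero_rpow hκ.ne', zero_mul, min_eq_right zero_le_one] at h2
      have h3 := (ENNReal.continuous_ofReal.tendsto _).comp h2
      rw [ENNReal.ofReal_zero] at h3
      exact h3
  simpa using h1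

/-- With `n = k - j` the distance from `k`, distances up to `J` form the window. The bushes further
back split by their level into small ones, kept as rescaled terms, and large ones, put with the
backbone into `coarseTotal`. -/
lemma scaled_weightSum_sub_le {κ s : ℝ} (hκ : κ = α / (1 - α) - 1) {i J k : ℕ} (hi : i < J)
    (hk : J ≤ k) {η : Config} (hη : ∀ j, 0 < R (next^[j] η)) (hη' : ∀ j, NoTie (next^[j] η))
    (hs : Summable fun j => coarseWeight s j η) :
    |R (next^[k] η) ^ κ * weightSum (k - (i + 1)) η -
      ∑ n ∈ Ico (i + 1) (J + 1), windowTerm κ J (bushWindow α J (next^[k - J] η)) n| ≤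
    ∑ n ∈ Ico (J + 1) (k + 1), (Iic s).indicator 1 (R (next^[k - n] η)) *
      ((R (next^[k] η) / R (next^[k - n] η)) ^ κ * scaledBush α (next^[k - n] η)) +
      R (next^[k] η) ^ κ * coarseTotal s η := by
  set r := R (next^[k] η) ^ κ with hr
  have hr0 : 0 ≤ r := rpow_nonneg (R_nonneg _) _
  have hb : ∀ j, 0 ≤ bw (next^[j] η) := fun j => bw_nonneg (hη' j)
  have e1 : ∑ n ∈ Ico (i + 1) (J + 1), windowTerm κ J (bushWindow α J (next^[k - J] η)) n =
      ∑ n ∈ Ico (i + 1) (J + 1), r * bw (next^[k - n] η) :=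
    sum_congr rfl fun n hn => by
      rw [Finset.mem_Ico] at hn
      have := windowTerm_bushWindow hκ (show 1 ≤ n by omega) (show n ≤ J by omega) hk hη
      rw [this.1, this.2]
  have e2 : ∑ n ∈ Ico (J + 1) (k + 1), (Iic s).indicator 1 (R (next^[k - n] η)) *
      ((R (next^[k] η) / R (next^[k - n] η)) ^ κ * scaledBush α (next^[k - n] η)) =
      ∑ n ∈ Ico (J + 1) (k + 1), (Iic s).indicator 1 (R (next^[k - n] η)) *
        (r * bw (next^[k - n] η)) :=
    sum_congr rfl fun n hn => by
      rw [Finset.mem_Ico] at hn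
      have := windowTerm_bushWindow hκ (show 1 ≤ n by omega) le_rfl (show n ≤ k by omega) hη
      rw [this.2]
  have e3 : ∑ j ∈ range (k - (i + 1) + 1), bw (next^[j] η) =
      ∑ n ∈ Ico (i + 1) (J + 1), bw (next^[k - n] η) +
        ∑ n ∈ Ico (J + 1) (k + 1), bw (next^[k - n] η) := by
    rw [Finset.sum_Ico_consecutive _ (by omega) (by omega),
      Finset.sum_Ico_reflect (fun j => bw (next^[j] η)) (i + 1) (le_refl (k + 1))]
    rw [Nat.sub_self, Finset.range_eq_Ico]
    congr 2
    omega
  have e4 : ∑ n ∈ Ico (J + 1) (k + 1), (Ioi s).indicator 1 (R (next^[k - n] η)) *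
      bw (next^[k - n] η) ≤ ∑ j ∈ range k, (Ioi s).indicator 1 (R (next^[j] η)) *
        bw (next^[j] η) := by
    rw [Finset.sum_Ico_reflect (fun j => (Ioi s).indicator 1 (R (next^[j] η)) *
      bw (next^[j] η)) (J + 1) (le_refl (k + 1)), Nat.sub_self, Finset.range_eq_Ico]
    refine Finset.sum_le_sum_of_subset_of_nonneg (Finset.Ico_subset_Ico_right (by omega))
      fun j _ _ => mul_nonneg (Set.indicator_nonneg (fun _ _ => zero_le_one) _) (hb j)
  have e5 : ∑ j ∈ range (k - (i + 1)), wt (next^[j + 1] η) [] ≤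
      ∑ j ∈ range k, wt (next^[j + 1] η) [] :=
    Finset.sum_le_sum_of_subset_of_nonneg (Finset.range_mono (by omega))
      fun j _ _ => wt_nonneg _ _
  have e6 := sum_coarseWeight_le hη' hs k
  simp only [coarseWeight, Finset.sum_add_distrib] at e6
  have e7 : ∑ n ∈ Ico (J + 1) (k + 1), bw (next^[k - n] η) =
      ∑ n ∈ Ico (J + 1) (k + 1), (Iic s).indicator 1 (R (next^[k - n] η)) *
        bw (next^[k - n] η) + ∑ n ∈ Ico (J + 1) (k + 1),
          (Ioi s).indicator 1 (R (next^[k - n] η)) * bw (next^[k - n] η) := by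
    rw [← Finset.sum_add_distrib]
    refine sum_congr rfl fun n _ => ?_
    rw [← add_mul, ← Set.compl_Iic, Set.indicator_self_add_compl_apply, Pi.one_apply, one_mul]
  have e8 : ∑ n ∈ Ico (J + 1) (k + 1), (Iic s).indicator 1 (R (next^[k - n] η)) *
        (r * bw (next^[k - n] η)) = r * ∑ n ∈ Ico (J + 1) (k + 1),
          (Iic s).indicator 1 (R (next^[k - n] η)) * bw (next^[k - n] η) := by
    rw [Finset.mul_sum]
    exact sum_congr rfl fun n _ => by ring
  have e9 : 0 ≤ ∑ n ∈ Ico (J + 1) (k + 1), bw (next^[k - n] η) :=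
    sum_nonneg fun n _ => hb _
  have e10 : 0 ≤ ∑ j ∈ range (k - (i + 1)), wt (next^[j + 1] η) [] :=
    sum_nonneg fun n _ => wt_nonneg _ _
  rw [e1, e2, e8, weightSum, e3, ← Finset.mul_sum, ← mul_sub, ← mul_add, abs_of_nonneg
    (mul_nonneg hr0 (by linarith))]
  refine mul_le_mul_of_nonneg_left ?_ hr0
  linarith

section

variable {Ω' Ω'' : Type*} [MeasurableSpace Ω'] {μ' : Measure Ω'} [IsProbabilityMeasure μ']
  [MeasurableSpace Ω''] {μ'' : Measure Ω''} [IsProbabilityMeasure μ''] {Z : Ω' → ℝ}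
  {P Zc : ℕ → Ω'' → ℝ}

/-- The joint limit law of the rescaled weights of the cut clusters. -/
lemma Regular.tendsto_scaled_weightSum (h : Regular ν α c₁) (hα : 1 / 2 < α)
    (hΛ : RateLimit ν α fun l => ∫ ω, exp (-l * Z ω) ∂μ') (hZ : AEMeasurable Z μ')
    (hZ0 : ∀ᵐ ω ∂μ', 0 ≤ Z ω) (hP : ∀ i, HasLaw (P i) (ratioLaw α) μ'')
    (hZc : ∀ j, HasLaw (Zc j) (μ'.map Z) μ'') (hind : iIndepFun (Sum.elim P Zc) μ'') :
    (∀ᵐ ω ∂μ'', Summable (seriesTerm α (fun i => P i ω) (fun j => Zc j ω))) ∧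
    ∀ m : ℕ, TendstoInDistribution (fun (k : ℕ) η (i : Fin m) =>
        R (next^[k] η) ^ (α / (1 - α) - 1) * weightSum (k - ((i : ℕ) + 1)) η) atTop
      (fun ω (i : Fin m) => limitSeries α (fun i => P i ω) (fun j => Zc j ω) ((i : ℕ) + 1))
      (fun _ => law ν) μ'' := by
  have h1α : 0 < 1 - α := by have := h.lt_one; linarith
  set κ := α / (1 - α) - 1 with hκdef
  have hκ : 0 < κ := by
    rw [hκdef, sub_pos, lt_div_iff₀ h1α]; linarith
  obtain ⟨K, hK, σ, hσ0, hσ1, s₀, h0, hle⟩ := h.exists_lintegral_min_le hκ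
  have hsumm : ∀ᵐ ω ∂μ'', Summable (seriesTerm α (fun i => P i ω) (fun j => Zc j ω)) := by
    have h1 := summable_of_lintegral_min_one_le (μ := μ'')
      (f := fun n ω => seriesTerm α (fun i => P i ω) (fun j => Zc j ω) (n + 1) / 2)
      (fun n => (aemeasurable_seriesTerm (fun i => (hP i).aemeasurable)
        (fun j => (hZc j).aemeasurable) (n + 1)).div_const 2) (by
        filter_upwards [ae_mem_of_hasLaw_ratioLaw h.pos h.lt_one hP,
          ae_nonneg_of_hasLaw hZ hZ0 hZc] with ω h1 h2 n
        exact div_nonneg (seriesTerm_nonneg h1 h2 _) two_pos.le)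
      (g := fun n => K * σ ^ (n + 1))
      (((summable_nat_add_iff 1).2 (summable_geometric_of_lt_one hσ0.le hσ1)).mul_left K)
      (fun n => by positivity)
      (fun n => h.lintegral_seriesTerm_le hα hΛ hZ hZ0 hP hZc hind h0 (n + 1) (by omega)
        fun i => hle i (n + 1))
    filter_upwards [h1] with ω hω
    refine (summable_nat_add_iff 1).1 ((hω.mul_left 2).congr fun n => ?_)
    ring
  refine ⟨hsumm, fun m => ?_⟩
  have hcont : ∀ J, Continuous fun (x : Fin J → ℝ × ℝ) (i : Fin m) =>
      ∑ n ∈ Ico ((i : ℕ) + 1) (J + 1), windowTerm κ J x n := fun J =>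
    continuous_pi fun i => continuous_finsetSum _ fun n _ => continuous_windowTerm hκ.le J n
  set V : ℕ → Ω'' → Fin m → ℝ := fun J ω i => ∑ n ∈ Ico ((i : ℕ) + 1) (J + 1),
    seriesTerm α (fun i => P i ω) (fun j => Zc j ω) n / 2 with hV
  have hX : ∀ J, TendstoInDistribution (fun k η (i : Fin m) => ∑ n ∈ Ico ((i : ℕ) + 1)
      (J + 1), windowTerm κ J (bushWindow α J (next^[k - J] η)) n) atTop (V J)
      (fun _ => law ν) μ'' := fun J => by
    have h1 := (h.tendsto_shifted_bushWindow hΛ hZ hZ0 hP hZc hind J).continuous_comp (hcont J)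
    have h2 : V J = (fun (x : Fin J → ℝ × ℝ) (i : Fin m) => ∑ n ∈ Ico ((i : ℕ) + 1) (J + 1),
        windowTerm κ J x n) ∘ fun ω (j : Fin J) => (Zc (J - j) ω / 2, P (J - j) ω) := by
      funext ω i
      refine sum_congr rfl fun n hn => ?_
      rw [Finset.mem_Ico] at hn
      exact (windowTerm_limit (show 1 ≤ n by omega) (show n ≤ J by omega) (fun i => P i ω)
        (fun j => Zc j ω)).symm
    rw [h2]
    exact h1
  have hVlim : ∀ᵐ ω ∂μ'', Tendsto (fun J => V J ω) atTop (𝓝 fun i : Fin m =>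
      limitSeries α (fun i => P i ω) (fun j => Zc j ω) ((i : ℕ) + 1)) := by
    filter_upwards [hsumm] with ω hω
    refine tendsto_pi_nhds.2 fun i => ?_
    have h1 := ((summable_nat_add_iff ((i : ℕ) + 1)).2 hω).hasSum.tendsto_sum_nat
    have h2 := (h1.const_mul (1 / 2)).comp (tendsto_sub_atTop_nat (i : ℕ))
    rw [limitSeries]
    convert h2 using 1
    · funext J
      simp only [hV, Function.comp_apply]
      rw [Finset.sum_Ico_eq_sum_range, Finset.mul_sum, show J + 1 - ((i : ℕ) + 1) = J - i by omega]
      exact sum_congr rfl fun n _ => by rw [add_comm n]; ring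
    · simp only [add_comm]
  refine tendstoInDistribution_of_approx (V := V) (fun k => (measurable_pi_lambda _ fun i =>
    ((measurable_R.comp (measurable_iterate_next k)).pow_const _).mul
      (measurable_weightSum _)).aemeasurable)
    (aemeasurable_of_tendsto_metrizable_ae atTop (fun J => (hX J).aemeasurable_limit) hVlim)
    (Eventually.of_forall hX) hVlim fun ε hε => ?_
  -- The tail beyond the window of the geometric bounds for single bushes.
  have hgeom : Tendsto (fun J => K * (σ ^ (J + 1) / (1 - σ))) atTop (𝓝 0) := by
    have h1 := ((tendsto_add_atTop_iff_nat 1).2 (tendsto_pow_atTop_nhds_zero_of_lt_one hσ0.le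
      hσ1)).div_const (1 - σ) |>.const_mul K
    simpa using h1
  filter_upwards [hgeom.eventually (gt_mem_nhds (half_pos hε)), eventually_ge_atTop m]
    with J hJ hmJ
  filter_upwards [(h.tendsto_lintegral_coarseTotal s₀ hκ).eventually (gt_mem_nhds
    (ENNReal.ofReal_pos.2 (half_pos hε))), eventually_ge_atTop J] with k hk hkJ
  set A : ℕ → Config → ℝ≥0∞ := fun n η => (Iic s₀).indicator 1 (R (next^[k - n] η)) *
    ofReal (min 1 ((R (next^[n] (next^[k - n] η)) / R (next^[k - n] η)) ^ κ *
      scaledBush α (next^[k - n] η))) with hA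
  have hAm : ∀ n, Measurable (A n) := fun n => by
    have h1 : Measurable fun η => (Iic s₀).indicator (1 : ℝ → ℝ≥0∞) (R (next^[k - n] η)) :=
      (measurable_one.indicator measurableSet_Iic).comp
        (measurable_R.comp (measurable_iterate_next _))
    have h2 : Measurable fun η => ofReal (min 1 ((R (next^[n] (next^[k - n] η)) /
        R (next^[k - n] η)) ^ κ * scaledBush α (next^[k - n] η))) :=
      (measurable_const.min ((((measurable_R.comp ((measurable_iterate_next n).comp
        (measurable_iterate_next (k - n)))).div (measurable_R.comp (measurable_iterate_next
        (k - n)))).pow_const _).mul (measurable_scaledBush.comp (measurable_iterate_next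
        (k - n))))).ennreal_ofReal
    exact h1.mul h2
  have hAsm : Measurable fun η => ∑ n ∈ Ico (J + 1) (k + 1), A n η :=
    Finset.measurable_fun_sum _ fun n _ => hAm n
  calc _ ≤ ∫⁻ η, (∑ n ∈ Ico (J + 1) (k + 1), A n η +
        ofReal (min 1 (R (next^[k] η) ^ κ * coarseTotal s₀ η))) ∂law ν := by
        refine lintegral_mono_ae ?_
        filter_upwards [h.ae_R_iterate_pos, h.ae_noTie_iterate,
          h.ae_summable_coarseWeight h0] with η h1 h2 h3
        set B : ℕ → ℝ := fun n => (Iic s₀).indicator 1 (R (next^[k - n] η)) *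
          ((R (next^[k] η) / R (next^[k - n] η)) ^ κ * scaledBush α (next^[k - n] η)) with hB
        have hB0 : ∀ n, 0 ≤ B n := fun n => mul_nonneg (Set.indicator_nonneg
          (fun _ _ => zero_le_one) _) (mul_nonneg (rpow_nonneg (div_nonneg (R_nonneg _)
            (R_nonneg _)) _) (scaledBush_nonneg (h2 _)))
        have hR0 : 0 ≤ R (next^[k] η) ^ κ * coarseTotal s₀ η :=
          mul_nonneg (rpow_nonneg (R_nonneg _) _) ENNReal.toReal_nonneg
        have h4 : dist (fun i : Fin m => R (next^[k] η) ^ κ * weightSum (k - ((i : ℕ) + 1)) η)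
            (fun i : Fin m => ∑ n ∈ Ico ((i : ℕ) + 1) (J + 1),
              windowTerm κ J (bushWindow α J (next^[k - J] η)) n) ≤
            ∑ n ∈ Ico (J + 1) (k + 1), B n + R (next^[k] η) ^ κ * coarseTotal s₀ η := by
          refine (dist_pi_le_iff (add_nonneg (sum_nonneg fun n _ => hB0 n) hR0)).2
            fun i => ?_
          rw [Real.dist_eq]
          exact scaled_weightSum_sub_le hκdef (by omega) hkJ h1 h2 h3
        refine (ofReal_le_ofReal (min_le_min le_rfl h4)).trans ?_
        have h5 := ofReal_min_one_add_le (sum_nonneg fun n (_ : n ∈ Ico (J + 1)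
          (k + 1)) => hB0 n) hR0
        refine h5.trans (add_le_add ((ofReal_min_one_sum_le _ fun n _ => hB0 n).trans
          (Finset.sum_le_sum fun n hn => ?_)) le_rfl)
        rw [Finset.mem_Ico] at hn
        simp only [hA, hB]
        rw [← Function.iterate_add_apply, show n + (k - n) = k by omega]
        rcases le_or_gt (R (next^[k - n] η)) s₀ with hle | hgt
        · simp [Set.indicator_of_mem (Set.mem_Iic.2 hle)]
        · simp [Set.indicator_of_notMem (show R (next^[k - n] η) ∉ Iic s₀ by simpa using hgt)]
    _ ≤ ofReal (ε / 2) + ofReal (ε / 2) := by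
        rw [lintegral_add_left hAsm, lintegral_finsetSum _ fun n _ => hAm n]
        refine add_le_add ?_ hk.le
        calc _ ≤ ∑ n ∈ Ico (J + 1) (k + 1), ofReal (K * σ ^ n) :=
              Finset.sum_le_sum fun n _ => hle (k - n) n
          _ = ofReal (K * ∑ n ∈ Ico (J + 1) (k + 1), σ ^ n) := by
              rw [Finset.mul_sum, ENNReal.ofReal_sum_of_nonneg fun n _ => by positivity]
          _ ≤ _ := by
              refine ofReal_le_ofReal (le_trans ?_ hJ.le)
              gcongr
              exact geom_sum_Ico_le_of_lt_one hσ0.le hσ1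
    _ = _ := by rw [← ofReal_add (half_pos hε).le (half_pos hε).le, add_halves]

end

end

/-! ### Parts (ii) and (iii) for the original weighted tree -/

section

variable {ν : Measure ℕ} [IsProbabilityMeasure ν] {α c : ℝ}

lemma regular_of_isEquivalent (hone : ∀ᵐ n ∂ν, 1 ≤ n) (hα : 0 < α) (hα1 : α < 1) (hc : 0 < c)
    (htail : Asymptotics.IsEquivalent atTop
      (fun y : ℝ => ν.real {n : ℕ | y < (n : ℝ)}) (fun y : ℝ => c * y ^ (-α))) :
    Regular ν α (c * Real.Gamma (1 - α)) where
  zero := offspring_zero hone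
  two := offspring_two hc htail
  pos := hα
  lt_one := hα1
  const_pos := mul_pos hc (Real.Gamma_pos_of_pos (by linarith))
  asymp := tendsto_phi_div hα hα1 hc htail

section Transfer

variable {Ω : Type*} [MeasurableSpace Ω] {μ : Measure Ω} [IsProbabilityMeasure μ]
  {X : Vertex → Ω → ℕ} {U : Vertex → Ω → ℝ}

/-- The cut clusters and the future maximum weights of a weighted tree are given by its
configuration. -/
lemma ae_cut_eq (h : IsWeightedBPTree ν X U μ) (hν : ν {0} = 0) (h2 : 0 < ν.real {n | 2 ≤ n}) :
    ∀ᵐ ω ∂μ, ∀ k, (cutSize (fun v => X v ω) (fun v => U v ω) k : ℝ) = sizeSum k (field X U ω) ∧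
      cutWeight (fun v => X v ω) (fun v => U v ω) k = weightSum k (field X U ω) ∧
      futureMax (fun v => X v ω) (fun v => U v ω) k = R (next^[k] (field X U ω)) := by
  filter_upwards [ae_deg_field h hν, ae_wt_field h, ae_field h (ae_generic hν h2)]
    with ω h1 h3 h4 k
  rw [← h1, ← h3]
  exact ⟨cutSize_eq_sizeSum h4 k, cutWeight_eq_weightSum h4 k, futureMax_eq h4.hNoTie k⟩

lemma exists_independent_sequences (ρ₁ ρ₂ : Measure ℝ) [IsProbabilityMeasure ρ₁]
    [IsProbabilityMeasure ρ₂] : ∃ (Ω'' : Type) (_ : MeasurableSpace Ω'') (μ'' : Measure Ω'')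
      (_ : IsProbabilityMeasure μ'') (P Z : ℕ → Ω'' → ℝ), (∀ i, HasLaw (P i) ρ₁ μ'') ∧
      (∀ j, HasLaw (Z j) ρ₂ μ'') ∧ iIndepFun (Sum.elim P Z) μ'' := by
  set κ : ℕ ⊕ ℕ → Measure ℝ := Sum.elim (fun _ => ρ₁) (fun _ => ρ₂) with hκ
  have : ∀ i, IsProbabilityMeasure (κ i) := by
    rintro (i | i)
    · exact ‹IsProbabilityMeasure ρ₁›
    · exact ‹IsProbabilityMeasure ρ₂›
  refine ⟨ℕ ⊕ ℕ → ℝ, inferInstance, Measure.infinitePi κ, inferInstance,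
    fun i ω => ω (Sum.inl i), fun j ω => ω (Sum.inr j), fun i => ?_, fun j => ?_, ?_⟩
  · exact ⟨(measurable_pi_apply _).aemeasurable, Measure.infinitePi_map_eval κ (Sum.inl i)⟩
  · exact ⟨(measurable_pi_apply _).aemeasurable, Measure.infinitePi_map_eval κ (Sum.inr j)⟩
  · have h1 := iIndepFun_infinitePi (P := κ) (X := fun _ x => x) fun _ => measurable_id
    refine h1.congr ?_
    rintro (i | i) <;> rfl

lemma tendstoInDistribution_scaled_cutWeight (htree : IsWeightedBPTree ν X U μ) {c₁ : ℝ}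
    (h : Regular ν α c₁) (hα : 1 / 2 < α) {M : ℕ → Ω → ℕ} {C W : ℕ → Ω → ℝ}
    (hM : ∀ k ω, M k ω = cutSize (fun v => X v ω) (fun v => U v ω) k)
    (hC : ∀ k ω, C k ω = cutWeight (fun v => X v ω) (fun v => U v ω) k)
    (hW : ∀ k ω, W k ω = futureMax (fun v => X v ω) (fun v => U v ω) k)
    {Ω' : Type*} [MeasurableSpace Ω'] {μ' : Measure Ω'} [IsProbabilityMeasure μ'] {Z : Ω' → ℝ}
    (hZ : TendstoInDistribution
      (fun (k : ℕ) ω => W k ω ^ (α / (1 - α)) * ((M k ω : ℝ) - (M (k - 1) ω : ℝ)))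
      atTop Z (fun _ => μ) μ') :
    ∃ (Ω'' : Type) (_ : MeasurableSpace Ω'') (μ'' : Measure Ω'')
      (_ : IsProbabilityMeasure μ'') (P Zc : ℕ → Ω'' → ℝ),
      (∀ i, HasLaw (P i) (ratioLaw α) μ'') ∧ (∀ j, HasLaw (Zc j) (μ'.map Z) μ'') ∧
      iIndepFun (Sum.elim P Zc) μ'' ∧
      (∀ᵐ ω ∂μ'', Summable (seriesTerm α (fun i => P i ω) (fun j => Zc j ω))) ∧
      ∀ m : ℕ, TendstoInDistribution (fun (k : ℕ) ω (i : Fin m) =>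
          W k ω ^ (α / (1 - α) - 1) * C (k - ((i : ℕ) + 1)) ω) atTop
        (fun ω (i : Fin m) => limitSeries α (fun i => P i ω) (fun j => Zc j ω) ((i : ℕ) + 1))
        (fun _ => μ) μ'' := by
  have hcut := ae_cut_eq htree h.zero h.two
  set Y : ℕ → Config → ℝ := fun k η => R (next^[k] η) ^ (α / (1 - α)) * (bs (next^[k] η) + 1)
    with hY
  have hYm : ∀ k, Measurable (Y k) := fun k =>
    ((measurable_R.comp (measurable_iterate_next k)).pow_const _).mul
      ((measurable_bs.comp (measurable_iterate_next k)).add_const 1)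
  -- At `k = 0` truncated subtraction makes the increment `M 0 - M (0 - 1)` zero, which is not the
  -- size of a bush; a shift by one removes this index without changing the limit.
  have h1 : TendstoInDistribution (fun k ω => Y (k + 1) (field X U ω)) atTop Z (fun _ => μ) μ' := by
    have h2 : TendstoInDistribution (fun (k : ℕ) ω => W (k + 1) ω ^ (α / (1 - α)) *
        ((M (k + 1) ω : ℝ) - (M (k + 1 - 1) ω : ℝ))) atTop Z (fun _ => μ) μ' :=
      ⟨fun k => hZ.forall_aemeasurable (k + 1), hZ.aemeasurable_limit,
        hZ.tendsto.comp (tendsto_add_atTop_nat 1)⟩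
    refine h2.congr (fun k => ?_) (Eventually.of_forall fun _ => rfl)
    filter_upwards [hcut] with ω hω
    rw [hW, hM, hM, (hω (k + 1)).1, (hω (k + 1 - 1)).1, (hω (k + 1)).2.2, Nat.add_sub_cancel,
      sizeSum, Finset.sum_range_succ, sizeSum, add_sub_cancel_left]
  have h2 := (tendstoInDistribution_comp_iff (hasLaw_field htree) fun k => hYm (k + 1)).1 h1
  have h3 : TendstoInDistribution Y atTop Z (fun _ => law ν) μ' :=
    ⟨fun k => (hYm k).aemeasurable, h2.aemeasurable_limit,
      (tendsto_add_atTop_iff_nat (f := fun k => (⟨(law ν).map (Y k), _⟩ :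
        ProbabilityMeasure ℝ)) 1).1 h2.tendsto⟩
  obtain ⟨hZ0, hrate⟩ := h.rate_limit_of_tendsto h3
  have hΛ : RateLimit ν α fun l => ∫ ω, exp (-l * Z ω) ∂μ' := fun l hl =>
    ⟨laplace_pos hZ.aemeasurable_limit hZ0 hl, hrate l hl⟩
  have := isProbabilityMeasure_ratioLaw h.pos.le h.lt_one.le
  have := Measure.isProbabilityMeasure_map hZ.aemeasurable_limit
  obtain ⟨Ω'', mΩ, μ'', hμ, P, Zc, hP, hZc, hind⟩ :=
    exists_independent_sequences (ratioLaw α) (μ'.map Z)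
  obtain ⟨h4, h5⟩ := h.tendsto_scaled_weightSum hα hΛ hZ.aemeasurable_limit hZ0 hP hZc hind
  refine ⟨Ω'', mΩ, μ'', hμ, P, Zc, hP, hZc, hind, h4, fun m => ?_⟩
  have hm : ∀ k, Measurable fun η (i : Fin m) =>
      R (next^[k] η) ^ (α / (1 - α) - 1) * weightSum (k - ((i : ℕ) + 1)) η := fun k =>
    measurable_pi_lambda _ fun i => ((measurable_R.comp (measurable_iterate_next k)).pow_const
      _).mul (measurable_weightSum _)
  have h6 := (tendstoInDistribution_comp_iff (hasLaw_field htree) hm).2 (h5 m)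
  refine h6.congr (fun k => ?_) (Eventually.of_forall fun _ => rfl)
  filter_upwards [hcut] with ω hω
  funext i
  rw [hW, hC, (hω k).2.2, (hω _).2.1]

lemma exists_tendsto_cutWeight (htree : IsWeightedBPTree ν X U μ) {c₁ : ℝ} (h : Regular ν α c₁)
    (hα : α < 1 / 2) {C : ℕ → Ω → ℝ}
    (hC : ∀ k ω, C k ω = cutWeight (fun v => X v ω) (fun v => U v ω) k) :
    ∃ Z : Ω → ℝ, TendstoInDistribution C atTop Z (fun _ => μ) μ ∧
      ∀ᵐ ω ∂μ, Tendsto (fun k => C k ω) atTop (𝓝 (Z ω)) := by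
  have hcut := ae_cut_eq htree h.zero h.two
  have hCm : ∀ k, AEMeasurable (C k) μ := fun k =>
    ((measurable_weightSum k).comp_aemeasurable (hasLaw_field htree).aemeasurable).congr (by
      filter_upwards [hcut] with ω hω
      rw [hC, (hω k).2.1]
      rfl)
  have hlim : ∀ᵐ ω ∂μ, ∃ z, Tendsto (fun k => C k ω) atTop (𝓝 z) := by
    filter_upwards [hcut, ae_field htree (h.ae_tendsto_weightSum hα)] with ω hω ⟨z, hz⟩
    exact ⟨z, hz.congr fun k => by rw [hC, (hω k).2.1]⟩
  obtain ⟨Z, hZm, hZ⟩ := measurable_limit_of_tendsto_metrizable_ae hCm hlim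
  exact ⟨Z, tendstoInDistribution_of_ae_tendsto hCm hZm.aemeasurable hZ, hZ⟩

end Transfer

end

section

variable {ν : Measure ℕ} [IsProbabilityMeasure ν] {q : ℝ → ℝ → ℝ≥0∞}

/-! ### The weight of the cut clusters is nearly proportional to their size -/

/-- The product of the bush functionals of the first vertices of the backbone. -/
def bushProds (q : ℝ → ℝ → ℝ≥0∞) (k : ℕ) (η : Config) : ℝ≥0∞ :=
  ∏ j ∈ range k, bushProd q (next^[j] η)

lemma measurable_bushProds (hq : Measurable (uncurry q)) (k : ℕ) :
    Measurable (bushProds q k) :=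
  Finset.measurable_fun_prod _ fun j _ => (measurable_bushProd hq).comp (measurable_iterate_next j)

lemma bushProds_succ (k : ℕ) (η : Config) :
    bushProds q (k + 1) η = bushProd q η * bushProds q k (next η) := by
  rw [bushProds, Finset.prod_range_succ', mul_comm]
  rfl

/-- A supermartingale-type bound: by the exact one-step formula a bush factor replaces `rate 1` by
`rate q`, which is no larger, so one factor after another may be dropped. -/
lemma lintegral_bushProds_le (hν : ν {0} = 0) (h2 : 0 < ν.real {n | 2 ≤ n})
    (hq : Measurable (uncurry q))
    (hle : ∀ s ∈ Icc (0 : ℝ) 1, ∫⁻ u in Icc 0 s, q s u ≤ ofReal s) (k n : ℕ) :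
    ∫⁻ η, bushProds q k (next^[n] η) ∂law ν ≤ 1 := by
  induction k generalizing n with
  | zero => simp [bushProds]
  | succ k ih =>
    have hm := measurable_bushProds hq k
    have hd := measurable_dens (ν := ν) n (g := 1) measurable_one
    have hfree : RootFree fun η => bushProd q η * bushProds q k (next η) := fun η => by
      have h1 : bushProd q (keep {(true, [])}ᶜ η) = bushProd q η := rootFree_bushProd η
      have h3 : bushProds q k (next (keep {(true, [])}ᶜ η)) = bushProds q k (next η) :=
        RootFree.comp_next (bushProds q k) η
      simp only [h1, h3]
    have hKm : Measurable fun η => bushProd q η * bushProds q k (next η) :=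
      (measurable_bushProd hq).mul (hm.comp measurable_next)
    have e1 := lintegral_dens hν h2 n (g := 1) measurable_one hKm hfree
    have e2 := lintegral_dens hν h2 n (g := 1) measurable_one (hm.comp measurable_next)
      (RootFree.comp_next (bushProds q k))
    simp only [Pi.one_apply, one_mul, Function.comp_apply, ← iterate_succ_apply' next]
      at e1 e2
    simp only [bushProds_succ, ← iterate_succ_apply' next]
    rw [e1]
    refine le_trans ?_ (ih (n + 1))
    rw [e2, lintegral_next hν h2 hd hm]
    simp only [← mul_assoc]
    rw [lintegral_step hν hq hd hm]
    refine lintegral_mono fun η => ?_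
    have := rate_le hν hq (S_mem η) (hle _ (S_mem η))
    calc _ = dens ν n 1 (S η) * rate ν q (S η) * bushProds q k η := by rw [rate]; ring
      _ ≤ _ := by gcongr

/-- The edge functional that compares the weight of an edge with half the level. -/
def compareq (l : ℝ) : ℝ → ℝ → ℝ≥0∞ := fun s u =>
  ofReal (exp (l * u + (-(l * s / 2) - l ^ 2)))

lemma measurable_compareq (l : ℝ) : Measurable (uncurry (compareq l)) := by
  unfold compareq uncurry
  fun_prop

/-- With `x = l(u - s/2)`, use `exp x ≤ 1 + x + x²` and `x² ≤ l²/4`. The linear term integrates to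
zero over `[0, s]`, and `(1 + l²/4) exp(-l²) ≤ 1` explains the compensator `-l²` in `compareq`. -/
lemma lintegral_compareq_le {l : ℝ} (hl : |l| ≤ 1) {s : ℝ} (hs : s ∈ Icc (0 : ℝ) 1) :
    ∫⁻ u in Icc 0 s, compareq l s u ≤ ofReal s := by
  have h1 : ∀ u ∈ Icc 0 s, compareq l s u ≤
      ofReal ((1 + l * (u - s / 2) + l ^ 2 / 4) * exp (-l ^ 2)) := fun u hu => by
    refine ofReal_le_ofReal ?_
    rw [show l * u + (-(l * s / 2) - l ^ 2) = l * (u - s / 2) + -l ^ 2 by ring, Real.exp_add]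
    refine mul_le_mul_of_nonneg_right ?_ (exp_pos _).le
    have hu2 : |u - s / 2| ≤ 1 / 2 := by
      rw [abs_le]; constructor <;> linarith [hu.1, hu.2, hs.1, hs.2]
    have h2 : |l * (u - s / 2)| ≤ 1 := by
      rw [abs_mul]
      nlinarith [abs_nonneg l, abs_nonneg (u - s / 2)]
    have h3 := Real.abs_exp_sub_one_sub_id_le h2
    have h4 : (l * (u - s / 2)) ^ 2 ≤ l ^ 2 / 4 := by
      rw [mul_pow]
      have : (u - s / 2) ^ 2 ≤ (1 / 2) ^ 2 := sq_le_sq' (abs_le.1 hu2).1 (abs_le.1 hu2).2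
      nlinarith [sq_nonneg l]
    linarith [(abs_le.1 h3).2]
  refine (setLIntegral_mono' measurableSet_Icc h1).trans ?_
  have hcont : Continuous fun u : ℝ => (1 + l * (u - s / 2) + l ^ 2 / 4) * exp (-l ^ 2) := by
    fun_prop
  rw [← ofReal_integral_eq_lintegral_ofReal hcont.integrableOn_Icc, integral_Icc_eq_integral_Ioc,
    ← intervalIntegral.integral_of_le hs.1]
  · refine ofReal_le_ofReal ?_
    have h2 : ∫ u in (0 : ℝ)..s, (1 + l * (u - s / 2) + l ^ 2 / 4) * exp (-l ^ 2) =
        s * ((1 + l ^ 2 / 4) * exp (-l ^ 2)) := by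
      have hd : ∀ u ∈ Set.uIcc 0 s, HasDerivAt
          (fun u => ((1 + l ^ 2 / 4) * u + l * (u ^ 2 / 2 - s / 2 * u)) * exp (-l ^ 2))
          ((1 + l * (u - s / 2) + l ^ 2 / 4) * exp (-l ^ 2)) u := fun u _ => by
        have h5 := (((hasDerivAt_id u).const_mul (1 + l ^ 2 / 4)).add
          ((((hasDerivAt_id u).pow 2).div_const 2).sub
            ((hasDerivAt_id u).const_mul (s / 2)) |>.const_mul l)).mul_const (exp (-l ^ 2))
        refine h5.congr_deriv ?_
        simp only [id]
        ring
      rw [intervalIntegral.integral_eq_sub_of_hasDerivAt hd (hcont.intervalIntegrable _ _)]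
      ring
    rw [h2]
    refine mul_le_of_le_one_right hs.1 ?_
    rw [Real.exp_neg, ← div_eq_mul_inv, div_le_one (exp_pos _)]
    nlinarith [Real.add_one_le_exp (l ^ 2), sq_nonneg l]
  · filter_upwards [ae_restrict_mem measurableSet_Icc] with u hu
    refine mul_nonneg ?_ (exp_pos _).le
    have h2 : |l * (u - s / 2)| ≤ 1 := by
      rw [abs_mul]
      have hu2 : |u - s / 2| ≤ 1 := by
        rw [abs_le]; constructor <;> linarith [hu.1, hu.2, hs.1, hs.2]
      exact mul_le_one₀ hl (abs_nonneg _) hu2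
    have := (abs_le.1 h2).1
    nlinarith [sq_nonneg l]

/-- The difference between the weight of a bush and its size times half the level. -/
def excess (η : Config) : ℝ := bw η - R η / 2 * bs η

lemma bushProds_compareq {η : Config} (h : ∀ j, NoTie (next^[j] η)) (l : ℝ) (k : ℕ) :
    bushProds (compareq l) k η = ofReal (exp
      (l * ∑ j ∈ range k, excess (next^[j] η) -
        l ^ 2 * ∑ j ∈ range k, bs (next^[j] η))) := by
  have h1 : ∀ j, bushProd (compareq l) (next^[j] η) = ofReal (exp
      (l * excess (next^[j] η) - l ^ 2 * bs (next^[j] η))) := fun j => by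
    have : bushProd (compareq l) (next^[j] η) = _ :=
      bushProd_exp' (h j) (fun _ => l) (fun s => -(l * s / 2) - l ^ 2)
    rw [this, excess]
    congr 2
    ring
  rw [bushProds, prod_congr rfl fun j _ => h1 j,
    ← ENNReal.ofReal_prod_of_nonneg fun j _ => (exp_pos _).le, ← Real.exp_sum,
    Finset.sum_sub_distrib, Finset.mul_sum, Finset.mul_sum]

/-- Markov's inequality at the height `exp(l² k)` gives a geometric bound for the exceptional
events, then Borel-Cantelli. -/
lemma ae_eventually_excess_lt (hν : ν {0} = 0) (h2 : 0 < ν.real {n | 2 ≤ n}) {l : ℝ} (hl : |l| ≤ 1)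
    (hl0 : l ≠ 0) : ∀ᵐ η ∂law ν, ∀ᶠ k : ℕ in atTop,
      l * ∑ j ∈ range k, excess (next^[j] η) <
        l ^ 2 * (∑ j ∈ range k, bs (next^[j] η) + k) := by
  have hl2 : 0 < l ^ 2 := by positivity
  have hnt : ∀ᵐ η ∂law ν, ∀ j, NoTie (next^[j] η) :=
    ae_all_iff.2 fun j => ae_iterate hν h2 (ae_noTie hν h2) j
  set A : ℕ → Set Config := fun k => {η | ofReal (exp (l ^ 2 * k)) ≤
    bushProds (compareq l) k η} with hA
  have hAle : ∀ k, law ν (A k) ≤ ofReal (exp (-l ^ 2)) ^ k := fun k => by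
    have h3 := mul_meas_ge_le_lintegral (μ := law ν) (measurable_bushProds (measurable_compareq l) k)
      (ofReal (exp (l ^ 2 * k)))
    have h4 := h3.trans (lintegral_bushProds_le hν h2 (measurable_compareq l)
      (fun s hs => lintegral_compareq_le hl hs) k 0)
    calc law ν (A k) = ofReal (exp (-l ^ 2)) ^ k *
          (ofReal (exp (l ^ 2 * k)) * law ν (A k)) := by
          rw [← mul_assoc, ← ENNReal.ofReal_pow (exp_pos _).le,
            ← ofReal_mul (by positivity), ← Real.exp_nat_mul, ← Real.exp_add,
            show (k : ℝ) * -l ^ 2 + l ^ 2 * k = 0 by ring]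
          simp
      _ ≤ ofReal (exp (-l ^ 2)) ^ k * 1 := by gcongr
      _ = _ := mul_one _
  have hsum : ∑' k, law ν (A k) ≠ ∞ := by
    refine ne_top_of_le_ne_top ?_ (ENNReal.tsum_le_tsum hAle)
    rw [ENNReal.tsum_geometric]
    refine ENNReal.inv_ne_top.2 (tsub_pos_of_lt ?_).ne'
    exact ENNReal.ofReal_lt_one.2 (by
    rw [← Real.exp_zero]
    exact Real.exp_lt_exp.2 (by linarith))
  filter_upwards [ae_eventually_notMem hsum, hnt] with η h3 h4
  filter_upwards [h3] with k hk
  have h5 : ¬ ofReal (exp (l ^ 2 * k)) ≤ bushProds (compareq l) k η := hk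
  rw [bushProds_compareq h4, not_le, ENNReal.ofReal_lt_ofReal_iff (exp_pos _),
    Real.exp_lt_exp] at h5
  linarith

lemma ae_eventually_abs_excess_le (hν : ν {0} = 0) (h2 : 0 < ν.real {n | 2 ≤ n}) :
    ∀ᵐ η ∂law ν, ∀ δ : ℝ, 0 < δ → ∀ᶠ k : ℕ in atTop,
      |∑ j ∈ range k, excess (next^[j] η)| ≤
        δ * (∑ j ∈ range k, bs (next^[j] η) + k) := by
  have hnt : ∀ᵐ η ∂law ν, ∀ j, NoTie (next^[j] η) :=
    ae_all_iff.2 fun j => ae_iterate hν h2 (ae_noTie hν h2) j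
  have hl : ∀ m : ℕ, |1 / ((m : ℝ) + 1)| ≤ 1 ∧ 0 < 1 / ((m : ℝ) + 1) := fun m => by
    have : 0 < 1 / ((m : ℝ) + 1) := by positivity
    rw [abs_of_pos this, div_le_one (by positivity)]
    exact ⟨by linarith [m.cast_nonneg (α := ℝ)], this⟩
  -- Dividing the Chernoff bound by `l = ±1/(m+1)` leaves the factor `|l|`, to be made smaller than
  -- `δ`; both signs are needed for the absolute value.
  have h3 := ae_all_iff.2 fun m : ℕ => ae_eventually_excess_lt hν h2 (hl m).1 (hl m).2.ne'
  have h4 := ae_all_iff.2 fun m : ℕ => ae_eventually_excess_lt hν h2 (l := -(1 / ((m : ℝ) + 1)))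
    (by rw [abs_neg]; exact (hl m).1) (neg_ne_zero.2 (hl m).2.ne')
  filter_upwards [h3, h4, hnt] with η h3 h4 h5 δ hδ
  obtain ⟨m, hm⟩ := exists_nat_one_div_lt hδ
  filter_upwards [h3 m, h4 m] with k h6 h7
  have hb : 0 ≤ ∑ j ∈ range k, bs (next^[j] η) + (k : ℝ) :=
    add_nonneg (sum_nonneg fun j _ => bs_nonneg (h5 j)) k.cast_nonneg
  set l := 1 / ((m : ℝ) + 1) with hldef
  have hl0 := (hl m).2
  rw [sq, mul_assoc] at h6
  rw [neg_sq, sq, neg_mul, mul_assoc, ← mul_neg] at h7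
  have h8 := lt_of_mul_lt_mul_left h6 hl0.le
  have h9 := lt_of_mul_lt_mul_left h7 hl0.le
  refine (abs_le.2 ⟨by linarith, h8.le⟩).trans ?_
  gcongr

/-- Three errors: the excess, at most `δ/2` times size; the replacement of `R_j` by `p_c`, small
relative to size except for finitely many bushes; and the backbone, linear in `k`. -/
lemma ae_eventually_weightSum_sub_le (hν : ν {0} = 0) (h2 : 0 < ν.real {n | 2 ≤ n}) :
    ∀ᵐ η ∂law ν, ∀ δ : ℝ, 0 < δ → ∀ᶠ k : ℕ in atTop,
      |weightSum k η - criticalProb ν / 2 * sizeSum k η| ≤ δ * |sizeSum k η| + 4 * (k + 1) := by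
  have hnt : ∀ᵐ η ∂law ν, ∀ j, NoTie (next^[j] η) :=
    ae_all_iff.2 fun j => ae_iterate hν h2 (ae_noTie hν h2) j
  have hp0 : 0 ≤ criticalProb ν := inv_nonneg.2 (integral_nonneg fun n => n.cast_nonneg)
  have hp1 := criticalProb_le_one (ν := ν) hν
  filter_upwards [ae_eventually_abs_excess_le hν h2, tendsto_R_iterate hν h2, hnt]
    with η h3 h4 h5 δ hδ
  have hb : ∀ j, 0 ≤ bs (next^[j] η) := fun j => bs_nonneg (h5 j)
  obtain ⟨N, hN⟩ := eventually_atTop.1 (h4.eventually (Metric.ball_mem_nhds _ hδ))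
  set F := ∑ j ∈ range N, bs (next^[j] η) with hF
  filter_upwards [(tendsto_add_atTop_nat 1).eventually (h3 (δ / 2) (half_pos hδ)),
    -- The fixed total size `F` of the first `N` bushes is absorbed into the linear error once `k ≥
    -- F`.
    (tendsto_natCast_atTop_atTop (R := ℝ)).eventually_ge_atTop F] with k h6 h7
  set B := ∑ j ∈ range (k + 1), bs (next^[j] η) with hB
  have hB0 : 0 ≤ B := sum_nonneg fun j _ => hb j
  have e1 : sizeSum k η = B + (k + 1) := by
    rw [sizeSum, Finset.sum_add_distrib]
    simp [hB]
  have e2 : weightSum k η = ∑ j ∈ range (k + 1), excess (next^[j] η) +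
      ∑ j ∈ range (k + 1), (R (next^[j] η) - criticalProb ν) / 2 * bs (next^[j] η) +
      criticalProb ν / 2 * B + ∑ j ∈ range k, wt (next^[j + 1] η) [] := by
    rw [weightSum, hB, Finset.mul_sum, ← Finset.sum_add_distrib, ← Finset.sum_add_distrib]
    congr 1
    exact sum_congr rfl fun j _ => by rw [excess]; ring
  have e3 : |∑ j ∈ range (k + 1), (R (next^[j] η) - criticalProb ν) / 2 *
      bs (next^[j] η)| ≤ δ / 2 * B + F := by
    have hterm : ∀ j, |(R (next^[j] η) - criticalProb ν) / 2 * bs (next^[j] η)| ≤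
        δ / 2 * bs (next^[j] η) + if j < N then bs (next^[j] η) else 0 := fun j => by
      rw [abs_mul, abs_of_nonneg (hb j), abs_div, abs_two]
      have hbj := hb j
      split_ifs with hj
      · have h8 : |R (next^[j] η) - criticalProb ν| ≤ 1 := by
          rw [abs_le]
          constructor <;> linarith [R_nonneg (next^[j] η), R_le_one (next^[j] η)]
        have := mul_nonneg (half_pos hδ).le hbj
        nlinarith
      · have h8 : |R (next^[j] η) - criticalProb ν| < δ := hN j (by omega)
        rw [add_zero]
        gcongr
    refine (Finset.abs_sum_le_sum_abs _ _).trans ((Finset.sum_le_sum fun j _ => hterm j).trans ?_)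
    rw [Finset.sum_add_distrib, ← Finset.mul_sum, ← Finset.sum_filter]
    refine add_le_add le_rfl (Finset.sum_le_sum_of_subset_of_nonneg (fun j hj => ?_)
      fun j _ _ => hb j)
    exact mem_range.2 (Finset.mem_filter.1 hj).2
  have e4 : ∑ j ∈ range k, wt (next^[j + 1] η) [] ≤ k := by
    have := Finset.sum_le_sum fun j (_ : j ∈ range k) => wt_le_one (next^[j + 1] η) []
    simpa using this
  have e5 : 0 ≤ ∑ j ∈ range k, wt (next^[j + 1] η) [] :=
    sum_nonneg fun j _ => wt_nonneg _ _
  have hk0 : (0 : ℝ) ≤ k := k.cast_nonneg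
  push_cast at h6
  rw [e2, e1, abs_of_nonneg (show 0 ≤ B + ((k : ℝ) + 1) by linarith)]
  have h6' := abs_le.1 h6
  have e3' := abs_le.1 e3
  rw [abs_le]
  have hpk : 0 ≤ criticalProb ν / 2 * ((k : ℝ) + 1) := by positivity
  have hpk' : criticalProb ν / 2 * ((k : ℝ) + 1) ≤ (k : ℝ) + 1 := by nlinarith
  have hδk : 0 ≤ δ * ((k : ℝ) + 1) := by positivity
  constructor <;> linarith

end

section

open scoped Uniformity

variable {ε : ℝ}

/-! ### The space of càdlàg paths -/

lemma uniformity_hasBasis (ε : ℝ) : (𝓤 (D ε)).HasBasis (fun _ : ℕ => True) (close ε) := by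
  refine ⟨fun s => ?_⟩
  change s ∈ FilterBasis.filter _ ↔ _
  rw [FilterBasis.mem_filter_iff]
  constructor
  · rintro ⟨_, ⟨n, rfl⟩, hn⟩
    exact ⟨n, trivial, hn⟩
  · rintro ⟨n, -, hn⟩
    exact ⟨_, ⟨n, rfl⟩, hn⟩

/-- This makes the path space pseudometrizable, so that metric criteria for convergence in
distribution apply. -/
instance (ε : ℝ) : (𝓤 (D ε)).IsCountablyGenerated :=
  (⟨uniformity_hasBasis ε, Set.to_countable _⟩ : HasCountableBasis _ _ _).isCountablyGenerated

lemma mem_close_of_path {n : ℕ} {x y : D ε}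
    (h : ∀ t : Ici ε, (t : ℝ) ≤ n → |y.path t - x.path t| < 1 / ((n : ℝ) + 1)) :
    (x, y) ∈ close ε n :=
  ⟨OrderIso.refl _, fun t => by simp; positivity, h⟩

lemma IsCadlag.const_mul {f : Ici ε → ℝ} (h : IsCadlag f) (p : ℝ) :
    IsCadlag fun t => p * f t := fun t =>
  ⟨(h t).1.const_mul p, by
    obtain ⟨l, hl⟩ := (h t).2
    exact ⟨p * l, hl.const_mul p⟩⟩

/-- The multiple of a path. -/
def scale (p : ℝ) (x : D ε) : D ε := ⟨fun t => p * x.path t, x.isCadlag.const_mul p⟩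

lemma continuous_scale {p : ℝ} (h0 : 0 ≤ p) (h1 : p ≤ 1) :
    Continuous (scale p : D ε → D ε) := by
  refine UniformContinuous.continuous (((uniformity_hasBasis ε).uniformContinuous_iff
    (uniformity_hasBasis ε)).2 fun n _ => ⟨n, trivial, ?_⟩)
  rintro x y ⟨φ, h2, h3⟩
  refine ⟨φ, h2, fun t ht => ?_⟩
  simp only [scale]
  rw [← mul_sub, abs_mul, abs_of_nonneg h0]
  exact (mul_le_of_le_one_left (abs_nonneg _) h1).trans_lt (h3 t ht)

lemma rightLim_const_mul {p : ℝ} (hp : p ≠ 0) (f : ℝ → ℝ) (t : ℝ) :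
    rightLim (fun s => p * f s) t = p * rightLim f t := by
  by_cases h : ∃ y, Tendsto f (𝓝[>] t) (𝓝 y)
  · obtain ⟨y, hy⟩ := h
    rw [rightLim_eq_of_tendsto hy, rightLim_eq_of_tendsto (hy.const_mul p)]
  · rw [rightLim_eq_of_not_tendsto _ h, rightLim_eq_of_not_tendsto]
    rintro ⟨y, hy⟩
    refine h ⟨p⁻¹ * y, (hy.const_mul p⁻¹).congr fun s => ?_⟩
    rw [inv_mul_cancel_left₀ hp]

/-- For `p ≠ 0` scaling neither creates nor destroys right limits or càdlàg paths, and both default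
values are zero paths; for `p = 0` both sides are the zero path. -/
lemma toD_const_mul (p : ℝ) (f : ℝ → ℝ) :
    toD ε (fun t => p * f t) = scale p (toD ε f) := by
  rcases eq_or_ne p 0 with rfl | hp
  · have h1 : ∀ t : Ici ε, rightLim (fun s => 0 * f s) t = 0 := fun t => by
      simp only [zero_mul]
      exact rightLim_eq_of_tendsto tendsto_const_nhds
    have h2 : IsCadlag fun t : Ici ε => rightLim (fun s => 0 * f s) t := by
      simp only [h1]
      exact isCadlag_zero
    rw [toD, dif_pos h2, scale, D.mk.injEq]
    funext t
    rw [h1, zero_mul]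
  · have h1 : (fun t : Ici ε => rightLim (fun s => p * f s) t) =
        fun t : Ici ε => p * rightLim f t :=
      funext fun t => rightLim_const_mul hp f t
    by_cases h2 : IsCadlag fun t : Ici ε => rightLim f t
    · have h3 : IsCadlag fun t : Ici ε => rightLim (fun s => p * f s) t := by
        rw [h1]
        exact h2.const_mul p
      rw [toD, dif_pos h3, toD, dif_pos h2, scale, D.mk.injEq]
      exact h1
    · have h3 : ¬ IsCadlag fun t : Ici ε => rightLim (fun s => p * f s) t := by
        rw [h1]
        intro h3
        refine h2 ?_
        have := h3.const_mul p⁻¹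
        simpa only [inv_mul_cancel_left₀ hp] using this
      rw [toD, dif_neg h3, toD, dif_neg h2, scale, D.mk.injEq]
      simp

/-- The paths that reach a height at least `c` until time `N`. -/
def reaching (ε : ℝ) (N : ℕ) (c : ℝ) : Set (D ε) :=
  {x | ∃ t : Ici ε, (t : ℝ) ≤ N ∧ c ≤ |x.path t|}

/-- A nearby path may differ by less than one unit in time and one in height, hence the two shifts.
-/
lemma closure_reaching_subset (N : ℕ) (c : ℝ) :
    closure (reaching ε N c) ⊆ reaching ε (N + 1) (c - 1) := by
  intro x hx
  obtain ⟨y, ⟨s, hs, hc⟩, φ, h1, h2⟩ := (mem_closure_iff_nhds_basis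
    (nhds_basis_uniformity' (uniformity_hasBasis ε))).1 hx (N + 1) trivial
  have hN : 1 / (((N + 1 : ℕ) : ℝ) + 1) ≤ 1 := by
    rw [div_le_one (by positivity)]
    push_cast
    linarith [N.cast_nonneg (α := ℝ)]
  have h3 := (h1 (φ.symm s)).trans_le hN
  rw [φ.apply_symm_apply] at h3
  have h4 : (φ.symm s : ℝ) ≤ (N + 1 : ℕ) := by
    push_cast
    linarith [(abs_lt.1 h3).1]
  have h5 := (h2 _ h4).trans_le hN
  rw [φ.apply_symm_apply] at h5
  refine ⟨φ.symm s, h4, ?_⟩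
  have := abs_sub_abs_le_abs_sub (y.path s) (x.path (φ.symm s))
  linarith

/-- One-sided limits bound the path near each point, and compactness of `[ε, N]` combines finitely
many of these bounds. -/
lemma IsCadlag.exists_abs_le {f : Ici ε → ℝ} (h : IsCadlag f) (N : ℝ) :
    ∃ C, ∀ t : Ici ε, (t : ℝ) ≤ N → |f t| ≤ C := by
  have hK : IsCompact (Subtype.val ⁻¹' Icc ε N : Set (Ici ε)) :=
    isClosed_Ici.isClosedEmbedding_subtypeVal.isCompact_preimage isCompact_Icc
  obtain ⟨C, hC⟩ := hK.induction_on (p := fun s => ∃ C, ∀ t ∈ s, |f t| ≤ C) ⟨0, by simp⟩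
    (fun s t hst ⟨C, hC⟩ => ⟨C, fun u hu => hC u (hst hu)⟩)
    (fun s t ⟨C, hC⟩ ⟨C', hC'⟩ => ⟨max C C', fun u hu => hu.elim
      (fun h1 => (hC u h1).trans (le_max_left _ _)) fun h1 => (hC' u h1).trans (le_max_right _ _)⟩)
    (fun t _ => by
      obtain ⟨h1, l, hl⟩ := h t
      have h2 : ∀ᶠ s in 𝓝[≥] t, |f s| < |f t| + 1 :=
        (h1.abs).eventually (gt_mem_nhds (lt_add_one _))
      have h3 : ∀ᶠ s in 𝓝[<] t, |f s| < |l| + 1 := hl.abs.eventually (gt_mem_nhds (lt_add_one _))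
      refine ⟨{s | |f s| ≤ max (|f t| + 1) (|l| + 1)}, mem_nhdsWithin_of_mem_nhds ?_, _,
        fun s hs => hs⟩
      rw [← nhdsLT_sup_nhdsGE]
      exact ⟨by filter_upwards [h3] with s hs using hs.le.trans (le_max_right _ _),
        by filter_upwards [h2] with s hs using hs.le.trans (le_max_left _ _)⟩)
  exact ⟨C, fun t ht => hC t ⟨t.2, ht⟩⟩

/-! ### Step paths -/

/-- The index of the step of the right-continuous version of a step path with steps of length
`1 / k`. -/
def stepIndex (k : ℕ) (t : ℝ) : ℕ := if k = 0 then 0 else ⌊k * t⌋₊ + 1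

lemma stepIndex_le {k : ℕ} {t : ℝ} (ht : 0 ≤ t) : (stepIndex k t : ℝ) ≤ k * t + 1 := by
  rw [stepIndex]
  split_ifs with hk
  · simp [hk]
  · push_cast
    linarith [Nat.floor_le (show 0 ≤ (k : ℝ) * t by positivity)]

lemma le_stepIndex {k : ℕ} (t : ℝ) : k * t ≤ (stepIndex k t : ℝ) := by
  rw [stepIndex]
  split_ifs with hk
  · simp [hk]
  · push_cast
    exact (Nat.lt_floor_add_one _).le

/-- Immediately to the right of `t` the ceiling of `k t` is the floor plus one, also at jump times;
for `k = 0` the path is constant. -/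
lemma toD_step_apply (hε : 0 < ε) (s : ℝ) (k : ℕ) (a : ℕ → ℝ) (t : Ici ε) :
    (toD ε fun t : ℝ => s * a ⌈(k : ℝ) * t⌉₊).path t = s * a (stepIndex k t) := by
  have hr : ∀ t : ℝ, ε ≤ t →
      Tendsto (fun t : ℝ => s * a ⌈(k : ℝ) * t⌉₊) (𝓝[>] t) (𝓝 (s * a (stepIndex k t))) := fun t ht => by
    refine tendsto_const_nhds.congr' ?_
    rcases Nat.eq_zero_or_pos k with rfl | hk
    · simp [stepIndex]
    have hk' : (0 : ℝ) < k := by exact_mod_cast hk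
    have ht0 : 0 ≤ (k : ℝ) * t := mul_nonneg hk'.le (hε.le.trans ht)
    filter_upwards [Ioo_mem_nhdsGT (show t < (⌊(k : ℝ) * t⌋₊ + 1) / k by
      rw [lt_div_iff₀ hk', mul_comm]; exact Nat.lt_floor_add_one _)] with u hu
    have h1 : (k : ℝ) * u < ⌊(k : ℝ) * t⌋₊ + 1 := by
      have := hu.2
      rwa [lt_div_iff₀ hk', mul_comm] at this
    have h2 : (⌊(k : ℝ) * t⌋₊ : ℝ) < k * u :=
      (Nat.floor_le ht0).trans_lt (mul_lt_mul_of_pos_left hu.1 hk')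
    rw [stepIndex, if_neg hk.ne', (Nat.ceil_eq_iff (Nat.succ_ne_zero ⌊(k : ℝ) * t⌋₊)).2]
    exact ⟨by simpa using h2, by push_cast; exact h1.le⟩
  have hl : ∀ t : ℝ, ε < t →
      Tendsto (fun t : ℝ => s * a ⌈(k : ℝ) * t⌉₊) (𝓝[<] t) (𝓝 (s * a ⌈(k : ℝ) * t⌉₊)) := fun t ht => by
    refine tendsto_const_nhds.congr' ?_
    rcases Nat.eq_zero_or_pos k with rfl | hk
    · simp
    have hk' : (0 : ℝ) < k := by exact_mod_cast hk
    have ht0 : 0 < (k : ℝ) * t := mul_pos hk' (hε.trans ht)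
    have hn := Nat.ceil_pos.2 ht0
    have h3 := (Nat.ceil_eq_iff hn.ne').1 (rfl : ⌈(k : ℝ) * t⌉₊ = _)
    filter_upwards [Ioo_mem_nhdsLT (show ((⌈(k : ℝ) * t⌉₊ - 1 : ℕ) : ℝ) / k < t by
      rw [div_lt_iff₀ hk', mul_comm t]; exact h3.1)] with u hu
    have h1 : ((⌈(k : ℝ) * t⌉₊ - 1 : ℕ) : ℝ) < k * u := by
      have := hu.1
      rwa [div_lt_iff₀ hk', mul_comm u] at this
    rw [(Nat.ceil_eq_iff hn.ne').2 ⟨h1, (mul_lt_mul_of_pos_left hu.2 hk').le.trans h3.2⟩]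
  rw [toD_apply ε _ (fun t ht => ⟨_, hr t ht⟩) fun t ht => ⟨_, hl t ht⟩]
  exact rightLim_eq_of_tendsto (hr t t.2)

/-- Up to time `n` only the values with index below `k n + 2` matter, and with the identity time
change their closeness suffices. Continuity yields measurability of the path-valued map. -/
lemma continuous_toD_step (hε : 0 < ε) (s : ℝ) (k : ℕ) :
    Continuous fun a : ℕ → ℝ => toD ε fun t : ℝ => s * a ⌈(k : ℝ) * t⌉₊ := by
  refine continuous_iff_continuousAt.2 fun a => ?_
  rw [ContinuousAt, (nhds_basis_uniformity' (uniformity_hasBasis ε)).tendsto_right_iff]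
  intro n _
  have h1 : ∀ᶠ b : ℕ → ℝ in 𝓝 a, ∀ i ∈ range (k * n + 2),
      |s * b i - s * a i| < 1 / ((n : ℝ) + 1) := by
    refine (Finset.eventually_all _).2 fun i _ => ?_
    have h2 : Continuous fun b : ℕ → ℝ => |s * b i - s * a i| := by fun_prop
    have h3 := h2.tendsto a
    rw [sub_self, abs_zero] at h3
    exact h3.eventually (gt_mem_nhds (by positivity))
  filter_upwards [h1] with b hb
  refine mem_close_of_path fun t ht => ?_
  rw [toD_step_apply hε, toD_step_apply hε]
  refine hb _ (mem_range.2 ?_)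
  have h2 := stepIndex_le (k := k) (hε.le.trans t.2)
  have h3 : (k : ℝ) * t ≤ k * n := by gcongr
  have h4 : (stepIndex k (t : ℝ) : ℝ) < (k * n + 2 : ℕ) := by push_cast; linarith
  exact_mod_cast h4

lemma measurable_toD_step {Ω : Type*} [MeasurableSpace Ω] {A : ℕ → Ω → ℝ}
    (hA : ∀ j, Measurable (A j)) (hε : 0 < ε) (s : ℝ) (k : ℕ) :
    Measurable fun ω => toD ε fun t : ℝ => s * A ⌈(k : ℝ) * t⌉₊ ω := by
  have h1 : Measurable fun ω j => A j ω := measurable_pi_iff.2 hA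
  have h2 : Measurable fun a : ℕ → ℝ => toD ε fun t : ℝ => s * a ⌈(k : ℝ) * t⌉₊ :=
    (continuous_toD_step hε s k).measurable
  have h := h2.comp h1
  simp only [Function.comp_def] at h
  exact h

end

section

open scoped Uniformity

variable {ε : ℝ} {Ω Ω' : Type*} [MeasurableSpace Ω] [MeasurableSpace Ω'] {μ : Measure Ω}
  [IsProbabilityMeasure μ] {μ' : Measure Ω'} [IsProbabilityMeasure μ']

/-! ### Convergence of processes that are asymptotically proportional -/

lemma reaching_anti (N : ℕ) {c c' : ℝ} (h : c ≤ c') : reaching ε N c' ⊆ reaching ε N c :=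
  fun _ ⟨t, ht, hc⟩ => ⟨t, ht, h.trans hc⟩

/-- Sequences that converge in distribution are uniformly bounded on bounded time intervals. -/
lemma exists_reaching_subset {x : ℕ → Ω → D ε} {z : Ω' → D ε}
    (h : TendstoInDistribution x atTop z (fun _ => μ) μ') (N : ℕ) {δ : ℝ≥0∞} (hδ : 0 < δ) :
    ∃ (c : ℝ) (F : Set (D ε)), IsClosed F ∧ reaching ε N c ⊆ F ∧ 
      ∀ᶠ k in atTop, μ (x k ⁻¹' F) < δ := by
  let _ : PseudoMetricSpace (D ε) := UniformSpace.pseudoMetricSpace (D ε)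
  set F : ℕ → Set (D ε) := fun m => closure (reaching ε N m) with hF
  have hFc : ∀ m, IsClosed (F m) := fun m => isClosed_closure
  have hanti : Antitone F := fun m m' hm => closure_mono (reaching_anti N (by exact_mod_cast hm))
  -- Each path is bounded up to time `N + 1`, so it leaves the closed sets `F m`; portmanteau for
  -- closed sets then carries smallness from the limit to large `k`.
  have hempty : ⋂ m, F m = ∅ := by
    refine Set.eq_empty_of_forall_notMem fun y hy => ?_
    obtain ⟨C, hC⟩ := y.isCadlag.exists_abs_le (N + 1 : ℕ)
    obtain ⟨m, hm⟩ := exists_nat_gt (C + 1)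
    obtain ⟨t, ht, hc⟩ := closure_reaching_subset N m (Set.mem_iInter.1 hy m)
    linarith [hC t ht]
  have := Measure.isProbabilityMeasure_map h.aemeasurable_limit
  have h1 := tendsto_measure_iInter_atTop (μ := μ'.map z)
    (fun m => (hFc m).measurableSet.nullMeasurableSet) hanti ⟨0, measure_ne_top _ _⟩
  rw [hempty, measure_empty] at h1
  obtain ⟨m, hm⟩ := (h1.eventually (gt_mem_nhds hδ)).exists
  refine ⟨m, F m, hFc m, subset_closure, ?_⟩
  have h2 := ProbabilityMeasure.limsup_measure_closed_le_of_tendsto h.tendsto (hFc m)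
  filter_upwards [eventually_lt_of_limsup_lt (h2.trans_lt hm)] with k hk
  rw [ProbabilityMeasure.coe_mk, Measure.map_apply_of_aemeasurable (h.forall_aemeasurable k)
    (hFc m).measurableSet] at hk
  exact hk

/-- Egorov-type step: an almost surely eventual property holds from a deterministic index on,
outside an event of small probability. -/
lemma tendsto_measure_not_eventually {p : ℕ → Ω → Prop} (hp : ∀ j, MeasurableSet {ω | p j ω})
    (h : ∀ᵐ ω ∂μ, ∀ᶠ j in atTop, p j ω) :
    Tendsto (fun m : ℕ => μ {ω | ∃ j, m ≤ j ∧ ¬ p j ω}) atTop (𝓝 0) := by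
  have hm : ∀ m : ℕ, MeasurableSet {ω | ∃ j, m ≤ j ∧ ¬ p j ω} := fun m => by
    have : {ω | ∃ j, m ≤ j ∧ ¬ p j ω} = ⋃ j, ⋃ (_ : m ≤ j), {ω | p j ω}ᶜ := by
      ext ω
      simp
    rw [this]
    exact MeasurableSet.iUnion fun j => MeasurableSet.iUnion fun _ => (hp j).compl
  have h1 := tendsto_measure_iInter_atTop (μ := μ) (fun m => (hm m).nullMeasurableSet)
    (fun m m' hmm ω ⟨j, hj, hpj⟩ => ⟨j, hmm.trans hj, hpj⟩) ⟨0, measure_ne_top _ _⟩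
  have h2 : μ (⋂ m, {ω | ∃ j, m ≤ j ∧ ¬ p j ω}) = 0 := by
    refine measure_mono_null (fun ω hω => ?_) (ae_iff.1 h)
    simp only [Set.mem_iInter, Set.mem_ofPred_eq, eventually_atTop, not_exists] at hω ⊢
    intro m hm
    obtain ⟨j, hj, hpj⟩ := hω m
    exact hpj (hm j hj)
  rwa [h2] at h1

/-- The two step paths jump at the same times, so no time change is needed: off a small event they
are uniformly close up to time `n`. The relative error uses boundedness of the rescaled path, the
linear error uses `γ ≥ 2`. -/
lemma tendstoJ1_of_abs_sub_le {A B : ℕ → Ω → ℝ} (hA : ∀ j, Measurable (A j))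
    (hB : ∀ j, Measurable (B j)) {p : ℝ} (hp0 : 0 ≤ p) (hp1 : p ≤ 1) {γ : ℝ} (hγ : 2 ≤ γ)
    {Y : ℝ → Ω' → ℝ}
    (h : ∀ᵐ ω ∂μ, ∀ δ : ℝ, 0 < δ → ∀ᶠ j : ℕ in atTop,
      |B j ω - p * A j ω| ≤ δ * |A j ω| + 4 * (j + 1))
    (hJ : TendstoJ1 (fun k t ω => (k : ℝ) ^ (-γ) * A ⌈(k : ℝ) * t⌉₊ ω) Y μ μ') :
    TendstoJ1 (fun k t ω => (k : ℝ) ^ (-γ) * B ⌈(k : ℝ) * t⌉₊ ω) (fun t ω => p * Y t ω) μ μ' := by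
  intro ε hε
  have h1 := hJ ε hε
  let _ : PseudoMetricSpace (D ε) := UniformSpace.pseudoMetricSpace (D ε)
  set x : ℕ → Ω → D ε := fun k ω => toD ε fun t : ℝ => (k : ℝ) ^ (-γ) * A ⌈(k : ℝ) * t⌉₊ ω with hx
  set y : ℕ → Ω → D ε := fun k ω => toD ε fun t : ℝ => (k : ℝ) ^ (-γ) * B ⌈(k : ℝ) * t⌉₊ ω with hy
  have hxm : ∀ k, Measurable (x k) := fun k => measurable_toD_step hA hε _ k
  have hym : ∀ k, Measurable (y k) := fun k => measurable_toD_step hB hε _ k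
  have h2 := h1.continuous_comp (continuous_scale hp0 hp1)
  have hz : (fun ω => toD ε fun t => p * Y t ω) = scale p ∘ fun ω => toD ε fun t => Y t ω :=
    funext fun ω => toD_const_mul p _
  rw [hz]
  refine tendstoInDistribution_of_approx (X := fun _ k => scale p ∘ x k)
    (V := fun _ => scale p ∘ fun ω => toD ε fun t => Y t ω) (fun k => (hym k).aemeasurable)
    h2.aemeasurable_limit (Eventually.of_forall fun _ => h2)
    (Eventually.of_forall fun ω => tendsto_const_nhds) fun η hη => Eventually.of_forall fun _ => ?_
  -- The allowance `η` is spent in thirds: closeness of paths, the event that the path is too high,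
  -- and the event that the comparison fails at some index from `m` on.
  obtain ⟨n, -, hn⟩ := (uniformity_hasBasis ε).mem_iff.1 (Metric.dist_mem_uniformity
    (show 0 < η / 3 by positivity))
  have hη3 : 0 < ofReal (η / 3) := ENNReal.ofReal_pos.2 (by positivity)
  obtain ⟨c, F, hF, hcF, hev⟩ := exists_reaching_subset h1 n hη3
  -- Chosen so that `δ c` is at most half of the tolerance `1/(n+1)`; the other half is left for the
  -- linear error.
  set δ : ℝ := 1 / (2 * ((n : ℝ) + 1) * (|c| + 1)) with hδdef
  have hδ : 0 < δ := by positivity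
  have hp : ∀ j : ℕ, MeasurableSet {ω | |B j ω - p * A j ω| ≤ δ * |A j ω| + 4 * (j + 1)} :=
    fun j => measurableSet_le ((hB j).sub ((hA j).const_mul p)).abs
      (((hA j).abs.const_mul δ).add_const _)
  have hbad := tendsto_measure_not_eventually hp (by
    filter_upwards [h] with ω hω using hω δ hδ)
  obtain ⟨m, hm⟩ := (hbad.eventually (gt_mem_nhds hη3)).exists
  have hsmall : ∀ᶠ k : ℕ in atTop, (k : ℝ) ^ (-γ) * (4 * (k * n + 2)) < 1 / (2 * ((n : ℝ) + 1)) := by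
    have h3 : Tendsto (fun k : ℕ => 4 * ((n : ℝ) * (k : ℝ)⁻¹ + 2 * ((k : ℝ)⁻¹ * (k : ℝ)⁻¹))) atTop
        (𝓝 (4 * ((n : ℝ) * 0 + 2 * (0 * 0)))) :=
      ((tendsto_inv_atTop_nhds_zero_nat.const_mul _).add ((tendsto_inv_atTop_nhds_zero_nat.mul
        tendsto_inv_atTop_nhds_zero_nat).const_mul 2)).const_mul 4
    simp only [mul_zero, add_zero] at h3
    filter_upwards [h3.eventually (gt_mem_nhds (show 0 < 1 / (2 * ((n : ℝ) + 1)) by positivity)),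
      eventually_ge_atTop 1] with k hk hk1
    refine lt_of_le_of_lt ?_ hk
    have hk1' : (1 : ℝ) ≤ k := by exact_mod_cast hk1
    have hk0 : (0 : ℝ) < k := by linarith
    calc (k : ℝ) ^ (-γ) * (4 * (k * n + 2)) ≤ (k : ℝ) ^ (-2 : ℝ) * (4 * (k * n + 2)) := by
          gcongr
      _ = _ := by
          rw [Real.rpow_neg hk0.le, Real.rpow_two]
          field_simp
  -- Since times start at `ε > 0`, the condition `k ≥ m/ε` makes every step index at least `m`,
  -- where the comparison holds.
  filter_upwards [hev, hsmall, eventually_ge_atTop 1,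
    (tendsto_natCast_atTop_atTop (R := ℝ)).eventually_ge_atTop (m / ε)] with k h3 h4 hk1 h5
  have hFm : MeasurableSet (x k ⁻¹' F) := hxm k hF.measurableSet
  set Bad : Set Ω := {ω | ∃ j, m ≤ j ∧ ¬ |B j ω - p * A j ω| ≤ δ * |A j ω| + 4 * (j + 1)}
    with hBad
  have hBadm : MeasurableSet Bad := by
    have : Bad = ⋃ j, ⋃ (_ : m ≤ j),
        {ω | |B j ω - p * A j ω| ≤ δ * |A j ω| + 4 * (j + 1)}ᶜ := by
      ext ω
      simp [hBad]
    rw [this]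
    exact MeasurableSet.iUnion fun j => MeasurableSet.iUnion fun _ => (hp j).compl
  have hI1 : Measurable ((x k ⁻¹' F).indicator (1 : Ω → ℝ≥0∞)) := measurable_one.indicator hFm
  have hI2 : Measurable (Bad.indicator (1 : Ω → ℝ≥0∞)) := measurable_one.indicator hBadm
  calc _ ≤ ∫⁻ ω, (ofReal (η / 3) + ((x k ⁻¹' F).indicator 1 ω + Bad.indicator 1 ω)) ∂μ := by
        refine lintegral_mono fun ω => ?_
        by_cases hω1 : ω ∈ x k ⁻¹' F
        · rw [Set.indicator_of_mem hω1]
          exact (ofReal_le_one.2 (min_le_left _ _)).trans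
            (le_self_add.trans le_add_self)
        by_cases hω2 : ω ∈ Bad
        · rw [Set.indicator_of_mem hω2]
          exact (ofReal_le_one.2 (min_le_left _ _)).trans
            (le_add_self.trans le_add_self)
        refine le_trans (ofReal_le_ofReal ((min_le_right _ _).trans ?_)) le_self_add
        have hclose : (y k ω, (scale p ∘ x k) ω) ∈ close ε n := by
          refine mem_close_of_path fun t ht => ?_
          have hAt : (x k ω).path t = (k : ℝ) ^ (-γ) * A (stepIndex k t) ω :=
            toD_step_apply hε ((k : ℝ) ^ (-γ)) k (fun j => A j ω) t
          have hBt : (y k ω).path t = (k : ℝ) ^ (-γ) * B (stepIndex k t) ω :=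
            toD_step_apply hε ((k : ℝ) ^ (-γ)) k (fun j => B j ω) t
          have ht0 : 0 ≤ (t : ℝ) := hε.le.trans t.2
          have hs0 : 0 ≤ (k : ℝ) ^ (-γ) := rpow_nonneg k.cast_nonneg _
          have hj : m ≤ stepIndex k t := by
            have h6 : (m : ℝ) ≤ stepIndex k t := by
              refine le_trans ?_ (le_stepIndex (k := k) t)
              rw [div_le_iff₀ hε] at h5
              exact h5.trans (mul_le_mul_of_nonneg_left t.2 k.cast_nonneg)
            exact_mod_cast h6
          have h7 : |B (stepIndex k t) ω - p * A (stepIndex k t) ω| ≤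
              δ * |A (stepIndex k t) ω| + 4 * (stepIndex k t + 1) := by
            by_contra h8
            exact hω2 ⟨_, hj, h8⟩
          have h8 : |(x k ω).path t| < c := by
            by_contra h9
            exact hω1 (hcF ⟨t, ht, not_lt.1 h9⟩)
          rw [hAt, abs_mul, abs_of_nonneg hs0] at h8
          have h9 : (stepIndex k t : ℝ) + 1 ≤ k * n + 2 := by
            have h10 := stepIndex_le (k := k) ht0
            have h11 : (k : ℝ) * t ≤ k * n := by gcongr
            linarith
          have h12 : δ * c ≤ 1 / (2 * ((n : ℝ) + 1)) := by
            rw [hδdef, one_div_mul_eq_div, div_le_div_iff₀ (by positivity) (by positivity)]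
            have := le_abs_self c
            have : 0 < 2 * ((n : ℝ) + 1) := by positivity
            nlinarith
          have h13 : 1 / (2 * ((n : ℝ) + 1)) + 1 / (2 * ((n : ℝ) + 1)) = 1 / ((n : ℝ) + 1) := by
            field_simp
            ring
          simp only [Function.comp_apply, scale]
          rw [hAt, hBt, abs_sub_comm, mul_left_comm, ← mul_sub, abs_mul, abs_of_nonneg hs0]
          calc (k : ℝ) ^ (-γ) * |B (stepIndex k t) ω - p * A (stepIndex k t) ω| ≤
                (k : ℝ) ^ (-γ) * (δ * |A (stepIndex k t) ω| + 4 * (k * n + 2)) := by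
                gcongr
                refine h7.trans ?_
                linarith
            _ = δ * ((k : ℝ) ^ (-γ) * |A (stepIndex k t) ω|) +
                (k : ℝ) ^ (-γ) * (4 * (k * n + 2)) := by ring
            _ ≤ δ * c + (k : ℝ) ^ (-γ) * (4 * (k * n + 2)) := by gcongr
            _ < _ := by linarith
        exact (hn hclose).le
    _ ≤ ofReal (η / 3) + (ofReal (η / 3) + ofReal (η / 3)) := by
        rw [lintegral_add_left measurable_const, lintegral_add_left hI1,
          lintegral_indicator_one hFm, lintegral_indicator_one hBadm]
        simp only [lintegral_const, measure_univ, mul_one]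
        exact add_le_add le_rfl (add_le_add h3.le hm.le)
    _ = _ := by
        rw [← ofReal_add (by positivity) (by positivity),
          ← ofReal_add (by positivity) (by positivity)]
        congr 1
        ring

/-! ### Part (i) for the original weighted tree -/

section Transfer

variable {ν : Measure ℕ} [IsProbabilityMeasure ν] {X : Vertex → Ω → ℕ} {U : Vertex → Ω → ℝ}

/-- Step processes of a weighted tree can be replaced by those of its configuration. -/
lemma tendstoJ1_field_iff (htree : IsWeightedBPTree ν X U μ) {A : ℕ → Config → ℝ}
    (hA : ∀ j, Measurable (A j)) {A' : ℕ → Ω → ℝ}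
    (hAA' : ∀ᵐ ω ∂μ, ∀ j, A' j ω = A j (field X U ω)) (γ : ℝ) {Y : ℝ → Ω' → ℝ} :
    TendstoJ1 (fun k t ω => (k : ℝ) ^ (-γ) * A' ⌈(k : ℝ) * t⌉₊ ω) Y μ μ' ↔
      TendstoJ1 (fun k t η => (k : ℝ) ^ (-γ) * A ⌈(k : ℝ) * t⌉₊ η) Y (law ν) μ' := by
  refine forall₂_congr fun ε hε => ?_
  rw [← tendstoInDistribution_comp_iff (hasLaw_field htree)
    fun k => measurable_toD_step hA hε ((k : ℝ) ^ (-γ)) k]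
  have h1 : ∀ k : ℕ, (fun ω => toD ε fun t : ℝ => (k : ℝ) ^ (-γ) * A' ⌈(k : ℝ) * t⌉₊ ω) =ᵐ[μ]
      fun ω => toD ε fun t : ℝ => (k : ℝ) ^ (-γ) * A ⌈(k : ℝ) * t⌉₊ (field X U ω) := fun k => by
    filter_upwards [hAA'] with ω hω
    simp only [hω]
  exact ⟨fun h => h.congr h1 EventuallyEq.rfl,
    fun h => h.congr (fun k => (h1 k).symm) EventuallyEq.rfl⟩

/-- The argument is pathwise and takes place on configurations; it depends on `α` only through `p_c`
and the assumed scaling limit. The factor `p_c/2` lies in `[0, 1]`, as the scaling lemma requires.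
-/
lemma tendstoJ1_cutWeight (htree : IsWeightedBPTree ν X U μ) (hν : ν {0} = 0)
    (h2 : 0 < ν.real {n | 2 ≤ n}) {M : ℕ → Ω → ℕ} {C : ℕ → Ω → ℝ}
    (hM : ∀ k ω, M k ω = cutSize (fun v => X v ω) (fun v => U v ω) k)
    (hC : ∀ k ω, C k ω = cutWeight (fun v => X v ω) (fun v => U v ω) k)
    {γ : ℝ} (hγ : 2 ≤ γ) {Y : ℝ → Ω' → ℝ}
    (h : TendstoJ1 (fun k t ω => (k : ℝ) ^ (-γ) * (M ⌈(k : ℝ) * t⌉₊ ω : ℝ)) Y μ μ') :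
    TendstoJ1 (fun k t ω => (k : ℝ) ^ (-γ) * C ⌈(k : ℝ) * t⌉₊ ω)
      (fun t ω => criticalProb ν / 2 * Y t ω) μ μ' := by
  have hcut := ae_cut_eq htree hν h2
  have h0 : 0 ≤ criticalProb ν := inv_nonneg.2 (integral_nonneg fun n => n.cast_nonneg)
  have h1 := criticalProb_le_one (ν := ν) hν
  rw [tendstoJ1_field_iff htree measurable_weightSum (by
    filter_upwards [hcut] with ω hω j
    rw [hC, (hω j).2.1])]
  rw [tendstoJ1_field_iff (A' := fun j ω => (M j ω : ℝ)) htree measurable_sizeSum (by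
    filter_upwards [hcut] with ω hω j
    rw [hM, (hω j).1])] at h
  exact tendstoJ1_of_abs_sub_le measurable_sizeSum measurable_weightSum (by linarith) (by linarith)
    hγ (ae_eventually_weightSum_sub_le hν h2) h

end Transfer

end

end

end IPC

theorem theorem1 {Ω : Type*} [MeasurableSpace Ω] (μ : Measure Ω) [IsProbabilityMeasure μ]
    (ν : Measure ℕ) [IsProbabilityMeasure ν]
    (X : IPC.Vertex → Ω → ℕ) (U : IPC.Vertex → Ω → ℝ)
    (htree : IPC.IsWeightedBPTree ν X U μ)
    (hone : ∀ᵐ n ∂ν, 1 ≤ n)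
    (α c : ℝ) (hα : 0 < α) (hc : 0 < c)
    (htail : Asymptotics.IsEquivalent atTop
      (fun y : ℝ => ν.real {n : ℕ | y < (n : ℝ)}) (fun y : ℝ => c * y ^ (-α)))
    (M : ℕ → Ω → ℕ) (hM : ∀ k ω, M k ω = IPC.cutSize (fun v => X v ω) (fun v => U v ω) k)
    (C : ℕ → Ω → ℝ) (hC : ∀ k ω, C k ω = IPC.cutWeight (fun v => X v ω) (fun v => U v ω) k)
    (W : ℕ → Ω → ℝ) (hW : ∀ k ω, W k ω = IPC.futureMax (fun v => X v ω) (fun v => U v ω) k) :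
    -- First instance
    ((2 < α ∨ (1 < α ∧ α < 2)) →
      ∀ (γ : ℝ), 2 ≤ γ →
      ∀ (Ω' : Type*) [MeasurableSpace Ω'] (μ' : Measure Ω') [IsProbabilityMeasure μ']
        (Z : ℝ → Ω' → ℝ), (∀ t, 0 < t → AEMeasurable (Z t) μ') →
        (∀ᵐ ω ∂μ', ∀ t, 0 < t → IntervalIntegrable (fun u => Z u ω) volume 0 t) →
        IPC.TendstoJ1 (fun k t ω => (k : ℝ) ^ (-γ) * (M ⌈(k : ℝ) * t⌉₊ ω : ℝ))
          (fun t ω => ∫ u in (0 : ℝ)..t, Z u ω) μ μ' →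
        IPC.TendstoJ1 (fun k t ω => (k : ℝ) ^ (-γ) * C ⌈(k : ℝ) * t⌉₊ ω)
          (fun t ω => IPC.criticalProb ν / 2 * ∫ u in (0 : ℝ)..t, Z u ω) μ μ') ∧
    -- Second instance
    ((1 / 2 < α ∧ α < 1) →
      ∀ (Ω' : Type*) [MeasurableSpace Ω'] (μ' : Measure Ω') [IsProbabilityMeasure μ']
        (Z : Ω' → ℝ),
        TendstoInDistribution
          (fun (k : ℕ) ω => W k ω ^ (α / (1 - α)) * ((M k ω : ℝ) - (M (k - 1) ω : ℝ)))
          atTop Z (fun _ => μ) μ' →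
        ∃ (Ω'' : Type) (_ : MeasurableSpace Ω'') (μ'' : Measure Ω'')
          (_ : IsProbabilityMeasure μ'') (P Zc : ℕ → Ω'' → ℝ),
          (∀ i, HasLaw (P i) (IPC.ratioLaw α) μ'') ∧
          (∀ j, HasLaw (Zc j) (μ'.map Z) μ'') ∧
          iIndepFun (Sum.elim P Zc) μ'' ∧
          (∀ᵐ ω ∂μ'', Summable (IPC.seriesTerm α (fun i => P i ω) (fun j => Zc j ω))) ∧
          ∀ m : ℕ,
            TendstoInDistribution
              (fun (k : ℕ) ω (i : Fin m) =>
                W k ω ^ (α / (1 - α) - 1) * C (k - ((i : ℕ) + 1)) ω)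
              atTop
              (fun ω (i : Fin m) =>
                IPC.limitSeries α (fun i => P i ω) (fun j => Zc j ω) ((i : ℕ) + 1))
              (fun _ => μ) μ'') ∧
    -- Third instance
    ((0 < α ∧ α < 1 / 2) →
      ∃ Z : Ω → ℝ,
        TendstoInDistribution C atTop Z (fun _ => μ) μ ∧
        ∀ᵐ ω ∂μ, Tendsto (fun k => C k ω) atTop (𝓝 (Z ω))) := by
  have hν := IPC.offspring_zero hone
  have h2 := IPC.offspring_two hc htail
  refine ⟨fun _ γ hγ Ω' _ μ' _ Z _ _ hJ => IPC.tendstoJ1_cutWeight htree hν h2 hM hC hγ hJ,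
    fun h Ω' _ μ' _ Z hZ => IPC.tendstoInDistribution_scaled_cutWeight htree
      (IPC.regular_of_isEquivalent hone hα h.2 hc htail) h.1 hM hC hW hZ,
    fun h => IPC.exists_tendsto_cutWeight htree
      (IPC.regular_of_isEquivalent hone hα (by linarith [h.2]) hc htail) h.2 hC⟩
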